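/- **Setting.** Let $N\ge 1$, $A\in\mathbb R^{N\times N}$, $B\in\mathbb R^{N\times d}$ with $\operatorname{rank}B=d$, and assume the Kalman condition $\operatorname{rank}[B,AB,\dots,A^{N-1}B]=N$. Let $b\in\mathbb R^d$, let $Q\in\mathbb R^{d\times d}$ be symmetric and non-negative definite, and let $\nu$ be a Lévy measure on $\mathbb R^d\setminus\{0\}$, i.e. $\int (1\wedge|z|^2)\,\nu(dz)<\infty$. Assume that there are $r_0>0$, $\alpha\in(0,2)$ and a finite measure $\mu$ on $\mathbb S^{d-1}$ such that $$\nu(C)\ \ge\ \int_0^{r_0}\int_{\mathbb S^{d-1}}\mathbf 1_C(r\theta)\,\mu(d\theta)\,\frac{dr}{r^{1+\alpha}}\quad\text{for all Borel } C\subset\mathbb R^d\setminus\{0\},$$ where $\mu$ is non-degenerate: for some $\eta\ge1$, $\eta^{-1}|p|^\alpha\le\int_{\mathbb S^{d-1}}|p\cdot s|^\alpha\mu(ds)\le\eta|p|^\alpha$ for all $p\in\mathbb R^d$. Let $\mathcal L^{ou}=\mathcal L+\langle Ax,D_x\rangle$ with $$\mathcal L\phi(x)=\tfrac12\operatorname{Tr}\bigl(BQB^*D^2\phi(x)\bigr)+\langle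 Bb,D\phi(x)\rangle+\int\bigl[\phi(x+Bz)-\phi(x)-\langle D\phi(x),Bz\rangle\mathbf 1_{|z|<1}\bigr]\nu(dz).$$ Its formal adjoint is $(\mathcal L^{ou})^*\phi(x)=\mathcal L^*\phi(x)-\langle Ax,D\phi(x)\rangle-\operatorname{Tr}(A)\phi(x)$, where $$\mathcal L^*\phi(x)=\tfrac12\operatorname{Tr}\bigl(BQB^*D^2\phi(x)\bigr)-\langle Bb,D\phi(x)\rangle+\int\bigl[\phi(x-Bz)-\phi(x)+\langle D\phi(x),Bz\rangle\mathbf 1_{|z|<1}\bigr]\nu(dz).$$ For $\lambda>0$, a *weak solution* of $\lambda u-\mathcal L^{ou}u=g$ is a bounded uniformly continuous function $u:\mathbb R^N\to\mathbb R$ such that $\int u\,[\lambda\phi-(\mathcal L^{ou})^*\phi]\,dx=\int \phi g\,dx$ for all $\phi\in C_c^\infty(\mathbb R^N)$. Let $Z$ be a càdlàg Lévy process on $\mathbb R^d$ with $\mathbb E\,e^{ip\cdot Z_t}=e^{-t\Phi(p)}$, where $$\Phi(p)=-ib\cdot p+\tfrac12p\cdot Qp+\int\bigl(1-e^{ip\cdot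 z}+ip\cdot z\,\mathbf 1_{|z|<1}\bigr)\nu(dz),$$ let $X^x$ be the solution of $X^x_t=x+\int_0^tAX^x_s\,ds+BZ_t$, and put $P_t\phi(x)=\mathbb E[\phi(X_t^x)]$. Let $n$ be the least $r$ with $\operatorname{rank}[B,AB,\dots,A^{r-1}B]=N$. Let $V_0=\{0\}$, $V_h=\sum_{k=1}^h\operatorname{Im}(A^{k-1}B)$, and $W_h=V_{h-1}^\perp\cap V_h$ for $1\le h\le n$. For a Euclidean space $F$ and $\gamma=k+\theta>0$ with $k\in\mathbb N_0$, $\theta\in(0,1]$, let $C^\gamma_b(F)$ be the Zygmund–Hölder space of the $\psi\in C^k(F)$ with $$\|\psi\|_{C^\gamma_b}=\sum_{i=0}^k\sup_F|D^i\psi|+[\psi]_\gamma<\infty .$$ Here $[\psi]_\gamma=\sup_{x\ne y}\frac{|D^k\psi(x)-D^k\psi(y)|}{|x-y|^\theta}$ if $\theta<1$, and $[\psi]_\gamma=\sup_{x\ne y}\frac{|D^k\psi(x)+D^k\psi(y)-2D^k\psi(\frac{x+y}2)|}{|x-y|}$ if $\theta=1$. Let $C^\gamma_{b,d}$ be the space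 of the $\phi:\mathbb R^N\to\mathbb R$ whose restrictions $W_h\ni z\mapsto\phi(x_0+z)$ are all in $C_b^{\gamma/(1+\alpha(h-1))}(W_h)$ and for which $$\|\phi\|_{C^\gamma_{b,d}}=\sum_{h=1}^n\ \sup_{x_0\in\mathbb R^N}\|\phi(x_0+\cdot)\|_{C_b^{\gamma/(1+\alpha(h-1))}(W_h)}<\infty .$$ **Theorem (Elliptic Schauder Estimates).** Fix $\lambda>0$ and $\beta\in(0,1)$. There is a constant $C>0$, depending only on $\lambda$, $\beta$ and $N,d,A,B,\alpha,\nu,r_0,\mu$ (so not on $b$, $Q$, $g$), such that the following holds for every $g\in C^\beta_{b,d}$. The equation $\lambda u-\mathcal L^{ou}u=g$ has exactly one weak solution $u$; it is given by $u(x)=\int_0^\infty e^{-\lambda t}P_tg(x)\,dt$ (an absolutely convergent integral) for every $x\in\mathbb R^N$; it belongs to $C^{\alpha+\beta}_{b,d}$; and $$\|u\|_{C^{\alpha+\beta}_{b,d}}\ \le\ C\,\|g\|_{C^\beta_{b,d}} .$$ -/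

import Mathlib

open MeasureTheory ProbabilityTheory Filter Topology
open scoped NNReal ENNReal RealInnerProductSpace

noncomputable section

namespace LevyOU

/-! ### The geometry of the drift -/

/-- The block matrix `[B, AB, …, A^{r-1}B]`. -/
def kalmanMatrix {N d : ℕ} (A : Matrix (Fin N) (Fin N) ℝ) (B : Matrix (Fin N) (Fin d) ℝ)
    (r : ℕ) : Matrix (Fin N) (Fin r × Fin d) ℝ :=
  Matrix.of fun i q => (A ^ (q.1 : ℕ) * B) i q.2

/-- The Kalman rank condition `N = rank [B, AB, …, A^{N-1}B]`. -/
def KalmanCondition {N d : ℕ} (A : Matrix (Fin N) (Fin N) ℝ)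
    (B : Matrix (Fin N) (Fin d) ℝ) : Prop :=
  (kalmanMatrix A B N).rank = N

/-- The least `r` with `N = rank [B, AB, …, A^{r-1}B]`. -/
def kalmanIndex {N d : ℕ} (A : Matrix (Fin N) (Fin N) ℝ) (B : Matrix (Fin N) (Fin d) ℝ) : ℕ :=
  sInf {r : ℕ | (kalmanMatrix A B r).rank = N}

/-- `V_h = Im B + Im (AB) + ⋯ + Im (A^{h-1}B)`, so that `V_0 = 0`. -/
def reachable {N d : ℕ} (A : Matrix (Fin N) (Fin N) ℝ) (B : Matrix (Fin N) (Fin d) ℝ)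
    (h : ℕ) : Submodule ℝ (EuclideanSpace ℝ (Fin N)) :=
  ⨆ k ∈ Finset.range h, LinearMap.range (Matrix.toEuclideanLin (A ^ k * B))

/-- The `h`-th layer `E_h(ℝ^N) = (V_{h-1})^⊥ ∩ V_h`, for `1 ≤ h`. -/
def layer {N d : ℕ} (A : Matrix (Fin N) (Fin N) ℝ) (B : Matrix (Fin N) (Fin d) ℝ)
    (h : ℕ) : Submodule ℝ (EuclideanSpace ℝ (Fin N)) :=
  (reachable A B (h - 1))ᗮ ⊓ reachable A B h

/-! ### Zygmund-Hölder spaces -/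

/-- The integer `k` in the decomposition `γ = k + θ` with `θ ∈ (0, 1]`, for `0 < γ`. -/
def intPart (γ : ℝ) : ℕ := ⌈γ⌉₊ - 1

/-- The exponent `θ ∈ (0, 1]` in the decomposition `γ = k + θ`, for `0 < γ`. -/
def fracPart (γ : ℝ) : ℝ := γ - (intPart γ : ℝ)

section Zygmund

variable {F : Type*} [NormedAddCommGroup F] [NormedSpace ℝ F]

open Classical in
/-- The Zygmund-Hölder seminorm of order `γ = k + θ`: the `θ`-Hölder seminorm of the `k`-th
derivative if `θ < 1`, its Zygmund seminorm if `θ = 1`. -/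
def zygmundSeminorm (γ : ℝ) (ψ : F → ℝ) : ℝ≥0∞ :=
  if fracPart γ = 1 then
    ⨆ (x : F) (y : F) (_ : x ≠ y),
      ‖iteratedFDeriv ℝ (intPart γ) ψ x + iteratedFDeriv ℝ (intPart γ) ψ y
        - (2 : ℝ) • iteratedFDeriv ℝ (intPart γ) ψ (midpoint ℝ x y)‖ₑ / ‖x - y‖ₑ
  else
    ⨆ (x : F) (y : F) (_ : x ≠ y),
      ‖iteratedFDeriv ℝ (intPart γ) ψ x - iteratedFDeriv ℝ (intPart γ) ψ y‖ₑ
        / ‖x - y‖ₑ ^ fracPart γ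

/-- The norm of `C^γ_b(F)`, with values in `[0, ∞]`. -/
def zygmundNorm (γ : ℝ) (ψ : F → ℝ) : ℝ≥0∞ :=
  (∑ i ∈ Finset.range (intPart γ + 1), ⨆ x : F, ‖iteratedFDeriv ℝ i ψ x‖ₑ)
    + zygmundSeminorm γ ψ

end Zygmund

/-- The norm of the anisotropic space `C^γ_{b,d}(ℝ^N)`, with values in `[0, ∞]`. -/
def anisoNorm {N d : ℕ} (A : Matrix (Fin N) (Fin N) ℝ) (B : Matrix (Fin N) (Fin d) ℝ)
    (α γ : ℝ) (φ : EuclideanSpace ℝ (Fin N) → ℝ) : ℝ≥0∞ :=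
  ∑ h ∈ Finset.Icc 1 (kalmanIndex A B), ⨆ x₀ : EuclideanSpace ℝ (Fin N),
    zygmundNorm (γ / (1 + α * ((h : ℝ) - 1)))
      (fun z : layer A B h => φ (x₀ + (z : EuclideanSpace ℝ (Fin N))))

/-- Membership in `C^γ_{b,d}(ℝ^N)`: along every layer the function is continuously differentiable
up to the order concerned, and the norm is finite. -/
structure MemAniso {N d : ℕ} (A : Matrix (Fin N) (Fin N) ℝ) (B : Matrix (Fin N) (Fin d) ℝ)
    (α γ : ℝ) (φ : EuclideanSpace ℝ (Fin N) → ℝ) : Prop where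
  contDiff : ∀ h ∈ Finset.Icc 1 (kalmanIndex A B), ∀ x₀ : EuclideanSpace ℝ (Fin N),
    ContDiff ℝ (intPart (γ / (1 + α * ((h : ℝ) - 1))))
      (fun z : layer A B h => φ (x₀ + (z : EuclideanSpace ℝ (Fin N))))
  norm_lt_top : anisoNorm A B α γ φ < ∞

/-! ### Lévy measures, Lévy processes and the Ornstein-Uhlenbeck process -/

/-- Lévy measures on `ℝ^d ∖ {0}`, seen as measures on `ℝ^d` that do not charge the origin. -/
structure IsLevyMeasure {d : ℕ} (ν : Measure (EuclideanSpace ℝ (Fin d))) : Prop where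
  zero : ν {0} = 0
  lintegral_lt_top : ∫⁻ z, min 1 (‖z‖ₑ ^ 2) ∂ν < ∞

/-- The measure `μ` on the unit sphere is non-degenerate (with respect to the exponent `α`). -/
def NonDegenerateSpherical {d : ℕ} (α : ℝ)
    (μ : Measure (Metric.sphere (0 : EuclideanSpace ℝ (Fin d)) 1)) : Prop :=
  ∃ η : ℝ, 1 ≤ η ∧ ∀ p : EuclideanSpace ℝ (Fin d),
    η⁻¹ * ‖p‖ ^ α ≤ ∫ s, |⟪p, (s : EuclideanSpace ℝ (Fin d))⟫| ^ α ∂μ ∧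
    ∫ s, |⟪p, (s : EuclideanSpace ℝ (Fin d))⟫| ^ α ∂μ ≤ η * ‖p‖ ^ α

/-- The non-degeneracy condition: `ν` dominates the Lévy measure of a truncated `α`-stable
process with spherical part `μ` and truncation radius `r₀`. -/
structure NonDegenerate {d : ℕ} (ν : Measure (EuclideanSpace ℝ (Fin d))) (α r₀ : ℝ)
    (μ : Measure (Metric.sphere (0 : EuclideanSpace ℝ (Fin d)) 1)) : Prop where
  r₀_pos : 0 < r₀
  α_pos : 0 < α
  α_lt_two : α < 2
  finite : IsFiniteMeasure μ
  nondegenerate : NonDegenerateSpherical α μ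
  le_apply : ∀ C : Set (EuclideanSpace ℝ (Fin d)), MeasurableSet C → (0 ∉ C) →
    ∫⁻ r in Set.Ioc 0 r₀,
      (∫⁻ θ, C.indicator 1 (r • (θ : EuclideanSpace ℝ (Fin d))) ∂μ)
        * ENNReal.ofReal (1 / r ^ (1 + α)) ≤ ν C

/-- The Lévy symbol `Φ` of the triplet `(b, Q, ν)`. -/
def levySymbol {d : ℕ} (b : EuclideanSpace ℝ (Fin d)) (Q : Matrix (Fin d) (Fin d) ℝ)
    (ν : Measure (EuclideanSpace ℝ (Fin d))) (p : EuclideanSpace ℝ (Fin d)) : ℂ :=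
  -(Complex.I * (⟪b, p⟫ : ℝ)) + (1 / 2 : ℂ) * (⟪p, Matrix.toEuclideanLin Q p⟫ : ℝ)
    + ∫ z, (1 - Complex.exp (Complex.I * (⟪p, z⟫ : ℝ))
        + (Metric.ball (0 : EuclideanSpace ℝ (Fin d)) 1).indicator
            (fun z => Complex.I * (⟪p, z⟫ : ℝ)) z) ∂ν

/-- Right-continuous paths with left limits. -/
def IsCadlagPath {E : Type*} [TopologicalSpace E] (f : ℝ≥0 → E) : Prop :=
  ∀ t : ℝ≥0, ContinuousWithinAt f (Set.Ici t) t ∧ ∃ l : E, Tendsto f (𝓝[<] t) (𝓝 l)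

/-- `Z` is a Lévy process with Lévy symbol `Φ`, i.e. `𝔼[exp(i p·Z_t)] = exp(-t Φ(p))`. -/
structure IsLevyProcess {Ω : Type*} [MeasurableSpace Ω] (Pr : Measure Ω) {d : ℕ}
    (Φ : EuclideanSpace ℝ (Fin d) → ℂ) (Z : ℝ≥0 → Ω → EuclideanSpace ℝ (Fin d)) : Prop where
  measurable : ∀ t, Measurable (Z t)
  zero : ∀ᵐ ω ∂Pr, Z 0 ω = 0
  cadlag : ∀ᵐ ω ∂Pr, IsCadlagPath fun t => Z t ω
  indep_increments : HasIndepIncrements Z Pr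
  stationary_increments : ∀ s t : ℝ≥0,
    IdentDistrib (fun ω => Z (s + t) ω - Z s ω) (Z t) Pr Pr
  symbol : ∀ (t : ℝ≥0) (p : EuclideanSpace ℝ (Fin d)),
    ∫ ω, Complex.exp (Complex.I * (⟪p, Z t ω⟫ : ℝ)) ∂Pr = Complex.exp (-((t : ℝ) : ℂ) * Φ p)

/-- `X` solves `X_t = x + ∫_0^t A X_s ds + B Z_t` for all `t ≥ 0`, almost surely. -/
structure IsOUProcess {Ω : Type*} [MeasurableSpace Ω] (Pr : Measure Ω) {N d : ℕ}
    (A : Matrix (Fin N) (Fin N) ℝ) (B : Matrix (Fin N) (Fin d) ℝ)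
    (Z : ℝ≥0 → Ω → EuclideanSpace ℝ (Fin d)) (x : EuclideanSpace ℝ (Fin N))
    (X : ℝ≥0 → Ω → EuclideanSpace ℝ (Fin N)) : Prop where
  measurable : ∀ t, Measurable (X t)
  cadlag : ∀ᵐ ω ∂Pr, IsCadlagPath fun t => X t ω
  equation : ∀ᵐ ω ∂Pr, ∀ t : ℝ≥0,
    X t ω = x + (∫ s in (0 : ℝ)..t, Matrix.toEuclideanLin A (X s.toNNReal ω))
      + Matrix.toEuclideanLin B (Z t ω)

/-- The transition semigroup `P_t φ (x) = 𝔼[φ(X_t^x)]`, where `X x` is the process started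
from `x`. -/
def transitionSemigroup {Ω : Type*} [MeasurableSpace Ω] (Pr : Measure Ω) {N : ℕ}
    (X : EuclideanSpace ℝ (Fin N) → ℝ≥0 → Ω → EuclideanSpace ℝ (Fin N)) (t : ℝ≥0)
    (φ : EuclideanSpace ℝ (Fin N) → ℝ) (x : EuclideanSpace ℝ (Fin N)) : ℝ :=
  ∫ ω, φ (X x t ω) ∂Pr

/-! ### The operator and weak solutions -/

/-- The Hessian matrix. -/
def hessianMatrix {N : ℕ} (φ : EuclideanSpace ℝ (Fin N) → ℝ) (x : EuclideanSpace ℝ (Fin N)) :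
    Matrix (Fin N) (Fin N) ℝ :=
  Matrix.of fun i j =>
    iteratedFDeriv ℝ 2 φ x ![EuclideanSpace.single i 1, EuclideanSpace.single j 1]

/-- The formal adjoint `𝓛^*` of the Lévy operator `𝓛` with triplet `(b, Q, ν)`. -/
def levyAdjoint {N d : ℕ} (B : Matrix (Fin N) (Fin d) ℝ)
    (b : EuclideanSpace ℝ (Fin d)) (Q : Matrix (Fin d) (Fin d) ℝ)
    (ν : Measure (EuclideanSpace ℝ (Fin d))) (φ : EuclideanSpace ℝ (Fin N) → ℝ)
    (x : EuclideanSpace ℝ (Fin N)) : ℝ :=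
  1 / 2 * (B * Q * B.transpose * hessianMatrix φ x).trace
    - fderiv ℝ φ x (Matrix.toEuclideanLin B b)
    + ∫ z, (φ (x - Matrix.toEuclideanLin B z) - φ x
        + (Metric.ball (0 : EuclideanSpace ℝ (Fin d)) 1).indicator
            (fun z => fderiv ℝ φ x (Matrix.toEuclideanLin B z)) z) ∂ν

/-- The formal adjoint of `𝓛^{ou} = 𝓛 + ⟨Ax, D⟩`. -/
def ouAdjoint {N d : ℕ} (A : Matrix (Fin N) (Fin N) ℝ) (B : Matrix (Fin N) (Fin d) ℝ)
    (b : EuclideanSpace ℝ (Fin d)) (Q : Matrix (Fin d) (Fin d) ℝ)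
    (ν : Measure (EuclideanSpace ℝ (Fin d))) (φ : EuclideanSpace ℝ (Fin N) → ℝ)
    (x : EuclideanSpace ℝ (Fin N)) : ℝ :=
  levyAdjoint B b Q ν φ x - fderiv ℝ φ x (Matrix.toEuclideanLin A x) - A.trace * φ x

/-- `u` is a weak solution of `lam u - 𝓛^{ou} u = g`: it is bounded and uniformly continuous and
satisfies the equation tested against every `φ ∈ C_c^∞(ℝ^N)`. -/
structure IsWeakSolution {N d : ℕ} (A : Matrix (Fin N) (Fin N) ℝ)
    (B : Matrix (Fin N) (Fin d) ℝ)
    (b : EuclideanSpace ℝ (Fin d)) (Q : Matrix (Fin d) (Fin d) ℝ)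
    (ν : Measure (EuclideanSpace ℝ (Fin d))) (lam : ℝ)
    (g u : EuclideanSpace ℝ (Fin N) → ℝ) : Prop where
  bounded : ∃ M : ℝ, ∀ x, |u x| ≤ M
  uniformContinuous : UniformContinuous u
  integral_eq : ∀ φ : EuclideanSpace ℝ (Fin N) → ℝ, ContDiff ℝ (⊤ : ℕ∞) φ →
    HasCompactSupport φ →
    ∫ x, u x * (lam * φ x - ouAdjoint A B b Q ν φ x) = ∫ x, φ x * g x

end LevyOU

end

/-! The candidate solution is the resolvent of the transition semigroup, and everything rests on an
explicit description of its law. Write Y_t = ∫_0^t e^{-sA} B dZ_s, so that X_t^x = e^{tA}(x + Y_t)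
and P_t g(x) = E g(e^{tA}(x + Y_t)). The law of Y_t (`ouLaw`) is defined by its characteristic
function alone. That such a law exists follows from the Lévy–Khintchine formula on (0,t] × ℝ^d,
built here from compound Poisson laws and Lévy's continuity theorem; no stochastic integral is
needed.

Smoothing. Put τ = min(t, 1). The jumps of Z before time τ that belong to the truncated stable part
of ν and have size at most τ^{1/α}ρ can be split off, so the law of Y_t is a convolution of their
contribution with some other probability law R (`exists_convolution_factor`). By self-similarity the
contribution is the image, under τ^{1/α} times the dilation T_τ (multiplication by τ^i on the
stratum of index i), of a law Q_τ with jumps T_τ^{-1} e^{-τsA} B z, s ≤ 1. These directions extend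
continuously to τ = 0 and stay non-degenerate there by the Kalman condition, so compactness gives a
Gramian bound uniform in τ (`exists_gramian_lower_bound`). Hence the characteristic function of Q_τ
decays like exp(-c|p|^α) with all its derivatives, and Q_τ has a smooth, rapidly decreasing density
with bounds independent of τ (`exists_stable_density`). The drift b, the Gaussian part and the
remaining jumps sit in R, about which only total mass one is used; this is why the final constant
depends neither on b nor on Q.

A displacement of x along the stratum i is a displacement of Q_τ multiplied by τ^{-(1+αi)/α}, so
each derivative along that stratum costs t^{-σ/α} with σ = 1+αi. On the other hand g oscillates by
t^{β/α} at the scale of the rescaled noise. For short times this gives |D^m P_t g| ≤ C t^{(β-mσ)/α}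
(`exists_isSmoothing`). Integrating against e^{-λt} and cutting the time integral at h^{α/σ}, up to
a constant, for two points at distance h gives the order (α+β)/σ, with second differences when this
number is an integer (`IsSmoothing.zygmundNorm_integral_le`).

Existence. For a test function φ, the identity to be proved compares two signed measures integrated
against g, so it suffices to compare Fourier transforms. The function t ↦ e^{-λt}
E[e^{ip·e^{tA}Y_t}] φ̂(e^{tA*}p) has as derivative minus the same expression with λφ - (L^{ou})*φ in
place of φ; integrating over (0,∞) gives the claim (`integral_ouResolvent_mul_dualTest`).

Uniqueness. The difference of two solutions is mollified. The result solves the equation pointwise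
up to an error coming from the linear drift, and that error tends to zero uniformly. A maximum
principle on the whole space, with a cutoff adapted to the linear growth of Ax, then forces the
difference to vanish (`eq_zero_of_weakSolution`).

Identification with the process. Variation of constants is carried out on Riemann sums of increments
of Z: they converge almost surely to X_t - e^{tA}x, and independence makes their characteristic
functions explicit (`charFun_map_ouProcess`). -/

noncomputable section

namespace LevyOU

set_option linter.unusedSectionVars false

/-! ### Derivatives of parametric integrals -/

section ParametricIntegral

variable {T : Type*} [MeasurableSpace T] {m : Measure T}
  {F : Type*} [NormedAddCommGroup F] [NormedSpace ℝ F] [FiniteDimensional ℝ F]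
  {G : Type*} [NormedAddCommGroup G] [NormedSpace ℝ G]

/-- An operator-valued map on a finite-dimensional space is measurable if its values are. -/
theorem aestronglyMeasurable_clm_of_apply {L : T → F →L[ℝ] G}
    (hL : ∀ v, AEStronglyMeasurable (fun t => L t v) m) : AEStronglyMeasurable L m := by
  let b := Module.finBasis ℝ F
  have key : L = fun t => ∑ i, ContinuousLinearMap.smulRightL ℝ F G
      (LinearMap.toContinuousLinearMap (b.coord i)) (L t (b i)) := by
    funext t
    ext v
    have h := congrArg (L t) (b.sum_repr v)
    simp only [map_sum, map_smul] at h
    simpa using h.symm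
  rw [key]
  refine Finset.aestronglyMeasurable_fun_sum _ fun i _ => ?_
  exact (ContinuousLinearMap.continuous _).comp_aestronglyMeasurable (hL _)

/-- A derivative is a limit of difference quotients along the sequence 1/n, so measurability of the
point values suffices; no joint measurability in parameter and point is required. -/
theorem aestronglyMeasurable_fderiv_family {f : T → F → G}
    (hf : ∀ᵐ t ∂m, Differentiable ℝ (f t))
    (hmeas : ∀ x, AEStronglyMeasurable (fun t => f t x) m) (x : F) :
    AEStronglyMeasurable (fun t => fderiv ℝ (f t) x) m := by
  refine aestronglyMeasurable_clm_of_apply fun v => ?_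
  refine aestronglyMeasurable_of_tendsto_ae atTop
    (f := fun (n : ℕ) t => (n : ℝ) • (f t (x + (n : ℝ)⁻¹ • v) - f t x)) (fun n => ?_) ?_
  · exact ((hmeas _).sub (hmeas _)).const_smul _
  · filter_upwards [hf] with t ht
    have h1 := (ht x).hasFDerivAt.lim_real v
    exact h1.comp tendsto_natCast_atTop_atTop

theorem aestronglyMeasurable_iteratedFDeriv_family {k : ℕ} {f : T → F → G}
    (hf : ∀ᵐ t ∂m, ContDiff ℝ k (f t))
    (hmeas : ∀ x, AEStronglyMeasurable (fun t => f t x) m) {j : ℕ} (hj : j ≤ k) (x : F) :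
    AEStronglyMeasurable (fun t => iteratedFDeriv ℝ j (f t) x) m := by
  induction j generalizing x with
  | zero =>
    simp only [iteratedFDeriv_zero_eq_comp]
    exact (LinearIsometryEquiv.continuous _).comp_aestronglyMeasurable (hmeas x)
  | succ j ih =>
    simp only [iteratedFDeriv_succ_eq_comp_left, Function.comp_apply]
    refine (LinearIsometryEquiv.continuous _).comp_aestronglyMeasurable ?_
    refine aestronglyMeasurable_fderiv_family (f := fun t => iteratedFDeriv ℝ j (f t)) ?_
      (fun x => ih (by omega) x) x
    filter_upwards [hf] with t ht
    exact ht.differentiable_iteratedFDeriv (by exact_mod_cast hj)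

/-- Differentiation under the integral, applied successively to the iterated derivatives; domination
is only needed on bounded sets. Exhibiting the Taylor series yields regularity and the formula for
the derivatives at once. -/
theorem hasFTaylorSeriesUpTo_integral_of_dominated (k : ℕ) {f : T → F → G}
    (hf : ∀ᵐ t ∂m, ContDiff ℝ k (f t))
    (hmeas : ∀ x, AEStronglyMeasurable (fun t => f t x) m)
    (hb : ∀ R : ℝ, ∀ j ≤ k, ∃ b : T → ℝ, Integrable b m ∧
      ∀ᵐ t ∂m, ∀ x, ‖x‖ ≤ R → ‖iteratedFDeriv ℝ j (f t) x‖ ≤ b t) :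
    HasFTaylorSeriesUpTo k (fun x => ∫ t, f t x ∂m)
      (fun x j => ∫ t, iteratedFDeriv ℝ j (f t) x ∂m) := by
  have hint : ∀ j ≤ k, ∀ x, Integrable (fun t => iteratedFDeriv ℝ j (f t) x) m := by
    intro j hj x
    obtain ⟨b, hbi, hbb⟩ := hb ‖x‖ j hj
    exact hbi.mono' (aestronglyMeasurable_iteratedFDeriv_family hf hmeas hj x)
      (hbb.mono fun t ht => ht x le_rfl)
  constructor
  · intro x
    rw [show (∫ t, f t x ∂m) = ∫ t, (continuousMultilinearCurryFin0 ℝ F G)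
      (iteratedFDeriv ℝ 0 (f t) x) ∂m by simp]
    exact ((continuousMultilinearCurryFin0 ℝ F G).toContinuousLinearEquiv.integral_comp_comm
      (fun t => iteratedFDeriv ℝ 0 (f t) x)).symm
  · intro j hj x
    have hj' : j + 1 ≤ k := by
      have : j < k := by exact_mod_cast hj
      omega
    obtain ⟨b, hbi, hbb⟩ := hb (‖x‖ + 1) (j + 1) hj'
    have := hasFDerivAt_integral_of_dominated_of_fderiv_le (μ := m) (𝕜 := ℝ) (x₀ := x)
      (s := Metric.ball x 1) (F := fun x t => iteratedFDeriv ℝ j (f t) x)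
      (F' := fun x t => fderiv ℝ (iteratedFDeriv ℝ j (f t)) x) (bound := b)
      (Metric.ball_mem_nhds _ one_pos)
      (Eventually.of_forall fun y =>
        aestronglyMeasurable_iteratedFDeriv_family hf hmeas (by omega) y)
      (hint j (by omega) x) ?_ ?_ hbi ?_
    · convert! this using 1
      let e : (F [×(j + 1)]→L[ℝ] G) ≃L[ℝ] (F →L[ℝ] F [×j]→L[ℝ] G) :=
        (continuousMultilinearCurryLeftEquiv ℝ (fun _ : Fin (j + 1) => F) G
          ).toContinuousLinearEquiv
      exact (ContinuousLinearEquiv.integral_comp_comm (𝕜 := ℝ) (E := F [×(j + 1)]→L[ℝ] G)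
        (F := F →L[ℝ] F [×j]→L[ℝ] G) (μ := m) e (fun t => iteratedFDeriv ℝ (j + 1) (f t) x)).symm
    · refine aestronglyMeasurable_fderiv_family (f := fun t => iteratedFDeriv ℝ j (f t)) ?_
        (fun x => aestronglyMeasurable_iteratedFDeriv_family hf hmeas (by omega) x) x
      filter_upwards [hf] with t ht
      exact ht.differentiable_iteratedFDeriv (by exact_mod_cast hj')
    · filter_upwards [hbb] with t ht y hy
      rw [norm_fderiv_iteratedFDeriv]
      refine ht y ?_
      have : ‖y - x‖ < 1 := by simpa [dist_eq_norm] using hy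
      have := norm_le_norm_add_norm_sub' y x
      linarith [norm_sub_rev y x]
    · filter_upwards [hf] with t ht y hy
      exact (ht.differentiable_iteratedFDeriv (by exact_mod_cast hj') y).hasFDerivAt
  · intro j hj
    have hj' : j ≤ k := by exact_mod_cast hj
    rw [continuous_iff_continuousAt]
    intro x
    obtain ⟨b, hbi, hbb⟩ := hb (‖x‖ + 1) j hj'
    refine continuousAt_of_dominated (bound := b)
      (Eventually.of_forall fun y =>
        aestronglyMeasurable_iteratedFDeriv_family hf hmeas hj' y) ?_ hbi ?_
    · filter_upwards [Metric.ball_mem_nhds x one_pos] with y hy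
      filter_upwards [hbb] with t ht
      refine ht y ?_
      have : ‖y - x‖ < 1 := by simpa [dist_eq_norm] using hy
      have := norm_le_norm_add_norm_sub' y x
      linarith [norm_sub_rev y x]
    · filter_upwards [hf] with t ht
      exact (ht.continuous_iteratedFDeriv (by exact_mod_cast hj')).continuousAt

theorem contDiff_integral_of_dominated (k : ℕ) {f : T → F → G}
    (hf : ∀ᵐ t ∂m, ContDiff ℝ k (f t))
    (hmeas : ∀ x, AEStronglyMeasurable (fun t => f t x) m)
    (hb : ∀ R : ℝ, ∀ j ≤ k, ∃ b : T → ℝ, Integrable b m ∧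
      ∀ᵐ t ∂m, ∀ x, ‖x‖ ≤ R → ‖iteratedFDeriv ℝ j (f t) x‖ ≤ b t) :
    ContDiff ℝ k (fun x => ∫ t, f t x ∂m) :=
  (hasFTaylorSeriesUpTo_integral_of_dominated k hf hmeas hb).contDiff (n := (k : ℕ∞))

theorem iteratedFDeriv_integral_of_dominated (k : ℕ) {f : T → F → G}
    (hf : ∀ᵐ t ∂m, ContDiff ℝ k (f t))
    (hmeas : ∀ x, AEStronglyMeasurable (fun t => f t x) m)
    (hb : ∀ R : ℝ, ∀ j ≤ k, ∃ b : T → ℝ, Integrable b m ∧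
      ∀ᵐ t ∂m, ∀ x, ‖x‖ ≤ R → ‖iteratedFDeriv ℝ j (f t) x‖ ≤ b t)
    {j : ℕ} (hj : j ≤ k) (x : F) :
    iteratedFDeriv ℝ j (fun x => ∫ t, f t x ∂m) x = ∫ t, iteratedFDeriv ℝ j (f t) x ∂m :=
  ((hasFTaylorSeriesUpTo_integral_of_dominated k hf hmeas hb).eq_iteratedFDeriv
    (by exact_mod_cast hj) x).symm

end ParametricIntegral

/-! ### Characteristic functions of infinitely divisible laws -/

section Characteristic

variable {E : Type*} [NormedAddCommGroup E] [InnerProductSpace ℝ E] [FiniteDimensional ℝ E]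
  [MeasurableSpace E] [BorelSpace E]

/-- `f` is the characteristic function of some probability measure. -/
def IsCharacteristic (f : E → ℂ) : Prop :=
  ∃ P : Measure E, IsProbabilityMeasure P ∧ ∀ p, charFun P p = f p

omit [FiniteDimensional ℝ E] in
theorem isCharacteristic_exp_inner (a : E) :
    IsCharacteristic (fun p : E => Complex.exp ((⟪a, p⟫ : ℝ) * Complex.I)) :=
  ⟨Measure.dirac a, inferInstance, fun p => by rw [charFun_dirac]⟩

theorem IsCharacteristic.mul {f g : E → ℂ} (hf : IsCharacteristic f) (hg : IsCharacteristic g) :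
    IsCharacteristic (fun p => f p * g p) := by
  obtain ⟨P, hP, hPf⟩ := hf
  obtain ⟨Q, hQ, hQg⟩ := hg
  exact ⟨P ∗ Q, inferInstance, fun p => by rw [charFun_conv, hPf, hQg]⟩

theorem IsCharacteristic.pow {f : E → ℂ} (hf : IsCharacteristic f) (n : ℕ) :
    IsCharacteristic (fun p => f p ^ n) := by
  induction n with
  | zero => simpa using isCharacteristic_exp_inner (0 : E)
  | succ n ih => simpa only [pow_succ] using ih.mul hf

/-- Lévy's continuity theorem. Continuity of the limit at 0 gives tightness, Prokhorov's theorem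
gives compactness, and a limit along an ultrafilter plays the role of a convergent subsequence. -/
theorem IsCharacteristic.of_tendsto {f : ℕ → E → ℂ} {g : E → ℂ}
    (hf : ∀ n, IsCharacteristic (f n)) (hg : ContinuousAt g 0)
    (h : ∀ p, Tendsto (fun n => f n p) atTop (𝓝 (g p))) : IsCharacteristic g := by
  choose P hP hPf using hf
  have htight := isTightMeasureSet_of_tendsto_charFun (μ := P) hg
    (fun t => by simpa only [hPf] using h t)
  let Q : ℕ → ProbabilityMeasure E := fun n => ⟨P n, hP n⟩
  have hc : IsCompact (closure (Set.range Q)) := by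
    refine isCompact_closure_of_isTightMeasureSet ?_
    convert! htight using 1
    ext ρ
    exact ⟨fun ⟨μ, ⟨n, hn⟩, h⟩ => ⟨n, by rw [← h, ← hn]; rfl⟩, fun ⟨n, hn⟩ => ⟨Q n, ⟨n, rfl⟩, hn⟩⟩
  let 𝒰 : Ultrafilter ℕ := Ultrafilter.of atTop
  have h𝒰 : (𝒰 : Filter ℕ) ≤ atTop := Ultrafilter.of_le atTop
  obtain ⟨R, -, hR⟩ := hc.ultrafilter_le_nhds (𝒰.map Q) (by
    rw [le_principal_iff]
    refine mem_of_superset ?_ subset_closure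
    simp [Ultrafilter.coe_map])
  have hR' : Tendsto Q 𝒰 (𝓝 R) := hR
  refine ⟨R, inferInstance, fun p => ?_⟩
  have h1 : Tendsto (fun n => charFun (P n) p) 𝒰 (𝓝 (charFun R p)) := by
    rw [ProbabilityMeasure.tendsto_iff_forall_integral_rclike_tendsto ℂ] at hR'
    simp_rw [charFun_eq_integral_innerProbChar]
    exact hR' (BoundedContinuousFunction.innerProbChar p)
  have h2 : Tendsto (fun n => charFun (P n) p) 𝒰 (𝓝 (g p)) := by
    simp only [hPf]
    exact (h p).mono_left h𝒰
  exact tendsto_nhds_unique h1 h2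

omit [FiniteDimensional ℝ E] in
theorem integrable_exp_inner (m : Measure E) [IsFiniteMeasure m] (p : E) :
    Integrable (fun x : E => Complex.exp ((⟪x, p⟫ : ℝ) * Complex.I)) m := by
  refine (integrable_const (1 : ℝ)).mono' (by fun_prop) (Eventually.of_forall fun x => ?_)
  rw [Complex.norm_exp_ofReal_mul_I]

/-- Compound Poisson laws. -/
theorem isCharacteristic_compoundPoisson (m : Measure E) [IsFiniteMeasure m] :
    IsCharacteristic (fun p : E => Complex.exp
      (∫ x, (Complex.exp ((⟪x, p⟫ : ℝ) * Complex.I) - 1) ∂m)) := by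
  set c : ℝ := m.real Set.univ with hc
  have hc0 : 0 ≤ c := measureReal_nonneg
  have hval : ∀ p : E, ∫ x, (Complex.exp ((⟪x, p⟫ : ℝ) * Complex.I) - 1) ∂m
      = charFun m p - c := by
    intro p
    rw [integral_sub (integrable_exp_inner m p) (integrable_const _), charFun_apply]
    simp [hc]
  simp only [hval]
  -- The law is the limit of convolution powers of (1 - c/l)δ_0 + m/l with l = n + K + 1 factors;
  -- the shift by K + 1 makes c/l ≤ 1, so the weight of δ_0 is never negative.
  let K : ℕ := ⌈c⌉₊
  have hK : ∀ n : ℕ, c / ((n + K + 1 : ℕ) : ℝ) ≤ 1 := by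
    intro n
    rw [div_le_one (by positivity)]
    have := Nat.le_ceil c
    push_cast
    have hn : (0 : ℝ) ≤ n := n.cast_nonneg
    linarith
  refine IsCharacteristic.of_tendsto
    (f := fun n p => (1 + (charFun m p - c) / ((n + K + 1 : ℕ) : ℂ)) ^ (n + K + 1)) ?_ ?_ ?_
  · intro n
    refine IsCharacteristic.pow ?_ _
    let q : ℝ≥0 := ((n + K + 1 : ℕ) : ℝ≥0)⁻¹
    have hq : (q : ℝ) = ((n + K + 1 : ℕ) : ℝ)⁻¹ := by simp [q]
    obtain ⟨w, hw⟩ : ∃ w : ℝ≥0, (w : ℝ) = 1 - c / ((n + K + 1 : ℕ) : ℝ) :=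
      ⟨⟨_, by linarith [hK n]⟩, rfl⟩
    refine ⟨w • Measure.dirac 0 + q • m, ⟨?_⟩, fun p => ?_⟩
    · have : ((w • Measure.dirac (0 : E) + q • m) : Measure E).real Set.univ = 1 := by
        rw [measureReal_add_apply]
        simp only [measureReal_nnreal_smul_apply, ← hc, hq]
        simp only [probReal_univ, hw]
        field_simp
        ring
      rw [measureReal_def, ENNReal.toReal_eq_one_iff] at this
      exact this
    · rw [charFun_apply, integral_add_measure, integral_smul_nnreal_measure,
        integral_smul_nnreal_measure, integral_dirac, ← charFun_apply]
      · simp only [inner_zero_left, Complex.ofReal_zero, zero_mul, Complex.exp_zero, NNReal.smul_def,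
          hq, hw, Complex.real_smul]
        push_cast
        field_simp
        ring
      · exact integrable_exp_inner _ _
      · exact integrable_exp_inner _ _
  · fun_prop
  · intro p
    have h1 := (Complex.tendsto_one_add_div_pow_exp (charFun m p - c)).comp
      (tendsto_add_atTop_nat (K + 1))
    exact h1

theorem norm_exp_mul_I_sub_one_sub_le (x : ℝ) :
    ‖Complex.exp (x * Complex.I) - 1 - x * Complex.I‖ ≤ 3 * x ^ 2 := by
  by_cases hx : |x| ≤ 1
  · have h1 := Complex.norm_exp_sub_one_sub_id_le (x := x * Complex.I) (by simpa using hx)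
    have h2 : ‖(x * Complex.I : ℂ)‖ ^ 2 = x ^ 2 := by simp
    rw [h2] at h1
    nlinarith [sq_nonneg x]
  · push Not at hx
    have h1 : ‖Complex.exp (x * Complex.I) - 1 - x * Complex.I‖ ≤ 1 + 1 + |x| := by
      refine (norm_sub_le _ _).trans (add_le_add ((norm_sub_le _ _).trans (add_le_add ?_ ?_)) ?_)
      · rw [Complex.norm_exp_ofReal_mul_I]
      · simp
      · simp
    nlinarith [sq_abs x]

/-- The integrand of the Lévy–Khintchine formula, with jumps `y` compensated on `S`. -/
def levyKernel {X : Type*} (y : X → E) (S : Set X) (p : E) (e : X) : ℂ :=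
  Complex.exp ((⟪y e, p⟫ : ℝ) * Complex.I) - 1
    - S.indicator (fun e => ((⟪y e, p⟫ : ℝ) : ℂ) * Complex.I) e

/-- The weight `|y|²` on `S` and `1` elsewhere. -/
def levyWeight {X : Type*} (y : X → E) (S : Set X) (e : X) : ℝ :=
  S.indicator (fun e => ‖y e‖ ^ 2) e + Sᶜ.indicator 1 e

variable {X : Type*} [MeasurableSpace X] {M : Measure X} {y : X → E} {S : Set X}

omit [FiniteDimensional ℝ E] [MeasurableSpace E] [BorelSpace E] [MeasurableSpace X] in
theorem norm_levyKernel_le (p : E) (e : X) :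
    ‖levyKernel y S p e‖ ≤ 3 * (1 + ‖p‖ ^ 2) * levyWeight y S e := by
  unfold levyKernel levyWeight
  by_cases he : e ∈ S
  · simp only [Set.indicator_of_mem he, Set.indicator_of_notMem (fun h : e ∈ Sᶜ => h he), add_zero]
    refine (norm_exp_mul_I_sub_one_sub_le _).trans ?_
    have h1 : ⟪y e, p⟫ ^ 2 ≤ (‖y e‖ * ‖p‖) ^ 2 := by
      rw [← sq_abs ⟪y e, p⟫]
      gcongr
      exact abs_real_inner_le_norm _ _
    nlinarith [sq_nonneg ‖y e‖]
  · simp only [Set.indicator_of_notMem he, Set.indicator_of_mem (show e ∈ Sᶜ from he), sub_zero,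
      zero_add, Pi.one_apply, mul_one]
    have : ‖Complex.exp ((⟪y e, p⟫ : ℝ) * Complex.I) - 1‖ ≤ 1 + 1 := by
      refine (norm_sub_le _ _).trans ?_
      rw [Complex.norm_exp_ofReal_mul_I]
      simp
    nlinarith [sq_nonneg ‖p‖]

omit [InnerProductSpace ℝ E] [FiniteDimensional ℝ E] [MeasurableSpace E] [BorelSpace E] in
theorem integrable_levyWeight (hS : MeasurableSet S)
    (h1 : IntegrableOn (fun e => ‖y e‖ ^ 2) S M) (h2 : M Sᶜ < ∞) :
    Integrable (levyWeight y S) M := by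
  refine Integrable.add (h1.integrable_indicator hS) ?_
  exact (integrable_indicator_iff hS.compl).2 (integrableOn_const (hs := h2.ne))

theorem measurable_levyKernel (hy : Measurable y) (hS : MeasurableSet S) (p : E) :
    Measurable (levyKernel y S p) := by
  unfold levyKernel
  have h : Measurable fun e => (((⟪y e, p⟫ : ℝ) : ℂ) * Complex.I) := by fun_prop
  exact ((Complex.measurable_exp.comp h).sub_const 1).sub (h.indicator hS)

theorem integrable_levyKernel (hy : Measurable y) (hS : MeasurableSet S)
    (hw : Integrable (levyWeight y S) M) (p : E) : Integrable (levyKernel y S p) M :=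
  (hw.const_mul _).mono' (measurable_levyKernel hy hS p).aestronglyMeasurable
    (Eventually.of_forall fun e => norm_levyKernel_le p e)

theorem continuous_integral_levyKernel (hy : Measurable y) (hS : MeasurableSet S)
    (hw : Integrable (levyWeight y S) M) :
    Continuous (fun p : E => ∫ e, levyKernel y S p e ∂M) := by
  rw [continuous_iff_continuousAt]
  intro p
  refine continuousAt_of_dominated
    (bound := fun e => 3 * (1 + (‖p‖ + 1) ^ 2) * levyWeight y S e)
    (Eventually.of_forall fun q => (measurable_levyKernel hy hS q).aestronglyMeasurable) ?_
    (hw.const_mul _) (Eventually.of_forall fun e => ?_)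
  · filter_upwards [Metric.ball_mem_nhds p one_pos] with q hq
    refine Eventually.of_forall fun e => (norm_levyKernel_le q e).trans ?_
    have hq' : ‖q‖ ≤ ‖p‖ + 1 := by
      have : ‖q - p‖ < 1 := by simpa [dist_eq_norm] using hq
      have := norm_le_norm_add_norm_sub' q p
      linarith [norm_sub_rev q p]
    have hw0 : 0 ≤ levyWeight y S e := by
      unfold levyWeight
      exact add_nonneg (Set.indicator_nonneg (fun _ _ => by positivity) _)
        (Set.indicator_nonneg (fun _ _ => by simp) _)
    gcongr
  · unfold levyKernel
    by_cases he : e ∈ S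
    · simp only [Set.indicator_of_mem he]
      fun_prop
    · simp only [Set.indicator_of_notMem he]
      fun_prop

/-- The Lévy–Khintchine formula without Gaussian part defines a characteristic function. -/
theorem isCharacteristic_levy (hy : Measurable y) (hS : MeasurableSet S)
    (h1 : IntegrableOn (fun e => ‖y e‖ ^ 2) S M) (h2 : M Sᶜ < ∞) :
    IsCharacteristic (fun p : E => Complex.exp (∫ e, levyKernel y S p e ∂M)) := by
  have hw := integrable_levyWeight hS h1 h2
  -- Truncation of the small compensated jumps. On `D n` the jump measure is finite, so the law is
  -- compound Poisson, and the compensator is a deterministic translation by `-c`.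
  let D : ℕ → Set X := fun n => Sᶜ ∪ {e | ((n : ℝ) + 1)⁻¹ ≤ ‖y e‖}
  have hDm : ∀ n, MeasurableSet (D n) := fun n =>
    hS.compl.union (measurableSet_le measurable_const hy.norm)
  have hSD : ∀ n, M (S ∩ D n) < ∞ := by
    intro n
    have h3 := h1.measure_norm_ge_lt_top (ε := ((n : ℝ) + 1)⁻¹ ^ 2) (by positivity)
    rw [Measure.restrict_apply₀' hS.nullMeasurableSet] at h3
    refine lt_of_le_of_lt (measure_mono ?_) h3
    rintro e ⟨heS, heD⟩
    refine ⟨?_, heS⟩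
    rcases heD with h | h
    · exact absurd heS h
    · have h' : ((n : ℝ) + 1)⁻¹ ≤ ‖y e‖ := h
      change ((n : ℝ) + 1)⁻¹ ^ 2 ≤ ‖‖y e‖ ^ 2‖
      rw [Real.norm_of_nonneg (by positivity)]
      gcongr
  have hDfin : ∀ n, M (D n) < ∞ := by
    intro n
    refine lt_of_le_of_lt (measure_mono (t := Sᶜ ∪ (S ∩ D n)) ?_)
      ((measure_union_le _ _).trans_lt (ENNReal.add_lt_top.2 ⟨h2, hSD n⟩))
    intro e he
    by_cases heS : e ∈ S
    · exact Or.inr ⟨heS, he⟩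
    · exact Or.inl heS
  refine IsCharacteristic.of_tendsto
    (f := fun n p => Complex.exp (∫ e in D n, levyKernel y S p e ∂M)) (fun n => ?_)
    (Complex.continuous_exp.comp (continuous_integral_levyKernel hy hS hw)).continuousAt
    (fun p => ?_)
  · have : IsFiniteMeasure (M.restrict (D n)) := ⟨by simpa using hDfin n⟩
    let c : E := ∫ e in D n, S.indicator y e ∂M
    have hyint : Integrable (S.indicator y) (M.restrict (D n)) := by
      rw [integrable_indicator_iff hS]
      have hfin : IsFiniteMeasure ((M.restrict (D n)).restrict S) := inferInstance
      have h3 : Integrable (fun e => ‖y e‖ ^ 2) ((M.restrict (D n)).restrict S) := by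
        rw [Measure.restrict_restrict hS]
        exact h1.mono_set Set.inter_subset_left
      refine ((integrable_const (1 : ℝ)).add h3).mono' hy.aestronglyMeasurable
        (Eventually.of_forall fun e => ?_)
      simp only [Pi.add_apply]
      nlinarith [sq_nonneg (‖y e‖ - 1)]
    have h := (isCharacteristic_compoundPoisson ((M.restrict (D n)).map y)).mul
      (isCharacteristic_exp_inner (-c))
    convert! h using 2 with p
    rw [← Complex.exp_add]
    congr 1
    rw [integral_map hy.aemeasurable (by fun_prop)]
    have e1 : ∫ e in D n, S.indicator (fun e => ((⟪y e, p⟫ : ℝ) : ℂ) * Complex.I) e ∂M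
        = ((⟪c, p⟫ : ℝ) : ℂ) * Complex.I := by
      have e2 : ∀ e, S.indicator (fun e => ((⟪y e, p⟫ : ℝ) : ℂ) * Complex.I) e
          = ((⟪p, S.indicator y e⟫ : ℝ) : ℂ) * Complex.I := by
        intro e
        by_cases he : e ∈ S
        · simp [Set.indicator_of_mem he, real_inner_comm]
        · simp [Set.indicator_of_notMem he]
      simp_rw [e2]
      rw [integral_mul_const, integral_complex_ofReal, integral_inner hyint, real_inner_comm]
    unfold levyKernel
    rw [integral_sub, e1]
    · simp [inner_neg_left, sub_eq_add_neg]
    · refine Integrable.sub ?_ (integrable_const _)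
      refine (integrable_const (1 : ℝ)).mono' (by fun_prop) (Eventually.of_forall fun x => ?_)
      rw [Complex.norm_exp_ofReal_mul_I]
    · have e2 : S.indicator (fun e => ((⟪y e, p⟫ : ℝ) : ℂ) * Complex.I)
          = fun e => ((⟪p, S.indicator y e⟫ : ℝ) : ℂ) * Complex.I := by
        funext e
        by_cases he : e ∈ S
        · simp [Set.indicator_of_mem he, real_inner_comm]
        · simp [Set.indicator_of_notMem he]
      rw [e2]
      exact ((hyint.const_inner p).ofReal).mul_const _
  · refine (Complex.continuous_exp.tendsto _).comp ?_
    simp_rw [← integral_indicator (hDm _)]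
    refine tendsto_integral_of_dominated_convergence
      (fun e => 3 * (1 + ‖p‖ ^ 2) * levyWeight y S e)
      (fun n => ((measurable_levyKernel hy hS p).indicator (hDm n)).aestronglyMeasurable)
      (hw.const_mul _) (fun n => Eventually.of_forall fun e =>
        (norm_indicator_le_norm_self _ _).trans (norm_levyKernel_le p e))
      (Eventually.of_forall fun e => ?_)
    -- Compensated jumps of size zero never enter `D n`, but there the kernel vanishes; every other
    -- point lies in `D n` for large n.
    by_cases he : e ∈ S ∧ y e = 0
    · have : levyKernel y S p e = 0 := by
        simp [levyKernel, Set.indicator_of_mem he.1, he.2]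
      have h0 : ∀ n, (D n).indicator (levyKernel y S p) e = 0 := fun n => by
        by_cases h : e ∈ D n
        · rw [Set.indicator_of_mem h, this]
        · rw [Set.indicator_of_notMem h]
      simp only [h0, this]
      exact tendsto_const_nhds
    · refine tendsto_const_nhds.congr' ?_
      have hev : ∀ᶠ n : ℕ in atTop, e ∈ D n := by
        by_cases heS : e ∈ S
        · have hy0 : 0 < ‖y e‖ := norm_pos_iff.2 fun h => he ⟨heS, h⟩
          have := tendsto_one_div_add_atTop_nhds_zero_nat (𝕜 := ℝ)
          filter_upwards [this.eventually (gt_mem_nhds hy0)] with n hn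
          exact Or.inr (by simpa using hn.le)
        · exact Eventually.of_forall fun n => Or.inl heS
      filter_upwards [hev] with n hn
      rw [Set.indicator_of_mem hn]

/-- Taylor expansion of third order: with r = (n+1)^{-1/2} the error is O(r³|x|³), and the factor n
+ 1 = r^{-2} leaves O(r). This is the central limit computation behind Gaussian laws. -/
theorem tendsto_nat_mul_exp_sub (x : ℝ) :
    Tendsto (fun n : ℕ => ((n : ℂ) + 1) * (Complex.exp (((Real.sqrt (n + 1))⁻¹ * x : ℝ)
      * Complex.I) - 1 - ((Real.sqrt (n + 1))⁻¹ * x : ℝ) * Complex.I)) atTop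
      (𝓝 ((-(x ^ 2 / 2) : ℝ) : ℂ)) := by
  have hs : Tendsto (fun n : ℕ => (Real.sqrt ((n : ℝ) + 1))⁻¹) atTop (𝓝 0) := by
    refine (Real.tendsto_sqrt_atTop.comp ?_).inv_tendsto_atTop
    exact tendsto_atTop_add_const_right _ _ tendsto_natCast_atTop_atTop
  rw [tendsto_iff_norm_sub_tendsto_zero]
  have h1 : Tendsto (fun n : ℕ => (Real.sqrt ((n : ℝ) + 1))⁻¹ * (4 * |x| ^ 3)) atTop (𝓝 0) := by
    simpa using hs.mul_const (4 * |x| ^ 3)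
  refine squeeze_zero' (Eventually.of_forall fun n => norm_nonneg _) ?_ h1
  have h2 : ∀ᶠ n : ℕ in atTop, (Real.sqrt ((n : ℝ) + 1))⁻¹ * |x| ≤ 1 := by
    have : Tendsto (fun n : ℕ => (Real.sqrt ((n : ℝ) + 1))⁻¹ * |x|) atTop (𝓝 0) := by
      simpa using hs.mul_const |x|
    exact this.eventually_le_const one_pos
  filter_upwards [h2] with n hn
  set r : ℝ := (Real.sqrt ((n : ℝ) + 1))⁻¹ with hr
  have hr0 : 0 < r := by positivity
  have hrn : ((n : ℝ) + 1) * r ^ 2 = 1 := by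
    rw [hr, inv_pow, Real.sq_sqrt (by positivity)]
    field_simp
  have hz : ‖((r * x : ℝ) : ℂ) * Complex.I‖ = r * |x| := by
    simp [abs_of_pos hr0]
  have hb := Complex.exp_bound (x := ((r * x : ℝ) : ℂ) * Complex.I) (by rw [hz]; exact hn)
    (n := 3) (by norm_num)
  rw [hz] at hb
  have hsum : ∑ m ∈ Finset.range 3, (((r * x : ℝ) : ℂ) * Complex.I) ^ m / (m.factorial : ℂ)
      = 1 + ((r * x : ℝ) : ℂ) * Complex.I - ((r * x) ^ 2 / 2 : ℝ) := by
    simp [Finset.sum_range_succ, mul_pow, Nat.factorial]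
    ring
  rw [hsum] at hb
  have heq : ((n : ℂ) + 1) * (Complex.exp (((r * x : ℝ) : ℂ) * Complex.I) - 1
      - ((r * x : ℝ) : ℂ) * Complex.I) - ((-(x ^ 2 / 2) : ℝ) : ℂ)
      = ((n : ℂ) + 1) * (Complex.exp (((r * x : ℝ) : ℂ) * Complex.I)
        - (1 + ((r * x : ℝ) : ℂ) * Complex.I - ((r * x) ^ 2 / 2 : ℝ))) := by
    have : (((n : ℝ) + 1) * r ^ 2 : ℂ) = 1 := by exact_mod_cast hrn
    push_cast at this ⊢
    linear_combination (-(x : ℂ) ^ 2 / 2) * this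
  have hn1 : ‖((n : ℂ) + 1)‖ = (n : ℝ) + 1 := by
    rw [show ((n : ℂ) + 1) = ((n + 1 : ℕ) : ℂ) by push_cast; ring, Complex.norm_natCast]
    push_cast; ring
  push_cast at heq hb ⊢
  rw [heq, norm_mul, hn1]
  calc ((n : ℝ) + 1) * _ ≤ ((n : ℝ) + 1) * ((r * |x|) ^ 3 * (3 + 1)) := by
        refine mul_le_mul_of_nonneg_left (hb.trans ?_) (by positivity)
        refine mul_le_mul_of_nonneg_left ?_ (by positivity)
        norm_num [Nat.factorial]
    _ = (((n : ℝ) + 1) * r ^ 2) * (r * (4 * |x| ^ 3)) := by ring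
    _ = _ := by rw [hrn, one_mul]

/-- Gaussian characteristic functions. -/
theorem isCharacteristic_gaussian (hy : Measurable y) (h1 : Integrable (fun e => ‖y e‖ ^ 2) M) :
    IsCharacteristic (fun p : E => Complex.exp ((-(1 / 2 * ∫ e, ⟪y e, p⟫ ^ 2 ∂M) : ℝ))) := by
  have hint : ∀ p : E, Integrable (fun e => ⟪y e, p⟫ ^ 2) M := by
    intro p
    refine (h1.mul_const (‖p‖ ^ 2)).mono' (by fun_prop) (Eventually.of_forall fun e => ?_)
    rw [Real.norm_of_nonneg (sq_nonneg _), ← mul_pow, ← sq_abs]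
    gcongr
    exact abs_real_inner_le_norm _ _
  have hval : ∀ (n : ℕ) (p : E) (e : X), levyKernel (fun e => (Real.sqrt (n + 1))⁻¹ • y e) Set.univ
      p e = Complex.exp (((Real.sqrt (n + 1))⁻¹ * ⟪y e, p⟫ : ℝ) * Complex.I) - 1
        - ((Real.sqrt (n + 1))⁻¹ * ⟪y e, p⟫ : ℝ) * Complex.I := by
    intro n p e
    simp only [levyKernel, Set.indicator_univ, real_inner_smul_left]
  -- The Gaussian law is a limit of fully compensated jump laws, with intensity multiplied by n + 1
  -- and jumps divided by √(n+1).
  refine IsCharacteristic.of_tendsto (f := fun n p => Complex.exp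
    (∫ e, levyKernel (fun e => (Real.sqrt (n + 1))⁻¹ • y e) Set.univ p e
      ∂(((n + 1 : ℕ) : ℝ≥0) • M))) (fun n => ?_) ?_ (fun p => ?_)
  · refine isCharacteristic_levy (by fun_prop) MeasurableSet.univ ?_ (by simp)
    rw [integrableOn_univ]
    refine Integrable.smul_measure_nnreal ?_
    simp_rw [norm_smul, mul_pow]
    exact h1.const_mul _
  · have hc : ContinuousAt (fun p : E => ∫ e, ⟪y e, p⟫ ^ 2 ∂M) 0 := by
      refine continuousAt_of_dominated (bound := fun e => ‖y e‖ ^ 2)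
        (Eventually.of_forall fun q => (hint q).aestronglyMeasurable) ?_ h1
        (Eventually.of_forall fun e => by fun_prop)
      filter_upwards [Metric.ball_mem_nhds (0 : E) one_pos] with q hq
      refine Eventually.of_forall fun e => ?_
      have hq' : ‖q‖ ≤ 1 := by simpa using (Metric.mem_ball.1 hq).le
      rw [Real.norm_of_nonneg (sq_nonneg _), ← sq_abs]
      gcongr
      exact (abs_real_inner_le_norm _ _).trans (mul_le_of_le_one_right (norm_nonneg _) hq')
    fun_prop
  · refine (Complex.continuous_exp.tendsto _).comp ?_
    have e1 : ∀ n : ℕ, ∫ e, levyKernel (fun e => (Real.sqrt (n + 1))⁻¹ • y e) Set.univ p e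
        ∂(((n + 1 : ℕ) : ℝ≥0) • M) = ∫ e, ((n : ℂ) + 1) * (Complex.exp
          (((Real.sqrt (n + 1))⁻¹ * ⟪y e, p⟫ : ℝ) * Complex.I) - 1
        - ((Real.sqrt (n + 1))⁻¹ * ⟪y e, p⟫ : ℝ) * Complex.I) ∂M := by
      intro n
      rw [integral_smul_nnreal_measure, integral_const_mul]
      simp_rw [hval]
      rw [NNReal.smul_def, Complex.real_smul]
      push_cast
      rfl
    have e2 : (((-(1 / 2 * ∫ e, ⟪y e, p⟫ ^ 2 ∂M) : ℝ)) : ℂ)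
        = ∫ e, ((-(⟪y e, p⟫ ^ 2 / 2) : ℝ) : ℂ) ∂M := by
      rw [integral_complex_ofReal, integral_neg, integral_div]
      congr 2
      ring
    simp_rw [e1]
    rw [e2]
    refine tendsto_integral_of_dominated_convergence (fun e => 3 * ⟪y e, p⟫ ^ 2)
      (fun n => by fun_prop) ((hint p).const_mul 3) (fun n => Eventually.of_forall fun e => ?_)
      (Eventually.of_forall fun e => tendsto_nat_mul_exp_sub _)
    rw [norm_mul]
    have hn1 : ‖((n : ℂ) + 1)‖ = (n : ℝ) + 1 := by
      rw [show ((n : ℂ) + 1) = ((n + 1 : ℕ) : ℂ) by push_cast; ring, Complex.norm_natCast]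
      push_cast; ring
    rw [hn1]
    refine (mul_le_mul_of_nonneg_left (norm_exp_mul_I_sub_one_sub_le _) (by positivity)).trans ?_
    rw [mul_pow, inv_pow, Real.sq_sqrt (by positivity)]
    apply le_of_eq
    field_simp

end Characteristic

/-! ### Layers of the drift -/

section Layers

variable {E U : Type*} [NormedAddCommGroup E] [InnerProductSpace ℝ E] [FiniteDimensional ℝ E]
  [NormedAddCommGroup U] [InnerProductSpace ℝ U]
  (A : E →L[ℝ] E) (B : U →L[ℝ] E)

/-- The space `Im B + Im (AB) + ⋯ + Im (A^{h-1}B)` for operators `A` and `B`. -/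
def reachSpace (h : ℕ) : Submodule ℝ E :=
  ⨆ k ∈ Finset.range h, LinearMap.range (((A ^ k) ∘L B).toLinearMap)

/-- The orthogonal complement of `reachSpace A B i` in `reachSpace A B (i + 1)`. -/
def stratum (i : ℕ) : Submodule ℝ E := (reachSpace A B i)ᗮ ⊓ reachSpace A B (i + 1)

omit [FiniteDimensional ℝ E] in
theorem pow_noise_mem_reachSpace {k h : ℕ} (hk : k < h) (z : U) : (A ^ k) (B z) ∈ reachSpace A B h :=
  Submodule.mem_iSup_of_mem k (Submodule.mem_iSup_of_mem (Finset.mem_range.2 hk) ⟨z, rfl⟩)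

omit [FiniteDimensional ℝ E] in
theorem reachSpace_le_iff {h : ℕ} {W : Submodule ℝ E} :
    reachSpace A B h ≤ W ↔ ∀ k < h, ∀ z, (A ^ k) (B z) ∈ W := by
  constructor
  · exact fun H k hk z => H (pow_noise_mem_reachSpace A B hk z)
  · intro H
    refine iSup₂_le fun k hk => ?_
    rintro _ ⟨z, rfl⟩
    exact H k (Finset.mem_range.1 hk) z

omit [FiniteDimensional ℝ E] in
theorem reachSpace_mono : Monotone (reachSpace A B) := fun _ _ hh =>
  (reachSpace_le_iff A B).2 fun _ hk z => pow_noise_mem_reachSpace A B (hk.trans_le hh) z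

omit [FiniteDimensional ℝ E] in
theorem pow_mem_reachSpace {h : ℕ} (k : ℕ) {v : E} (hv : v ∈ reachSpace A B h) :
    (A ^ k) v ∈ reachSpace A B (h + k) := by
  have : reachSpace A B h ≤ (reachSpace A B (h + k)).comap (A ^ k).toLinearMap := by
    rw [reachSpace_le_iff]
    intro j hj z
    simp only [Submodule.mem_comap, ContinuousLinearMap.coe_coe]
    rw [← mul_apply_eq_comp, ← pow_add]
    exact pow_noise_mem_reachSpace A B (by omega) z
  exact this hv

/-- The orthogonal projection onto the layer of index `i + 1`. -/
def layerProj (i : ℕ) : E →L[ℝ] E :=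
  (reachSpace A B (i + 1)).starProjection - (reachSpace A B i).starProjection

theorem layerProj_apply (i : ℕ) (v : E) : layerProj A B i v =
    (reachSpace A B (i + 1)).starProjection v - (reachSpace A B i).starProjection v := rfl

theorem layerProj_mem (i : ℕ) (v : E) :
    layerProj A B i v ∈ stratum A B i := by
  refine ⟨?_, ?_⟩
  · rw [layerProj_apply,
      show ∀ a b : E, a - b = (v - b) - (v - a) from fun a b => by abel]
    refine Submodule.sub_mem _ (Submodule.sub_starProjection_mem_orthogonal _) ?_
    exact Submodule.orthogonal_le (reachSpace_mono A B (Nat.le_succ i))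
      (Submodule.sub_starProjection_mem_orthogonal _)
  · refine Submodule.sub_mem _ (Submodule.starProjection_apply_mem _ _) ?_
    exact reachSpace_mono A B (Nat.le_succ i) (Submodule.starProjection_apply_mem _ _)

theorem layerProj_eq_zero {i : ℕ} {v : E} (hv : v ∈ reachSpace A B i) :
    layerProj A B i v = 0 := by
  rw [layerProj_apply, Submodule.starProjection_eq_self_iff.2 hv,
    Submodule.starProjection_eq_self_iff.2 (reachSpace_mono A B (Nat.le_succ i) hv), sub_self]

/-- Strata are pairwise orthogonal: for j < i the vector is orthogonal to both spaces whose
projections are subtracted, and for j > i it lies in both of them. -/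
theorem layerProj_of_mem_stratum {i j : ℕ} {v : E}
    (hv : v ∈ stratum A B i) : layerProj A B j v = if j = i then v else 0 := by
  have h1 : v ∈ (reachSpace A B i)ᗮ := hv.1
  have h2 : v ∈ reachSpace A B (i + 1) := hv.2
  rcases lt_trichotomy j i with h | h | h
  · have h3 : v ∈ (reachSpace A B (j + 1))ᗮ := Submodule.orthogonal_le (reachSpace_mono A B h) h1
    have h4 : v ∈ (reachSpace A B j)ᗮ := Submodule.orthogonal_le (reachSpace_mono A B h.le) h1
    rw [if_neg h.ne, layerProj_apply, (Submodule.starProjection_apply_eq_zero_iff _).2 h3,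
      (Submodule.starProjection_apply_eq_zero_iff _).2 h4, sub_self]
  · subst h
    rw [if_pos rfl, layerProj_apply, Submodule.starProjection_eq_self_iff.2 h2,
      (Submodule.starProjection_apply_eq_zero_iff _).2 h1, sub_zero]
  · rw [if_neg h.ne', layerProj_eq_zero A B (reachSpace_mono A B h h2)]

theorem sum_layerProj {n : ℕ} (hn : reachSpace A B n = ⊤) (v : E) :
    ∑ i ∈ Finset.range (n), layerProj A B i v = v := by
  simp only [layerProj_apply]
  rw [Finset.sum_range_sub (fun i => (reachSpace A B i).starProjection v),
    hn]
  simp [reachSpace, Submodule.starProjection_top]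

theorem inner_layerProj (i : ℕ) (v w : E) :
    ⟪layerProj A B i v, w⟫ = ⟪v, layerProj A B i w⟫ := by
  simp only [layerProj_apply, inner_sub_left, inner_sub_right,
    Submodule.inner_starProjection_left_eq_right]

theorem norm_layerProj_le (i : ℕ) (v : E) :
    ‖layerProj A B i v‖ ≤ 2 * ‖v‖ := by
  rw [layerProj_apply, two_mul]
  refine (norm_sub_le _ _).trans (add_le_add ?_ ?_) <;>
  exact Submodule.norm_starProjection_apply_le _ _

/-- The anisotropic dilation, multiplying the layer of index `i + 1` by `c ^ i`. -/
def dilation (n : ℕ) (c : ℝ) : E →L[ℝ] E :=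
  ∑ i ∈ Finset.range (n), c ^ i • layerProj A B i

theorem dilation_apply (n : ℕ) (c : ℝ) (v : E) : dilation A B n c v =
    ∑ i ∈ Finset.range (n), c ^ i • layerProj A B i v := by
  simp [dilation]

theorem layerProj_dilation {i n : ℕ} (hi : i < n) (c : ℝ)
    (v : E) :
    layerProj A B i (dilation A B n c v) = c ^ i • layerProj A B i v := by
  rw [dilation_apply, map_sum, Finset.sum_eq_single i]
  · rw [map_smul, layerProj_of_mem_stratum A B (layerProj_mem A B i v), if_pos rfl]
  · intro j _ hj
    rw [map_smul, layerProj_of_mem_stratum A B (layerProj_mem A B j v), if_neg hj.symm, smul_zero]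
  · exact fun h => absurd (Finset.mem_range.2 hi) h

theorem dilation_of_mem_stratum {i n : ℕ} (hi : i < n) (c : ℝ)
    {v : E} (hv : v ∈ stratum A B i) :
    dilation A B n c v = c ^ i • v := by
  rw [dilation_apply, Finset.sum_eq_single i]
  · rw [layerProj_of_mem_stratum A B hv, if_pos rfl]
  · intro j _ hj
    rw [layerProj_of_mem_stratum A B hv, if_neg hj, smul_zero]
  · exact fun h => absurd (Finset.mem_range.2 hi) h

theorem dilation_dilation {n : ℕ} (hn : reachSpace A B n = ⊤) {c c' : ℝ} (hc : c * c' = 1)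
    (v : E) : dilation A B n c (dilation A B n c' v) = v := by
  rw [dilation_apply]
  conv_rhs => rw [← sum_layerProj A B hn v]
  refine Finset.sum_congr rfl fun i hi => ?_
  rw [layerProj_dilation A B (Finset.mem_range.1 hi), smul_smul, ← mul_pow, hc, one_pow, one_smul]

end Layers

/-! ### Taylor expansion of the exponential -/

section ExpRemainder

variable {𝔸 : Type*} [NormedRing 𝔸] [NormedAlgebra ℝ 𝔸] [CompleteSpace 𝔸]

/-- The Taylor remainder `∑ x ^ k a ^ k / (k + j)!` of the exponential. -/
def expRemainder (a : 𝔸) (j : ℕ) (x : ℝ) : 𝔸 :=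
  ∑' k : ℕ, (((k + j).factorial : ℝ)⁻¹ * x ^ k) • a ^ k

omit [CompleteSpace 𝔸] in
theorem norm_expRemainder_term_le (a : 𝔸) (j k : ℕ) (x : ℝ) :
    ‖(((k + j).factorial : ℝ)⁻¹ * x ^ k) • a ^ k‖ ≤
      (1 + ‖(1 : 𝔸)‖) * ((|x| * ‖a‖) ^ k / k.factorial) := by
  rw [norm_smul, norm_mul, norm_inv, norm_pow, Real.norm_natCast, Real.norm_eq_abs, mul_pow,
    div_eq_inv_mul, mul_assoc]
  have h1 : ((k + j).factorial : ℝ)⁻¹ ≤ (k.factorial : ℝ)⁻¹ := by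
    gcongr
    omega
  have h2 : ‖a ^ k‖ ≤ (1 + ‖(1 : 𝔸)‖) * ‖a‖ ^ k := by
    rcases Nat.eq_zero_or_pos k with rfl | hk
    · simp
    · refine (norm_pow_le' a hk).trans (le_mul_of_one_le_left (by positivity) ?_)
      linarith [norm_nonneg (1 : 𝔸)]
  calc _ ≤ (k.factorial : ℝ)⁻¹ * (|x| ^ k * ((1 + ‖(1 : 𝔸)‖) * ‖a‖ ^ k)) := by gcongr
    _ = _ := by ring

theorem summable_expRemainder (a : 𝔸) (j : ℕ) (x : ℝ) :
    Summable fun k : ℕ => (((k + j).factorial : ℝ)⁻¹ * x ^ k) • a ^ k :=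
  Summable.of_norm_bounded ((Real.summable_pow_div_factorial (|x| * ‖a‖)).mul_left _)
    fun k => norm_expRemainder_term_le a j k x

theorem continuous_expRemainder (a : 𝔸) (j : ℕ) : Continuous (expRemainder a j) := by
  rw [continuous_iff_continuousAt]
  intro x
  let f : ℕ → ℝ → 𝔸 := fun k y => (((k + j).factorial : ℝ)⁻¹ * y ^ k) • a ^ k
  have hf : ∀ k, ContinuousOn (f k) (Metric.ball 0 (|x| + 1)) := fun k =>
    ((continuous_const.mul (continuous_pow k)).smul continuous_const).continuousOn
  have hb : ∀ (k : ℕ) (y : ℝ), y ∈ Metric.ball 0 (|x| + 1) →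
      ‖f k y‖ ≤ (1 + ‖(1 : 𝔸)‖) * (((|x| + 1) * ‖a‖) ^ k / (k.factorial : ℝ)) := by
    intro k y hy
    refine (norm_expRemainder_term_le a j k y).trans ?_
    have : |y| ≤ |x| + 1 := by simpa using (Metric.mem_ball.1 hy).le
    gcongr
  have := continuousOn_tsum hf ((Real.summable_pow_div_factorial _).mul_left _) hb
  exact this.continuousAt (Metric.isOpen_ball.mem_nhds (by simp))

omit [CompleteSpace 𝔸] in
theorem expRemainder_zero (a : 𝔸) (j : ℕ) :
    expRemainder a j 0 = ((j.factorial : ℝ)⁻¹) • (1 : 𝔸) := by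
  unfold expRemainder
  rw [tsum_eq_single 0]
  · simp
  · intro k hk
    simp [hk]

/-- With x^j a^j factored out, the tail of the series becomes a continuous function of x with value
1/j! at 0. This is what allows the rescaled noise to be continued to τ = 0. -/
theorem exp_smul_eq (a : 𝔸) (j : ℕ) (x : ℝ) :
    NormedSpace.exp (x • a) = (∑ k ∈ Finset.range j, ((k.factorial : ℝ)⁻¹ * x ^ k) • a ^ k)
      + x ^ j • (a ^ j * expRemainder a j x) := by
  have h0 : NormedSpace.exp (x • a) = ∑' k : ℕ, ((k.factorial : ℝ)⁻¹ * x ^ k) • a ^ k := by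
    rw [NormedSpace.exp_eq_tsum ℝ]
    simp only [smul_pow, smul_smul]
  have h1 : Summable fun k : ℕ => ((k.factorial : ℝ)⁻¹ * x ^ k) • a ^ k := by
    simpa only [add_zero] using summable_expRemainder a 0 x
  rw [h0, ← h1.sum_add_tsum_nat_add j]
  congr 1
  unfold expRemainder
  rw [← (summable_expRemainder a j x).tsum_mul_left, ← tsum_const_smul'']
  refine tsum_congr fun k => ?_
  rw [mul_smul_comm, smul_smul, ← pow_add, add_comm j k]
  congr 1
  rw [pow_add]
  ring

end ExpRemainder

/-! ### The flow of the drift and the rescaled noise directions -/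

section Flow

variable {E U : Type*} [NormedAddCommGroup E] [InnerProductSpace ℝ E] [FiniteDimensional ℝ E]
  [NormedAddCommGroup U] [InnerProductSpace ℝ U]
  (A : E →L[ℝ] E) (B : U →L[ℝ] E)

/-- The flow `e^{tA}` of the drift. -/
def flow (t : ℝ) : E →L[ℝ] E :=
  NormedSpace.exp (t • A)

omit [FiniteDimensional ℝ E] in
theorem expRemainder_zero_apply (j : ℕ) (v : E) :
    expRemainder A j 0 v = ((j.factorial : ℝ)⁻¹) • v := by
  rw [expRemainder_zero]
  rfl

theorem continuous_flow : Continuous (flow A) :=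
  by
  let : NormedAlgebra ℚ (E →L[ℝ] E) := NormedAlgebra.restrictScalars ℚ ℝ _
  exact NormedSpace.exp_continuous.comp (by fun_prop)

omit [FiniteDimensional ℝ E] in
theorem flow_zero : flow A 0 = 1 := by simp [flow]

theorem flow_add (s t : ℝ) : flow A (s + t) = flow A s * flow A t := by
  unfold flow
  rw [add_smul]
  let : NormedAlgebra ℚ (E →L[ℝ] E) := NormedAlgebra.restrictScalars ℚ ℝ _
  exact NormedSpace.exp_add_of_commute ((Commute.refl _).smul_left _ |>.smul_right _)

theorem flow_add_apply (s t : ℝ) (x : E) :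
    flow A (s + t) x = flow A s (flow A t x) := by
  rw [flow_add, mul_apply_eq_comp]

theorem hasDerivAt_flow (t : ℝ) : HasDerivAt (flow A) (flow A t * A) t :=
  hasDerivAt_exp_smul_const (A) t

theorem exists_norm_flow_le (T : ℝ) : ∃ K : ℝ, 1 ≤ K ∧ ∀ t, |t| ≤ T → ‖flow A t‖ ≤ K := by
  obtain ⟨K, hn⟩ := (isCompact_Icc (a := -T) (b := T)).exists_bound_of_continuousOn
    (continuous_flow A).continuousOn
  exact ⟨max 1 K, le_max_left _ _, fun t ht => (hn t (abs_le.1 ht)).trans (le_max_right _ _)⟩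

/-- A power A^k with k < i - l sends v into a space that the projection of index i annihilates, so
the first surviving order is x^{i-l}. The subtraction is truncated: for i ≤ l no power of x is
gained. -/
theorem layerProj_flow {i l : ℕ} {v : E} (hv : v ∈ reachSpace A B (l + 1)) (x : ℝ) :
    layerProj A B i (flow A x v) =
      x ^ (i - l) • layerProj A B i ((A ^ (i - l)) (expRemainder A (i - l) x v)) := by
  have h1 : flow A x v = ∑ k ∈ Finset.range (i - l), ((k.factorial : ℝ)⁻¹ * x ^ k) • (A ^ k) v
      + x ^ (i - l) • (A ^ (i - l)) (expRemainder A (i - l) x v) := by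
    unfold flow
    rw [exp_smul_eq A (i - l) x, add_apply, sum_apply]
    rfl
  rw [h1, map_add, map_smul, map_sum, Finset.sum_eq_zero, zero_add]
  intro k hk
  rw [map_smul, layerProj_eq_zero, smul_zero]
  refine reachSpace_mono A B ?_ (pow_mem_reachSpace A B k hv)
  have := Finset.mem_range.1 hk
  omega

/-- The rescaled noise direction `T_τ⁻¹ e^{-τsA} B`, extended continuously to `τ = 0`. -/
def scaledNoise (n : ℕ) (τ s : ℝ) : U →L[ℝ] E :=
  ∑ i ∈ Finset.range n, (-s) ^ i •
    (layerProj A B i ∘L (A ^ i * expRemainder A i (-(τ * s))) ∘L B)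

theorem continuous_scaledNoise (n : ℕ) :
    Continuous (fun q : ℝ × ℝ => scaledNoise A B n q.1 q.2) := by
  unfold scaledNoise
  have := fun i => continuous_expRemainder A i
  fun_prop

theorem scaledNoise_apply (n : ℕ) (τ s : ℝ) (z : U) : scaledNoise A B n τ s z =
    ∑ i ∈ Finset.range n, (-s) ^ i •
      layerProj A B i ((A ^ i) (expRemainder A i (-(τ * s)) (B z))) := by
  unfold scaledNoise
  rw [sum_apply]
  rfl

/-- Since the image of B lies in the first space, the component of index i of e^{-τsA}Bz carries
(-τs)^i, and the factor τ^{-i} of the inverse dilation cancels the power of τ exactly. -/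
theorem scaledNoise_eq (n : ℕ) {τ : ℝ} (hτ : τ ≠ 0) (s : ℝ) (z : U) :
    scaledNoise A B n τ s z = dilation A B n τ⁻¹ (flow A (-(τ * s)) (B z)) := by
  rw [scaledNoise_apply, dilation_apply]
  refine Finset.sum_congr rfl fun i _ => ?_
  have hz : B z ∈ reachSpace A B (0 + 1) := by
    simpa using pow_noise_mem_reachSpace A B one_pos z
  rw [layerProj_flow A B hz, smul_smul, Nat.sub_zero, ← mul_pow]
  congr 2
  field_simp

/-- Non-degeneracy of the rescaled noise for a fixed value of the parameter. -/
theorem eq_zero_of_inner_scaledNoise {n : ℕ} (hn : reachSpace A B n = ⊤) {τ : ℝ} (hτ : 0 ≤ τ)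
    {p : E} (h : ∀ s ∈ Set.Icc (0 : ℝ) 1, ∀ z, ⟪p, scaledNoise A B n τ s z⟫ = 0) : p = 0 := by
  rcases hτ.eq_or_lt with rfl | hτ
  · have h1 : ∀ i < n, ∀ z, ⟪p, layerProj A B i ((A ^ i) (B z))⟫ = 0 := by
      intro i hi z
      -- At τ = 0 the pairing is a polynomial in s. Vanishing on [0,1] kills every coefficient, that
      -- is, every pairing of p with the component of index i of A^i B z.
      let P : Polynomial ℝ := ∑ i ∈ Finset.range n,
        Polynomial.C ((-1) ^ i * (i.factorial : ℝ)⁻¹ * ⟪p, layerProj A B i ((A ^ i) (B z))⟫)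
          * Polynomial.X ^ i
      have hP : P = 0 := by
        refine Polynomial.eq_zero_of_infinite_isRoot P ?_
        refine (Set.Icc_infinite (one_pos (α := ℝ))).mono fun s hs => ?_
        have h2 := h s hs z
        rw [scaledNoise_apply, inner_sum] at h2
        rw [Set.mem_ofPred_eq, Polynomial.IsRoot, Polynomial.eval_finsetSum, ← h2]
        refine Finset.sum_congr rfl fun i _ => ?_
        rw [zero_mul, neg_zero, expRemainder_zero_apply]
        simp only [Polynomial.eval_mul, Polynomial.eval_C, Polynomial.eval_pow, Polynomial.eval_X]
        rw [map_smul, map_smul, real_inner_smul_right, real_inner_smul_right, neg_pow s]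
        ring
      have h3 : P.coeff i = 0 := by rw [hP, Polynomial.coeff_zero]
      simp only [P, Polynomial.finsetSum_coeff, Polynomial.coeff_C_mul_X_pow] at h3
      rw [Finset.sum_ite_eq, if_pos (Finset.mem_range.2 hi)] at h3
      have : ((-1 : ℝ)) ^ i * (i.factorial : ℝ)⁻¹ ≠ 0 := by positivity
      exact (mul_eq_zero.1 h3).resolve_left this
    rw [← sum_layerProj A B hn p]
    refine Finset.sum_eq_zero fun i hi => ?_
    -- The component of p is orthogonal to A^k B z for k < i because it belongs to the stratum, and
    -- for k = i by `h1`. It also lies in the span of these vectors, hence it is zero.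
    have h2 : layerProj A B i p ∈ (reachSpace A B (i + 1))ᗮ := by
      have h3 : reachSpace A B (i + 1) ≤ (ℝ ∙ (layerProj A B i p))ᗮ := by
        rw [reachSpace_le_iff]
        intro k hk z
        rw [Submodule.mem_orthogonal_singleton_iff_inner_right]
        rcases (Nat.lt_succ_iff.1 hk).eq_or_lt with rfl | hk'
        · rw [inner_layerProj]
          exact h1 k (Finset.mem_range.1 hi) z
        · rw [real_inner_comm]
          exact (layerProj_mem A B i p).1 _ (pow_noise_mem_reachSpace A B hk' z)
      intro u hu
      have := h3 hu
      rw [Submodule.mem_orthogonal_singleton_iff_inner_right] at this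
      rwa [real_inner_comm]
    exact inner_self_eq_zero.1 (h2 _ (layerProj_mem A B i p).2)
  · set q : E := ContinuousLinearMap.adjoint (dilation A B n τ⁻¹) p with hq
    have h1 : ∀ x ∈ Set.Icc 0 τ, ∀ z, ⟪q, flow A (-x) (B z)⟫ = 0 := by
      intro x hx z
      have h2 := h (x / τ) ⟨div_nonneg hx.1 hτ.le, (div_le_one hτ).2 hx.2⟩ z
      rwa [scaledNoise_eq A B n hτ.ne', mul_div_cancel₀ _ hτ.ne',
        ← ContinuousLinearMap.adjoint_inner_left] at h2
    -- The Taylor coefficients of x ↦ ⟨q, e^{-xA}Bz⟩ at 0 vanish one after the other: subtract the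
    -- terms already known to be zero, divide by x^k, let x tend to 0.
    have h3 : ∀ k, ∀ z, ⟪q, (A ^ k) (B z)⟫ = 0 := by
      intro k
      induction k using Nat.strong_induction_on with
      | _ k ih =>
        intro z
        have h4 : ∀ x ∈ Set.Ioc 0 τ, ⟪q, (A ^ k) (expRemainder A k (-x) (B z))⟫ = 0 := by
          intro x hx
          have h5 := h1 x ⟨hx.1.le, hx.2⟩ z
          unfold flow at h5
          rw [exp_smul_eq A k (-x), add_apply, sum_apply, inner_add_right, inner_sum,
            Finset.sum_eq_zero, zero_add, smul_apply, real_inner_smul_right] at h5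
          · exact (mul_eq_zero.1 h5).resolve_left (pow_ne_zero _ (neg_ne_zero.2 hx.1.ne'))
          · intro i hi
            rw [smul_apply, real_inner_smul_right, ih i (Finset.mem_range.1 hi), mul_zero]
        have hcont : Continuous fun x : ℝ => ⟪q, (A ^ k) (expRemainder A k (-x) (B z))⟫ := by
          have := continuous_expRemainder A k
          fun_prop
        have h6 : ⟪q, (A ^ k) (expRemainder A k (-0) (B z))⟫ = 0 := by
          have hcl : IsClosed {x : ℝ | ⟪q, (A ^ k) (expRemainder A k (-x) (B z))⟫ = 0} :=
            isClosed_eq hcont continuous_const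
          have hsub := closure_minimal (show Set.Ioc 0 τ ⊆ _ from h4) hcl
          rw [closure_Ioc hτ.ne] at hsub
          exact hsub ⟨le_rfl, hτ.le⟩
        rw [neg_zero, expRemainder_zero_apply, map_smul, real_inner_smul_right] at h6
        exact (mul_eq_zero.1 h6).resolve_left (by positivity)
    have h7 : reachSpace A B n ≤ (ℝ ∙ q)ᗮ := by
      rw [reachSpace_le_iff]
      intro k _ z
      rw [Submodule.mem_orthogonal_singleton_iff_inner_right]
      exact h3 k z
    have hq0 : q = 0 := by
      have : q ∈ (ℝ ∙ q)ᗮ := h7 (hn ▸ Submodule.mem_top)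
      rw [Submodule.mem_orthogonal_singleton_iff_inner_right] at this
      exact inner_self_eq_zero.1 this
    have h8 : ⟪p, dilation A B n τ⁻¹ (dilation A B n τ p)⟫ = 0 := by
      rw [← ContinuousLinearMap.adjoint_inner_left, ← hq, hq0, inner_zero_left]
    rw [dilation_dilation A B hn (inv_mul_cancel₀ hτ.ne') p] at h8
    exact inner_self_eq_zero.1 h8

/-- Uniform lower bound for the Gramian of the rescaled noise. -/
theorem exists_gramian_lower_bound [FiniteDimensional ℝ U] {n : ℕ}
    (hn : reachSpace A B n = ⊤) :
    ∃ κ : ℝ, 0 < κ ∧ ∀ τ ∈ Set.Icc (0 : ℝ) 1, ∀ p : E, κ * ‖p‖ ^ 2 ≤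
      ∫ s in (0 : ℝ)..1, ‖ContinuousLinearMap.adjoint (scaledNoise A B n τ s) p‖ ^ 2 := by
  let G : (ℝ × E) × ℝ → ℝ := fun q =>
      ‖ContinuousLinearMap.adjoint (scaledNoise A B n q.1.1 q.2) q.1.2‖ ^ 2
  have hc0 : Continuous G := by
    have h1 : Continuous fun q : (ℝ × E) × ℝ => scaledNoise A B n q.1.1 q.2 :=
      (continuous_scaledNoise A B n).comp (by fun_prop : Continuous fun q : (ℝ × E) × ℝ =>
        (q.1.1, q.2))
    have h2 := (ContinuousLinearMap.adjoint (𝕜 := ℝ) (E := U) (F := E)).continuous.comp h1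
    exact ((h2.clm_apply (by fun_prop)).norm).pow 2
  let F : ℝ × E → ℝ := fun q => ∫ s in (0 : ℝ)..1, G (q, s)
  have hF : Continuous F := intervalIntegral.continuous_parametric_intervalIntegral_of_continuous'
    (f := fun q s => G (q, s)) hc0 0 1
  -- Positivity on the compact set [0,1] × sphere, with τ = 0 included, is what makes the constant
  -- uniform as τ tends to 0.
  have hpos : ∀ q ∈ Set.Icc (0 : ℝ) 1 ×ˢ Metric.sphere (0 : E) 1, 0 < F q := by
    rintro ⟨τ, p⟩ ⟨hτ, hp⟩
    have hcs : Continuous fun s : ℝ => G ((τ, p), s) := hc0.comp (by fun_prop)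
    have hG0 : ∀ s, 0 ≤ G ((τ, p), s) := fun s => sq_nonneg _
    refine lt_of_le_of_ne (intervalIntegral.integral_nonneg zero_le_one fun s _ => hG0 s)
      fun h0 => ?_
    have h1 : ∀ s ∈ Set.Icc (0 : ℝ) 1, G ((τ, p), s) = 0 := by
      by_contra! hne
      obtain ⟨s, hs, hs0⟩ := hne
      have := intervalIntegral.integral_pos zero_lt_one hcs.continuousOn
        (fun s _ => hG0 s) ⟨s, hs, lt_of_le_of_ne (hG0 s) hs0.symm⟩
      exact this.ne h0
    have h2 : p = 0 := by
      refine eq_zero_of_inner_scaledNoise A B hn hτ.1 fun s hs z => ?_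
      have h3 : ContinuousLinearMap.adjoint (scaledNoise A B n τ s) p = 0 := by
        simpa [G] using h1 s hs
      rw [← ContinuousLinearMap.adjoint_inner_left, h3, inner_zero_left]
    simp [h2] at hp
  have hK : IsCompact (Set.Icc (0 : ℝ) 1 ×ˢ Metric.sphere (0 : E) 1) :=
    isCompact_Icc.prod (isCompact_sphere _ _)
  obtain ⟨κ, hκ, hκF⟩ : ∃ κ : ℝ, 0 < κ ∧
      ∀ q ∈ Set.Icc (0 : ℝ) 1 ×ˢ Metric.sphere (0 : E) 1, κ ≤ F q := by
    rcases (Set.Icc (0 : ℝ) 1 ×ˢ Metric.sphere (0 : E) 1).eq_empty_or_nonempty with h | h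
    · exact ⟨1, one_pos, by simp [h]⟩
    · obtain ⟨q, hq, hmin⟩ := hK.exists_isMinOn h hF.continuousOn
      exact ⟨F q, hpos q hq, fun q' hq' => hmin hq'⟩
  refine ⟨κ, hκ, fun τ hτ p => ?_⟩
  rcases eq_or_ne p 0 with rfl | hp
  · simp
  have h1 := hκF (τ, ‖p‖⁻¹ • p) ⟨hτ, by simp [norm_smul, hp]⟩
  have h2 : F (τ, ‖p‖⁻¹ • p) = (‖p‖⁻¹) ^ 2 *
      ∫ s in (0 : ℝ)..1, ‖ContinuousLinearMap.adjoint (scaledNoise A B n τ s) p‖ ^ 2 := by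
    rw [← intervalIntegral.integral_const_mul]
    refine intervalIntegral.integral_congr fun s _ => ?_
    simp only [G, map_smul, norm_smul, mul_pow, norm_inv, norm_norm]
  rw [h2] at h1
  have hp' : 0 < ‖p‖ := norm_pos_iff.2 hp
  have h3 := mul_le_mul_of_nonneg_right h1 (sq_nonneg ‖p‖)
  rwa [mul_right_comm, ← mul_pow, inv_mul_cancel₀ hp'.ne', one_pow, one_mul] at h3

end Flow

/-! ### Truncated stable Lévy measures -/

section Stable

/-- The radial part `r ^ (-1-α) dr` on `(0, ρ]`. -/
def radial (α ρ : ℝ) : Measure ℝ :=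
  (volume.restrict (Set.Ioc 0 ρ)).withDensity fun r => ENNReal.ofReal (1 / r ^ (1 + α))

instance (α ρ : ℝ) : SFinite (radial α ρ) := by unfold radial; infer_instance

theorem measurable_radial_density (α : ℝ) :
    Measurable fun r : ℝ => ENNReal.ofReal (1 / r ^ (1 + α)) := by fun_prop

theorem lintegral_radial (α ρ : ℝ) {f : ℝ → ℝ≥0∞} (hf : Measurable f) :
    ∫⁻ r, f r ∂(radial α ρ) =
      ∫⁻ r in Set.Ioc 0 ρ, f r * ENNReal.ofReal (1 / r ^ (1 + α)) := by
  unfold radial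
  rw [lintegral_withDensity_eq_lintegral_mul _ (measurable_radial_density α) hf]
  simp only [Pi.mul_apply, mul_comm]

theorem radial_mono {α ρ ρ' : ℝ} (h : ρ ≤ ρ') : radial α ρ ≤ radial α ρ' :=
  Measure.le_iff.2 fun C hC => by
    unfold radial
    rw [withDensity_apply _ hC, withDensity_apply _ hC]
    exact lintegral_mono' (Measure.restrict_mono_measure
      (Measure.restrict_mono (Set.Ioc_subset_Ioc_right h) le_rfl) _) le_rfl

/-- Change of variables in r^{-1-α}dr. This self-similarity produces the parabolic scale τ^{1/α} of
the noise. -/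
theorem radial_mul {α ρ c : ℝ} (hc : 0 < c) :
    radial α (c * ρ) = ENNReal.ofReal (c ^ (-α)) • (radial α ρ).map (c * ·) := by
  refine Measure.ext_of_lintegral _ fun f hf => ?_
  rw [lintegral_smul_measure, lintegral_map hf (by fun_prop), lintegral_radial _ _ hf,
    lintegral_radial _ _ (by fun_prop), smul_eq_mul]
  have h1 : ∀ r : ℝ, (Set.Ioc 0 ρ).indicator
      (fun r => f (c * r) * ENNReal.ofReal (1 / r ^ (1 + α))) r
      = ENNReal.ofReal (c ^ (1 + α)) * (Set.Ioc 0 (c * ρ)).indicator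
        (fun r => f r * ENNReal.ofReal (1 / r ^ (1 + α))) (c * r) := by
    intro r
    by_cases hr : r ∈ Set.Ioc 0 ρ
    · have hr' : c * r ∈ Set.Ioc 0 (c * ρ) :=
        ⟨mul_pos hc hr.1, mul_le_mul_of_nonneg_left hr.2 hc.le⟩
      rw [Set.indicator_of_mem hr, Set.indicator_of_mem hr', mul_left_comm,
        ← ENNReal.ofReal_mul (by positivity), Real.mul_rpow hc.le hr.1.le]
      congr 2
      have : c ^ (1 + α) ≠ 0 := by positivity
      field_simp
    · have hr' : c * r ∉ Set.Ioc 0 (c * ρ) := fun h =>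
        hr ⟨pos_of_mul_pos_right h.1 hc.le, le_of_mul_le_mul_left h.2 hc⟩
      rw [Set.indicator_of_notMem hr, Set.indicator_of_notMem hr', mul_zero]
  rw [← lintegral_indicator measurableSet_Ioc, ← lintegral_indicator measurableSet_Ioc]
  simp_rw [h1]
  have hm : Measurable ((Set.Ioc 0 (c * ρ)).indicator
      fun r => f r * ENNReal.ofReal (1 / r ^ (1 + α))) :=
    Measurable.indicator (by fun_prop) measurableSet_Ioc
  have h2 := lintegral_map (μ := volume) hm (measurable_const_mul c)
  have h3 : Measurable fun r : ℝ => (Set.Ioc 0 (c * ρ)).indicator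
      (fun r => f r * ENNReal.ofReal (1 / r ^ (1 + α))) (c * r) :=
    hm.comp (measurable_const_mul c)
  rw [lintegral_const_mul _ h3, ← h2,
    Real.map_volume_mul_left hc.ne', lintegral_smul_measure, smul_eq_mul, ← mul_assoc, ← mul_assoc,
    ← ENNReal.ofReal_mul (by positivity), ← ENNReal.ofReal_mul (by positivity),
    abs_of_pos (inv_pos.2 hc), ← Real.rpow_add hc, ← Real.rpow_neg_one, ← Real.rpow_add hc]
  ring_nf
  simp

theorem lintegral_sq_radial {α ρ : ℝ} (hα : α < 2) (hρ : 0 ≤ ρ) :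
    ∫⁻ r, ENNReal.ofReal (r ^ 2) ∂(radial α ρ) = ENNReal.ofReal (ρ ^ (2 - α) / (2 - α)) := by
  rw [lintegral_radial _ _ (by fun_prop)]
  have h1 : ∀ r ∈ Set.Ioc 0 ρ, ENNReal.ofReal (r ^ 2) * ENNReal.ofReal (1 / r ^ (1 + α))
      = ENNReal.ofReal (r ^ (1 - α)) := by
    intro r hr
    rw [← ENNReal.ofReal_mul (by positivity)]
    congr 1
    have e : r ^ (1 - α) = r ^ (2 : ℝ) * r ^ (-(1 + α)) := by
      rw [← Real.rpow_add hr.1]; ring_nf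
    rw [e, Real.rpow_neg hr.1.le, one_div, Real.rpow_two]
  rw [setLIntegral_congr_fun measurableSet_Ioc h1,
    ← ofReal_integral_eq_lintegral_ofReal, ← intervalIntegral.integral_of_le hρ,
    integral_rpow (Or.inl (by linarith))]
  · rw [show 1 - α + 1 = 2 - α by ring, Real.zero_rpow (by linarith), sub_zero]
  · exact (intervalIntegral.intervalIntegrable_rpow' (by linarith)).1
  · filter_upwards [ae_restrict_mem measurableSet_Ioc] with r hr
    exact Real.rpow_nonneg hr.1.le _

variable {U : Type*} [NormedAddCommGroup U] [InnerProductSpace ℝ U] [FiniteDimensional ℝ U]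
  [MeasurableSpace U] [BorelSpace U] (μ : Measure (Metric.sphere (0 : U) 1)) [IsFiniteMeasure μ]

/-- The Lévy measure of a truncated `α`-stable process with spherical part `μ`. -/
def stable (α ρ : ℝ) : Measure U :=
  ((radial α ρ).prod μ).map fun q => q.1 • (q.2 : U)

instance (α ρ : ℝ) : SFinite (stable μ α ρ) := by unfold stable; infer_instance

theorem lintegral_stable (α ρ : ℝ) {f : U → ℝ≥0∞} (hf : Measurable f) :
    ∫⁻ z, f z ∂(stable μ α ρ) = ∫⁻ r, ∫⁻ θ, f (r • (θ : U)) ∂μ ∂(radial α ρ) := by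
  unfold stable
  rw [lintegral_map hf (by fun_prop), lintegral_prod _ (by fun_prop)]

theorem stable_mono {α ρ ρ' : ℝ} (h : ρ ≤ ρ') : stable μ α ρ ≤ stable μ α ρ' := by
  unfold stable
  exact Measure.map_mono (Measure.prod_mono (radial_mono h) le_rfl) (by fun_prop)

theorem stable_mul {α ρ c : ℝ} (hc : 0 < c) :
    stable μ α (c * ρ) = ENNReal.ofReal (c ^ (-α)) • (stable μ α ρ).map (c • ·) := by
  refine Measure.ext_of_lintegral _ fun f hf => ?_
  rw [lintegral_smul_measure, lintegral_map hf (by fun_prop), lintegral_stable _ _ _ hf,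
    lintegral_stable _ _ _ (by fun_prop), radial_mul hc, lintegral_smul_measure,
    lintegral_map (by fun_prop) (by fun_prop)]
  simp only [smul_smul]

/-- The domination is assumed only on sets that avoid the origin; it extends to all Borel sets
because the stable measure gives no mass to the origin. -/
theorem stable_le {ν : Measure U} {α r₀ : ℝ} (h : ∀ C : Set U, MeasurableSet C → (0 ∉ C) →
    ∫⁻ r in Set.Ioc 0 r₀, (∫⁻ θ, C.indicator 1 (r • (θ : U)) ∂μ)
        * ENNReal.ofReal (1 / r ^ (1 + α)) ≤ ν C) : stable μ α r₀ ≤ ν := by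
  refine Measure.le_iff.2 fun C hC => ?_
  have h0 : MeasurableSet ({0} : Set U) := measurableSet_singleton 0
  have hm : ∀ D : Set U, MeasurableSet D → Measurable (D.indicator (1 : U → ℝ≥0∞)) :=
    fun D hD => measurable_one.indicator hD
  have hval : ∀ D : Set U, MeasurableSet D → stable μ α r₀ D =
      ∫⁻ r in Set.Ioc 0 r₀, (∫⁻ θ, D.indicator 1 (r • (θ : U)) ∂μ)
        * ENNReal.ofReal (1 / r ^ (1 + α)) := by
    intro D hD
    rw [← lintegral_indicator_one hD, lintegral_stable _ _ _ (hm D hD), lintegral_radial]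
    have := hm D hD
    exact Measurable.lintegral_prod_right' (f := fun q : ℝ × Metric.sphere (0 : U) 1 =>
      D.indicator 1 (q.1 • (q.2 : U))) (this.comp (by fun_prop))
  have hz : stable μ α r₀ (C ∩ {0}) = 0 := by
    rw [hval _ (hC.inter h0)]
    rw [setLIntegral_congr_fun (g := 0) measurableSet_Ioc]
    · simp
    · intro r hr
      have : ∀ θ : Metric.sphere (0 : U) 1,
          (C ∩ {0}).indicator (1 : U → ℝ≥0∞) (r • (θ : U)) = 0 := by
        intro θ
        refine Set.indicator_of_notMem ?_ _
        rintro ⟨-, h⟩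
        have h' : r • (θ : U) = 0 := h
        rcases smul_eq_zero.1 h' with h1 | h1
        · exact hr.1.ne' h1
        · have := θ.2
          rw [h1] at this
          simp at this
      simp [this]
  calc stable μ α r₀ C ≤ stable μ α r₀ (C ∩ {0}) + stable μ α r₀ (C \ {0}) :=
        measure_le_inter_add_sdiff _ _ _
    _ ≤ ν C := by
        rw [hz, zero_add, hval _ (hC.diff h0)]
        exact (h _ (hC.diff h0) (by simp)).trans (measure_mono Set.sdiff_subset)

theorem ae_norm_le_stable (α ρ : ℝ) : ∀ᵐ z ∂(stable μ α ρ), ‖z‖ ≤ ρ := by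
  have hs : MeasurableSet {z : U | ‖z‖ ≤ ρ} := measurableSet_le measurable_norm measurable_const
  change stable μ α ρ ({z : U | ‖z‖ ≤ ρ}ᶜ) = 0
  rw [← lintegral_indicator_one hs.compl,
    lintegral_stable _ _ _ (measurable_one.indicator hs.compl), lintegral_radial,
    setLIntegral_congr_fun (g := 0) measurableSet_Ioc]
  · simp
  · intro r hr
    have : ∀ θ : Metric.sphere (0 : U) 1,
        ({z : U | ‖z‖ ≤ ρ}ᶜ).indicator (1 : U → ℝ≥0∞) (r • (θ : U)) = 0 := by
      intro θ
      refine Set.indicator_of_notMem ?_ _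
      have hθ : ‖(θ : U)‖ = 1 := by simp
      simp [norm_smul, hθ, abs_of_pos hr.1, hr.2]
    change (∫⁻ θ : Metric.sphere (0 : U) 1,
      ({z : U | ‖z‖ ≤ ρ}ᶜ).indicator (1 : U → ℝ≥0∞) (r • (θ : U)) ∂μ) * _ = 0
    simp [this]
  · exact Measurable.lintegral_prod_right' (f := fun q : ℝ × Metric.sphere (0 : U) 1 =>
      ({z : U | ‖z‖ ≤ ρ}ᶜ).indicator (1 : U → ℝ≥0∞) (q.1 • (q.2 : U)))
      ((measurable_one.indicator hs.compl).comp (by fun_prop))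

theorem lintegral_sq_stable {α ρ : ℝ} (hα : α < 2) (hρ : 0 ≤ ρ) (q : U) :
    ∫⁻ z, ENNReal.ofReal (⟪q, z⟫ ^ 2) ∂(stable μ α ρ) =
      ENNReal.ofReal (ρ ^ (2 - α) / (2 - α)) * ∫⁻ θ, ENNReal.ofReal (⟪q, (θ : U)⟫ ^ 2) ∂μ := by
  rw [lintegral_stable _ _ _ (by fun_prop), ← lintegral_sq_radial hα hρ,
    ← lintegral_mul_const _ (by fun_prop)]
  refine lintegral_congr fun r => ?_
  rw [← lintegral_const_mul _ (by fun_prop)]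
  refine lintegral_congr fun θ => ?_
  rw [← ENNReal.ofReal_mul (by positivity), real_inner_smul_right, mul_pow]

theorem integrable_sq_norm_stable {α ρ : ℝ} (hα : α < 2) (hρ : 0 ≤ ρ) :
    Integrable (fun z : U => ‖z‖ ^ 2) (stable μ α ρ) := by
  refine ⟨by fun_prop, ?_⟩
  rw [hasFiniteIntegral_iff_ofReal (Eventually.of_forall fun z => by positivity),
    lintegral_stable _ _ _ (by fun_prop)]
  have h1 : ∀ r : ℝ, ∫⁻ θ : Metric.sphere (0 : U) 1, ENNReal.ofReal (‖r • (θ : U)‖ ^ 2) ∂μ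
      = ENNReal.ofReal (r ^ 2) * μ Set.univ := by
    intro r
    rw [← lintegral_const]
    refine lintegral_congr fun θ => ?_
    have hθ : ‖(θ : U)‖ = 1 := by simp
    rw [norm_smul, hθ, mul_one, Real.norm_eq_abs, sq_abs]
  simp_rw [h1]
  rw [lintegral_mul_const _ (by fun_prop), lintegral_sq_radial hα hρ]
  exact ENNReal.mul_lt_top ENNReal.ofReal_lt_top (measure_lt_top _ _)

/-- Non-degeneracy of the quadratic form of the spherical measure. -/
theorem exists_quadratic_lower_bound {α η : ℝ} (hα0 : 0 < α) (hα : α < 2) (hη : 1 ≤ η)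
    (h : ∀ p : U, η⁻¹ * ‖p‖ ^ α ≤ ∫ s, |⟪p, (s : U)⟫| ^ α ∂μ) :
    ∃ κ : ℝ, 0 < κ ∧ ∀ q : U, κ * ‖q‖ ^ 2 ≤ ∫ s, ⟪q, (s : U)⟫ ^ 2 ∂μ := by
  set m : ℝ := μ.real Set.univ with hm
  have hm0 : 0 ≤ m := measureReal_nonneg
  -- The threshold δ is such that the values below it contribute at most half of the lower bound η⁻¹
  -- to the moment of order α; above it, x^α ≤ δ^{α-2}x² since α < 2.
  obtain ⟨δ, hδ, hδm⟩ : ∃ δ : ℝ, 0 < δ ∧ δ ^ α * m ≤ η⁻¹ / 2 := by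
    refine ⟨(η⁻¹ / (2 * (m + 1))) ^ α⁻¹, by positivity, ?_⟩
    rw [Real.rpow_inv_rpow (by positivity) hα0.ne']
    have : η⁻¹ / (2 * (m + 1)) * m ≤ η⁻¹ / (2 * (m + 1)) * (m + 1) := by gcongr; linarith
    refine this.trans (le_of_eq ?_)
    field_simp
  have hpt : ∀ x : ℝ, 0 ≤ x → x ^ α ≤ δ ^ α + δ ^ (α - 2) * x ^ 2 := by
    intro x hx
    rcases le_or_gt x δ with hxδ | hxδ
    · have : x ^ α ≤ δ ^ α := by gcongr
      have : 0 ≤ δ ^ (α - 2) * x ^ 2 := by positivity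
      linarith
    · have hx0 : 0 < x := hδ.trans hxδ
      have h1 : x ^ α = x ^ (α - 2) * x ^ 2 := by
        rw [← Real.rpow_two, ← Real.rpow_add hx0]; ring_nf
      have h2 : x ^ (α - 2) ≤ δ ^ (α - 2) :=
        Real.rpow_le_rpow_of_nonpos hδ hxδ.le (by linarith)
      have : 0 ≤ δ ^ α := by positivity
      rw [h1]
      nlinarith [sq_nonneg x]
  have hint2 : ∀ q : U, Integrable (fun s : Metric.sphere (0 : U) 1 => ⟪q, (s : U)⟫ ^ 2) μ := by
    intro q
    refine (integrable_const (‖q‖ ^ 2)).mono' (by fun_prop) (Eventually.of_forall fun s => ?_)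
    have hs : ‖(s : U)‖ = 1 := by simp
    rw [Real.norm_of_nonneg (by positivity), ← sq_abs]
    have := abs_real_inner_le_norm q (s : U)
    rw [hs, mul_one] at this
    gcongr
  have hinta : ∀ q : U,
      Integrable (fun s : Metric.sphere (0 : U) 1 => |⟪q, (s : U)⟫| ^ α) μ := by
    intro q
    refine ((integrable_const (δ ^ α)).add ((hint2 q).const_mul (δ ^ (α - 2)))).mono'
      (Measurable.aestronglyMeasurable (by fun_prop)) (Eventually.of_forall fun s => ?_)
    rw [Real.norm_of_nonneg (by positivity)]
    refine (hpt _ (abs_nonneg _)).trans (le_of_eq ?_)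
    simp
  have hunit : ∀ q : U, ‖q‖ = 1 →
      η⁻¹ / 2 / δ ^ (α - 2) ≤ ∫ s, ⟪q, (s : U)⟫ ^ 2 ∂μ := by
    intro q hq
    have h1 := h q
    rw [hq, Real.one_rpow, mul_one] at h1
    have h2 : ∫ s, |⟪q, (s : U)⟫| ^ α ∂μ ≤
        ∫ s : Metric.sphere (0 : U) 1, (δ ^ α + δ ^ (α - 2) * ⟪q, (s : U)⟫ ^ 2) ∂μ := by
      refine integral_mono (hinta q) ((integrable_const _).add ((hint2 q).const_mul _)) fun s => ?_
      have := hpt |⟪q, (s : U)⟫| (abs_nonneg _)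
      rwa [sq_abs] at this
    rw [integral_add (integrable_const _) ((hint2 q).const_mul _), integral_const,
      integral_const_mul, smul_eq_mul, ← hm] at h2
    rw [div_le_iff₀ (by positivity)]
    nlinarith
  refine ⟨η⁻¹ / 2 / δ ^ (α - 2), by positivity, fun q => ?_⟩
  rcases eq_or_ne q 0 with rfl | hq
  · simp
  have hq' : 0 < ‖q‖ := norm_pos_iff.2 hq
  have h1 := hunit (‖q‖⁻¹ • q) (by simp [norm_smul, hq])
  simp_rw [real_inner_smul_left, mul_pow] at h1
  rw [integral_const_mul] at h1
  have h3 := mul_le_mul_of_nonneg_right h1 (sq_nonneg ‖q‖)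
  rwa [mul_right_comm, ← mul_pow, inv_mul_cancel₀ hq'.ne', one_pow, one_mul] at h3

/-- Lower bound for the real part of the symbol of a truncated stable process. -/
theorem exists_symbol_lower_bound {α η ρ : ℝ} (hα0 : 0 < α) (hα : α < 2) (hη : 1 ≤ η)
    (h : ∀ p : U, η⁻¹ * ‖p‖ ^ α ≤ ∫ s, |⟪p, (s : U)⟫| ^ α ∂μ) (hρ : 0 < ρ) (hρ1 : ρ ≤ 1) :
    ∃ c : ℝ, 0 < c ∧ ∀ R : ℝ, 1 ≤ R → ∀ q : U, ‖q‖ ≤ R →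
      c * R ^ (α - 2) * ‖q‖ ^ 2 ≤ ∫ z, (1 - Real.cos ⟪q, z⟫) ∂(stable μ α ρ) := by
  obtain ⟨κ, hκ, hκq⟩ := exists_quadratic_lower_bound μ hα0 hα hη h
  have h2α : 0 < 2 - α := by linarith
  refine ⟨2 / Real.pi ^ 2 * (ρ ^ (2 - α) / (2 - α)) * κ, by positivity, fun R hR q hq => ?_⟩
  have hR0 : 0 < R := by linarith
  -- Only jumps of size at most ρ/R are kept. There |⟨q,z⟩| ≤ ρ ≤ 1 < π, so 1 - cos is bounded below
  -- by a quadratic, and the second moment of these jumps scales like R^{α-2}. Keeping R apart from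
  -- |q| gives one prefactor for a whole family of vectors q.
  have hρR : ρ / R ≤ ρ := div_le_self hρ.le hR
  have hint : ∀ ρ' : ℝ, 0 ≤ ρ' → Integrable (fun z : U => ⟪q, z⟫ ^ 2) (stable μ α ρ') := by
    intro ρ' hρ'
    refine ((integrable_sq_norm_stable μ hα hρ').const_mul (‖q‖ ^ 2)).mono' (by fun_prop)
      (Eventually.of_forall fun z => ?_)
    rw [Real.norm_of_nonneg (by positivity), ← sq_abs, ← mul_pow]
    gcongr
    exact abs_real_inner_le_norm _ _
  have hcos : Integrable (fun z : U => 1 - Real.cos ⟪q, z⟫) (stable μ α ρ) := by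
    refine (hint ρ hρ.le).mono' (by fun_prop) (Eventually.of_forall fun z => ?_)
    rw [Real.norm_of_nonneg (by linarith [Real.cos_le_one ⟪q, z⟫])]
    have := Real.one_sub_sq_div_two_le_cos (x := ⟪q, z⟫)
    nlinarith [sq_nonneg ⟪q, z⟫]
  have hθ : ∫⁻ θ, ENNReal.ofReal (⟪q, (θ : U)⟫ ^ 2) ∂μ
      = ENNReal.ofReal (∫ θ, ⟪q, (θ : U)⟫ ^ 2 ∂μ) := by
    rw [ofReal_integral_eq_lintegral_ofReal _ (Eventually.of_forall fun z => by positivity)]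
    refine (integrable_const (‖q‖ ^ 2)).mono' (by fun_prop) (Eventually.of_forall fun s => ?_)
    have hs : ‖(s : U)‖ = 1 := by simp
    rw [Real.norm_of_nonneg (by positivity), ← sq_abs]
    have := abs_real_inner_le_norm q (s : U)
    rw [hs, mul_one] at this
    gcongr
  have hsq : ∫ z, ⟪q, z⟫ ^ 2 ∂(stable μ α (ρ / R)) =
      (ρ / R) ^ (2 - α) / (2 - α) * ∫ θ, ⟪q, (θ : U)⟫ ^ 2 ∂μ := by
    rw [integral_eq_lintegral_of_nonneg_ae (Eventually.of_forall fun z => by positivity)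
      (by fun_prop), lintegral_sq_stable μ hα (by positivity), hθ, ENNReal.toReal_mul,
      ENNReal.toReal_ofReal (by positivity),
      ENNReal.toReal_ofReal (integral_nonneg fun θ => by positivity)]
  calc 2 / Real.pi ^ 2 * (ρ ^ (2 - α) / (2 - α)) * κ * R ^ (α - 2) * ‖q‖ ^ 2
      = 2 / Real.pi ^ 2 * ((ρ / R) ^ (2 - α) / (2 - α) * (κ * ‖q‖ ^ 2)) := by
        rw [Real.div_rpow hρ.le hR0.le, show α - 2 = -(2 - α) by ring, Real.rpow_neg hR0.le]
        ring
    _ ≤ 2 / Real.pi ^ 2 * ((ρ / R) ^ (2 - α) / (2 - α) * ∫ θ, ⟪q, (θ : U)⟫ ^ 2 ∂μ) := by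
        gcongr
        exact hκq q
    _ = ∫ z, 2 / Real.pi ^ 2 * ⟪q, z⟫ ^ 2 ∂(stable μ α (ρ / R)) := by
        rw [← hsq, integral_const_mul]
    _ ≤ ∫ z, (1 - Real.cos ⟪q, z⟫) ∂(stable μ α (ρ / R)) := by
        refine integral_mono_ae ((hint _ (by positivity)).const_mul _)
          (hcos.mono_measure (stable_mono μ hρR)) ?_
        filter_upwards [ae_norm_le_stable μ α (ρ / R)] with z hz
        have h1 : |⟪q, z⟫| ≤ Real.pi := by
          calc |⟪q, z⟫| ≤ ‖q‖ * ‖z‖ := abs_real_inner_le_norm _ _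
            _ ≤ R * (ρ / R) := by gcongr
            _ = ρ := by field_simp
            _ ≤ Real.pi := by linarith [Real.pi_gt_three]
        have := Real.cos_le_one_sub_mul_cos_sq h1
        linarith
    _ ≤ _ := integral_mono_measure (stable_mono μ hρR)
        (Eventually.of_forall fun z => by simpa using Real.cos_le_one ⟪q, z⟫) hcos

end Stable

/-! ### Smooth densities -/

section Density

open Complex FourierTransform SchwartzMap

variable {E : Type*} [NormedAddCommGroup E] [InnerProductSpace ℝ E] [FiniteDimensional ℝ E]
  [MeasurableSpace E] [BorelSpace E]

theorem norm_iteratedFDeriv_cexp (j : ℕ) (z : ℂ) :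
    ‖iteratedFDeriv ℝ j Complex.exp z‖ = ‖Complex.exp z‖ := by
  have h := (Complex.contDiff_exp (𝕜 := ℂ) (n := j)).contDiffAt (x := z)
  rw [← h.restrictScalars_iteratedFDeriv (𝕜 := ℝ)]
  simp only [Function.comp_apply, ContinuousMultilinearMap.norm_restrictScalars]
  rw [norm_iteratedFDeriv_eq_norm_iteratedDeriv, iteratedDeriv_eq_iterate,
    Complex.iter_deriv_exp]

/-- The second order remainder `e^{is} - 1 - is`. -/
def expTail (s : ℝ) : ℂ := Complex.exp ((s : ℂ) * I) - 1 - (s : ℂ) * I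

theorem hasDerivAt_exp_mul_I (s : ℝ) :
    HasDerivAt (fun s : ℝ => Complex.exp ((s : ℂ) * I)) (I * Complex.exp ((s : ℂ) * I)) s := by
  have h1 : HasDerivAt (fun s : ℝ => (s : ℂ) * I) (1 * I) s := ((hasDerivAt_id s).ofReal_comp).mul_const I
  have := h1.cexp
  simpa [mul_comm] using this

theorem iteratedDeriv_exp_mul_I (j : ℕ) :
    iteratedDeriv j (fun s : ℝ => Complex.exp ((s : ℂ) * I))
      = fun s : ℝ => I ^ j * Complex.exp ((s : ℂ) * I) := by
  induction j with
  | zero => simp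
  | succ j ih =>
    rw [iteratedDeriv_succ, ih]
    funext s
    rw [((hasDerivAt_exp_mul_I s).const_mul (I ^ j)).deriv]
    ring

theorem deriv_expTail : deriv expTail = fun s : ℝ => I * (Complex.exp ((s : ℂ) * I) - 1) := by
  funext s
  have h1 : HasDerivAt (fun s : ℝ => (s : ℂ) * I) (1 * I) s := ((hasDerivAt_id s).ofReal_comp).mul_const I
  have := ((hasDerivAt_exp_mul_I s).sub_const 1).sub h1
  refine (HasDerivAt.deriv this).trans ?_
  ring

theorem contDiff_expTail : ContDiff ℝ (⊤ : ℕ∞) expTail := by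
  unfold expTail
  have : ContDiff ℝ (⊤ : ℕ∞) (fun s : ℝ => (s : ℂ)) := Complex.ofRealCLM.contDiff
  fun_prop

/-- The truncated exponent is intended: derivatives of order at least two are merely bounded. After
the chain rule with the linear map ⟨y,·⟩, the order j supplies the missing factors |y|^j. -/
theorem norm_iteratedDeriv_expTail_le (j : ℕ) (s : ℝ) :
    ‖iteratedDeriv j expTail s‖ ≤ 3 * |s| ^ (2 - j) := by
  match j with
  | 0 => simpa [expTail] using norm_exp_mul_I_sub_one_sub_le s
  | 1 =>
    rw [iteratedDeriv_one, deriv_expTail]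
    have h : ‖Complex.exp ((s : ℂ) * I) - 1‖ ≤ |s| := by
      have := Real.norm_exp_I_mul_ofReal_sub_one_le (x := s)
      simpa [mul_comm] using this
    simp only [norm_mul, norm_I, one_mul, Nat.add_one_sub_one, pow_one]
    linarith [abs_nonneg s]
  | j + 2 =>
    have h2 : deriv (deriv expTail) = fun s : ℝ => -Complex.exp ((s : ℂ) * I) := by
      rw [deriv_expTail]
      funext s
      rw [(((hasDerivAt_exp_mul_I s).sub_const 1).const_mul I).deriv, ← mul_assoc, I_mul_I]
      ring
    rw [iteratedDeriv_succ', iteratedDeriv_succ', h2, iteratedDeriv_fun_neg, iteratedDeriv_exp_mul_I]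
    simp [norm_exp_ofReal_mul_I]

variable {X : Type*} [MeasurableSpace X]

omit [FiniteDimensional ℝ E] [MeasurableSpace E] [BorelSpace E] [MeasurableSpace X] in
theorem levyKernel_univ (y : X → E) (e : X) :
    (fun p => levyKernel y Set.univ p e) = expTail ∘ (innerSL ℝ (y e)) := by
  funext p
  simp [levyKernel, expTail]

theorem contDiff_levyKernel_univ (y : X → E) (e : X) :
    ContDiff ℝ (⊤ : ℕ∞) (fun p => levyKernel y Set.univ p e) := by
  rw [levyKernel_univ]
  exact contDiff_expTail.comp (innerSL ℝ (y e)).contDiff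

/-- Every derivative retains a factor |y|², which is integrable: |y|^{2-j}|y|^j is |y|² for j ≤ 2,
and for larger j the surplus powers are absorbed by K. -/
theorem norm_iteratedFDeriv_levyKernel_le {y : X → E} {K : ℝ} (hK : 1 ≤ K) {e : X}
    (hy : ‖y e‖ ≤ K) (j : ℕ) (p : E) :
    ‖iteratedFDeriv ℝ j (fun p => levyKernel y Set.univ p e) p‖
      ≤ 3 * (1 + ‖p‖) ^ 2 * K ^ j * ‖y e‖ ^ 2 := by
  rw [levyKernel_univ]
  rw [ContinuousLinearMap.iteratedFDeriv_comp_right (innerSL ℝ (y e)) contDiff_expTail p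
    (i := j) (by exact_mod_cast le_top)]
  refine (ContinuousMultilinearMap.norm_compContinuousLinearMap_le _ _).trans ?_
  rw [norm_iteratedFDeriv_eq_norm_iteratedDeriv]
  simp only [innerSL_apply_norm, Finset.prod_const, Finset.card_univ, Fintype.card_fin]
  have h1 := norm_iteratedDeriv_expTail_le j ((innerSL ℝ (y e)) p)
  have h2 : |(innerSL ℝ (y e)) p| ≤ ‖y e‖ * ‖p‖ := abs_real_inner_le_norm _ _
  have hp : 0 ≤ ‖p‖ := norm_nonneg p
  have hye : 0 ≤ ‖y e‖ := norm_nonneg _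
  calc _ ≤ 3 * (‖y e‖ * ‖p‖) ^ (2 - j) * ‖y e‖ ^ j := by
        gcongr
        exact h1.trans (by gcongr)
    _ = 3 * ‖p‖ ^ (2 - j) * (‖y e‖ ^ (2 - j) * ‖y e‖ ^ j) := by ring
    _ ≤ 3 * (1 + ‖p‖) ^ 2 * (K ^ j * ‖y e‖ ^ 2) := by
        gcongr ?_ * ?_ * ?_
        · calc ‖p‖ ^ (2 - j) ≤ (1 + ‖p‖) ^ (2 - j) := by gcongr; linarith
            _ ≤ (1 + ‖p‖) ^ 2 := pow_le_pow_right₀ (by linarith) (by omega)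
        · rcases le_or_gt j 2 with hj | hj
          · rw [← pow_add, Nat.sub_add_cancel hj]
            exact le_mul_of_one_le_left (by positivity) (one_le_pow₀ hK)
          · obtain ⟨i, rfl⟩ := Nat.exists_eq_add_of_lt hj
            have : 2 - (2 + i + 1) = 0 := by omega
            rw [this, pow_zero, one_mul, show 2 + i + 1 = (i + 1) + 2 by ring, pow_add]
            gcongr
            calc ‖y e‖ ^ (i + 1) ≤ K ^ (i + 1) := by gcongr
              _ ≤ K ^ (i + 1 + 2) := pow_le_pow_right₀ hK (by omega)
    _ = _ := by ring

variable {M : Measure X}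

theorem norm_iteratedFDeriv_integral_levyKernel_le {y : X → E} (hy : Measurable y) {K : ℝ}
    (hK : 1 ≤ K) (hyK : ∀ᵐ e ∂M, ‖y e‖ ≤ K) (hi : Integrable (fun e => ‖y e‖ ^ 2) M)
    (hiK : ∫ e, ‖y e‖ ^ 2 ∂M ≤ K) :
    ContDiff ℝ (⊤ : ℕ∞) (fun p => ∫ e, levyKernel y Set.univ p e ∂M) ∧ ∀ (j : ℕ) (p : E),
      ‖iteratedFDeriv ℝ j (fun p => ∫ e, levyKernel y Set.univ p e ∂M) p‖
        ≤ 3 * (1 + ‖p‖) ^ 2 * K ^ (j + 1) := by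
  have hf : ∀ k : ℕ, ∀ᵐ e ∂M, ContDiff ℝ k (fun p => levyKernel y Set.univ p e) := fun k =>
    Eventually.of_forall fun e => (contDiff_levyKernel_univ y e).of_le (by exact_mod_cast le_top)
  have hm : ∀ p, AEStronglyMeasurable (fun e => levyKernel y Set.univ p e) M := fun p =>
    (measurable_levyKernel hy MeasurableSet.univ p).aestronglyMeasurable
  have hb : ∀ k : ℕ, ∀ R : ℝ, ∀ j ≤ k, ∃ b : X → ℝ, Integrable b M ∧
      ∀ᵐ e ∂M, ∀ x, ‖x‖ ≤ R →
        ‖iteratedFDeriv ℝ j (fun p => levyKernel y Set.univ p e) x‖ ≤ b e := by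
    intro k R j _
    refine ⟨fun e => 3 * (1 + R) ^ 2 * K ^ j * ‖y e‖ ^ 2, hi.const_mul _, ?_⟩
    filter_upwards [hyK] with e he x hx
    refine (norm_iteratedFDeriv_levyKernel_le hK he j x).trans ?_
    have := norm_nonneg x
    gcongr
  refine ⟨contDiff_infty.2 fun k => contDiff_integral_of_dominated k (hf k) hm (hb k),
    fun j p => ?_⟩
  rw [iteratedFDeriv_integral_of_dominated j (hf j) hm (hb j) le_rfl p]
  calc _ ≤ ∫ e, 3 * (1 + ‖p‖) ^ 2 * K ^ j * ‖y e‖ ^ 2 ∂M := by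
        refine norm_integral_le_of_norm_le (hi.const_mul _) ?_
        filter_upwards [hyK] with e he
        exact norm_iteratedFDeriv_levyKernel_le hK he j p
    _ ≤ 3 * (1 + ‖p‖) ^ 2 * K ^ j * K := by
        rw [integral_const_mul]
        gcongr
    _ = _ := by ring

/-- The characteristic function of a truncated law of order `α` decays with all derivatives. -/
theorem exists_decay_exp_integral_levyKernel (X : Type*) [MeasurableSpace X] {K c α : ℝ}
    (hK : 1 ≤ K) (hc : 0 < c) (hα : 0 < α) (k j : ℕ) : ∃ C : ℝ, 0 ≤ C ∧ ∀ (M : Measure X)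
    (y : X → E), Measurable y → (∀ᵐ e ∂M, ‖y e‖ ≤ K) → Integrable (fun e => ‖y e‖ ^ 2) M →
    ∫ e, ‖y e‖ ^ 2 ∂M ≤ K →
    (∀ p : E, 1 ≤ ‖p‖ → (∫ e, levyKernel y Set.univ p e ∂M).re ≤ -(c * ‖p‖ ^ α)) →
    ∀ p, ‖p‖ ^ k * ‖iteratedFDeriv ℝ j
      (fun p => Complex.exp (∫ e, levyKernel y Set.univ p e ∂M)) p‖ ≤ C := by
  -- The chain rule for exp ∘ Θ produces at most (1+|p|)^{2j}, and the weight adds |p|^k. The decay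
  -- exp(-c|p|^α) ≤ m!/(c|p|^α)^m beats both as soon as αm ≥ k + 2j.
  obtain ⟨m, hm⟩ := exists_nat_ge ((k + 2 * j : ℝ) / α)
  have hm' : (k + 2 * j : ℝ) ≤ α * m := by rw [div_le_iff₀ hα] at hm; linarith
  let C₁ : ℝ := j.factorial * Real.exp (12 * K ^ 2) * (3 * K ^ 2 * 4) ^ j
  let C₂ : ℝ := j.factorial * (m.factorial / c ^ m) * (3 * K ^ 2 * 4) ^ j
  refine ⟨max C₁ C₂, by positivity, fun M y hy hyK hi hiK hre p => ?_⟩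
  obtain ⟨hsm, hbd⟩ := norm_iteratedFDeriv_integral_levyKernel_le hy hK hyK hi hiK
  set Θ : E → ℂ := fun p => ∫ e, levyKernel y Set.univ p e ∂M with hΘ
  have hp0 := norm_nonneg p
  have h1 : ‖iteratedFDeriv ℝ j (Complex.exp ∘ Θ) p‖
      ≤ j.factorial * ‖Complex.exp (Θ p)‖ * (3 * K ^ 2 * (1 + ‖p‖) ^ 2) ^ j := by
    refine norm_iteratedFDeriv_comp_le (N := (⊤ : ℕ∞)) Complex.contDiff_exp hsm
      (by exact_mod_cast le_top) p (fun i _ => (norm_iteratedFDeriv_cexp i _).le)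
      (fun i hi1 _ => (hbd i p).trans ?_)
    have h3 : 3 * (1 + ‖p‖) ^ 2 ≤ (3 * (1 + ‖p‖) ^ 2) ^ i :=
      le_self_pow₀ (by nlinarith) (by omega)
    calc 3 * (1 + ‖p‖) ^ 2 * K ^ (i + 1) ≤ (3 * (1 + ‖p‖) ^ 2) ^ i * K ^ (2 * i) := by
          gcongr
          omega
      _ = _ := by rw [pow_mul, ← mul_pow]; ring
  have h2 : ‖iteratedFDeriv ℝ j (fun p => Complex.exp (Θ p)) p‖
      ≤ j.factorial * Real.exp (Θ p).re * (3 * K ^ 2 * (1 + ‖p‖) ^ 2) ^ j := by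
    rw [← Complex.norm_exp]
    exact h1
  refine (mul_le_mul_of_nonneg_left h2 (by positivity)).trans ?_
  rcases le_or_gt ‖p‖ 1 with hp | hp
  · refine le_trans ?_ (le_max_left _ _)
    have h3 : (Θ p).re ≤ 12 * K ^ 2 := by
      have h4 := hbd 0 p
      rw [norm_iteratedFDeriv_zero] at h4
      have h5 := (Complex.re_le_norm _).trans h4
      have h6 : (1 + ‖p‖) ^ 2 ≤ 4 := by nlinarith
      refine h5.trans ?_
      calc 3 * (1 + ‖p‖) ^ 2 * K ^ (0 + 1) ≤ 3 * 4 * K ^ 2 := by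
            gcongr
            omega
        _ = _ := by ring
    calc ‖p‖ ^ k * (j.factorial * Real.exp (Θ p).re * (3 * K ^ 2 * (1 + ‖p‖) ^ 2) ^ j)
        ≤ 1 * (j.factorial * Real.exp (12 * K ^ 2) * (3 * K ^ 2 * (1 + 1) ^ 2) ^ j) := by
          gcongr
          exact pow_le_one₀ hp0 hp
      _ = C₁ := by
          simp only [C₁]
          norm_num
  · refine le_trans ?_ (le_max_right _ _)
    have hpos : 0 < ‖p‖ := by linarith
    have h3 : Real.exp (Θ p).re ≤ (m.factorial / c ^ m) * (‖p‖ ^ (k + 2 * j))⁻¹ := by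
      have h4 : Real.exp (Θ p).re ≤ Real.exp (-(c * ‖p‖ ^ α)) := Real.exp_le_exp.2 (hre p hp.le)
      have h5 := Real.pow_div_factorial_le_exp (x := c * ‖p‖ ^ α) (by positivity) m
      have h6 : ‖p‖ ^ (k + 2 * j) ≤ (‖p‖ ^ α) ^ m := by
        rw [← Real.rpow_natCast, ← Real.rpow_natCast, ← Real.rpow_mul hp0]
        refine Real.rpow_le_rpow_of_exponent_le hp.le ?_
        push_cast
        exact hm'
      rw [Real.exp_neg] at h4
      refine h4.trans ?_
      rw [inv_le_comm₀ (by positivity) (by positivity)]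
      refine le_trans ?_ h5
      rw [mul_inv, inv_inv, inv_div, mul_pow, div_mul_eq_mul_div]
      gcongr
    calc ‖p‖ ^ k * (j.factorial * Real.exp (Θ p).re * (3 * K ^ 2 * (1 + ‖p‖) ^ 2) ^ j)
        ≤ ‖p‖ ^ k * (j.factorial * ((m.factorial / c ^ m) * (‖p‖ ^ (k + 2 * j))⁻¹)
            * (3 * K ^ 2 * (‖p‖ + ‖p‖) ^ 2) ^ j) := by gcongr
      _ = C₂ := by
          simp only [C₂]
          rw [show 3 * K ^ 2 * (‖p‖ + ‖p‖) ^ 2 = 3 * K ^ 2 * 4 * ‖p‖ ^ 2 by ring, mul_pow _ (‖p‖ ^ 2),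
            ← pow_mul, pow_add]
          field_simp

end Density

/-! ### From Schwartz characteristic functions to densities -/

section FourierDensity

open Complex FourierTransform SchwartzMap

variable {E : Type*} [NormedAddCommGroup E] [InnerProductSpace ℝ E] [FiniteDimensional ℝ E]
  [MeasurableSpace E] [BorelSpace E]

/-- The Fourier transform is bounded for the Schwartz seminorms, uniformly. -/
theorem exists_decay_fourier (b : ℕ → ℕ → ℝ) (a m : ℕ) : ∃ C : ℝ, 0 ≤ C ∧ ∀ χ : 𝓢(E, ℂ),
    (∀ k n, ∀ x, ‖x‖ ^ k * ‖iteratedFDeriv ℝ n χ x‖ ≤ b k n) →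
    ∀ w : E, (1 + ‖w‖) ^ a * ‖iteratedFDeriv ℝ m (𝓕 χ : 𝓢(E, ℂ)) w‖ ≤ C := by
  have hsum : ∀ (s : Finset (ℕ × ℕ)) (f : 𝓢(E, ℂ)),
      (∑ i ∈ s, schwartzSeminormFamily ℂ E ℂ i) f = ∑ i ∈ s, schwartzSeminormFamily ℂ E ℂ i f := by
    intro s f
    exact sum_apply _ _ _
  -- Continuity of the Fourier transform on the Schwartz space bounds this seminorm of the transform
  -- by finitely many seminorms of χ, each of which is controlled by `b`. Hence the constant does
  -- not depend on χ.
  let q : Seminorm ℂ 𝓢(E, ℂ) := (2 : ℝ≥0) ^ a • (Finset.Iic (a, m)).sup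
    (schwartzSeminormFamily ℂ E ℂ)
  have hq : Continuous q := by
    have h : Continuous ⇑((Finset.Iic (a, m)).sup (schwartzSeminormFamily ℂ E ℂ)) := by
      refine Seminorm.continuous_of_le (q := ∑ i ∈ Finset.Iic (a, m), schwartzSeminormFamily ℂ E ℂ i)
        ?_ (Seminorm.finset_sup_le_sum _ _)
      have h2 := funext (hsum (Finset.Iic (a, m)))
      rw [h2]
      exact continuous_finsetSum _ fun i _ => (schwartz_withSeminorms ℂ E ℂ).continuous_seminorm i
    exact h.const_smul ((2 : ℝ≥0) ^ a)
  let q' : Seminorm ℂ 𝓢(E, ℂ) := q.comp (fourierCLM ℂ 𝓢(E, ℂ)).toLinearMap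
  have hq' : Continuous q' := hq.comp (fourierCLM ℂ 𝓢(E, ℂ)).continuous
  obtain ⟨s, C, -, hC⟩ := Seminorm.bound_of_continuous (schwartz_withSeminorms ℂ E ℂ) q' hq'
  refine ⟨C * ∑ i ∈ s, |b i.1 i.2|, by positivity, fun χ hχ w => ?_⟩
  have h1 := SchwartzMap.one_add_le_sup_seminorm_apply (𝕜 := ℂ) (m := (a, m)) le_rfl le_rfl (𝓕 χ : 𝓢(E, ℂ)) w
  have h2 : q' χ ≤ C * ∑ i ∈ s, |b i.1 i.2| := by
    refine (hC χ).trans ?_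
    rw [smul_apply, NNReal.smul_def, smul_eq_mul]
    refine mul_le_mul_of_nonneg_left ?_ C.2
    refine (Seminorm.finset_sup_le_sum _ _ χ).trans ?_
    rw [hsum]
    refine Finset.sum_le_sum fun i _ => ?_
    exact SchwartzMap.seminorm_le_bound ℂ i.1 i.2 χ (abs_nonneg _)
      fun x => (hχ i.1 i.2 x).trans (le_abs_self _)
  refine h1.trans (le_trans (le_of_eq ?_) h2)
  simp only [q', q, Seminorm.comp_apply, smul_apply, NNReal.smul_def]
  rfl

/-- A probability measure whose characteristic function is a Schwartz function has a smooth
density. -/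
theorem integral_eq_integral_mul_fourier {P : Measure E} [IsProbabilityMeasure P] {χ : 𝓢(E, ℂ)}
    (h : ∀ v, charFun P ((2 * Real.pi) • v) = χ v) {G : E → ℝ} (hG : Measurable G) {K : ℝ}
    (hGK : ∀ x, |G x| ≤ K) :
    ∫ x, G x ∂P = ∫ x, G x * ((𝓕 χ : 𝓢(E, ℂ)) x).re := by
  set f : 𝓢(E, ℂ) := 𝓕 χ with hf
  have hfi : Integrable f := f.integrable
  have hinv : ∀ p, ∫ x, Complex.exp ((⟪x, p⟫ : ℝ) * I) * f x = charFun P p := by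
    intro p
    have h1 : (𝓕⁻ f : 𝓢(E, ℂ)) = χ := by rw [hf]; exact FourierPair.fourierInv_fourier_eq χ
    have h2 := h ((2 * Real.pi)⁻¹ • p)
    rw [smul_inv_smul₀ (by positivity)] at h2
    rw [h2, ← h1, SchwartzMap.fourierInv_coe, Real.fourierInv_eq']
    refine integral_congr_ae (Eventually.of_forall fun x => ?_)
    simp only [smul_eq_mul, inner_smul_right]
    congr 3
    push_cast
    field_simp
  have hmul : ∀ p, Integrable fun x => Complex.exp ((⟪x, p⟫ : ℝ) * I) * f x := by
    intro p
    refine hfi.bdd_mul (c := 1) (by fun_prop) (Eventually.of_forall fun x => ?_)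
    rw [norm_exp_ofReal_mul_I]
  -- The characteristic function satisfies the Hermitian symmetry of a real measure, so f and its
  -- conjugate have the same transform, and the real part can serve as a density.
  let r : E → ℝ := fun x => (f x).re
  have hr : Integrable r := hfi.re
  have hrc : Continuous r := Complex.continuous_re.comp f.continuous
  have hrF : ∀ p, ∫ x, Complex.exp ((⟪x, p⟫ : ℝ) * I) * (r x : ℂ) = charFun P p := by
    intro p
    have h1 : ∀ x, Complex.exp ((⟪x, p⟫ : ℝ) * I) * (r x : ℂ)
        = (1 / 2 : ℂ) * (Complex.exp ((⟪x, p⟫ : ℝ) * I) * f x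
          + (starRingEnd ℂ) (Complex.exp ((⟪x, -p⟫ : ℝ) * I) * f x)) := by
      intro x
      rw [map_mul, ← Complex.exp_conj]
      simp only [r, inner_neg_right, ofReal_neg, map_mul, map_neg, conj_I, conj_ofReal]
      rw [re_eq_add_conj, show -(⟪x, p⟫ : ℂ) * -I = ⟪x, p⟫ * I by ring]
      ring
    have h2 : Integrable fun x => (starRingEnd ℂ) (Complex.exp ((⟪x, -p⟫ : ℝ) * I) * f x) :=
      (RCLike.conjLIE (K := ℂ)).integrable_comp_iff.2 (hmul (-p))
    simp_rw [h1]
    rw [integral_const_mul, integral_add (hmul p) h2, hinv, integral_conj, hinv, charFun_neg, conj_conj]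
    ring
  -- compare the positive and negative parts
  let Pn : Measure E := volume.withDensity fun x => ENNReal.ofReal (-r x)
  let Pp : Measure E := volume.withDensity fun x => ENNReal.ofReal (r x)
  have hPn : IsFiniteMeasure Pn := isFiniteMeasure_withDensity_ofReal hr.neg.2
  have hPp : IsFiniteMeasure Pp := isFiniteMeasure_withDensity_ofReal hr.2
  have hmp : Measurable fun x => (r x).toNNReal := hrc.measurable.real_toNNReal
  have hmn : Measurable fun x => (-r x).toNNReal := hrc.neg.measurable.real_toNNReal
  have hintp : ∀ {V : Type} [NormedAddCommGroup V] [NormedSpace ℝ V] (g : E → V),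
      ∫ x, g x ∂Pp = ∫ x, (r x).toNNReal • g x := fun g =>
    integral_withDensity_eq_integral_smul hmp g
  have hintn : ∀ {V : Type} [NormedAddCommGroup V] [NormedSpace ℝ V] (g : E → V),
      ∫ x, g x ∂Pn = ∫ x, (-r x).toNNReal • g x := fun g =>
    integral_withDensity_eq_integral_smul hmn g
  have hdiff : ∀ {V : Type} [NormedAddCommGroup V] [NormedSpace ℝ V] (g : E → V),
      Integrable g Pp → Integrable g Pn →
      ∫ x, g x ∂Pp - ∫ x, g x ∂Pn = ∫ x, r x • g x := by
    intro V _ _ g hg1 hg2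
    rw [hintp, hintn, ← integral_sub]
    · refine integral_congr_ae (Eventually.of_forall fun x => ?_)
      simp only [NNReal.smul_def, ← sub_smul, Real.coe_toNNReal']
      congr 1
      rcases le_total (r x) 0 with h | h
      · rw [max_eq_right h, max_eq_left (by linarith)]; ring
      · rw [max_eq_left h, max_eq_right (by linarith)]; ring
    · exact (integrable_withDensity_iff_integrable_smul hmp).1 hg1
    · exact (integrable_withDensity_iff_integrable_smul hmn).1 hg2
  -- Putting the negative part on the left turns the identity into one between finite positive
  -- measures, to which uniqueness of characteristic functions applies; no sign of r has to be
  -- proved.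
  have heq : P + Pn = Pp := by
    refine Measure.ext_of_charFun ?_
    funext p
    have h1 := hdiff (fun x => Complex.exp ((⟪x, p⟫ : ℝ) * I)) (integrable_exp_inner Pp p)
      (integrable_exp_inner Pn p)
    rw [charFun_apply, charFun_apply, integral_add_measure (integrable_exp_inner P p)
      (integrable_exp_inner Pn p), ← charFun_apply, ← hrF p]
    rw [sub_eq_iff_eq_add] at h1
    rw [h1]
    congr 1
    refine integral_congr_ae (Eventually.of_forall fun x => ?_)
    simp only [real_smul]
    ring
  have hGi : ∀ (m : Measure E) [IsFiniteMeasure m], Integrable G m := fun m _ =>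
    (integrable_const K).mono' hG.aestronglyMeasurable (Eventually.of_forall hGK)
  have h1 := hdiff G (hGi Pp) (hGi Pn)
  rw [← heq, integral_add_measure (hGi P) (hGi Pn), add_sub_cancel_right] at h1
  rw [h1]
  exact integral_congr_ae (Eventually.of_forall fun x => by simp only [smul_eq_mul, r]; ring)

end FourierDensity

/-! ### Uniform densities of the rescaled stable noise -/

section StableDensity

open Complex FourierTransform SchwartzMap

variable {E : Type*} [NormedAddCommGroup E] [InnerProductSpace ℝ E] [FiniteDimensional ℝ E]
  [MeasurableSpace E] [BorelSpace E]
variable {U : Type*} [NormedAddCommGroup U] [InnerProductSpace ℝ U] [FiniteDimensional ℝ U]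
  [MeasurableSpace U] [BorelSpace U]

theorem re_levyKernel_univ {X : Type*} (y : X → E) (p : E) (e : X) :
    (levyKernel y Set.univ p e).re = Real.cos ⟪y e, p⟫ - 1 := by
  simp [levyKernel, Complex.exp_ofReal_mul_I_re]

/-- The jump measure on `(0, 1] × U` of a truncated stable noise. -/
def stableJumps (μ : Measure (Metric.sphere (0 : U) 1)) (α T ρ : ℝ) : Measure (ℝ × U) :=
  (volume.restrict (Set.Ioc 0 T)).prod (stable μ α ρ)

theorem exists_norm_scaledNoise_le (A : E →L[ℝ] E) (B : U →L[ℝ] E) (n : ℕ) :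
    ∃ Λ : ℝ, 1 ≤ Λ ∧ ∀ τ ∈ Set.Icc (0 : ℝ) 1, ∀ s ∈ Set.Icc (0 : ℝ) 1,
      ‖scaledNoise A B n τ s‖ ≤ Λ := by
  obtain ⟨K, hK⟩ := (isCompact_Icc (a := (0 : ℝ)) (b := 1) |>.prod
    (isCompact_Icc (a := (0 : ℝ)) (b := 1))).exists_bound_of_continuousOn
    (f := fun q : ℝ × ℝ => scaledNoise A B n q.1 q.2) (continuous_scaledNoise A B n).continuousOn
  exact ⟨max K 1, le_max_right _ _, fun τ hτ s hs => (hK (τ, s) ⟨hτ, hs⟩).trans (le_max_left _ _)⟩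

/-- The rescaled truncated stable noise has a smooth density, with uniform bounds. -/
theorem exists_stable_density {A : E →L[ℝ] E} {B : U →L[ℝ] E} {n : ℕ}
    (hn : reachSpace A B n = ⊤) (μ : Measure (Metric.sphere (0 : U) 1)) [IsFiniteMeasure μ]
    {α η ρ : ℝ} (hα0 : 0 < α) (hα : α < 2) (hη : 1 ≤ η)
    (h : ∀ p : U, η⁻¹ * ‖p‖ ^ α ≤ ∫ s, |⟪p, (s : U)⟫| ^ α ∂μ) (hρ : 0 < ρ) (hρ1 : ρ ≤ 1) (a k : ℕ) :
    ∃ C : ℝ, 0 ≤ C ∧ ∀ τ ∈ Set.Ioc (0 : ℝ) 1, ∃ r : E → ℝ, ContDiff ℝ (⊤ : ℕ∞) r ∧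
      (∀ m ≤ k, ∀ w, (1 + ‖w‖) ^ a * ‖iteratedFDeriv ℝ m r w‖ ≤ C) ∧
      ∀ P : Measure E, IsProbabilityMeasure P →
        (∀ p, charFun P p = Complex.exp (∫ q, levyKernel
          (fun q : ℝ × U => scaledNoise A B n τ q.1 q.2) Set.univ p q ∂stableJumps μ α 1 ρ)) →
        ∀ (G : E → ℝ) (K : ℝ), Measurable G → (∀ x, |G x| ≤ K) →
          ∫ x, G x ∂P = ∫ x, G x * r x := by
  obtain ⟨Λ, hΛ1, hΛ⟩ := exists_norm_scaledNoise_le A B n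
  obtain ⟨κ, hκ, hgram⟩ := exists_gramian_lower_bound A B hn
  obtain ⟨c₀, hc₀, hsym⟩ := exists_symbol_lower_bound μ hα0 hα hη h hρ hρ1
  have hsq := integrable_sq_norm_stable μ hα hρ.le
  set J := ∫ z, ‖z‖ ^ 2 ∂stable μ α ρ with hJ
  set π2 : ℝ := 2 * Real.pi with hπ2
  have hπ1 : 1 ≤ π2 := by have := Real.pi_gt_three; simp only [hπ2]; linarith
  have hπ0 : 0 ≤ π2 := by linarith
  have hJ0 : 0 ≤ J := integral_nonneg fun z => by positivity
  have hπΛ : 1 ≤ π2 * Λ := one_le_mul_of_one_le_of_one_le hπ1 hΛ1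
  -- One constant for two purposes: it bounds the jumps, which are at most 2πΛρ with ρ ≤ 1, and
  -- their second moment, which is at most (2πΛ)²J.
  set K : ℝ := (π2 * Λ) + (π2 * Λ) ^ 2 * J with hKdef
  have hK : 1 ≤ K := by
    have : 0 ≤ (π2 * Λ) ^ 2 * J := by positivity
    linarith
  let c : ℝ := c₀ * (π2 * Λ) ^ (α - 2) * (π2 ^ 2 * κ)
  have hc : 0 < c := by
    have : 0 < (π2 * Λ) ^ (α - 2) := Real.rpow_pos_of_pos (by linarith) _
    positivity
  choose b hb0 hb using fun k j =>
    exists_decay_exp_integral_levyKernel (E := E) (ℝ × U) hK hc hα0 k j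
  choose C hC0 hC using fun m => exists_decay_fourier (E := E) b a m
  refine ⟨∑ m ∈ Finset.range (k + 1), C m, Finset.sum_nonneg fun m _ => hC0 m, fun τ hτ => ?_⟩
  set M := stableJumps μ α 1 ρ with hM
  let y : ℝ × U → E := fun q => scaledNoise A B n τ q.1 q.2
  -- The factor 2π translates between characteristic functions and the normalisation of the Fourier
  -- transform.
  let y' : ℝ × U → E := fun q => π2 • y q
  have hyc : Continuous y := by
    have h1 : Continuous fun q : ℝ × U => scaledNoise A B n τ q.1 :=
      (continuous_scaledNoise A B n).comp (continuous_const.prodMk continuous_fst)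
    exact h1.clm_apply continuous_snd
  have hy'c : Continuous y' := hyc.const_smul π2
  have hs_ae : ∀ᵐ q ∂M, q.1 ∈ Set.Ioc (0 : ℝ) 1 := by
    have := (Measure.quasiMeasurePreserving_fst (μ := (volume : Measure ℝ).restrict (Set.Ioc 0 1))
      (ν := stable μ α ρ)).ae (ae_restrict_mem measurableSet_Ioc)
    exact this
  have hz_ae : ∀ᵐ q ∂M, ‖q.2‖ ≤ ρ := by
    have := (Measure.quasiMeasurePreserving_snd (μ := (volume : Measure ℝ).restrict (Set.Ioc 0 1))
      (ν := stable μ α ρ)).ae (ae_norm_le_stable μ α ρ)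
    exact this
  have hyle : ∀ᵐ q ∂M, ‖y' q‖ ≤ π2 * Λ * ‖q.2‖ := by
    filter_upwards [hs_ae] with q hq
    simp only [y', y, norm_smul, Real.norm_eq_abs, abs_of_pos (show 0 < π2 by linarith)]
    rw [mul_assoc π2 Λ]
    refine mul_le_mul_of_nonneg_left ?_ hπ0
    exact (scaledNoise A B n τ q.1).le_of_opNorm_le (hΛ τ ⟨hτ.1.le, hτ.2⟩ q.1 ⟨hq.1.le, hq.2⟩) _
  have hsqM : Integrable (fun q : ℝ × U => ‖q.2‖ ^ 2) M := by
    have := (integrable_const (1 : ℝ) (μ := (volume : Measure ℝ).restrict (Set.Ioc 0 1))).mul_prod hsq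
    simp only [one_mul] at this
    exact this
  have hsqJ : ∫ q : ℝ × U, ‖q.2‖ ^ 2 ∂M = J := by
    have := integral_prod_mul (μ := (volume : Measure ℝ).restrict (Set.Ioc 0 1)) (ν := stable μ α ρ)
      (fun _ => (1 : ℝ)) (fun z => ‖z‖ ^ 2)
    simp only [one_mul] at this
    refine this.trans ?_
    simp [hJ]
  have hyK : ∀ᵐ q ∂M, ‖y' q‖ ≤ K := by
    filter_upwards [hyle, hz_ae] with q h1 h2
    have : 0 ≤ (π2 * Λ) ^ 2 * J := by positivity
    nlinarith
  have hyle2 : ∀ᵐ q ∂M, ‖‖y' q‖ ^ 2‖ ≤ (π2 * Λ) ^ 2 * ‖q.2‖ ^ 2 := by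
    filter_upwards [hyle] with q h1
    rw [norm_pow, norm_norm, ← mul_pow]
    gcongr
  have hyi : Integrable (fun q => ‖y' q‖ ^ 2) M :=
    (hsqM.const_mul ((π2 * Λ) ^ 2)).mono' (hy'c.norm.pow 2).aestronglyMeasurable hyle2
  have hyiK : ∫ q, ‖y' q‖ ^ 2 ∂M ≤ K := by
    calc _ ≤ ∫ q : ℝ × U, (π2 * Λ) ^ 2 * ‖q.2‖ ^ 2 ∂M :=
          integral_mono_ae hyi (hsqM.const_mul _) (by
            filter_upwards [hyle2] with q hq using (le_abs_self _).trans hq)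
      _ = (π2 * Λ) ^ 2 * J := by rw [integral_const_mul, hsqJ]
      _ ≤ K := by linarith
  have hw : Integrable (levyWeight y' Set.univ) M :=
    integrable_levyWeight MeasurableSet.univ hyi.integrableOn (by simp)
  -- The symbol bound is applied for each s to 2π times the adjoint of the rescaled noise at p, with
  -- the common radius R = 2πΛ|p|. Integrating in s brings in the Gramian, and |p|^{α-2}|p|² =
  -- |p|^α.
  have hre : ∀ p : E, 1 ≤ ‖p‖ → (∫ e, levyKernel y' Set.univ p e ∂M).re ≤ -(c * ‖p‖ ^ α) := by
    intro p hp
    have hki := integrable_levyKernel hy'c.measurable MeasurableSet.univ hw p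
    have h1 : (∫ e, levyKernel y' Set.univ p e ∂M).re
        = -∫ e, (1 - Real.cos ⟪y' e, p⟫) ∂M := by
      rw [← integral_neg]
      have := integral_re hki
      simp only [RCLike.re_to_complex] at this
      rw [← this]
      refine integral_congr_ae (Eventually.of_forall fun e => ?_)
      simp only [re_levyKernel_univ]
      ring
    have hci : Integrable (fun e => 1 - Real.cos ⟪y' e, p⟫) M := by
      refine (hki.re.neg).congr (Eventually.of_forall fun e => ?_)
      simp [re_levyKernel_univ]
    rw [h1, neg_le_neg_iff, hM, stableJumps, integral_prod _ hci]
    have hR : 1 ≤ π2 * Λ * ‖p‖ := one_le_mul_of_one_le_of_one_le hπΛ hp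
    have hadj : ∀ s ∈ Set.Ioc (0 : ℝ) 1, c₀ * (π2 * Λ * ‖p‖) ^ (α - 2)
        * (π2 ^ 2 * ‖ContinuousLinearMap.adjoint (scaledNoise A B n τ s) p‖ ^ 2)
        ≤ ∫ z, (1 - Real.cos ⟪y' (s, z), p⟫) ∂stable μ α ρ := by
      intro s hs
      have h2 := hsym (π2 * Λ * ‖p‖) hR
        (π2 • ContinuousLinearMap.adjoint (scaledNoise A B n τ s) p) (by
          rw [norm_smul, Real.norm_of_nonneg hπ0, mul_assoc π2 Λ]
          refine mul_le_mul_of_nonneg_left ?_ hπ0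
          refine (ContinuousLinearMap.le_opNorm _ _).trans ?_
          gcongr
          rw [LinearIsometryEquiv.norm_map]
          exact hΛ τ ⟨hτ.1.le, hτ.2⟩ s ⟨hs.1.le, hs.2⟩)
      rw [norm_smul, Real.norm_of_nonneg hπ0, mul_pow] at h2
      refine h2.trans (le_of_eq (integral_congr_ae (Eventually.of_forall fun z => ?_)))
      simp only [y', y, inner_smul_left, ContinuousLinearMap.adjoint_inner_left]
      rw [real_inner_comm]
    have hcont : Continuous fun s : ℝ =>
        ‖ContinuousLinearMap.adjoint (scaledNoise A B n τ s) p‖ ^ 2 := by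
      have h1 : Continuous fun s : ℝ => scaledNoise A B n τ s :=
        (continuous_scaledNoise A B n).comp (continuous_const.prodMk continuous_id)
      have h2 : Continuous fun s : ℝ => ContinuousLinearMap.adjoint (scaledNoise A B n τ s) :=
        ContinuousLinearMap.adjoint.continuous.comp h1
      exact ((h2.clm_apply continuous_const).norm).pow 2
    have hg := hgram τ ⟨hτ.1.le, hτ.2⟩ p
    rw [intervalIntegral.integral_of_le zero_le_one] at hg
    calc c * ‖p‖ ^ α = c₀ * (π2 * Λ * ‖p‖) ^ (α - 2) * (π2 ^ 2 * (κ * ‖p‖ ^ 2)) := by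
          have h3 : ‖p‖ ^ α = ‖p‖ ^ (α - 2) * ‖p‖ ^ 2 := by
            rw [← Real.rpow_natCast, ← Real.rpow_add (by linarith)]
            norm_num
          rw [h3, Real.mul_rpow (by positivity) (by positivity)]
          simp only [c]
          ring
      _ ≤ c₀ * (π2 * Λ * ‖p‖) ^ (α - 2) * (π2 ^ 2 * ∫ s in Set.Ioc 0 1,
            ‖ContinuousLinearMap.adjoint (scaledNoise A B n τ s) p‖ ^ 2) := by gcongr
      _ = ∫ s in Set.Ioc 0 1, c₀ * (π2 * Λ * ‖p‖) ^ (α - 2)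
            * (π2 ^ 2 * ‖ContinuousLinearMap.adjoint (scaledNoise A B n τ s) p‖ ^ 2) := by
          rw [integral_const_mul, integral_const_mul]
      _ ≤ _ := by
          refine setIntegral_mono_on ?_ hci.integral_prod_left measurableSet_Ioc hadj
          exact ((hcont.integrableOn_Icc (a := 0) (b := 1)).mono_set
            Set.Ioc_subset_Icc_self).const_mul _ |>.const_mul _
  have hsmooth : ContDiff ℝ (⊤ : ℕ∞)
      (fun p => Complex.exp (∫ e, levyKernel y' Set.univ p e ∂M)) :=
    Complex.contDiff_exp.comp
      (norm_iteratedFDeriv_integral_levyKernel_le hy'c.measurable hK hyK hyi hyiK).1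
  have hdec := fun k j => hb k j M y' hy'c.measurable hyK hyi hyiK hre
  let χ : 𝓢(E, ℂ) := ⟨_, hsmooth, fun k j => ⟨b k j, hdec k j⟩⟩
  have hχ := fun m => hC m χ hdec
  refine ⟨fun w => ((𝓕 χ : 𝓢(E, ℂ)) w).re, ?_, ?_, ?_⟩
  · exact Complex.reCLM.contDiff.comp (𝓕 χ : 𝓢(E, ℂ)).smooth'
  · intro m hm w
    have h1 : ‖iteratedFDeriv ℝ m (fun w => ((𝓕 χ : 𝓢(E, ℂ)) w).re) w‖
        ≤ ‖iteratedFDeriv ℝ m (𝓕 χ : 𝓢(E, ℂ)) w‖ := by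
      have h2 := ContinuousLinearMap.norm_iteratedFDeriv_comp_left Complex.reCLM
        ((𝓕 χ : 𝓢(E, ℂ)).smooth m).contDiffAt (x := w) (n := m) le_rfl
      refine h2.trans ?_
      simp
    refine (mul_le_mul_of_nonneg_left h1 (by positivity)).trans ((hχ m w).trans ?_)
    exact Finset.single_le_sum (fun i _ => hC0 i) (Finset.mem_range.2 (by omega))
  · intro P hP hchar G K' hG hGK
    refine integral_eq_integral_mul_fourier (fun v => ?_) hG hGK
    rw [hchar]
    refine congrArg Complex.exp (integral_congr_ae (Eventually.of_forall fun q => ?_))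
    simp only [levyKernel, Set.indicator_univ, y', y, inner_smul_left, inner_smul_right]
    rfl

end StableDensity

/-! ### The law of the Ornstein–Uhlenbeck process -/

section Law

open Complex

/-- The complement has density 1 - dM₁/dM with respect to M. Infinite measures cannot be subtracted
value by value, so a Radon–Nikodym derivative is used. -/
theorem exists_measure_add_of_le {X : Type*} [MeasurableSpace X] {M₁ M : Measure X} [SFinite M₁]
    [SigmaFinite M]
    (h : M₁ ≤ M) : ∃ M₂ : Measure X, M = M₁ + M₂ := by
  have hac : M₁ ≪ M := Measure.absolutelyContinuous_of_le h
  have h1 : M₁.rnDeriv M ≤ᵐ[M] 1 := by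
    refine ae_le_of_forall_setLIntegral_le_of_sigmaFinite (Measure.measurable_rnDeriv _ _)
      fun s hs _ => ?_
    rw [Measure.setLIntegral_rnDeriv hac]
    simpa using h s
  refine ⟨M.withDensity (1 - M₁.rnDeriv M), ?_⟩
  conv_rhs => enter [1]; rw [← Measure.withDensity_rnDeriv_eq M₁ M hac]
  rw [← withDensity_add_left (Measure.measurable_rnDeriv _ _)]
  conv_lhs => rw [← withDensity_one (μ := M)]
  refine withDensity_congr_ae ?_
  filter_upwards [h1] with x hx
  simp only [Pi.add_apply, Pi.sub_apply]
  exact (add_tsub_cancel_of_le hx).symm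

variable {E : Type*} [NormedAddCommGroup E] [InnerProductSpace ℝ E] [FiniteDimensional ℝ E]
  [MeasurableSpace E] [BorelSpace E]
variable {U : Type*} [NormedAddCommGroup U] [InnerProductSpace ℝ U] [FiniteDimensional ℝ U]
  [MeasurableSpace U] [BorelSpace U]
variable {ι : Type*} [Fintype ι]

theorem IsCharacteristic.prod {f : ι → E → ℂ} (hf : ∀ j, IsCharacteristic (f j)) (s : Finset ι) :
    IsCharacteristic (fun p => ∏ j ∈ s, f j p) := by
  classical
  induction s using Finset.induction_on with
  | empty => simpa using isCharacteristic_exp_inner (0 : E)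
  | insert j s hj ih => simpa only [Finset.prod_insert hj] using (hf j).mul ih

/-- The exponent of the Lévy process with drift `b`, Gaussian covariance `∑ vⱼ ⊗ vⱼ` and Lévy
measure `ν`. -/
def noiseExponent (b : U) (v : ι → U) (ν : Measure U) (p : U) : ℂ :=
  ((⟪b, p⟫ : ℝ) : ℂ) * I - ((1 / 2 * ∑ j, ⟪v j, p⟫ ^ 2 : ℝ) : ℂ)
    + ∫ z, levyKernel id (Metric.ball 0 1) p z ∂ν

theorem continuous_noiseExponent (b : U) (v : ι → U) {ν : Measure U}
    (hν : Integrable (levyWeight id (Metric.ball 0 1)) ν) :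
    Continuous (noiseExponent b v ν) := by
  have := continuous_integral_levyKernel measurable_id Metric.isOpen_ball.measurableSet hν
  unfold noiseExponent
  fun_prop

variable (A : E →L[ℝ] E) (B : U →L[ℝ] E)

/-- The exponent of `∫₀ᵗ e^{-sA} B dZ_s`. -/
def ouExponent (b : U) (v : ι → U) (ν : Measure U) (t : ℝ) (p : E) : ℂ :=
  ∫ s in (0 : ℝ)..t, noiseExponent b v ν (ContinuousLinearMap.adjoint (flow A (-s) ∘L B) p)

/-- The jumps of `∫₀ᵗ e^{-sA} B dZ_s`. -/
def noiseJump (q : ℝ × U) : E := flow A (-q.1) (B q.2)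

theorem continuous_noiseJump : Continuous (noiseJump A B) := by
  have h1 : Continuous fun q : ℝ × U => flow A (-q.1) :=
    (continuous_flow A).comp continuous_fst.neg
  exact h1.clm_apply (B.continuous.comp continuous_snd)

theorem inner_adjoint_flow (s : ℝ) (z : U) (p : E) :
    ⟪z, ContinuousLinearMap.adjoint (flow A (-s) ∘L B) p⟫ = ⟪noiseJump A B (s, z), p⟫ := by
  rw [ContinuousLinearMap.adjoint_inner_right]
  rfl

theorem continuous_adjoint_flow :
    Continuous fun q : ℝ × E => ContinuousLinearMap.adjoint (flow A (-q.1) ∘L B) q.2 := by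
  have h1 : Continuous fun q : ℝ × E => flow A (-q.1) ∘L B :=
    ((continuous_flow A).comp continuous_fst.neg).clm_comp continuous_const
  have h2 : Continuous fun q : ℝ × E => ContinuousLinearMap.adjoint (flow A (-q.1) ∘L B) :=
    ContinuousLinearMap.adjoint.continuous.comp h1
  exact h2.clm_apply continuous_snd

variable {ν : Measure U}

theorem measure_compl_ball_lt_top (hν : Integrable (levyWeight id (Metric.ball 0 1)) ν) :
    ν (Metric.ball 0 1)ᶜ < ∞ := by
  have h1 := hν.measure_norm_ge_lt_top (ε := 1) one_pos
  refine (measure_mono fun z hz => ?_).trans_lt h1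
  have hz' : z ∉ Metric.ball (0 : U) 1 := hz
  simp [levyWeight, Set.indicator_of_notMem hz', Set.indicator_of_mem hz]

theorem integrableOn_sq_norm_ball (hν : Integrable (levyWeight id (Metric.ball 0 1)) ν) :
    IntegrableOn (fun z => ‖z‖ ^ 2) (Metric.ball 0 1) ν := by
  refine hν.integrableOn.congr_fun (fun z hz => ?_) Metric.isOpen_ball.measurableSet
  simp only [levyWeight, Set.indicator_of_mem hz, id]
  rw [Set.indicator_of_notMem (fun h : z ∈ (Metric.ball (0 : U) 1)ᶜ => h hz), add_zero]

/-- The jump set that is compensated. -/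
def smallJumps : Set (ℝ × U) := Set.univ ×ˢ Metric.ball 0 1

theorem measurableSet_smallJumps : MeasurableSet (smallJumps (U := U)) :=
  MeasurableSet.univ.prod Metric.isOpen_ball.measurableSet

theorem integrableOn_sq_noiseJump [SFinite ν]
    (hν : Integrable (levyWeight id (Metric.ball 0 1)) ν) (t : ℝ) :
    IntegrableOn (fun q => ‖noiseJump A B q‖ ^ 2) smallJumps
      ((volume.restrict (Set.Ioc 0 t)).prod ν) := by
  obtain ⟨K, hK1, hK⟩ := exists_norm_flow_le A |t|
  have h1 : Integrable (fun q : ℝ × U => ‖q.2‖ ^ 2)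
      ((volume.restrict (Set.Ioc 0 t)).prod (ν.restrict (Metric.ball 0 1))) := by
    have := (integrable_const (1 : ℝ) (μ := (volume : Measure ℝ).restrict (Set.Ioc 0 t))).mul_prod
      (integrableOn_sq_norm_ball hν)
    simpa only [one_mul] using this
  rw [IntegrableOn, smallJumps, ← Measure.prod_restrict, Measure.restrict_univ]
  refine (h1.const_mul ((K * ‖B‖) ^ 2)).mono'
    ((continuous_noiseJump A B).norm.pow 2).aestronglyMeasurable ?_
  have hs := (Measure.quasiMeasurePreserving_fst (μ := (volume : Measure ℝ).restrict (Set.Ioc 0 t))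
      (ν := ν.restrict (Metric.ball 0 1))).ae (ae_restrict_mem measurableSet_Ioc)
  filter_upwards [hs] with q hq
  rw [norm_pow, norm_norm, ← mul_pow]
  gcongr
  have h3 : |(-q.1)| ≤ |t| := by
    rw [abs_neg, abs_of_pos hq.1]
    exact hq.2.trans (le_abs_self t)
  exact ((flow A (-q.1)).le_of_opNorm_le (hK _ h3) _).trans
    (by rw [mul_assoc]; gcongr; exact B.le_opNorm _)

theorem measure_compl_smallJumps [SFinite ν]
    (hν : Integrable (levyWeight id (Metric.ball 0 1)) ν) (t : ℝ) :
    ((volume.restrict (Set.Ioc 0 t)).prod ν) smallJumpsᶜ < ∞ := by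
  have h1 : (smallJumps (U := U))ᶜ = Set.univ ×ˢ (Metric.ball 0 1)ᶜ := by
    ext q; simp [smallJumps]
  rw [h1, Measure.prod_prod]
  exact ENNReal.mul_lt_top (by simp) (measure_compl_ball_lt_top hν)

/-- Fubini brings the exponent into Lévy–Khintchine form on (0,t] × U: a translation, one Gaussian
factor for each direction `v j`, and a jump part. Compensation is decided by the size of the jump of
Z, not by that of its image under e^{-sA}B. -/
theorem ouExponent_eq [SFinite ν] (hν : Integrable (levyWeight id (Metric.ball 0 1)) ν)
    (b : U) (v : ι → U) {t : ℝ} (ht : 0 ≤ t) (p : E) :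
    ouExponent A B b v ν t p
      = ((⟪∫ s in Set.Ioc 0 t, noiseJump A B (s, b), p⟫ : ℝ) : ℂ) * I
        + ∑ j, ((-(1 / 2 * ∫ s in Set.Ioc 0 t, ⟪noiseJump A B (s, v j), p⟫ ^ 2) : ℝ) : ℂ)
        + ∫ q, levyKernel (noiseJump A B) smallJumps p q ∂(volume.restrict (Set.Ioc 0 t)).prod ν := by
  have hc : ∀ z, Continuous fun s => noiseJump A B (s, z) := fun z =>
    (continuous_noiseJump A B).comp (continuous_id.prodMk continuous_const)
  have hci : ∀ {V : Type} [NormedAddCommGroup V] {f : ℝ → V}, Continuous f →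
      Integrable f (volume.restrict (Set.Ioc 0 t)) := fun hf =>
    (hf.integrableOn_Icc (a := 0) (b := t)).mono_set Set.Ioc_subset_Icc_self
  have hker : Integrable (levyKernel (noiseJump A B) smallJumps p)
      ((volume.restrict (Set.Ioc 0 t)).prod ν) :=
    integrable_levyKernel (continuous_noiseJump A B).measurable measurableSet_smallJumps
      (integrable_levyWeight measurableSet_smallJumps (integrableOn_sq_noiseJump A B hν t)
        (measure_compl_smallJumps hν t)) p
  have hkey : ∀ s, noiseExponent b v ν (ContinuousLinearMap.adjoint (flow A (-s) ∘L B) p)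
      = ((⟪noiseJump A B (s, b), p⟫ : ℝ) : ℂ) * I
        + ((-(1 / 2 * ∑ j, ⟪noiseJump A B (s, v j), p⟫ ^ 2) : ℝ) : ℂ)
        + ∫ z, levyKernel (noiseJump A B) smallJumps p (s, z) ∂ν := by
    intro s
    unfold noiseExponent
    simp only [inner_adjoint_flow]
    congr 1
    · push_cast; ring
    · refine integral_congr_ae (Eventually.of_forall fun z => ?_)
      simp only [levyKernel, id, inner_adjoint_flow]
      congr 1
      by_cases hz : z ∈ Metric.ball (0 : U) 1
      · rw [Set.indicator_of_mem hz, Set.indicator_of_mem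
          (show (s, z) ∈ smallJumps from ⟨trivial, hz⟩)]
      · rw [Set.indicator_of_notMem hz, Set.indicator_of_notMem
          (fun h : (s, z) ∈ smallJumps => hz h.2)]
  have i1 : Integrable (fun s => ((⟪noiseJump A B (s, b), p⟫ : ℝ) : ℂ) * I)
      (volume.restrict (Set.Ioc 0 t)) := hci (by have := hc b; fun_prop)
  have i2 : ∀ j, Integrable (fun s => ⟪noiseJump A B (s, v j), p⟫ ^ 2)
      (volume.restrict (Set.Ioc 0 t)) := fun j => hci (by have := hc (v j); fun_prop)
  have i2' : Integrable (fun s => (-(1 / 2 * ∑ j, ⟪noiseJump A B (s, v j), p⟫ ^ 2) : ℝ))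
      (volume.restrict (Set.Ioc 0 t)) := ((integrable_finsetSum _ fun j _ => i2 j).const_mul _).neg
  unfold ouExponent
  rw [intervalIntegral.integral_of_le ht]
  simp_rw [hkey]
  have i2c : Integrable (fun s => ((-(1 / 2 * ∑ j, ⟪noiseJump A B (s, v j), p⟫ ^ 2) : ℝ) : ℂ))
      (volume.restrict (Set.Ioc 0 t)) := i2'.ofReal
  have i3 : Integrable (fun s => ((⟪noiseJump A B (s, b), p⟫ : ℝ) : ℂ) * I
      + ((-(1 / 2 * ∑ j, ⟪noiseJump A B (s, v j), p⟫ ^ 2) : ℝ) : ℂ))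
      (volume.restrict (Set.Ioc 0 t)) := i1.add i2c
  rw [integral_add i3 hker.integral_prod_left, integral_add i1 i2c,
    integral_prod _ hker, integral_mul_const, integral_complex_ofReal, integral_complex_ofReal,
    integral_neg, integral_const_mul, integral_finsetSum _ fun j _ => i2 j]
  congr 2
  · have h5 : Integrable (fun s => noiseJump A B (s, b)) (volume.restrict (Set.Ioc 0 t)) :=
      ((hc b).integrableOn_Icc (a := 0) (b := t)).mono_set Set.Ioc_subset_Icc_self
    rw [real_inner_comm, ← integral_inner h5]
    simp_rw [real_inner_comm]
  · push_cast
    rw [Finset.sum_neg_distrib, Finset.mul_sum]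

/-- The factor τ from the time variable cancels the factor (τ^{1/α})^{-α} = τ^{-1} from the stable
measure, so no prefactor remains. -/
theorem stableJumps_mul (μ : Measure (Metric.sphere (0 : U) 1)) [IsFiniteMeasure μ]
    {α ρ τ : ℝ} (hα : 0 < α) (hτ : 0 < τ) :
    stableJumps μ α τ (τ ^ (1 / α) * ρ)
      = (stableJumps μ α 1 ρ).map (fun q => (τ * q.1, τ ^ (1 / α) • q.2)) := by
  have hc : 0 < τ ^ (1 / α) := Real.rpow_pos_of_pos hτ _
  have hcα : (τ ^ (1 / α)) ^ (-α) = τ⁻¹ := by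
    rw [← Real.rpow_mul hτ.le, ← Real.rpow_neg_one]
    congr 1
    field_simp
  have h1 : (volume : Measure ℝ).restrict (Set.Ioc 0 τ)
      = ENNReal.ofReal τ • ((volume : Measure ℝ).restrict (Set.Ioc 0 1)).map (τ * ·) := by
    have h2 : Set.Ioc (0 : ℝ) 1 = (τ * ·) ⁻¹' Set.Ioc 0 τ := by
      ext s
      simp only [Set.mem_Ioc, Set.mem_preimage]
      constructor
      · rintro ⟨h, h'⟩; exact ⟨by positivity, by nlinarith⟩
      · rintro ⟨h, h'⟩; exact ⟨pos_of_mul_pos_right h hτ.le, by nlinarith⟩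
    rw [h2, ← Measure.restrict_map (by fun_prop) measurableSet_Ioc, ← Measure.restrict_smul]
    have h3 := Real.smul_map_volume_mul_left hτ.ne'
    rw [abs_of_pos hτ] at h3
    rw [h3]
  have hsf : SFinite ((stable μ α ρ).map (τ ^ (1 / α) • ·)) := inferInstance
  rw [stableJumps, stableJumps, stable_mul μ hc, h1, hcα, Measure.prod_smul_left]
  have h4 : (((volume : Measure ℝ).restrict (Set.Ioc 0 1)).map (τ * ·)).prod (ENNReal.ofReal τ⁻¹ • (stable μ α ρ).map (τ ^ (1 / α) • ·))
      = ENNReal.ofReal τ⁻¹ • (((volume : Measure ℝ).restrict (Set.Ioc 0 1)).map (τ * ·)).prod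
        ((stable μ α ρ).map (τ ^ (1 / α) • ·)) := Measure.prod_smul_right _
  rw [h4, smul_smul, ← ENNReal.ofReal_mul hτ.le, mul_inv_cancel₀ hτ.ne', ENNReal.ofReal_one,
    one_smul, Measure.map_prod_map _ _ (by fun_prop) (by fun_prop)]
  rfl

/-- The law of the Ornstein–Uhlenbeck process at time `t` is the convolution of a rescaled truncated
stable law with another law. -/
theorem exists_convolution_factor [SigmaFinite ν]
    (hν : Integrable (levyWeight id (Metric.ball 0 1)) ν) {n : ℕ} (hn : reachSpace A B n = ⊤)
    (μ : Measure (Metric.sphere (0 : U) 1)) [IsFiniteMeasure μ] {α ρ : ℝ} (hα0 : 0 < α)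
    (hα : α < 2) (hρ : 0 < ρ) (hρ1 : ρ < 1) (hle : stable μ α ρ ≤ ν)
    (b : U) (v : ι → U) {t τ : ℝ} (hτ : 0 < τ) (hτ1 : τ ≤ 1) (hτt : τ ≤ t) :
    ∃ Q R : Measure E, IsProbabilityMeasure Q ∧ IsProbabilityMeasure R ∧
      (∀ p, charFun Q p = Complex.exp (∫ q, levyKernel
        (fun q : ℝ × U => scaledNoise A B n τ q.1 q.2) Set.univ p q ∂stableJumps μ α 1 ρ)) ∧
      ∀ p, charFun ((Q.map fun w => τ ^ (1 / α) • dilation A B n τ w) ∗ R) p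
        = Complex.exp (ouExponent A B b v ν t p) := by
  have ht : 0 ≤ t := hτ.le.trans hτt
  set c : ℝ := τ ^ (1 / α) with hc
  have hc0 : 0 < c := Real.rpow_pos_of_pos hτ _
  have hc1 : c ≤ 1 := Real.rpow_le_one hτ.le hτ1 (by positivity)
  have hcρ : c * ρ ≤ ρ := by nlinarith
  let S : E →L[ℝ] E := c • dilation A B n τ
  let y : ℝ × U → E := fun q => scaledNoise A B n τ q.1 q.2
  have hyc : Continuous y := by
    have h1 : Continuous fun q : ℝ × U => scaledNoise A B n τ q.1 :=
      (continuous_scaledNoise A B n).comp (continuous_const.prodMk continuous_fst)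
    exact h1.clm_apply continuous_snd
  have hSy : ∀ q : ℝ × U, noiseJump A B (τ * q.1, c • q.2) = S (y q) := by
    intro q
    simp only [S, y, noiseJump, smul_apply, map_smul]
    rw [scaledNoise_eq A B n hτ.ne', dilation_dilation A B hn (mul_inv_cancel₀ hτ.ne')]
  set M := ((volume : Measure ℝ).restrict (Set.Ioc 0 t)).prod ν with hM
  set M₁ := stableJumps μ α τ (c * ρ) with hM₁
  have hM₁M : M₁ ≤ M := Measure.prod_mono
    (Measure.restrict_mono (Set.Ioc_subset_Ioc_right hτt) le_rfl) ((stable_mono μ hcρ).trans hle)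
  have : SFinite M₁ := by rw [hM₁, stableJumps]; infer_instance
  -- The jump measure is split, not the process: `M₁` gives the smoothing factor, and `M₂` is of no
  -- importance beyond being dominated by `M`.
  obtain ⟨M₂, hM₂⟩ := exists_measure_add_of_le hM₁M
  have hM₂M : M₂ ≤ M := by rw [hM₂]; exact Measure.le_add_left le_rfl
  have hym := (continuous_noiseJump A B).measurable
  have hSm := measurableSet_smallJumps (U := U)
  have hwi := integrableOn_sq_noiseJump A B hν t
  have hwf := measure_compl_smallJumps hν t
  have hw := integrable_levyWeight hSm hwi hwf
  have hmap : M₁ = (stableJumps μ α 1 ρ).map (fun q => (τ * q.1, c • q.2)) :=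
    stableJumps_mul μ hα0 hτ
  -- The jumps of `M₁` have size at most cρ < 1, so all of them are compensated and the indicator in
  -- the kernel can be dropped.
  have hz_ae : ∀ᵐ q ∂M₁, q ∈ smallJumps := by
    have := (Measure.quasiMeasurePreserving_snd (μ := (volume : Measure ℝ).restrict (Set.Ioc 0 τ))
      (ν := stable μ α (c * ρ))).ae (ae_norm_le_stable μ α (c * ρ))
    rw [hM₁, stableJumps]
    filter_upwards [this] with q hq
    refine ⟨trivial, ?_⟩
    rw [mem_ball_zero_iff]
    exact lt_of_le_of_lt hq (by linarith)
  have hker1 : ∀ p, ∫ q, levyKernel (noiseJump A B) smallJumps p q ∂M₁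
      = ∫ q, levyKernel y Set.univ (ContinuousLinearMap.adjoint S p) q ∂stableJumps μ α 1 ρ := by
    intro p
    have h1 : ∫ q, levyKernel (noiseJump A B) smallJumps p q ∂M₁
        = ∫ q, levyKernel (noiseJump A B) Set.univ p q ∂M₁ := by
      refine integral_congr_ae ?_
      filter_upwards [hz_ae] with q hq
      simp only [levyKernel, Set.indicator_of_mem hq, Set.indicator_univ]
    rw [h1, hmap, integral_map (by fun_prop)
      (measurable_levyKernel hym MeasurableSet.univ p).aestronglyMeasurable]
    refine integral_congr_ae (Eventually.of_forall fun q => ?_)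
    simp only [levyKernel, Set.indicator_univ, hSy, ContinuousLinearMap.adjoint_inner_right]
  -- the two factors
  have hQ : IsCharacteristic (fun p : E => Complex.exp
      (∫ q, levyKernel y Set.univ p q ∂stableJumps μ α 1 ρ)) := by
    refine isCharacteristic_levy hyc.measurable MeasurableSet.univ ?_ (by simp)
    obtain ⟨Λ, hΛ1, hΛ⟩ := exists_norm_scaledNoise_le A B n
    have hsqM : Integrable (fun q : ℝ × U => ‖q.2‖ ^ 2) (stableJumps μ α 1 ρ) := by
      have := (integrable_const (1 : ℝ) (μ := (volume : Measure ℝ).restrict (Set.Ioc 0 1))).mul_prod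
        (integrable_sq_norm_stable μ hα hρ.le)
      simp only [one_mul] at this
      exact this
    have hs_ae : ∀ᵐ q ∂stableJumps μ α 1 ρ, q.1 ∈ Set.Ioc (0 : ℝ) 1 := by
      have := (Measure.quasiMeasurePreserving_fst (μ := (volume : Measure ℝ).restrict (Set.Ioc 0 1))
        (ν := stable μ α ρ)).ae (ae_restrict_mem measurableSet_Ioc)
      exact this
    refine ((hsqM.const_mul (Λ ^ 2)).mono' (hyc.norm.pow 2).aestronglyMeasurable ?_).integrableOn
    filter_upwards [hs_ae] with q hq
    change ‖‖y q‖ ^ 2‖ ≤ _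
    rw [norm_pow, norm_norm, ← mul_pow]
    gcongr
    exact (scaledNoise A B n τ q.1).le_of_opNorm_le
      (hΛ τ ⟨hτ.le, hτ1⟩ q.1 ⟨hq.1.le, hq.2⟩) _
  have hci : ∀ z, Integrable (fun s => ‖noiseJump A B (s, z)‖ ^ 2)
      (volume.restrict (Set.Ioc 0 t)) := fun z =>
    ((((continuous_noiseJump A B).comp
      (continuous_id.prodMk continuous_const)).norm.pow 2).integrableOn_Icc
      (a := 0) (b := t)).mono_set Set.Ioc_subset_Icc_self
  -- The second factor collects the drift, the Gaussian part and the jumps of `M₂`.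
  have hR : IsCharacteristic (fun p : E => Complex.exp
        (((⟪∫ s in Set.Ioc 0 t, noiseJump A B (s, b), p⟫ : ℝ) : ℂ) * I)
      * (∏ j, Complex.exp ((-(1 / 2 * ∫ s in Set.Ioc 0 t, ⟪noiseJump A B (s, v j), p⟫ ^ 2) : ℝ)))
      * Complex.exp (∫ q, levyKernel (noiseJump A B) smallJumps p q ∂M₂)) := by
    refine ((isCharacteristic_exp_inner _).mul (IsCharacteristic.prod (fun j => ?_) _)).mul ?_
    · exact isCharacteristic_gaussian (((continuous_noiseJump A B).comp
        (continuous_id.prodMk continuous_const)).measurable) (hci (v j))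
    · exact isCharacteristic_levy hym hSm (hwi.mono_measure hM₂M) ((hM₂M _).trans_lt hwf)
  obtain ⟨Q, hQp, hQc⟩ := hQ
  obtain ⟨R, hRp, hRc⟩ := hR
  beta_reduce at hQc hRc
  refine ⟨Q, R, hQp, hRp, hQc, fun p => ?_⟩
  have hSmeas : Measurable fun w => c • dilation A B n τ w := S.continuous.measurable
  have hmp : IsProbabilityMeasure (Q.map fun w => c • dilation A B n τ w) :=
    Measure.isProbabilityMeasure_map hSmeas.aemeasurable
  rw [charFun_conv, hRc, ouExponent_eq A B hν b v ht, ← hM, hM₂,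
    integral_add_measure
      ((integrable_levyKernel hym hSm hw p).mono_measure hM₁M)
      ((integrable_levyKernel hym hSm hw p).mono_measure hM₂M), hker1]
  have h1 : charFun (Q.map fun w => c • dilation A B n τ w) p
      = charFun Q (ContinuousLinearMap.adjoint S p) := by
    rw [charFun_apply, charFun_apply, integral_map hSmeas.aemeasurable (by fun_prop)]
    refine integral_congr_ae (Eventually.of_forall fun w => ?_)
    simp only [ContinuousLinearMap.adjoint_inner_right]
    rfl
  rw [h1, hQc, ← Complex.exp_sum, ← Complex.exp_add, ← Complex.exp_add, ← Complex.exp_add]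
  congr 1
  ring

/-- Existence of the law of the Ornstein–Uhlenbeck process. -/
theorem isCharacteristic_ouExponent [SigmaFinite ν]
    (hν : Integrable (levyWeight id (Metric.ball 0 1)) ν)
    (b : U) (v : ι → U) {t : ℝ} (ht : 0 ≤ t) :
    IsCharacteristic (fun p => Complex.exp (ouExponent A B b v ν t p)) := by
  have hym := (continuous_noiseJump A B).measurable
  have hSm := measurableSet_smallJumps (U := U)
  have hci : ∀ z, Integrable (fun s => ‖noiseJump A B (s, z)‖ ^ 2)
      (volume.restrict (Set.Ioc 0 t)) := fun z =>
    ((((continuous_noiseJump A B).comp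
      (continuous_id.prodMk continuous_const)).norm.pow 2).integrableOn_Icc
      (a := 0) (b := t)).mono_set Set.Ioc_subset_Icc_self
  simp_rw [ouExponent_eq A B hν b v ht, Complex.exp_add, Complex.exp_sum]
  refine ((isCharacteristic_exp_inner _).mul (IsCharacteristic.prod (fun j => ?_) _)).mul ?_
  · exact isCharacteristic_gaussian (((continuous_noiseJump A B).comp
      (continuous_id.prodMk continuous_const)).measurable) (hci (v j))
  · exact isCharacteristic_levy hym hSm (integrableOn_sq_noiseJump A B hν t)
      (measure_compl_smallJumps hν t)

end Law

/-! ### Zygmund–Hölder regularity of a resolvent -/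

section Resolvent

theorem integrableOn_exp_mul_rpow_add_one {lam a : ℝ} (hlam : 0 < lam) (ha : -1 < a) :
    IntegrableOn (fun t : ℝ => Real.exp (-lam * t) * (t ^ a + 1)) (Set.Ioi 0) := by
  have h1 : IntegrableOn (fun t : ℝ => t ^ a * Real.exp (-lam * t)) (Set.Ioi 0) := by
    have := integrableOn_rpow_mul_exp_neg_mul_rpow ha (one_pos : (0 : ℝ) < 1) hlam
    simpa only [Real.rpow_one] using this
  have h2 := integrableOn_exp_mul_Ioi (a := -lam) (by linarith) 0
  refine (h1.add h2).congr_fun (fun t _ => ?_) measurableSet_Ioi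
  simp only [Pi.add_apply]
  ring

/-- The integral is cut at `t₀`. Beyond it, t^c is integrable by itself because c < -1, and the
exponential is spent only on the constant 1. -/
theorem norm_integral_exp_smul_le {G : Type*} [NormedAddCommGroup G] [NormedSpace ℝ G] {f : ℝ → G}
    {lam t₀ c M : ℝ} {ψ : ℝ → ℝ} (hlam : 0 < lam) (ht₀ : 0 < t₀) (hc : c < -1) (hM : 0 ≤ M)
    (hψ : IntegrableOn ψ (Set.Ioc 0 t₀)) (h1 : ∀ t ∈ Set.Ioc 0 t₀, ‖f t‖ ≤ ψ t)
    (h2 : ∀ t, t₀ < t → ‖f t‖ ≤ M * (t ^ c + 1)) :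
    ‖∫ t in Set.Ioi 0, Real.exp (-lam * t) • f t‖
      ≤ (∫ t in Set.Ioc 0 t₀, ψ t) + M * (t₀ ^ (c + 1) / (-(c + 1)) + 1 / lam) := by
  let φ : ℝ → ℝ := fun t => M * (t ^ c + Real.exp (-lam * t))
  have i1 := integrableOn_Ioi_rpow_of_lt hc ht₀
  have i2 : IntegrableOn (fun t => Real.exp (-lam * t)) (Set.Ioi t₀) :=
    integrableOn_exp_mul_Ioi (a := -lam) (by linarith) t₀
  have hφ : IntegrableOn φ (Set.Ioi t₀) := (i1.add i2).const_mul M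
  have hφi : ∫ t in Set.Ioi t₀, φ t ≤ M * (t₀ ^ (c + 1) / (-(c + 1)) + 1 / lam) := by
    simp only [φ]
    rw [integral_const_mul, integral_add i1 i2, integral_Ioi_rpow_of_lt hc ht₀,
      integral_exp_mul_Ioi (by linarith)]
    refine mul_le_mul_of_nonneg_left (add_le_add (le_of_eq ?_) ?_) hM
    · rw [neg_div, div_neg]
    · rw [neg_div_neg_eq]
      gcongr
      rw [Real.exp_le_one_iff]
      nlinarith
  have hexp : ∀ t : ℝ, 0 < t → Real.exp (-lam * t) ≤ 1 := fun t ht => by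
    rw [Real.exp_le_one_iff]
    nlinarith
  have hg : IntegrableOn ((Set.Ioc 0 t₀).indicator ψ + (Set.Ioi t₀).indicator φ) (Set.Ioi 0) :=
    ((hψ.integrable_indicator measurableSet_Ioc).add
      (hφ.integrable_indicator measurableSet_Ioi)).integrableOn
  refine (norm_integral_le_of_norm_le hg ?_).trans ?_
  · filter_upwards [ae_restrict_mem measurableSet_Ioi] with t ht
    have ht0 : 0 < t := ht
    rw [norm_smul, Real.norm_of_nonneg (Real.exp_pos _).le, Pi.add_apply]
    rcases le_or_gt t t₀ with h | h
    · rw [Set.indicator_of_mem (show t ∈ Set.Ioc 0 t₀ from ⟨ht, h⟩),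
        Set.indicator_of_notMem (show t ∉ Set.Ioi t₀ from fun h' => not_lt.2 h h'), add_zero]
      exact (mul_le_of_le_one_left (norm_nonneg _) (hexp t ht0)).trans (h1 t ⟨ht, h⟩)
    · rw [Set.indicator_of_notMem (show t ∉ Set.Ioc 0 t₀ from fun h' => not_lt.2 h'.2 h),
        Set.indicator_of_mem (show t ∈ Set.Ioi t₀ from h), zero_add]
      have h3 : 0 ≤ t ^ c := Real.rpow_nonneg ht0.le _
      calc Real.exp (-lam * t) * ‖f t‖ ≤ Real.exp (-lam * t) * (M * (t ^ c + 1)) := by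
            gcongr; exact h2 t h
        _ = M * (Real.exp (-lam * t) * t ^ c + Real.exp (-lam * t)) := by ring
        _ ≤ M * (t ^ c + Real.exp (-lam * t)) := by
            gcongr
            exact mul_le_of_le_one_left h3 (hexp t ht0)
  · simp only [Pi.add_apply]
    rw [integral_add (hψ.integrable_indicator measurableSet_Ioc).integrableOn
      (hφ.integrable_indicator measurableSet_Ioi).integrableOn,
      setIntegral_indicator measurableSet_Ioc, setIntegral_indicator measurableSet_Ioi]
    have e1 : Set.Ioi (0 : ℝ) ∩ Set.Ioc 0 t₀ = Set.Ioc 0 t₀ :=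
      Set.inter_eq_right.2 fun t ht => ht.1
    have e2 : Set.Ioi (0 : ℝ) ∩ Set.Ioi t₀ = Set.Ioi t₀ :=
      Set.inter_eq_right.2 fun t ht => ht₀.trans ht
    rw [e1, e2]
    gcongr

/-- The contribution of a difference of derivatives of order `k` to the resolvent: `j = 1` for
first order differences, `j = 2` for second order ones. -/
theorem norm_integral_exp_smul_le_rpow {G : Type*} [NormedAddCommGroup G] [NormedSpace ℝ G]
    {α β σ lam L h : ℝ} {k j : ℕ} {f : ℝ → G} (hα : 0 < α) (hβ : 0 < β) (hβ1 : β < 1) (hσ : 1 ≤ σ)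
    (hlam : 0 < lam) (hL : 0 ≤ L) (hk : k < (α + β) / σ) (hj : (α + β) / σ < k + j) (hj2 : j ≤ 2)
    (h0 : 0 < h) (h1 : h < 1)
    (hpos : 0 < k → ∀ t ∈ Set.Ioc 0 ((h / 2) ^ (α / σ)),
      ‖f t‖ ≤ 4 * (L * (t ^ ((β - k * σ) / α) + 1)))
    (hzero : k = 0 → ∀ t ∈ Set.Ioc 0 ((h / 2) ^ (α / σ)), ‖f t‖ ≤ 2 * L * h ^ (β / σ))
    (hder : ∀ t, 0 < t → ‖f t‖ ≤ h ^ j * L * (t ^ ((β - (k + j) * σ) / α) + 1)) :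
    ‖∫ t in Set.Ioi 0, Real.exp (-lam * t) • f t‖ ≤
      (8 / ((β - k * σ) / α + 1) + 2 + 4 / (-((β - (k + j) * σ) / α + 1)) + 1 / lam) * L
        * h ^ ((α + β) / σ - k) := by
  have hσ0 : 0 < σ := by linarith
  have hh2 : 0 < h / 2 := by positivity
  -- The time at which the parabolic scaling matches the distance h. Half of h appears because
  -- Zygmund differences compare the endpoints with their midpoint.
  set t₀ := (h / 2) ^ (α / σ) with ht₀
  have ht₀0 : 0 < t₀ := Real.rpow_pos_of_pos hh2 _
  have ht₀1 : t₀ ≤ 1 := Real.rpow_le_one hh2.le (by linarith) (by positivity)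
  set a := (β - k * σ) / α with ha
  set c := (β - (k + j) * σ) / α with hc
  set θ := (α + β) / σ - k with hθ
  rw [lt_div_iff₀ hσ0] at hk
  rw [div_lt_iff₀ hσ0] at hj
  have ha1 : 0 < a + 1 := by
    rw [ha, div_add_one hα.ne']
    exact div_pos (by linarith) hα
  have hc1 : c + 1 < 0 := by
    rw [hc, div_add_one hα.ne']
    exact div_neg_of_neg_of_pos (by linarith) hα
  have hθ0 : 0 < θ := by
    rw [hθ, sub_pos, lt_div_iff₀ hσ0]
    exact hk
  have hθj : θ < j := by
    rw [hθ, sub_lt_iff_lt_add', div_lt_iff₀ hσ0]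
    exact hj
  have hta : t₀ ^ (a + 1) ≤ h ^ θ := by
    rw [ht₀, ← Real.rpow_mul hh2.le]
    have : α / σ * (a + 1) = θ := by rw [ha, hθ]; field_simp; ring
    rw [this]
    exact Real.rpow_le_rpow hh2.le (by linarith) hθ0.le
  have htc : h ^ j * t₀ ^ (c + 1) ≤ 4 * h ^ θ := by
    rw [ht₀, ← Real.rpow_mul hh2.le]
    have : α / σ * (c + 1) = θ - j := by rw [hc, hθ]; field_simp; ring
    rw [this, Real.div_rpow h0.le (by norm_num), Real.rpow_sub h0, Real.rpow_natCast]
    have h2 : ((2 : ℝ) ^ (θ - j))⁻¹ ≤ 4 := by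
      rw [← Real.rpow_neg (by norm_num)]
      calc (2 : ℝ) ^ (-(θ - j)) ≤ 2 ^ (2 : ℝ) := by
            refine Real.rpow_le_rpow_of_exponent_le (by norm_num) ?_
            have : (j : ℝ) ≤ 2 := by exact_mod_cast hj2
            linarith
        _ = 4 := by norm_num
    calc h ^ j * (h ^ θ / h ^ j / 2 ^ (θ - j)) = (2 ^ (θ - j))⁻¹ * h ^ θ := by
          field_simp
      _ ≤ 4 * h ^ θ := by gcongr
  have hhj : h ^ j ≤ h ^ θ := by
    rw [← Real.rpow_natCast]
    exact Real.rpow_le_rpow_of_exponent_ge h0 h1.le hθj.le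
  have hhθ : 0 ≤ h ^ θ := Real.rpow_nonneg h0.le _
  have hM : 0 ≤ h ^ j * L := by positivity
  have htail : h ^ j * L * (t₀ ^ (c + 1) / (-(c + 1)) + 1 / lam)
      ≤ (4 / (-(c + 1)) + 1 / lam) * L * h ^ θ := by
    have hn : 0 < -(c + 1) := by linarith
    calc h ^ j * L * (t₀ ^ (c + 1) / (-(c + 1)) + 1 / lam)
        = L * ((h ^ j * t₀ ^ (c + 1)) / (-(c + 1)) + h ^ j / lam) := by ring
      _ ≤ L * ((4 * h ^ θ) / (-(c + 1)) + h ^ θ / lam) := by gcongr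
      _ = _ := by ring
  have hder' : ∀ t, t₀ < t → ‖f t‖ ≤ h ^ j * L * (t ^ c + 1) := fun t ht => hder t (ht₀0.trans ht)
  -- For k = 0 the bound by t^{β/α} + 1 would give only h^{α/σ}, so the Hölder regularity at short
  -- times has to provide the factor h^{β/σ}. For k > 0 the exponent is not positive and t^a
  -- dominates 1.
  rcases Nat.eq_zero_or_pos k with hk0 | hk0
  · refine (norm_integral_exp_smul_le (ψ := fun _ => 2 * L * h ^ (β / σ)) hlam ht₀0 (by linarith) hM
      (integrableOn_const (hs := by simp)) (hzero hk0) hder').trans ?_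
    have h3 : ∫ _ in Set.Ioc 0 t₀, 2 * L * h ^ (β / σ) ≤ 2 * L * h ^ θ := by
      rw [setIntegral_const, Real.volume_real_Ioc_of_le ht₀0.le, sub_zero, smul_eq_mul]
      have h4 : t₀ ≤ h ^ (α / σ) := Real.rpow_le_rpow hh2.le (by linarith) (by positivity)
      have h5 : h ^ (α / σ) * h ^ (β / σ) = h ^ θ := by
        rw [← Real.rpow_add h0, hθ, hk0]
        congr 1
        rw [Nat.cast_zero]
        ring
      calc t₀ * (2 * L * h ^ (β / σ)) ≤ h ^ (α / σ) * (2 * L * h ^ (β / σ)) := by gcongr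
        _ = 2 * L * (h ^ (α / σ) * h ^ (β / σ)) := by ring
        _ = _ := by rw [h5]
    have h6 : 0 ≤ 8 / (a + 1) * (L * h ^ θ) := by positivity
    linarith
  · have ha0 : a ≤ 0 := by
      rw [ha]
      refine div_nonpos_of_nonpos_of_nonneg ?_ hα.le
      have : (1 : ℝ) ≤ k := by exact_mod_cast hk0
      nlinarith
    have hint : IntegrableOn (fun t : ℝ => 8 * L * t ^ a) (Set.Ioc 0 t₀) := by
      have := (intervalIntegral.intervalIntegrable_rpow' (a := 0) (b := t₀) (r := a) (by linarith))
      rw [intervalIntegrable_iff_integrableOn_Ioc_of_le ht₀0.le] at this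
      exact this.const_mul _
    refine (norm_integral_exp_smul_le (ψ := fun t => 8 * L * t ^ a) hlam ht₀0 (by linarith) hM
      hint ?_ hder').trans ?_
    · intro t ht
      refine (hpos hk0 t ht).trans ?_
      have : 1 ≤ t ^ a := Real.one_le_rpow_of_pos_of_le_one_of_nonpos ht.1 (ht.2.trans ht₀1) ha0
      nlinarith
    · have h3 : ∫ t in Set.Ioc 0 t₀, 8 * L * t ^ a ≤ 8 / (a + 1) * L * h ^ θ := by
        rw [integral_const_mul, ← intervalIntegral.integral_of_le ht₀0.le,
          integral_rpow (Or.inl (by linarith)), Real.zero_rpow (by linarith), sub_zero]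
        calc 8 * L * (t₀ ^ (a + 1) / (a + 1)) ≤ 8 * L * (h ^ θ / (a + 1)) := by gcongr
          _ = _ := by ring
      have h6 : 0 ≤ L * h ^ θ := by positivity
      linarith

variable {F : Type*} [NormedAddCommGroup F] [NormedSpace ℝ F]

/-- Mean value inequality for z ↦ f(m+z) + f(m-z), with m the midpoint; its derivative is a first
difference of the derivative of f. -/
theorem norm_second_difference_le {G : Type*} [NormedAddCommGroup G] [NormedSpace ℝ G] {f : F → G}
    {M : ℝ} (hf : Differentiable ℝ f) (hM : ∀ x y, ‖fderiv ℝ f x - fderiv ℝ f y‖ ≤ M * ‖x - y‖)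
    (x y : F) : ‖f x + f y - (2 : ℝ) • f (midpoint ℝ x y)‖ ≤ M * ‖x - y‖ ^ 2 := by
  set m := midpoint ℝ x y with hm
  set e : F := (1 / 2 : ℝ) • (x - y) with he
  have hx : x = m + e := by
    rw [hm, he, midpoint_eq_smul_add, invOf_eq_inv]; module
  have hy : y = m - e := by
    rw [hm, he, midpoint_eq_smul_add, invOf_eq_inv]; module
  have hxy : x - y = (2 : ℝ) • e := by rw [he]; module
  let φ : F → G := fun z => f (m + z) + f (m - z)
  have hd : ∀ z, HasFDerivAt φ (fderiv ℝ f (m + z) - fderiv ℝ f (m - z)) z := by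
    intro z
    have h1 : HasFDerivAt (fun z => f (m + z)) (fderiv ℝ f (m + z)) z :=
      by
      have h3 := (hf (m + z)).hasFDerivAt.comp z ((hasFDerivAt_id z).const_add m)
      convert! h3 using 1
    have h2 : HasFDerivAt (fun z => f (m - z)) (-fderiv ℝ f (m - z)) z := by
      have h3 := (hf (m - z)).hasFDerivAt.comp z ((hasFDerivAt_id z).const_sub m)
      convert! h3 using 1
      ext v
      simp
    rw [sub_eq_add_neg]
    exact h1.add h2
  have hM0 : 0 ≤ M * ‖e‖ := by
    have := (norm_nonneg _).trans (hM e 0)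
    simpa using this
  have h3 := (convex_closedBall (0 : F) ‖e‖).norm_image_sub_le_of_norm_hasFDerivWithin_le
    (f := φ) (f' := fun z => fderiv ℝ f (m + z) - fderiv ℝ f (m - z)) (C := 2 * (M * ‖e‖))
    (fun z _ => (hd z).hasFDerivWithinAt) (fun z hz => ?_)
    (x := 0) (y := e) (by simp) (by simp)
  · have h4 : φ e - φ 0 = f x + f y - (2 : ℝ) • f m := by
      simp only [φ, ← hx, ← hy, add_zero, sub_zero, two_smul]
    rw [h4, sub_zero] at h3
    refine h3.trans ?_
    have h6 : ‖x - y‖ = 2 * ‖e‖ := by rw [hxy, norm_smul]; norm_num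
    rw [h6]
    nlinarith [mul_nonneg hM0 (norm_nonneg e)]
  · refine (hM _ _).trans ?_
    have h5 : m + z - (m - z) = (2 : ℝ) • z := by module
    rw [mem_closedBall_zero_iff] at hz
    rw [h5, norm_smul, Real.norm_of_nonneg (by norm_num)]
    rcases eq_or_lt_of_le (norm_nonneg e) with h0 | h0
    · have : ‖z‖ = 0 := le_antisymm (h0 ▸ hz) (norm_nonneg _)
      rw [this, ← h0]; simp
    · have hM' : 0 ≤ M := nonneg_of_mul_nonneg_left hM0 h0
      nlinarith [mul_le_mul_of_nonneg_left hz hM']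

theorem integral_add_sub_two_smul {G : Type*} [NormedAddCommGroup G] [NormedSpace ℝ G] {T : Type*}
    [MeasurableSpace T] {m : Measure T} {f g h : T → G} (hf : Integrable f m) (hg : Integrable g m)
    (hh : Integrable h m) : ∫ t, f t ∂m + ∫ t, g t ∂m - (2 : ℝ) • ∫ t, h t ∂m
      = ∫ t, (f t + g t - (2 : ℝ) • h t) ∂m := by
  have h1 : Integrable (fun t => f t + g t) m := hf.add hg
  have h2 : Integrable (fun t => (2 : ℝ) • h t) m := hh.smul (2 : ℝ)
  rw [integral_sub h1 h2, integral_add hf hg, integral_smul]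

theorem enorm_le_ofReal_iff {G : Type*} [NormedAddCommGroup G] {x : G} {r : ℝ} (hr : 0 ≤ r) :
    ‖x‖ₑ ≤ ENNReal.ofReal r ↔ ‖x‖ ≤ r := by
  rw [← ofReal_norm, ENNReal.ofReal_le_ofReal_iff hr]

theorem zygmundSeminorm_le {γ r : ℝ} (hr : 0 ≤ r) (hγ : 0 ≤ fracPart γ) {ψ : F → ℝ}
    (h1 : fracPart γ = 1 → ∀ x y, x ≠ y → ‖iteratedFDeriv ℝ (intPart γ) ψ x
      + iteratedFDeriv ℝ (intPart γ) ψ y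
      - (2 : ℝ) • iteratedFDeriv ℝ (intPart γ) ψ (midpoint ℝ x y)‖ ≤ r * ‖x - y‖)
    (h2 : fracPart γ ≠ 1 → ∀ x y, x ≠ y → ‖iteratedFDeriv ℝ (intPart γ) ψ x
      - iteratedFDeriv ℝ (intPart γ) ψ y‖ ≤ r * ‖x - y‖ ^ fracPart γ) :
    zygmundSeminorm γ ψ ≤ ENNReal.ofReal r := by
  unfold zygmundSeminorm
  split_ifs with h
  · refine iSup_le fun x => iSup_le fun y => iSup_le fun hxy => ENNReal.div_le_of_le_mul ?_
    rw [← ofReal_norm (x - y), ← ENNReal.ofReal_mul hr, enorm_le_ofReal_iff (by positivity)]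
    exact h1 h x y hxy
  · refine iSup_le fun x => iSup_le fun y => iSup_le fun hxy => ENNReal.div_le_of_le_mul ?_
    rw [← ofReal_norm (x - y), ENNReal.ofReal_rpow_of_nonneg (norm_nonneg _) hγ,
      ← ENNReal.ofReal_mul hr, enorm_le_ofReal_iff (by positivity)]
    exact h2 h x y hxy

theorem intPart_lt {γ : ℝ} (hγ : 0 < γ) : (intPart γ : ℝ) < γ ∧ γ ≤ intPart γ + 1 := by
  unfold intPart
  have h1 : 1 ≤ ⌈γ⌉₊ := Nat.one_le_iff_ne_zero.2 (Nat.ceil_pos.2 hγ).ne'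
  rw [Nat.cast_sub h1]
  have := Nat.ceil_lt_add_one hγ.le
  have := Nat.le_ceil γ
  push_cast
  constructor <;> linarith

/-- A family `v t` of functions with parabolic smoothing of order `σ / α` and anisotropic Hölder
regularity `β / σ`, with constant `L`. -/
structure IsSmoothing (α β σ L : ℝ) (v : ℝ → F → ℝ) : Prop where
  contDiff : ∀ t, 0 < t → ContDiff ℝ 3 (v t)
  measurable : ∀ z, AEStronglyMeasurable (fun t => v t z) (volume.restrict (Set.Ioi 0))
  norm_deriv_le : ∀ t, 0 < t → ∀ m ≤ 3, ∀ z,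
    ‖iteratedFDeriv ℝ m (v t) z‖ ≤ L * (t ^ ((β - m * σ) / α) + 1)
  abs_sub_le : ∀ t z z', ‖z - z'‖ ≤ 1 → 0 < t → t ≤ ‖z - z'‖ ^ (α / σ) →
    |v t z - v t z'| ≤ L * ‖z - z'‖ ^ (β / σ)

/-- The time weight of the `m`-th derivative. -/
def smoothingWeight (α β σ lam : ℝ) (m : ℕ) (t : ℝ) : ℝ :=
  Real.exp (-lam * t) * (t ^ ((β - m * σ) / α) + 1)

theorem smoothingWeight_nonneg (α β σ lam : ℝ) (m : ℕ) {t : ℝ} (ht : 0 < t) :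
    0 ≤ smoothingWeight α β σ lam m t := by
  unfold smoothingWeight
  positivity

variable {α β σ lam L : ℝ} {v : ℝ → F → ℝ} {k : ℕ}

theorem integrableOn_smoothingWeight (hα : 0 < α) (hσ : 1 ≤ σ)
    (hlam : 0 < lam) (hk : k * σ < α + β) {m : ℕ} (hm : m ≤ k) :
    IntegrableOn (smoothingWeight α β σ lam m) (Set.Ioi 0) := by
  refine integrableOn_exp_mul_rpow_add_one hlam ?_
  have h1 : (m : ℝ) ≤ k := by exact_mod_cast hm
  rw [lt_div_iff₀ hα]
  nlinarith

namespace IsSmoothing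

theorem contDiff_mul (hv : IsSmoothing α β σ L v) (hk : k ≤ 3) :
    ∀ᵐ t ∂(volume.restrict (Set.Ioi (0 : ℝ))),
      ContDiff ℝ k (fun z => Real.exp (-lam * t) * v t z) := by
  filter_upwards [ae_restrict_mem measurableSet_Ioi] with t ht
  exact contDiff_const.mul ((hv.contDiff t ht).of_le (by exact_mod_cast hk))

theorem iteratedFDeriv_mul (hv : IsSmoothing α β σ L v) {t : ℝ} (ht : 0 < t) {m : ℕ} (hm : m ≤ 3)
    (z : F) : iteratedFDeriv ℝ m (fun z => Real.exp (-lam * t) * v t z) z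
      = Real.exp (-lam * t) • iteratedFDeriv ℝ m (v t) z :=
  iteratedFDeriv_const_smul_apply (f := v t) (a := Real.exp (-lam * t))
    ((hv.contDiff t ht).of_le (by exact_mod_cast hm)).contDiffAt

theorem measurable_mul (hv : IsSmoothing α β σ L v) (z : F) :
    AEStronglyMeasurable (fun t => Real.exp (-lam * t) * v t z) (volume.restrict (Set.Ioi 0)) :=
  (by fun_prop : Continuous fun t : ℝ => Real.exp (-lam * t)).aestronglyMeasurable.mul
    (hv.measurable z)

theorem norm_deriv_mul_le (hv : IsSmoothing α β σ L v) {t : ℝ} (ht : 0 < t) {m : ℕ} (hm : m ≤ 3)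
    (z : F) : ‖iteratedFDeriv ℝ m (fun z => Real.exp (-lam * t) * v t z) z‖
      ≤ L * smoothingWeight α β σ lam m t := by
  rw [hv.iteratedFDeriv_mul ht hm, norm_smul, Real.norm_of_nonneg (Real.exp_pos _).le]
  refine (mul_le_mul_of_nonneg_left (hv.norm_deriv_le t ht m hm z) (Real.exp_pos _).le).trans ?_
  unfold smoothingWeight
  exact le_of_eq (by ring)

theorem dominated (hv : IsSmoothing α β σ L v) (hα : 0 < α) (hσ : 1 ≤ σ)
    (hlam : 0 < lam) (hk : k * σ < α + β) (hk3 : k ≤ 3) (R : ℝ) (m : ℕ) (hm : m ≤ k) :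
    ∃ b : ℝ → ℝ, Integrable b (volume.restrict (Set.Ioi (0 : ℝ))) ∧
      ∀ᵐ t ∂(volume.restrict (Set.Ioi (0 : ℝ))), ∀ x : F, ‖x‖ ≤ R →
        ‖iteratedFDeriv ℝ m (fun z => Real.exp (-lam * t) * v t z) x‖ ≤ b t := by
  refine ⟨_, (integrableOn_smoothingWeight hα hσ hlam hk hm).const_mul L, ?_⟩
  filter_upwards [ae_restrict_mem measurableSet_Ioi] with t ht x _
  exact hv.norm_deriv_mul_le ht (hm.trans hk3) x

variable [FiniteDimensional ℝ F]

theorem contDiff_integral (hv : IsSmoothing α β σ L v) (hα : 0 < α) (hσ : 1 ≤ σ)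
    (hlam : 0 < lam) (hk : k * σ < α + β) (hk3 : k ≤ 3) :
    ContDiff ℝ k (fun z => ∫ t in Set.Ioi (0 : ℝ), Real.exp (-lam * t) * v t z) :=
  contDiff_integral_of_dominated k (hv.contDiff_mul hk3) hv.measurable_mul
    (hv.dominated hα hσ hlam hk hk3)

theorem iteratedFDeriv_integral (hv : IsSmoothing α β σ L v) (hα : 0 < α) (hσ : 1 ≤ σ)
    (hlam : 0 < lam) (hk : k * σ < α + β) (hk3 : k ≤ 3) {m : ℕ} (hm : m ≤ k) (z : F) :
    iteratedFDeriv ℝ m (fun z => ∫ t in Set.Ioi (0 : ℝ), Real.exp (-lam * t) * v t z) z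
      = ∫ t in Set.Ioi (0 : ℝ), Real.exp (-lam * t) • iteratedFDeriv ℝ m (v t) z := by
  rw [iteratedFDeriv_integral_of_dominated k (hv.contDiff_mul hk3) hv.measurable_mul
    (hv.dominated hα hσ hlam hk hk3) hm z]
  exact setIntegral_congr_fun measurableSet_Ioi fun t ht =>
    hv.iteratedFDeriv_mul ht (hm.trans hk3) z

theorem integrableOn_iteratedFDeriv (hv : IsSmoothing α β σ L v) (hα : 0 < α) (hσ : 1 ≤ σ)
    (hlam : 0 < lam) (hk : k * σ < α + β) (hk3 : k ≤ 3) {m : ℕ} (hm : m ≤ k) (z : F) :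
    IntegrableOn (fun t => Real.exp (-lam * t) • iteratedFDeriv ℝ m (v t) z) (Set.Ioi 0) := by
  have h1 : IntegrableOn (fun t => iteratedFDeriv ℝ m (fun z => Real.exp (-lam * t) * v t z) z)
      (Set.Ioi 0) := by
    refine ((integrableOn_smoothingWeight hα hσ hlam hk hm).const_mul L).mono'
      (aestronglyMeasurable_iteratedFDeriv_family (hv.contDiff_mul hk3) hv.measurable_mul hm z) ?_
    filter_upwards [ae_restrict_mem measurableSet_Ioi] with t ht
    exact hv.norm_deriv_mul_le ht (hm.trans hk3) z
  exact h1.congr_fun (fun t ht => hv.iteratedFDeriv_mul ht (hm.trans hk3) z) measurableSet_Ioi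

theorem norm_iteratedFDeriv_integral_le (hv : IsSmoothing α β σ L v) (hα : 0 < α) (hσ : 1 ≤ σ)
    (hlam : 0 < lam) (hk : k * σ < α + β) (hk3 : k ≤ 3) {m : ℕ} (hm : m ≤ k) (z : F) :
    ‖iteratedFDeriv ℝ m (fun z => ∫ t in Set.Ioi (0 : ℝ), Real.exp (-lam * t) * v t z) z‖
      ≤ L * ∫ t in Set.Ioi (0 : ℝ), smoothingWeight α β σ lam m t := by
  rw [iteratedFDeriv_integral_of_dominated k (hv.contDiff_mul hk3) hv.measurable_mul
    (hv.dominated hα hσ hlam hk hk3) hm z, ← integral_const_mul]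
  refine norm_integral_le_of_norm_le
    ((integrableOn_smoothingWeight hα hσ hlam hk hm).const_mul L) ?_
  filter_upwards [ae_restrict_mem measurableSet_Ioi] with t ht
  exact hv.norm_deriv_mul_le ht (hm.trans hk3) z

theorem norm_sub_iteratedFDeriv_le (hv : IsSmoothing α β σ L v) {t : ℝ} (ht : 0 < t) {m : ℕ}
    (hm : m + 1 ≤ 3) (x y : F) :
    ‖iteratedFDeriv ℝ m (v t) x - iteratedFDeriv ℝ m (v t) y‖
      ≤ L * (t ^ ((β - (m + 1 : ℕ) * σ) / α) + 1) * ‖x - y‖ := by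
  refine Convex.norm_image_sub_le_of_norm_fderiv_le (𝕜 := ℝ) (s := Set.univ) (fun z _ => ?_)
    (fun z _ => ?_) convex_univ trivial trivial
  · exact ((hv.contDiff t ht).differentiable_iteratedFDeriv
      (by exact_mod_cast (by omega : m < 3))).differentiableAt
  · rw [norm_fderiv_iteratedFDeriv]
    exact hv.norm_deriv_le t ht _ hm z

theorem norm_second_sub_iteratedFDeriv_le (hv : IsSmoothing α β σ L v) {t : ℝ} (ht : 0 < t) {m : ℕ}
    (hm : m + 2 ≤ 3) (x y : F) :
    ‖iteratedFDeriv ℝ m (v t) x + iteratedFDeriv ℝ m (v t) y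
        - (2 : ℝ) • iteratedFDeriv ℝ m (v t) (midpoint ℝ x y)‖
      ≤ L * (t ^ ((β - (m + 2 : ℕ) * σ) / α) + 1) * ‖x - y‖ ^ 2 := by
  refine norm_second_difference_le ((hv.contDiff t ht).differentiable_iteratedFDeriv
      (by exact_mod_cast (by omega : m < 3))) (fun x y => ?_) x y
  rw [fderiv_iteratedFDeriv, Function.comp_apply, Function.comp_apply, ← dist_eq_norm,
    LinearIsometryEquiv.dist_map, dist_eq_norm]
  exact hv.norm_sub_iteratedFDeriv_le ht (m := m + 1) hm x y

/-- The constant of the difference estimates. -/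
def _root_.LevyOU.differenceConst (α β σ lam : ℝ) (k j : ℕ) : ℝ :=
  8 / ((β - k * σ) / α + 1) + 2 + 4 / (-((β - (k + j) * σ) / α + 1)) + 1 / lam

/-- Only derivatives up to order k pass through the time integral. The order k + 1 is used under the
integral, for times above the cut; k ≤ 2 keeps it within the three available derivatives. -/
theorem norm_first_difference_le (hv : IsSmoothing α β σ L v) (hα : 0 < α) (hβ : 0 < β)
    (hβ1 : β < 1) (hσ : 1 ≤ σ) (hlam : 0 < lam) (hL : 0 ≤ L) (hk : k < (α + β) / σ)
    (hk1 : (α + β) / σ < k + 1) (hk3 : k ≤ 2) {x y : F} (hxy : x ≠ y) (h1 : ‖x - y‖ < 1) :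
    ‖iteratedFDeriv ℝ k (fun z => ∫ t in Set.Ioi (0 : ℝ), Real.exp (-lam * t) * v t z) x
      - iteratedFDeriv ℝ k (fun z => ∫ t in Set.Ioi (0 : ℝ), Real.exp (-lam * t) * v t z) y‖
      ≤ differenceConst α β σ lam k 1 * L * ‖x - y‖ ^ ((α + β) / σ - k) := by
  have hkσ : k * σ < α + β := by rwa [lt_div_iff₀ (by linarith)] at hk
  have h0 : 0 < ‖x - y‖ := norm_pos_iff.2 (sub_ne_zero.2 hxy)
  have hh : (‖x - y‖ / 2) ^ (α / σ) ≤ ‖x - y‖ ^ (α / σ) :=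
    Real.rpow_le_rpow (by positivity) (by linarith) (by positivity)
  rw [hv.iteratedFDeriv_integral hα hσ hlam hkσ (by omega) le_rfl,
    hv.iteratedFDeriv_integral hα hσ hlam hkσ (by omega) le_rfl, ← integral_sub
      (hv.integrableOn_iteratedFDeriv hα hσ hlam hkσ (by omega) le_rfl x)
      (hv.integrableOn_iteratedFDeriv hα hσ hlam hkσ (by omega) le_rfl y)]
  simp_rw [← smul_sub]
  refine norm_integral_exp_smul_le_rpow hα hβ hβ1 hσ hlam hL hk (by exact_mod_cast hk1) (by norm_num)
    h0 h1 (fun _ t ht => ?_) (fun hk0 t ht => ?_) (fun t ht => ?_)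
  · have hx := hv.norm_deriv_le t ht.1 k (by omega) x
    have hy := hv.norm_deriv_le t ht.1 k (by omega) y
    have := norm_nonneg (iteratedFDeriv ℝ k (v t) x)
    linarith [norm_sub_le (iteratedFDeriv ℝ k (v t) x) (iteratedFDeriv ℝ k (v t) y)]
  · subst hk0
    have h2 := hv.abs_sub_le t x y h1.le ht.1 (ht.2.trans hh)
    have h3 : ‖iteratedFDeriv ℝ 0 (v t) x - iteratedFDeriv ℝ 0 (v t) y‖ = |v t x - v t y| := by
      rw [iteratedFDeriv_zero_eq_comp, Function.comp_apply, Function.comp_apply, ← map_sub,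
        LinearIsometryEquiv.norm_map, Real.norm_eq_abs]
    rw [h3]
    have : 0 ≤ L * ‖x - y‖ ^ (β / σ) := by positivity
    linarith
  · refine (hv.norm_sub_iteratedFDeriv_le ht (by omega) x y).trans (le_of_eq ?_)
    push_cast
    ring

/-- At an integer order the derivative of order k + 1 gives t^{-1} on both sides of the cut, hence a
logarithm; second differences gain one more order for the large times. The bound k ≤ 1 keeps k + 2
within the three available derivatives. -/
theorem norm_zygmund_difference_le (hv : IsSmoothing α β σ L v) (hα : 0 < α) (hβ : 0 < β)
    (hβ1 : β < 1) (hσ : 1 ≤ σ) (hlam : 0 < lam) (hL : 0 ≤ L) (hk : k < (α + β) / σ)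
    (hk1 : (α + β) / σ < k + 2) (hk3 : k ≤ 1) {x y : F} (hxy : x ≠ y) (h1 : ‖x - y‖ < 1) :
    ‖iteratedFDeriv ℝ k (fun z => ∫ t in Set.Ioi (0 : ℝ), Real.exp (-lam * t) * v t z) x
      + iteratedFDeriv ℝ k (fun z => ∫ t in Set.Ioi (0 : ℝ), Real.exp (-lam * t) * v t z) y
      - (2 : ℝ) • iteratedFDeriv ℝ k
        (fun z => ∫ t in Set.Ioi (0 : ℝ), Real.exp (-lam * t) * v t z) (midpoint ℝ x y)‖
      ≤ differenceConst α β σ lam k 2 * L * ‖x - y‖ ^ ((α + β) / σ - k) := by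
  have hkσ : k * σ < α + β := by rwa [lt_div_iff₀ (by linarith)] at hk
  have h0 : 0 < ‖x - y‖ := norm_pos_iff.2 (sub_ne_zero.2 hxy)
  have hint : ∀ z, Integrable (fun t => Real.exp (-lam * t) • iteratedFDeriv ℝ k (v t) z)
      (volume.restrict (Set.Ioi 0)) :=
    hv.integrableOn_iteratedFDeriv hα hσ hlam hkσ (by omega) le_rfl
  rw [hv.iteratedFDeriv_integral hα hσ hlam hkσ (by omega) le_rfl,
    hv.iteratedFDeriv_integral hα hσ hlam hkσ (by omega) le_rfl,
    hv.iteratedFDeriv_integral hα hσ hlam hkσ (by omega) le_rfl,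
    integral_add_sub_two_smul (hint x) (hint y) (hint (midpoint ℝ x y))]
  have he : ∀ t, Real.exp (-lam * t) • iteratedFDeriv ℝ k (v t) x
      + Real.exp (-lam * t) • iteratedFDeriv ℝ k (v t) y
      - (2 : ℝ) • Real.exp (-lam * t) • iteratedFDeriv ℝ k (v t) (midpoint ℝ x y)
      = Real.exp (-lam * t) • (iteratedFDeriv ℝ k (v t) x + iteratedFDeriv ℝ k (v t) y
        - (2 : ℝ) • iteratedFDeriv ℝ k (v t) (midpoint ℝ x y)) := fun t => by
    rw [smul_sub, smul_add, smul_comm]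
  simp_rw [he]
  refine norm_integral_exp_smul_le_rpow hα hβ hβ1 hσ hlam hL hk (by exact_mod_cast hk1) le_rfl
    h0 h1 (fun _ t ht => ?_) (fun hk0 t ht => ?_) (fun t ht => ?_)
  · have hx := hv.norm_deriv_le t ht.1 k (by omega) x
    have hy := hv.norm_deriv_le t ht.1 k (by omega) y
    have hm := hv.norm_deriv_le t ht.1 k (by omega) (midpoint ℝ x y)
    refine (norm_sub_le _ _).trans ?_
    rw [norm_smul, Real.norm_of_nonneg (by norm_num)]
    linarith [norm_add_le (iteratedFDeriv ℝ k (v t) x) (iteratedFDeriv ℝ k (v t) y)]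
  · subst hk0
    have hmx : ‖x - midpoint ℝ x y‖ = ‖x - y‖ / 2 := by
      rw [← dist_eq_norm, dist_left_midpoint, dist_eq_norm]; norm_num; ring
    have hmy : ‖y - midpoint ℝ x y‖ = ‖x - y‖ / 2 := by
      rw [← dist_eq_norm, dist_right_midpoint, dist_eq_norm]; norm_num; ring
    have hx := hv.abs_sub_le t x (midpoint ℝ x y) (by rw [hmx]; linarith) ht.1 (by rw [hmx]; exact ht.2)
    have hy := hv.abs_sub_le t y (midpoint ℝ x y) (by rw [hmy]; linarith) ht.1 (by rw [hmy]; exact ht.2)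
    rw [hmx] at hx
    rw [hmy] at hy
    have h3 : ‖iteratedFDeriv ℝ 0 (v t) x + iteratedFDeriv ℝ 0 (v t) y
        - (2 : ℝ) • iteratedFDeriv ℝ 0 (v t) (midpoint ℝ x y)‖
        = |(v t x - v t (midpoint ℝ x y)) + (v t y - v t (midpoint ℝ x y))| := by
      rw [iteratedFDeriv_zero_eq_comp, Function.comp_apply, Function.comp_apply,
        Function.comp_apply, ← map_smul, ← map_add, ← map_sub,
        LinearIsometryEquiv.norm_map, Real.norm_eq_abs, smul_eq_mul]
      congr 1
      ring
    have h4 : (‖x - y‖ / 2) ^ (β / σ) ≤ ‖x - y‖ ^ (β / σ) :=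
      Real.rpow_le_rpow (by positivity) (by linarith) (by positivity)
    have h5 := mul_le_mul_of_nonneg_left h4 hL
    rw [h3]
    refine (abs_add_le _ _).trans ?_
    linarith
  · refine (hv.norm_second_sub_iteratedFDeriv_le ht (by omega) x y).trans (le_of_eq ?_)
    push_cast
    ring

end IsSmoothing

/-- Differences need to be estimated only at distance less than 1. At larger distance the sup bound
of the top derivative is enough; the factor 4 = 1 + 1 + 2 is that of a second difference. -/
theorem zygmundNorm_le {γ r c₁ c₂ : ℝ} (hγ : 0 < γ) {u : F → ℝ} {S : ℕ → ℝ} {k : ℕ}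
    (hk : intPart γ = k) (hS0 : ∀ m, 0 ≤ S m) (hr : 0 ≤ r) (hSr : 4 * S k ≤ r) (hc₁ : c₁ ≤ r)
    (hc₂ : c₂ ≤ r) (hS : ∀ m ≤ k, ∀ z, ‖iteratedFDeriv ℝ m u z‖ ≤ S m)
    (h1st : γ < k + 1 → ∀ x y, x ≠ y → ‖x - y‖ < 1 →
      ‖iteratedFDeriv ℝ k u x - iteratedFDeriv ℝ k u y‖ ≤ c₁ * ‖x - y‖ ^ (γ - k))
    (h2nd : γ = k + 1 → ∀ x y, x ≠ y → ‖x - y‖ < 1 →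
      ‖iteratedFDeriv ℝ k u x + iteratedFDeriv ℝ k u y
        - (2 : ℝ) • iteratedFDeriv ℝ k u (midpoint ℝ x y)‖ ≤ c₂ * ‖x - y‖ ^ (γ - k)) :
    zygmundNorm γ u ≤ ENNReal.ofReal (∑ m ∈ Finset.range (k + 1), S m + r) := by
  subst hk
  obtain ⟨hk1, hk2⟩ := intPart_lt hγ
  have hθk : fracPart γ = γ - intPart γ := rfl
  have hSk := hS _ le_rfl
  rw [ENNReal.ofReal_add (Finset.sum_nonneg fun m _ => hS0 m) hr,
    ENNReal.ofReal_sum_of_nonneg (fun m _ => hS0 m)]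
  refine add_le_add (Finset.sum_le_sum fun m hm => iSup_le fun z => ?_)
    (zygmundSeminorm_le hr (by linarith) (fun h x y hxy => ?_) (fun h x y hxy => ?_))
  · rw [enorm_le_ofReal_iff (hS0 m)]
    exact hS m (by have := Finset.mem_range.1 hm; omega) z
  · rw [hθk] at h
    rcases lt_or_ge ‖x - y‖ 1 with h1 | h1
    · have h2 := h2nd (by linarith) x y hxy h1
      rw [h, Real.rpow_one] at h2
      exact h2.trans (mul_le_mul_of_nonneg_right hc₂ (norm_nonneg _))
    · refine (norm_sub_le _ _).trans ?_
      rw [norm_smul, Real.norm_of_nonneg (by norm_num)]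
      have := norm_add_le (iteratedFDeriv ℝ (intPart γ) u x) (iteratedFDeriv ℝ (intPart γ) u y)
      have h5 : r ≤ r * ‖x - y‖ := le_mul_of_one_le_right hr h1
      linarith [hSk x, hSk y, hSk (midpoint ℝ x y)]
  · have h' : γ < intPart γ + 1 := by
      rw [hθk] at h
      exact lt_of_le_of_ne hk2 fun h2 => h (by linarith)
    rw [hθk]
    rcases lt_or_ge ‖x - y‖ 1 with h1 | h1
    · exact (h1st h' x y hxy h1).trans
        (mul_le_mul_of_nonneg_right hc₁ (Real.rpow_nonneg (norm_nonneg _) _))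
    · refine (norm_sub_le _ _).trans ?_
      have h6 : 1 ≤ ‖x - y‖ ^ (γ - intPart γ) := Real.one_le_rpow h1 (by linarith)
      have h5 : r ≤ r * ‖x - y‖ ^ (γ - intPart γ) := le_mul_of_one_le_right hr h6
      linarith [hSk x, hSk y, hS0 (intPart γ)]

/-- The constant of the Schauder estimate for the resolvent. -/
def resolventConst (α β σ lam : ℝ) (k : ℕ) : ℝ :=
  ∑ m ∈ Finset.range (k + 1), (∫ t in Set.Ioi 0, smoothingWeight α β σ lam m t)
    + (4 * (∫ t in Set.Ioi 0, smoothingWeight α β σ lam k t)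
      + |differenceConst α β σ lam k 1| + |differenceConst α β σ lam k 2|)

theorem resolventConst_nonneg (α β σ lam : ℝ) (k : ℕ) : 0 ≤ resolventConst α β σ lam k := by
  have hI0 : ∀ m, 0 ≤ ∫ t in Set.Ioi 0, smoothingWeight α β σ lam m t := fun m =>
    setIntegral_nonneg measurableSet_Ioi fun t ht => smoothingWeight_nonneg α β σ lam m ht
  have h1 := Finset.sum_nonneg fun m (_ : m ∈ Finset.range (k + 1)) => hI0 m
  have h2 := hI0 k
  have h3 := abs_nonneg (differenceConst α β σ lam k 1)
  have h4 := abs_nonneg (differenceConst α β σ lam k 2)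
  unfold resolventConst
  linarith

end Resolvent

section Resolvent

variable {F : Type*} [NormedAddCommGroup F] [NormedSpace ℝ F]
  {α β σ lam L : ℝ} {v : ℝ → F → ℝ} {k : ℕ}

/-- Schauder estimate for the resolvent of a family of functions with parabolic smoothing. -/
theorem IsSmoothing.zygmundNorm_integral_le [FiniteDimensional ℝ F] (hv : IsSmoothing α β σ L v)
    (hα : 0 < α) (hα2 : α < 2) (hβ : 0 < β) (hβ1 : β < 1) (hσ : 1 ≤ σ) (hlam : 0 < lam)
    (hL : 0 ≤ L) (hk : intPart ((α + β) / σ) = k) :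
    ContDiff ℝ k (fun z => ∫ t in Set.Ioi (0 : ℝ), Real.exp (-lam * t) * v t z) ∧
      zygmundNorm ((α + β) / σ) (fun z => ∫ t in Set.Ioi (0 : ℝ), Real.exp (-lam * t) * v t z)
        ≤ ENNReal.ofReal (resolventConst α β σ lam k * L) := by
  have hσ0 : 0 < σ := by linarith
  have hγ : 0 < (α + β) / σ := by positivity
  -- Since α < 2, β < 1 and σ ≥ 1, the order stays below 3. This is why three derivatives of the
  -- semigroup suffice.
  have hγ3 : (α + β) / σ < 3 := by rw [div_lt_iff₀ hσ0]; linarith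
  obtain ⟨hk1, hk2⟩ := intPart_lt hγ
  rw [hk] at hk1 hk2
  have hk3 : k ≤ 2 := by
    have : (k : ℝ) < 3 := by linarith
    have : k < 3 := by exact_mod_cast this
    omega
  have hkσ : k * σ < α + β := by rwa [lt_div_iff₀ hσ0] at hk1
  refine ⟨hv.contDiff_integral hα hσ hlam hkσ (by omega), ?_⟩
  let I : ℕ → ℝ := fun m => ∫ t in Set.Ioi 0, smoothingWeight α β σ lam m t
  have hI0 : ∀ m, 0 ≤ I m := fun m => setIntegral_nonneg measurableSet_Ioi
    fun t ht => smoothingWeight_nonneg α β σ lam m ht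
  have hIk := hI0 k
  let c : ℕ → ℝ := differenceConst α β σ lam k
  have hc1 := abs_nonneg (c 1)
  have hc2 := abs_nonneg (c 2)
  have hS : ∀ m ≤ k, ∀ z : F, ‖iteratedFDeriv ℝ m
      (fun z => ∫ t in Set.Ioi (0 : ℝ), Real.exp (-lam * t) * v t z) z‖ ≤ L * I m :=
    fun m hm z => hv.norm_iteratedFDeriv_integral_le (lam := lam) hα hσ hlam hkσ (by omega) hm z
  have key := zygmundNorm_le (r := (4 * I k + |c 1| + |c 2|) * L) (c₁ := c 1 * L) (c₂ := c 2 * L)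
    (S := fun m => L * I m) hγ hk (fun m => mul_nonneg hL (hI0 m)) (mul_nonneg (by linarith) hL)
    (by
      have := mul_nonneg hc1 hL
      have := mul_nonneg hc2 hL
      linarith)
    (mul_le_mul_of_nonneg_right (by linarith [le_abs_self (c 1)]) hL)
    (mul_le_mul_of_nonneg_right (by linarith [le_abs_self (c 2)]) hL)
    hS
    (fun h x y hxy h1 => hv.norm_first_difference_le hα hβ hβ1 hσ hlam hL hk1 h hk3 hxy h1)
    (fun h x y hxy h1 => hv.norm_zygmund_difference_le hα hβ hβ1 hσ hlam hL hk1 (by linarith)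
      (by
        have : (k : ℝ) < 2 := by linarith
        have : k < 2 := by exact_mod_cast this
        omega) hxy h1)
  refine key.trans (ENNReal.ofReal_le_ofReal (le_of_eq ?_))
  rw [← Finset.mul_sum]
  unfold resolventConst
  ring

end Resolvent

/-! ### Anisotropic Hölder functions along the flow -/

section AnisoHolder

variable {E : Type*} [NormedAddCommGroup E] [InnerProductSpace ℝ E] [FiniteDimensional ℝ E]
variable {U : Type*} [NormedAddCommGroup U] [InnerProductSpace ℝ U]
variable (A : E →L[ℝ] E) (B : U →L[ℝ] E) (n : ℕ)

/-- Bounded functions that are Hölder continuous of order `β / (1 + α i)` along the `i`-th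
stratum. -/
structure IsAnisoHolder (α β K : ℝ) (g : E → ℝ) : Prop where
  bounded : ∀ x, |g x| ≤ K
  holder : ∀ i < n, ∀ v ∈ stratum A B i, ∀ x, |g (x + v) - g x| ≤ K * ‖v‖ ^ (β / (1 + α * i))

variable {A B n} {α β K : ℝ} {g : E → ℝ}

namespace IsAnisoHolder

theorem nonneg (hg : IsAnisoHolder A B n α β K g) : 0 ≤ K := (abs_nonneg _).trans (hg.bounded 0)

/-- The components of v are added one stratum at a time, each step being a displacement along a
single stratum. -/
theorem abs_sub_le (hg : IsAnisoHolder A B n α β K g) (hn : reachSpace A B n = ⊤) (x v : E) :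
    |g (x + v) - g x| ≤ K * ∑ i ∈ Finset.range n, ‖layerProj A B i v‖ ^ (β / (1 + α * i)) := by
  have key : ∀ m ≤ n, |g (x + ∑ i ∈ Finset.range m, layerProj A B i v) - g x|
      ≤ K * ∑ i ∈ Finset.range m, ‖layerProj A B i v‖ ^ (β / (1 + α * i)) := by
    intro m
    induction m with
    | zero => simp
    | succ m ih =>
      intro hm
      rw [Finset.sum_range_succ, Finset.sum_range_succ, mul_add, ← add_assoc]
      have h1 := hg.holder m (by omega) _ (layerProj_mem A B m v)
        (x + ∑ i ∈ Finset.range m, layerProj A B i v)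
      have h2 := ih (by omega)
      have h3 := _root_.abs_sub_le (g (x + ∑ i ∈ Finset.range m, layerProj A B i v + layerProj A B m v))
        (g (x + ∑ i ∈ Finset.range m, layerProj A B i v)) (g x)
      linarith
  have := key n le_rfl
  rwa [sum_layerProj A B hn] at this

theorem tendsto_modulus (hα : 0 < α) (hβ : 0 < β) : Tendsto
    (fun v => K * ∑ i ∈ Finset.range n, ‖layerProj A B i v‖ ^ (β / (1 + α * i))) (𝓝 0) (𝓝 0) := by
  have hc : Continuous
      (fun v => K * ∑ i ∈ Finset.range n, ‖layerProj A B i v‖ ^ (β / (1 + α * i))) := by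
    refine continuous_const.mul (continuous_finsetSum _ fun i _ => ?_)
    exact (layerProj A B i).continuous.norm.rpow_const fun v => Or.inr (by positivity)
  have h0 : K * ∑ i ∈ Finset.range n, ‖layerProj A B i 0‖ ^ (β / (1 + α * i)) = 0 := by
    rw [Finset.sum_eq_zero, mul_zero]
    intro i _
    rw [map_zero, norm_zero, Real.zero_rpow (by positivity)]
  have := hc.tendsto 0
  rwa [h0] at this

theorem uniformContinuous (hg : IsAnisoHolder A B n α β K g) (hn : reachSpace A B n = ⊤)
    (hα : 0 < α) (hβ : 0 < β) : UniformContinuous g := by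
  rw [Metric.uniformContinuous_iff]
  intro ε hε
  obtain ⟨δ, hδ, h⟩ := Metric.tendsto_nhds_nhds.1
    (tendsto_modulus (A := A) (B := B) (n := n) (K := K) hα hβ) ε hε
  refine ⟨δ, hδ, fun {x y} hxy => ?_⟩
  have h1 := h (x := x - y) (by rwa [dist_zero_right, ← dist_eq_norm])
  rw [dist_zero_right] at h1
  have h2 := hg.abs_sub_le hn y (x - y)
  rw [add_sub_cancel] at h2
  rw [Real.dist_eq]
  exact h2.trans_lt ((le_abs_self _).trans_lt h1)

theorem continuous (hg : IsAnisoHolder A B n α β K g) (hn : reachSpace A B n = ⊤)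
    (hα : 0 < α) (hβ : 0 < β) : Continuous g := (hg.uniformContinuous hn hα hβ).continuous

end IsAnisoHolder

variable (A B n)

/-- The flow moves the `l`-th stratum into the `j`-th one at order `t ^ (j - l)`. -/
theorem exists_norm_layerProj_flow_le : ∃ C : ℝ, 1 ≤ C ∧ ∀ t ∈ Set.Icc (0 : ℝ) 1, ∀ l,
    ∀ j < n, ∀ v ∈ reachSpace A B (l + 1), ‖layerProj A B j (flow A t v)‖ ≤ C * t ^ (j - l) * ‖v‖ := by
  have h1 : ∀ k : ℕ, ∃ M : ℝ, ∀ t ∈ Set.Icc (0 : ℝ) 1, ‖A ^ k * expRemainder A k t‖ ≤ M := fun k =>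
    isCompact_Icc.exists_bound_of_continuousOn
      (continuous_const.mul (continuous_expRemainder A k)).continuousOn
  choose M hM using h1
  have hM0 : ∀ k, 0 ≤ M k := fun k => (norm_nonneg _).trans (hM k 0 (by simp))
  refine ⟨1 + 2 * ∑ k ∈ Finset.range n, M k, by
    have := Finset.sum_nonneg fun k (_ : k ∈ Finset.range n) => hM0 k
    linarith, fun t ht l j hj v hv => ?_⟩
  rw [layerProj_flow A B hv, norm_smul, Real.norm_of_nonneg (pow_nonneg ht.1 _)]
  have h2 : ‖layerProj A B j ((A ^ (j - l)) (expRemainder A (j - l) t v))‖ ≤ 2 * (M (j - l) * ‖v‖) := by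
    refine (norm_layerProj_le A B j _).trans ?_
    gcongr
    exact (A ^ (j - l) * expRemainder A (j - l) t).le_of_opNorm_le (hM _ t ht) v
  have h3 : M (j - l) ≤ ∑ k ∈ Finset.range n, M k :=
    Finset.single_le_sum (fun k _ => hM0 k) (Finset.mem_range.2 (by omega))
  have h4 := pow_nonneg ht.1 (j - l)
  have h5 := norm_nonneg v
  calc t ^ (j - l) * _ ≤ t ^ (j - l) * (2 * (M (j - l) * ‖v‖)) := by gcongr
    _ ≤ t ^ (j - l) * (2 * ((∑ k ∈ Finset.range n, M k) * ‖v‖)) := by gcongr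
    _ ≤ (1 + 2 * ∑ k ∈ Finset.range n, M k) * t ^ (j - l) * ‖v‖ := by
      have : 0 ≤ t ^ (j - l) * ‖v‖ := by positivity
      linarith

theorem mul_rpow_le {c x θ : ℝ} (hc : 1 ≤ c) (hx : 0 ≤ x) (hθ : 0 ≤ θ) (hθ1 : θ ≤ 1) :
    (c * x) ^ θ ≤ c * (1 + x) := by
  have hcx : 0 ≤ c * x := by positivity
  rcases le_total (c * x) 1 with h | h
  · have := Real.rpow_le_one hcx h hθ
    nlinarith
  · calc (c * x) ^ θ ≤ (c * x) ^ (1 : ℝ) := Real.rpow_le_rpow_of_exponent_le h hθ1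
      _ ≤ _ := by rw [Real.rpow_one]; linarith

/-- Oscillation of an anisotropic Hölder function along the dilated flow. -/
theorem exists_abs_sub_flow_dilation_le (hn : reachSpace A B n = ⊤) (hα : 0 < α) (hβ : 0 < β)
    (hβ1 : β < 1) : ∃ C : ℝ, 0 ≤ C ∧ ∀ (K : ℝ) (g : E → ℝ), IsAnisoHolder A B n α β K g →
    ∀ t ∈ Set.Ioc (0 : ℝ) 1, ∀ y w : E,
      |g (y + flow A t (t ^ (1 / α) • dilation A B n t w)) - g y|
        ≤ K * C * t ^ (β / α) * (1 + ‖w‖) := by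
  obtain ⟨C, hC1, hC⟩ := exists_norm_layerProj_flow_le A B n
  set D : ℝ := 1 + 2 * n * C with hD
  have hD1 : 1 ≤ D := by
    have : (0 : ℝ) ≤ 2 * n * C := by positivity
    linarith
  refine ⟨n * D, by positivity, fun K g hg t ht y w => (hg.abs_sub_le hn y _).trans ?_⟩
  have hK := hg.nonneg
  rw [mul_assoc, mul_assoc]
  refine mul_le_mul_of_nonneg_left ?_ hK
  have hterm : ∀ j ∈ Finset.range n,
      ‖layerProj A B j (flow A t (t ^ (1 / α) • dilation A B n t w))‖ ^ (β / (1 + α * j))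
        ≤ D * (t ^ (β / α) * (1 + ‖w‖)) := by
    intro j hj
    have hj' := Finset.mem_range.1 hj
    have hpos : 0 < 1 + α * j := by positivity
    -- The component of index l contributes t^{1/α} t^l from the dilation and t^{j-l} from the flow.
    -- With truncated subtraction l + (j-l) ≥ j, so every l gives at most t^{(1+αj)/α}; the Hölder
    -- exponent β/(1+αj) then turns this into t^{β/α}.
    have h1 : ‖layerProj A B j (flow A t (t ^ (1 / α) • dilation A B n t w))‖
        ≤ (D * ‖w‖) * t ^ ((1 + α * j) / α) := by
      rw [map_smul, map_smul, norm_smul, Real.norm_of_nonneg (Real.rpow_nonneg ht.1.le _),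
        dilation_apply, map_sum, map_sum]
      have h2 : ∀ l ∈ Finset.range n, ‖layerProj A B j (flow A t (t ^ l • layerProj A B l w))‖
          ≤ 2 * C * ‖w‖ * t ^ j := by
        intro l _
        rw [map_smul, map_smul, norm_smul, Real.norm_of_nonneg (pow_nonneg ht.1.le _)]
        have h3 := hC t ⟨ht.1.le, ht.2⟩ l j hj' _ (layerProj_mem A B l w).2
        have h4 := norm_layerProj_le A B l w
        have ht0 := ht.1.le
        calc t ^ l * _ ≤ t ^ l * (C * t ^ (j - l) * (2 * ‖w‖)) := by
              gcongr
              exact h3.trans (by gcongr)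
          _ = 2 * C * ‖w‖ * t ^ (l + (j - l)) := by rw [pow_add]; ring
          _ ≤ 2 * C * ‖w‖ * t ^ j := by
              refine mul_le_mul_of_nonneg_left ?_ (by positivity)
              exact pow_le_pow_of_le_one ht0 ht.2 (by omega)
      have h5 : t ^ ((1 + α * j) / α) = t ^ (1 / α) * t ^ j := by
        rw [add_div, mul_div_cancel_left₀ _ hα.ne', Real.rpow_add ht.1, Real.rpow_natCast]
      have h6 := Real.rpow_nonneg ht.1.le (1 / α)
      have h7 := pow_nonneg ht.1.le j
      calc t ^ (1 / α) * _ ≤ t ^ (1 / α) * ∑ l ∈ Finset.range n, 2 * C * ‖w‖ * t ^ j := by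
            gcongr
            exact (norm_sum_le _ _).trans (Finset.sum_le_sum h2)
        _ = (2 * n * C * ‖w‖) * (t ^ (1 / α) * t ^ j) := by
            rw [Finset.sum_const, Finset.card_range, nsmul_eq_mul]; ring
        _ ≤ (D * ‖w‖) * (t ^ (1 / α) * t ^ j) := by
            gcongr
            linarith
        _ = _ := by rw [h5]
    calc _ ≤ ((D * ‖w‖) * t ^ ((1 + α * j) / α)) ^ (β / (1 + α * j)) :=
          Real.rpow_le_rpow (norm_nonneg _) h1 (by positivity)
      _ = (D * ‖w‖) ^ (β / (1 + α * j)) * t ^ (β / α) := by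
          rw [Real.mul_rpow (by positivity) (Real.rpow_nonneg ht.1.le _), ← Real.rpow_mul ht.1.le]
          congr 2
          field_simp
      _ ≤ D * (1 + ‖w‖) * t ^ (β / α) := by
          refine mul_le_mul_of_nonneg_right (mul_rpow_le hD1 (norm_nonneg _) (by positivity) ?_)
            (Real.rpow_nonneg ht.1.le _)
          rw [div_le_one hpos]
          have : 0 ≤ α * j := by positivity
          linarith
      _ = _ := by ring
  refine (Finset.sum_le_sum hterm).trans (le_of_eq ?_)
  rw [Finset.sum_const, Finset.card_range, nsmul_eq_mul]
  ring

/-- Oscillation of an anisotropic Hölder function along the flow, for short times. -/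
theorem exists_abs_sub_flow_le (hn : reachSpace A B n = ⊤) (hα : 0 < α) (hβ : 0 < β)
    (hβ1 : β < 1) : ∃ C : ℝ, 0 ≤ C ∧ ∀ (K : ℝ) (g : E → ℝ), IsAnisoHolder A B n α β K g →
    ∀ i < n, ∀ z ∈ stratum A B i, ‖z‖ ≤ 1 → ∀ t, 0 < t → t ≤ ‖z‖ ^ (α / (1 + α * i)) → ∀ y : E,
      |g (y + flow A t z) - g y| ≤ K * C * ‖z‖ ^ (β / (1 + α * i)) := by
  obtain ⟨C, hC1, hC⟩ := exists_norm_layerProj_flow_le A B n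
  refine ⟨n * C, by positivity, fun K g hg i hi z hz hz1 t ht0 htz y => (hg.abs_sub_le hn y _).trans ?_⟩
  have hK := hg.nonneg
  rw [mul_assoc]
  refine mul_le_mul_of_nonneg_left ?_ hK
  have hσ : 0 < 1 + α * (i : ℝ) := by positivity
  have ht1 : t ≤ 1 := htz.trans (Real.rpow_le_one (norm_nonneg _) hz1 (by positivity))
  have hz0 : 0 < ‖z‖ := by
    by_contra h
    have h0 : ‖z‖ = 0 := le_antisymm (not_lt.1 h) (norm_nonneg _)
    rw [h0, Real.zero_rpow (by positivity)] at htz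
    linarith
  have hterm : ∀ j ∈ Finset.range n, ‖layerProj A B j (flow A t z)‖ ^ (β / (1 + α * j))
        ≤ C * ‖z‖ ^ (β / (1 + α * i)) := by
    intro j hj
    have hpos : 0 < 1 + α * (j : ℝ) := by positivity
    have h1 := hC t ⟨ht0.le, ht1⟩ i j (Finset.mem_range.1 hj) z hz.2
    have hθ1 : β / (1 + α * j) ≤ 1 := by
      rw [div_le_one hpos]
      have : 0 ≤ α * (j : ℝ) := by positivity
      linarith
    -- For j ≥ i the bound on t converts powers of time into powers of |z|; for j ≤ i no time is
    -- gained, but |z| ≤ 1 and the target exponent is at most 1. The Hölder exponent β/(1+αj) then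
    -- gives the same power of |z| for every j.
    have h2 : t ^ (j - i) * ‖z‖ ≤ ‖z‖ ^ ((1 + α * j) / (1 + α * i)) := by
      rcases le_total i j with hij | hij
      · calc t ^ (j - i) * ‖z‖ ≤ (‖z‖ ^ (α / (1 + α * i))) ^ (j - i) * ‖z‖ := by gcongr
          _ = ‖z‖ ^ (α / (1 + α * i) * (j - i : ℕ) + 1) := by
              rw [Real.rpow_add hz0, Real.rpow_one, Real.rpow_mul hz0.le, Real.rpow_natCast]
          _ = ‖z‖ ^ ((1 + α * j) / (1 + α * i)) := by
              congr 1
              rw [Nat.cast_sub hij]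
              field_simp
              ring
      · rw [Nat.sub_eq_zero_of_le hij, pow_zero, one_mul]
        calc ‖z‖ = ‖z‖ ^ (1 : ℝ) := (Real.rpow_one _).symm
          _ ≤ _ := by
              refine Real.rpow_le_rpow_of_exponent_ge hz0 hz1 ?_
              rw [div_le_one hσ]
              have : (j : ℝ) ≤ i := by exact_mod_cast hij
              nlinarith
    calc _ ≤ (C * ‖z‖ ^ ((1 + α * j) / (1 + α * i))) ^ (β / (1 + α * j)) := by
          refine Real.rpow_le_rpow (norm_nonneg _) (h1.trans ?_) (by positivity)
          rw [mul_assoc]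
          gcongr
      _ = C ^ (β / (1 + α * j)) * ‖z‖ ^ (β / (1 + α * i)) := by
          rw [Real.mul_rpow (by positivity) (Real.rpow_nonneg hz0.le _), ← Real.rpow_mul hz0.le]
          congr 2
          field_simp
      _ ≤ C * ‖z‖ ^ (β / (1 + α * i)) := by
          refine mul_le_mul_of_nonneg_right ?_ (Real.rpow_nonneg hz0.le _)
          calc C ^ (β / (1 + α * j)) ≤ C ^ (1 : ℝ) := Real.rpow_le_rpow_of_exponent_le hC1 hθ1
            _ = C := Real.rpow_one C
  refine (Finset.sum_le_sum hterm).trans (le_of_eq ?_)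
  rw [Finset.sum_const, Finset.card_range, nsmul_eq_mul]
  ring

end AnisoHolder

/-! ### The Ornstein–Uhlenbeck semigroup -/

section Semigroup

open scoped BoundedContinuousFunction

/-- The mass of a closed set is a limit of integrals of bounded continuous functions, and closed
sets form a π-system that generates the Borel sets. -/
theorem measurable_toMeasure_of_continuous {T X : Type*} [TopologicalSpace T] [MeasurableSpace T]
    [BorelSpace T] [MeasurableSpace X] [TopologicalSpace X] [HasOuterApproxClosed X]
    [BorelSpace X] {κ : T → ProbabilityMeasure X} (hκ : Continuous κ) :
    Measurable fun t => (κ t : Measure X) := by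
  refine Measurable.measure_of_isPiSystem_of_isProbabilityMeasure
    (S := {s | IsClosed s}) (by rw [BorelSpace.measurable_eq (α := X), borel_eq_generateFrom_isClosed])
    isPiSystem_isClosed fun s hs => ?_
  have hs' : IsClosed s := hs
  exact measurable_of_tendsto_metrizable
    (f := fun k t => ∫⁻ x, hs'.apprSeq k x ∂(κ t : Measure X))
    (fun k => ((ProbabilityMeasure.continuous_lintegral_boundedContinuousFunction _).comp
      hκ).measurable)
    (tendsto_pi_nhds.2 fun t => HasOuterApproxClosed.tendsto_lintegral_apprSeq hs' _)

theorem continuous_intervalIntegral_uncurry {X G : Type*} [TopologicalSpace X]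
    [FirstCountableTopology X] [NormedAddCommGroup G] [NormedSpace ℝ G]
    {F : ℝ → X → G} (hF : Continuous fun q : ℝ × X => F q.1 q.2) :
    Continuous fun q : ℝ × X => ∫ s in 0..q.1, F s q.2 := by
  have h : Continuous (Function.uncurry fun (q : ℝ × X) (s : ℝ) => F s q.2) :=
    hF.comp (continuous_snd.prodMk (continuous_snd.comp continuous_fst))
  exact intervalIntegral.continuous_parametric_intervalIntegral_of_continuous h continuous_fst

variable {E : Type*} [NormedAddCommGroup E] [InnerProductSpace ℝ E] [FiniteDimensional ℝ E]
  [MeasurableSpace E] [BorelSpace E]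
variable {U : Type*} [NormedAddCommGroup U] [InnerProductSpace ℝ U] [FiniteDimensional ℝ U]
  [MeasurableSpace U] [BorelSpace U]
variable {ι : Type*} [Fintype ι]
variable (A : E →L[ℝ] E) (B : U →L[ℝ] E) (b : U) (v : ι → U) (ν : Measure U)

open Classical in
/-- The law of `∫_0^t e^{-sA} B dZ_s`, extended by the Dirac measure at `0` to negative times. -/
def ouLaw (t : ℝ) : ProbabilityMeasure E :=
  if h : ∃ P : ProbabilityMeasure E,
      ∀ p, charFun (P : Measure E) p = Complex.exp (ouExponent A B b v ν (max t 0) p) then h.choose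
  else diracProba 0

/-- The Ornstein–Uhlenbeck semigroup. -/
def ouSemigroup (t : ℝ) (g : E → ℝ) (x : E) : ℝ :=
  ∫ y, g (flow A t (x + y)) ∂(ouLaw A B b v ν t : Measure E)

variable {ν} [SigmaFinite ν] (hν : Integrable (levyWeight id (Metric.ball 0 1)) ν)
include hν

theorem charFun_ouLaw (t : ℝ) (p : E) : charFun (ouLaw A B b v ν t : Measure E) p
    = Complex.exp (ouExponent A B b v ν (max t 0) p) := by
  obtain ⟨P, hP, hPc⟩ := isCharacteristic_ouExponent A B hν b v (le_max_right t 0)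
  have h : ∃ P : ProbabilityMeasure E, ∀ p, charFun (P : Measure E) p
      = Complex.exp (ouExponent A B b v ν (max t 0) p) := ⟨⟨P, hP⟩, hPc⟩
  rw [ouLaw, dif_pos h]
  exact h.choose_spec p

theorem continuous_ouExponent :
    Continuous fun q : ℝ × E => ouExponent A B b v ν q.1 q.2 := by
  have h : Continuous fun q : ℝ × E =>
      noiseExponent b v ν (ContinuousLinearMap.adjoint (flow A (-q.1) ∘L B) q.2) :=
    (continuous_noiseExponent b v hν).comp (continuous_adjoint_flow A B)
  exact continuous_intervalIntegral_uncurry (F := fun s p =>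
      noiseExponent b v ν (ContinuousLinearMap.adjoint (flow A (-s) ∘L B) p)) h

/-- Pointwise convergence of the characteristic functions gives weak convergence. Continuity in time
is what turns the laws into a kernel, as Fubini requires later. -/
theorem continuous_ouLaw : Continuous (ouLaw A B b v ν) := by
  refine continuous_iff_seqContinuous.2 fun t t₀ ht => ?_
  refine ProbabilityMeasure.tendsto_iff_tendsto_charFun.2 fun p => ?_
  simp only [Function.comp_apply, charFun_ouLaw A B b v hν]
  have h1 := continuous_ouExponent A B b v hν
  have h2 : Continuous fun t : ℝ => (max t 0, p) := by fun_prop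
  exact ((Complex.continuous_exp.comp (h1.comp h2)).tendsto t₀).comp ht

theorem measurable_ouLaw : Measurable fun t => (ouLaw A B b v ν t : Measure E) :=
  measurable_toMeasure_of_continuous (continuous_ouLaw A B b v hν)

omit hν in
theorem abs_ouSemigroup_le {g : E → ℝ} {K : ℝ} (hg : ∀ x, |g x| ≤ K) (t : ℝ) (x : E) :
    |ouSemigroup A B b v ν t g x| ≤ K := by
  have := norm_integral_le_of_norm_le_const (μ := (ouLaw A B b v ν t : Measure E))
    (f := fun y => g (flow A t (x + y))) (C := K) (Eventually.of_forall fun y => hg _)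
  simpa [ouSemigroup] using this

omit hν in
theorem integrable_ouLaw {g : E → ℝ} {K : ℝ} (hgm : Measurable g) (hg : ∀ x, |g x| ≤ K) (t : ℝ)
    (x : E) : Integrable (fun y => g (flow A t (x + y))) (ouLaw A B b v ν t : Measure E) := by
  refine Integrable.of_bound (C := K) ?_ (Eventually.of_forall fun y => hg _)
  exact (hgm.comp ((flow A t).continuous.measurable.comp
    (measurable_const.add measurable_id))).aestronglyMeasurable

theorem stronglyMeasurable_ouSemigroup {g : E → ℝ} (hgm : Measurable g) :
    StronglyMeasurable fun q : ℝ × E => ouSemigroup A B b v ν q.1 g q.2 := by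
  let κ : Kernel ℝ E := ⟨_, measurable_ouLaw A B b v hν⟩
  have : IsMarkovKernel κ := ⟨fun t => inferInstanceAs (IsProbabilityMeasure (ouLaw A B b v ν t : Measure E))⟩
  have h : Measurable fun r : (ℝ × E) × E => g (flow A r.1.1 (r.1.2 + r.2)) := by
    have hc : Continuous fun r : (ℝ × E) × E => flow A r.1.1 (r.1.2 + r.2) :=
      ((continuous_flow A).comp (continuous_fst.comp continuous_fst)).clm_apply
        ((continuous_snd.comp continuous_fst).add continuous_snd)
    exact hgm.comp hc.measurable
  exact StronglyMeasurable.integral_kernel_prod_right' (κ := κ.comap Prod.fst measurable_fst)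
    (h.stronglyMeasurable)

end Semigroup

/-! ### Smoothing of the semigroup along the strata -/

section Smoothing

variable {E : Type*} [NormedAddCommGroup E] [InnerProductSpace ℝ E] [FiniteDimensional ℝ E]
  [MeasurableSpace E] [BorelSpace E]

theorem norm_iteratedFDeriv_comp_add_le {F : Type*} [NormedAddCommGroup F] [NormedSpace ℝ F]
    {r : E → ℝ} {k : ℕ} (hr : ContDiff ℝ k r) (w : E) (J : F →L[ℝ] E) (z : F) {m : ℕ}
    (hm : m ≤ k) : ‖iteratedFDeriv ℝ m (fun z => r (w + J z)) z‖
      ≤ ‖iteratedFDeriv ℝ m r (w + J z)‖ * ‖J‖ ^ m := by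
  have h1 : ContDiff ℝ k fun e => r (w + e) := hr.comp (contDiff_const.add contDiff_id)
  have h2 := J.iteratedFDeriv_comp_right h1 z (i := m) (by exact_mod_cast hm)
  have h3 : (fun z => r (w + J z)) = (fun e => r (w + e)) ∘ J := rfl
  rw [h3, h2, iteratedFDeriv_comp_add_left]
  refine (ContinuousMultilinearMap.norm_compContinuousLinearMap_le _ _).trans ?_
  simp

theorem one_add_norm_le_mul (w e : E) : 1 + ‖w‖ ≤ (1 + ‖w + e‖) * (1 + ‖e‖) := by
  have h := norm_sub_le (w + e) e
  rw [add_sub_cancel_right] at h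
  nlinarith [norm_nonneg (w + e), norm_nonneg e, mul_nonneg (norm_nonneg (w + e)) (norm_nonneg e)]

/-- The constant of the smoothing by a density with `k` rapidly decreasing derivatives. -/
def decayIntegral (E : Type*) [NormedAddCommGroup E] [InnerProductSpace ℝ E]
    [FiniteDimensional ℝ E] [MeasurableSpace E] [BorelSpace E] : ℝ :=
  ∫ w : E, (1 + ‖w‖) ^ (-(Module.finrank ℝ E + 1 : ℝ))

theorem integrable_decay : Integrable fun w : E => (1 + ‖w‖) ^ (-(Module.finrank ℝ E + 1 : ℝ)) :=
  integrable_one_add_norm (by linarith)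

theorem decayIntegral_nonneg : 0 ≤ decayIntegral E :=
  integral_nonneg fun w => by positivity

variable {F : Type*} [NormedAddCommGroup F] [NormedSpace ℝ F] [FiniteDimensional ℝ F]

/-- A substitution moves the shift Jz from H to the density, so derivatives fall on r. A constant
H(J z₀) may be subtracted first, since it does not affect derivatives of positive order; therefore
only the oscillation of H enters the bound, and not its size. -/
theorem smoothing_of_density {r H : E → ℝ} {C L : ℝ} {k : ℕ} (hr : ContDiff ℝ (⊤ : ℕ∞) r)
    (hC : 0 ≤ C)
    (hrC : ∀ m ≤ k, ∀ w, (1 + ‖w‖) ^ (Module.finrank ℝ E + 2) * ‖iteratedFDeriv ℝ m r w‖ ≤ C)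
    (hH : Measurable H) (hL : 0 ≤ L)
    (hHL : ∀ w w', |H (w' + w) - H w'| ≤ L * (1 + ‖w‖)) (J : F →L[ℝ] E) :
    ContDiff ℝ k (fun z => ∫ w, H (w + J z) * r w) ∧ ∀ m ≤ k, 0 < m → ∀ z,
      ‖iteratedFDeriv ℝ m (fun z => ∫ w, H (w + J z) * r w) z‖
        ≤ ‖J‖ ^ m * L * C * decayIntegral E := by
  set D : ℝ := Module.finrank ℝ E + 1 with hD
  -- One power of 1 + |w| compensates the growth of the oscillation of H, and the other dim E + 1
  -- make the integral converge.
  set a : ℕ := Module.finrank ℝ E + 2 with ha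
  set V : F → ℝ := fun z => ∫ w, H (w + J z) * r w with hV
  have hrk : ContDiff ℝ k r := hr.of_le (by exact_mod_cast le_top)
  have hpow : ∀ w : E, (1 + ‖w‖) * ((1 + ‖w‖) ^ a)⁻¹ = (1 + ‖w‖) ^ (-D) := by
    intro w
    have h0 : 0 < 1 + ‖w‖ := by positivity
    have h1 : D = ((Module.finrank ℝ E + 1 : ℕ) : ℝ) := by rw [hD]; push_cast; ring
    rw [Real.rpow_neg h0.le, h1, Real.rpow_natCast, ha, pow_succ (1 + ‖w‖) (Module.finrank ℝ E + 1)]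
    field_simp
  -- H is frozen at the base point `z₀`, where the derivative is to be evaluated, and the variable z
  -- is an increment seen only by the density.
  let f : F → E → F → ℝ := fun z₀ w z => (H (w + J z₀) - H (J z₀)) * r (w + (-J) z)
  have hf : ∀ z₀ w, ContDiff ℝ k (f z₀ w) := fun z₀ w =>
    contDiff_const.mul (hrk.comp (contDiff_const.add (-J).contDiff))
  have hfm : ∀ z₀ z, AEStronglyMeasurable (fun w => f z₀ w z) volume := fun z₀ z =>
    (((hH.comp (measurable_add_const _)).sub_const _).mul
      (hr.continuous.measurable.comp (measurable_add_const _))).aestronglyMeasurable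
  have hB : ∀ z₀ w z, ∀ m ≤ k, ‖iteratedFDeriv ℝ m (f z₀ w) z‖
      ≤ ‖J‖ ^ m * L * C * (1 + ‖J z‖) ^ a * (1 + ‖w‖) ^ (-D) := by
    intro z₀ w z m hm
    have h1 : iteratedFDeriv ℝ m (f z₀ w) z = (H (w + J z₀) - H (J z₀)) •
        iteratedFDeriv ℝ m (fun z => r (w + (-J) z)) z := by
      have := iteratedFDeriv_const_smul_apply (𝕜 := ℝ) (i := m)
        (a := H (w + J z₀) - H (J z₀)) (f := fun z => r (w + (-J) z)) (x := z)
        (((hrk.comp (contDiff_const.add (-J).contDiff)).of_le (by exact_mod_cast hm)).contDiffAt)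
      exact this
    have h2 := norm_iteratedFDeriv_comp_add_le hrk w (-J) z hm
    have h3 : |H (w + J z₀) - H (J z₀)| ≤ L * (1 + ‖w‖) := by
      rw [add_comm w]
      exact hHL w (J z₀)
    set e := w + (-J) z with he
    have h4 : (1 + ‖w‖) ^ a ≤ (1 + ‖e‖) ^ a * (1 + ‖J z‖) ^ a := by
      rw [← mul_pow]
      refine pow_le_pow_left₀ (by positivity) ?_ a
      have := one_add_norm_le_mul w ((-J) z)
      rwa [neg_apply, norm_neg, ← neg_apply] at this
    have h5 : ‖iteratedFDeriv ℝ m r e‖ ≤ C * ((1 + ‖J z‖) ^ a * ((1 + ‖w‖) ^ a)⁻¹) := by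
      have h6 := hrC m hm e
      rw [← div_eq_mul_inv, ← mul_div_assoc, le_div_iff₀ (by positivity)]
      calc ‖iteratedFDeriv ℝ m r e‖ * (1 + ‖w‖) ^ a
          ≤ ‖iteratedFDeriv ℝ m r e‖ * ((1 + ‖e‖) ^ a * (1 + ‖J z‖) ^ a) := by gcongr
        _ = ((1 + ‖e‖) ^ a * ‖iteratedFDeriv ℝ m r e‖) * (1 + ‖J z‖) ^ a := by ring
        _ ≤ C * (1 + ‖J z‖) ^ a := by gcongr
    rw [h1, norm_smul, Real.norm_eq_abs]
    rw [norm_neg] at h2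
    calc |H (w + J z₀) - H (J z₀)| * ‖iteratedFDeriv ℝ m (fun z => r (w + (-J) z)) z‖
        ≤ (L * (1 + ‖w‖)) * ((C * ((1 + ‖J z‖) ^ a * ((1 + ‖w‖) ^ a)⁻¹)) * ‖J‖ ^ m) := by
          gcongr
          exact h2.trans (by gcongr)
      _ = ‖J‖ ^ m * L * C * (1 + ‖J z‖) ^ a * ((1 + ‖w‖) * ((1 + ‖w‖) ^ a)⁻¹) := by ring
      _ = _ := by rw [hpow]
  have hfi : ∀ z₀ z, Integrable fun w => f z₀ w z := fun z₀ z => by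
    refine (integrable_decay.const_mul (‖J‖ ^ 0 * L * C * (1 + ‖J z‖) ^ a)).mono' (hfm z₀ z)
      (Eventually.of_forall fun w => ?_)
    have := hB z₀ w z 0 (Nat.zero_le _)
    rwa [norm_iteratedFDeriv_zero] at this
  have hri : Integrable r := by
    refine (integrable_decay.const_mul C).mono' hr.continuous.aestronglyMeasurable
      (Eventually.of_forall fun w => ?_)
    have h1 := hrC 0 (Nat.zero_le _) w
    rw [norm_iteratedFDeriv_zero] at h1
    rw [← hpow, ← mul_assoc, ← div_eq_mul_inv, le_div_iff₀ (by positivity)]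
    have h2 : 1 ≤ 1 + ‖w‖ := by linarith [norm_nonneg w]
    nlinarith
  have key : ∀ z₀ : F, (fun z => V (z₀ + z))
      = fun z => H (J z₀) * (∫ w, r w) + ∫ w, f z₀ w z := by
    intro z₀
    refine funext fun z => ?_
    have e1 : V (z₀ + z) = ∫ w, H (w + J z₀) * r (w + (-J) z) := by
      rw [hV, ← integral_add_right_eq_self (fun w => H (w + J z₀) * r (w + (-J) z)) (J z)]
      refine integral_congr_ae (Eventually.of_forall fun w => ?_)
      simp only [map_add, neg_apply, add_assoc, add_comm (J z₀) (J z), add_neg_cancel, add_zero]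
    have hri' : Integrable fun w => r (w + (-J) z) := hri.comp_add_right _
    rw [e1, ← integral_add_right_eq_self r ((-J) z), ← integral_const_mul,
      ← integral_add (hri'.const_mul _) (hfi z₀ z)]
    refine integral_congr_ae (Eventually.of_forall fun w => ?_)
    simp only [f]
    ring
  have hdom : ∀ z₀ : F, ∀ R : ℝ, ∀ j ≤ k, ∃ b : E → ℝ, Integrable b volume ∧
      ∀ᵐ w ∂volume, ∀ z, ‖z‖ ≤ R → ‖iteratedFDeriv ℝ j (f z₀ w) z‖ ≤ b w := by
    intro z₀ R j hj
    refine ⟨_, integrable_decay.const_mul (‖J‖ ^ j * L * C * (1 + ‖J‖ * R) ^ a),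
      Eventually.of_forall fun w z hz => (hB z₀ w z j hj).trans ?_⟩
    have := (J.le_opNorm z).trans (mul_le_mul_of_nonneg_left hz (norm_nonneg J))
    gcongr
  have hae : ∀ z₀, ∀ᵐ w ∂(volume : Measure E), ContDiff ℝ k (f z₀ w) := fun z₀ =>
    Eventually.of_forall (hf z₀)
  have hcd : ∀ z₀, ContDiff ℝ k fun z => ∫ w, f z₀ w z := fun z₀ =>
    contDiff_integral_of_dominated k (hae z₀) (hfm z₀) (hdom z₀)
  constructor
  · have h0 := key 0
    simp only [zero_add] at h0
    rw [show V = fun z => V z from rfl, h0]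
    exact contDiff_const.add (hcd 0)
  · intro m hm hm0 z₀
    have h1 : iteratedFDeriv ℝ m V z₀ = iteratedFDeriv ℝ m (fun z => ∫ w, f z₀ w z) 0 := by
      have h2 := iteratedFDeriv_comp_add_left (𝕜 := ℝ) (f := V) m z₀ 0
      rw [add_zero] at h2
      have h3 : (fun z => V (z₀ + z)) = (fun _ => H (J z₀) * ∫ w, r w) + fun z => ∫ w, f z₀ w z :=
        key z₀
      rw [← h2, h3, iteratedFDeriv_add_apply contDiff_const.contDiffAt
        ((hcd z₀).of_le (by exact_mod_cast hm)).contDiffAt,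
        iteratedFDeriv_const_of_ne hm0.ne', Pi.zero_apply, zero_add]
    rw [h1, iteratedFDeriv_integral_of_dominated k (hae z₀) (hfm z₀) (hdom z₀) hm,
      decayIntegral, ← integral_const_mul]
    refine norm_integral_le_of_norm_le (integrable_decay.const_mul (‖J‖ ^ m * L * C))
      (Eventually.of_forall fun w => ?_)
    have := hB z₀ w 0 m hm
    rwa [map_zero, norm_zero, add_zero, one_pow, mul_one] at this

end Smoothing

/-! ### Derivative bounds for the semigroup, uniform in b and Q -/

section SemigroupEstimates

open IsAnisoHolder

variable {E : Type*} [NormedAddCommGroup E] [InnerProductSpace ℝ E] [FiniteDimensional ℝ E]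
  [MeasurableSpace E] [BorelSpace E]
variable {U : Type*} [NormedAddCommGroup U] [InnerProductSpace ℝ U] [FiniteDimensional ℝ U]
  [MeasurableSpace U] [BorelSpace U]
variable {ι : Type*} [Fintype ι]
variable {A : E →L[ℝ] E} {B : U →L[ℝ] E} {n : ℕ} {ν : Measure U} [SigmaFinite ν]

theorem ouLaw_eq_conv (hν : Integrable (levyWeight id (Metric.ball 0 1)) ν)
    (hn : reachSpace A B n = ⊤)
    (μ : Measure (Metric.sphere (0 : U) 1)) [IsFiniteMeasure μ] {α ρ : ℝ} (hα0 : 0 < α)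
    (hα : α < 2) (hρ : 0 < ρ) (hρ1 : ρ < 1) (hle : stable μ α ρ ≤ ν)
    (b : U) (v : ι → U) {t τ : ℝ} (hτ : 0 < τ) (hτ1 : τ ≤ 1) (hτt : τ ≤ t) :
    ∃ Q R : Measure E, IsProbabilityMeasure Q ∧ IsProbabilityMeasure R ∧
      (∀ p, charFun Q p = Complex.exp (∫ q, levyKernel
        (fun q : ℝ × U => scaledNoise A B n τ q.1 q.2) Set.univ p q ∂stableJumps μ α 1 ρ)) ∧
      (ouLaw A B b v ν t : Measure E)
        = (Q.map fun w => τ ^ (1 / α) • dilation A B n τ w) ∗ R := by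
  obtain ⟨Q, R, hQ, hR, hQc, h⟩ :=
    exists_convolution_factor A B hν hn μ hα0 hα hρ hρ1 hle b v hτ hτ1 hτt
  refine ⟨Q, R, hQ, hR, hQc, ?_⟩
  have hm : Measurable fun w => τ ^ (1 / α) • dilation A B n τ w :=
    ((τ ^ (1 / α)) • dilation A B n τ).continuous.measurable
  have := Measure.isProbabilityMeasure_map (μ := Q) hm.aemeasurable
  refine Measure.ext_of_charFun (funext fun p => ?_)
  rw [h, charFun_ouLaw A B b v hν, max_eq_left (hτ.le.trans hτt)]

/-- Integrating the other factor R first, a displacement of the starting point by S e becomes a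
displacement by e of the variable with a smooth density. -/
theorem ouSemigroup_eq_integral {b : U} {v : ι → U} {t : ℝ} {Q R : Measure E}
    [IsProbabilityMeasure Q] [IsProbabilityMeasure R] {S : E →L[ℝ] E}
    (h : (ouLaw A B b v ν t : Measure E) = (Q.map S) ∗ R) {g : E → ℝ} {K : ℝ} (hgm : Measurable g)
    (hg : ∀ x, |g x| ≤ K) (x e : E) :
    ouSemigroup A B b v ν t g (x + S e) = ∫ w, ∫ y, g (flow A t (x + S (w + e) + y)) ∂ R ∂Q := by
  have hi := integrable_ouLaw A B b v hgm hg t (x + S e) (ν := ν)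
  have hp := Measure.isProbabilityMeasure_map (μ := Q) S.continuous.measurable.aemeasurable
  rw [ouSemigroup, h, integral_conv (h ▸ hi), integral_map S.continuous.measurable.aemeasurable]
  · refine integral_congr_ae (Eventually.of_forall fun w => integral_congr_ae
      (Eventually.of_forall fun y => ?_))
    simp only [map_add]
    congr 1
    abel
  · have hm : Measurable fun q : E × E => g (flow A t (x + S e + (q.1 + q.2))) := by
      have : Continuous fun q : E × E => flow A t (x + S e + (q.1 + q.2)) := by fun_prop
      exact hgm.comp this.measurable
    exact hm.stronglyMeasurable.integral_prod_right.aestronglyMeasurable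

/-- The semigroup is smoothing along the strata, uniformly in the drift and the Gaussian part. -/
theorem exists_isSmoothing (hν : Integrable (levyWeight id (Metric.ball 0 1)) ν)
    (hn : reachSpace A B n = ⊤)
    (μ : Measure (Metric.sphere (0 : U) 1)) [IsFiniteMeasure μ] {α ρ η β : ℝ} (hα0 : 0 < α)
    (hα : α < 2) (hρ : 0 < ρ) (hρ1 : ρ < 1) (hle : stable μ α ρ ≤ ν) (hη : 1 ≤ η)
    (h : ∀ p : U, η⁻¹ * ‖p‖ ^ α ≤ ∫ s, |⟪p, (s : U)⟫| ^ α ∂μ) (hβ : 0 < β) (hβ1 : β < 1) :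
    ∃ C : ℝ, 0 ≤ C ∧ ∀ (b : U) (v : ι → U) (K : ℝ) (g : E → ℝ), IsAnisoHolder A B n α β K g →
      ∀ i < n, ∀ x₀ : E, IsSmoothing α β (1 + α * i) (C * K)
        (fun t (z : stratum A B i) => ouSemigroup A B b v ν t g (x₀ + (z : E))) := by
  obtain ⟨Cr, hCr, hdens⟩ :=
    exists_stable_density hn μ hα0 hα hη h hρ hρ1.le (Module.finrank ℝ E + 2) 3
  obtain ⟨C₁, hC₁, hflow⟩ := exists_abs_sub_flow_dilation_le A B n hn hα0 hβ hβ1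
  obtain ⟨C₂, hC₂, hosc⟩ := exists_abs_sub_flow_le A B n hn hα0 hβ hβ1
  have hI := decayIntegral_nonneg (E := E)
  refine ⟨1 + (C₁ + 2) * Cr * decayIntegral E + C₂, by positivity, fun b v K g hg i hi x₀ => ?_⟩
  have hK := hg.nonneg
  have hgc := hg.continuous hn hα0 hβ
  have hgm := hgc.measurable
  have hσ : 0 < 1 + α * (i : ℝ) := by positivity
  have hmain : ∀ t, 0 < t → ContDiff ℝ 3
        (fun z : stratum A B i => ouSemigroup A B b v ν t g (x₀ + (z : E))) ∧
      ∀ m ≤ 3, 0 < m → ∀ z, ‖iteratedFDeriv ℝ m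
        (fun z : stratum A B i => ouSemigroup A B b v ν t g (x₀ + (z : E))) z‖
        ≤ K * ((C₁ + 2) * Cr * decayIntegral E) * (t ^ ((β - m * (1 + α * i)) / α) + 1) := by
    intro t ht
    -- For t > 1 only the noise before time 1 is used for smoothing; this is enough because the
    -- estimate need not decay in time.
    set τ := min t 1 with hτdef
    have hτ : 0 < τ := lt_min ht one_pos
    have hτ1 : τ ≤ 1 := min_le_right _ _
    obtain ⟨Q, R, hQ, hR, hQc, hconv⟩ :=
      ouLaw_eq_conv hν hn μ hα0 hα hρ hρ1 hle b v hτ hτ1 (min_le_left t 1)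
    obtain ⟨r, hr, hrC, hrQ⟩ := hdens τ ⟨hτ, hτ1⟩
    set c : ℝ := τ ^ (1 / α) with hc
    have hc0 : 0 < c := Real.rpow_pos_of_pos hτ _
    let S : E →L[ℝ] E := c • dilation A B n τ
    -- On the stratum of index i the map `S` is multiplication by c τ^i, so `s` times the inclusion
    -- is a right inverse of `S` there.
    let s : ℝ := (c * τ ^ i)⁻¹
    have hs0 : 0 < s := by positivity
    let J : stratum A B i →L[ℝ] E := s • (stratum A B i).subtypeL
    have hSJ : ∀ z : stratum A B i, S (J z) = z := by
      intro z
      have h1 : dilation A B n τ (z : E) = τ ^ i • (z : E) :=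
        dilation_of_mem_stratum A B hi τ z.2
      change c • dilation A B n τ (s • (z : E)) = z
      rw [map_smul, h1, smul_smul, smul_smul]
      have : c * s * τ ^ i = 1 := by
        have : c * τ ^ i ≠ 0 := by positivity
        simp only [s]
        field_simp
      rw [this, one_smul]
    have hJ : ‖J‖ ≤ s := by
      refine ContinuousLinearMap.opNorm_le_bound _ hs0.le fun z => ?_
      change ‖s • (z : E)‖ ≤ _
      rw [norm_smul, Real.norm_of_nonneg hs0.le]
      rfl
    let H : E → ℝ := fun w => ∫ y, g (flow A t (x₀ + S w + y)) ∂ R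
    have hHm : Measurable H := by
      have hcont : Continuous fun q : E × E => g (flow A t (x₀ + S q.1 + q.2)) := by fun_prop
      exact (hcont.measurable.stronglyMeasurable.integral_prod_right).measurable
    have hgi : ∀ w, Integrable (fun y => g (flow A t (x₀ + S w + y))) R := fun w =>
      Integrable.of_bound (C := K) (by
        have hcont : Continuous fun y => g (flow A t (x₀ + S w + y)) := by fun_prop
        exact hcont.aestronglyMeasurable) (Eventually.of_forall fun y => hg.bounded _)
    have hHb : ∀ w, |H w| ≤ K := by
      intro w
      have := norm_integral_le_of_norm_le_const (μ := R)
        (f := fun y => g (flow A t (x₀ + S w + y))) (C := K)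
        (Eventually.of_forall fun y => hg.bounded _)
      rwa [probReal_univ, mul_one] at this
    -- The oscillation of g along the dilated flow for t ≤ 1; for t > 1 the sup bound 2K replaces
    -- it.
    set L : ℝ := K * (C₁ + 2) * (if t ≤ 1 then t ^ (β / α) else 1) with hLdef
    have hL : 0 ≤ L := by
      have : 0 ≤ (if t ≤ 1 then t ^ (β / α) else 1) := by split_ifs <;> positivity
      positivity
    have hHL : ∀ w w', |H (w' + w) - H w'| ≤ L * (1 + ‖w‖) := by
      intro w w'
      have h1 : H (w' + w) - H w' = ∫ y, (g (flow A t (x₀ + S (w' + w) + y))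
          - g (flow A t (x₀ + S w' + y))) ∂ R := (integral_sub (hgi _) (hgi _)).symm
      have h2 : ∀ y, |g (flow A t (x₀ + S (w' + w) + y)) - g (flow A t (x₀ + S w' + y))|
          ≤ L * (1 + ‖w‖) := by
        intro y
        rw [hLdef]
        have hw : 1 ≤ 1 + ‖w‖ := by linarith [norm_nonneg w]
        split_ifs with ht1
        · have e1 : τ = t := min_eq_left ht1
          have e2 : flow A t (x₀ + S (w' + w) + y) = flow A t (x₀ + S w' + y)
              + flow A t (t ^ (1 / α) • dilation A B n t w) := by
            rw [← map_add]
            congr 1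
            simp only [S, map_add, smul_apply, hc, e1]
            abel
          rw [e2]
          refine (hflow K g hg t ⟨ht, ht1⟩ _ w).trans ?_
          have : 0 ≤ t ^ (β / α) := by positivity
          have h4 : K * C₁ * t ^ (β / α) ≤ K * (C₁ + 2) * t ^ (β / α) := by
            gcongr
            linarith
          exact mul_le_mul_of_nonneg_right h4 (by positivity)
        · refine (_root_.abs_sub _ _).trans ?_
          have h3 := hg.bounded (flow A t (x₀ + S (w' + w) + y))
          have h4 := hg.bounded (flow A t (x₀ + S w' + y))
          have h5 : 0 ≤ K * C₁ := by positivity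
          have h6 : K * (C₁ + 2) * 1 ≤ K * (C₁ + 2) * 1 * (1 + ‖w‖) :=
            le_mul_of_one_le_right (by positivity) hw
          linarith
      rw [h1]
      have := norm_integral_le_of_norm_le_const (μ := R)
        (f := fun y => g (flow A t (x₀ + S (w' + w) + y)) - g (flow A t (x₀ + S w' + y)))
        (Eventually.of_forall h2)
      rwa [probReal_univ, mul_one] at this
    have hV : (fun z : stratum A B i => ouSemigroup A B b v ν t g (x₀ + (z : E)))
        = fun z => ∫ w, H (w + J z) * r w := by
      funext z
      rw [← hSJ z, ouSemigroup_eq_integral (S := S) hconv hgm hg.bounded x₀ (J z)]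
      have := hrQ Q hQ hQc (fun w => H (w + J z)) K (hHm.comp (measurable_add_const _))
        (fun w => hHb _)
      exact this
    obtain ⟨h1, h2⟩ := smoothing_of_density hr hCr hrC hHm hL hHL J
    rw [hV]
    refine ⟨h1, fun m hm hm0 z => (h2 m hm hm0 z).trans ?_⟩
    have h3 : ‖J‖ ^ m ≤ s ^ m := by gcongr
    -- For t ≤ 1 one has s = t^{-1/α-i}, so each derivative costs t^{-(1+αi)/α}; for t > 1 one has s
    -- = 1.
    have h4 : s ^ m * (if t ≤ 1 then t ^ (β / α) else 1)
        ≤ t ^ ((β - m * (1 + α * i)) / α) + 1 := by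
      split_ifs with ht1
      · have e1 : τ = t := min_eq_left ht1
        have e2 : s ^ m * t ^ (β / α) = t ^ ((β - m * (1 + α * i)) / α) := by
          simp only [s, hc, e1]
          rw [← Real.rpow_natCast t i, ← Real.rpow_add ht, ← Real.rpow_neg ht.le,
            ← Real.rpow_natCast (t ^ _) m, ← Real.rpow_mul ht.le, ← Real.rpow_add ht]
          congr 1
          field_simp
          ring
        rw [e2]
        linarith
      · have e1 : τ = 1 := min_eq_right (not_le.1 ht1).le
        have e2 : s = 1 := by simp [s, hc, e1]
        rw [e2, one_pow, one_mul]
        have := Real.rpow_nonneg ht.le ((β - m * (1 + α * i)) / α)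
        linarith
    calc ‖J‖ ^ m * L * Cr * decayIntegral E ≤ s ^ m * L * Cr * decayIntegral E := by gcongr
      _ = K * ((C₁ + 2) * Cr * decayIntegral E) *
          (s ^ m * (if t ≤ 1 then t ^ (β / α) else 1)) := by rw [hLdef]; ring
      _ ≤ _ := by gcongr
  constructor
  · exact fun t ht => (hmain t ht).1
  · intro z
    exact ((stronglyMeasurable_ouSemigroup A B b v hν hgm).comp_measurable
      (measurable_id.prodMk measurable_const)).aestronglyMeasurable
  · intro t ht m hm z
    have h0 : 0 ≤ t ^ ((β - m * (1 + α * i)) / α) := Real.rpow_nonneg ht.le _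
    rcases Nat.eq_zero_or_pos m with rfl | hm0
    · rw [norm_iteratedFDeriv_zero]
      have h1 := abs_ouSemigroup_le A B b v (ν := ν) hg.bounded t (x₀ + (z : E))
      have h2 : 0 ≤ K * ((C₁ + 2) * Cr * decayIntegral E + C₂) := by positivity
      rw [Real.norm_eq_abs]
      refine h1.trans ?_
      have h3 : K ≤ (1 + (C₁ + 2) * Cr * decayIntegral E + C₂) * K := by linarith
      exact h3.trans (le_mul_of_one_le_right (hK.trans h3) (by linarith))
    · refine ((hmain t ht).2 m hm hm0 z).trans ?_
      have h2 : 0 ≤ K * C₂ := by positivity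
      refine mul_le_mul_of_nonneg_right ?_ (by linarith)
      linarith
  -- No smoothing is used here: the displacement is carried by the flow alone, and the oscillation
  -- bound is averaged over the law.
  · intro t z z' hz ht htz
    have h1 : ∀ y : E, |g (flow A t (x₀ + (z : E) + y)) - g (flow A t (x₀ + (z' : E) + y))|
        ≤ K * C₂ * ‖z - z'‖ ^ (β / (1 + α * i)) := by
      intro y
      have e2 : flow A t (x₀ + (z : E) + y)
          = flow A t (x₀ + (z' : E) + y) + flow A t ((z - z' : stratum A B i) : E) := by
        rw [← map_add]
        congr 1
        push_cast
        abel
      rw [e2]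
      exact hosc K g hg i hi _ (z - z').2 hz t ht htz _
    have h2 : ouSemigroup A B b v ν t g (x₀ + (z : E)) - ouSemigroup A B b v ν t g (x₀ + (z' : E))
        = ∫ y, (g (flow A t (x₀ + (z : E) + y)) - g (flow A t (x₀ + (z' : E) + y)))
          ∂(ouLaw A B b v ν t : Measure E) :=
      (integral_sub (integrable_ouLaw A B b v hgm hg.bounded t _)
        (integrable_ouLaw A B b v hgm hg.bounded t _)).symm
    have h3 := norm_integral_le_of_norm_le_const (μ := (ouLaw A B b v ν t : Measure E))
      (f := fun y => g (flow A t (x₀ + (z : E) + y)) - g (flow A t (x₀ + (z' : E) + y)))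
      (Eventually.of_forall h1)
    rw [← h2, Real.norm_eq_abs] at h3
    refine h3.trans ?_
    rw [probReal_univ, mul_one]
    have h4 : 0 ≤ (1 + (C₁ + 2) * Cr * decayIntegral E) * K := by positivity
    refine mul_le_mul_of_nonneg_right ?_ (by positivity)
    linarith

end SemigroupEstimates

/-! ### The resolvent of the semigroup -/

section Resolvent

variable {E : Type*} [NormedAddCommGroup E] [InnerProductSpace ℝ E] [FiniteDimensional ℝ E]
  [MeasurableSpace E] [BorelSpace E]
variable {U : Type*} [NormedAddCommGroup U] [InnerProductSpace ℝ U] [FiniteDimensional ℝ U]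
  [MeasurableSpace U] [BorelSpace U]
variable {ι : Type*} [Fintype ι]
variable (A : E →L[ℝ] E) (B : U →L[ℝ] E) (b : U) (v : ι → U) (ν : Measure U)

/-- The resolvent of the Ornstein–Uhlenbeck semigroup. -/
def ouResolvent (lam : ℝ) (g : E → ℝ) (x : E) : ℝ :=
  ∫ t in Set.Ioi (0 : ℝ), Real.exp (-lam * t) * ouSemigroup A B b v ν t g x

variable {ν} [SigmaFinite ν] (hν : Integrable (levyWeight id (Metric.ball 0 1)) ν)
  {lam K : ℝ} (hlam : 0 < lam) {g : E → ℝ} (hgm : Measurable g) (hg : ∀ x, |g x| ≤ K)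
include hν hlam hgm hg

theorem integrableOn_ouResolvent (x : E) :
    Integrable (fun t => Real.exp (-lam * t) * ouSemigroup A B b v ν t g x)
      (volume.restrict (Set.Ioi 0)) := by
  have h1 : Integrable (fun t : ℝ => Real.exp (-lam * t)) (volume.restrict (Set.Ioi 0)) :=
    integrableOn_exp_mul_Ioi (a := -lam) (by linarith) 0
  refine h1.mul_bdd (c := K) ?_ (Eventually.of_forall fun t => ?_)
  · exact ((stronglyMeasurable_ouSemigroup A B b v hν hgm).comp_measurable
      (measurable_id.prodMk measurable_const)).aestronglyMeasurable
  · exact abs_ouSemigroup_le A B b v hg t x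

theorem abs_ouResolvent_le (x : E) : |ouResolvent A B b v ν lam g x| ≤ K / lam := by
  have h1 : Integrable (fun t : ℝ => Real.exp (-lam * t)) (volume.restrict (Set.Ioi 0)) :=
    integrableOn_exp_mul_Ioi (a := -lam) (by linarith) 0
  have h2 : ‖ouResolvent A B b v ν lam g x‖ ≤ ∫ t in Set.Ioi (0 : ℝ), Real.exp (-lam * t) * K := by
    refine norm_integral_le_of_norm_le (h1.mul_const K) (Eventually.of_forall fun t => ?_)
    rw [norm_mul, Real.norm_of_nonneg (Real.exp_pos _).le]
    exact mul_le_mul_of_nonneg_left (abs_ouSemigroup_le A B b v hg t x) (Real.exp_pos _).le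
  rw [integral_mul_const, integral_exp_mul_Ioi (by linarith)] at h2
  refine h2.trans (le_of_eq ?_)
  rw [mul_zero, Real.exp_zero, neg_div_neg_eq]
  ring

/-- The exponential makes the times after T negligible, and up to T the flow is uniformly Lipschitz,
so the modulus of continuity of g passes to the semigroup. -/
theorem uniformContinuous_ouResolvent (hgu : UniformContinuous g) :
    UniformContinuous (ouResolvent A B b v ν lam g) := by
  have hK : 0 ≤ K := (abs_nonneg _).trans (hg 0)
  rw [Metric.uniformContinuous_iff]
  intro ε hε
  obtain ⟨T, hT⟩ : ∃ T : ℝ, 2 * K * (Real.exp (-lam * T) / lam) < ε / 2 := by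
    have h1 : Tendsto (fun T : ℝ => 2 * K * (Real.exp (-lam * T) / lam)) atTop (𝓝 0) := by
      have h2 : Tendsto (fun T : ℝ => -lam * T) atTop atBot :=
        tendsto_id.const_mul_atTop_of_neg (by linarith)
      simpa using ((Real.tendsto_exp_atBot.comp h2).div_const lam).const_mul (2 * K)
    exact (h1.eventually_lt_const (by positivity : (0 : ℝ) < ε / 2)).exists
  obtain ⟨δ, hδ, hgδ⟩ := Metric.uniformContinuous_iff.1 hgu (lam * ε / 2) (by positivity)
  obtain ⟨M, hM1, hM⟩ := exists_norm_flow_le A (max T 0)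
  have hM0 : 0 ≤ M := by linarith
  refine ⟨δ / (M + 1), by positivity, fun {x y} hxy => ?_⟩
  have hd : ∀ t, |ouSemigroup A B b v ν t g x - ouSemigroup A B b v ν t g y| ≤ 2 * K := fun t => by
    refine (_root_.abs_sub _ _).trans ?_
    linarith [abs_ouSemigroup_le A B b v (ν := ν) hg t x, abs_ouSemigroup_le A B b v (ν := ν) hg t y]
  have hs : ∀ t ∈ Set.Ioc 0 T,
      |ouSemigroup A B b v ν t g x - ouSemigroup A B b v ν t g y| ≤ lam * ε / 2 := by
    intro t ht
    have h2 : ouSemigroup A B b v ν t g x - ouSemigroup A B b v ν t g y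
        = ∫ z, (g (flow A t (x + z)) - g (flow A t (y + z)))
          ∂(ouLaw A B b v ν t : Measure E) :=
      (integral_sub (integrable_ouLaw A B b v hgm hg t _)
        (integrable_ouLaw A B b v hgm hg t _)).symm
    have h3 := norm_integral_le_of_norm_le_const (μ := (ouLaw A B b v ν t : Measure E))
      (f := fun z => g (flow A t (x + z)) - g (flow A t (y + z))) (C := lam * ε / 2)
      (Eventually.of_forall fun z => ?_)
    · rwa [← h2, probReal_univ, mul_one] at h3
    · rw [← dist_eq_norm]
      refine (hgδ ?_).le
      rw [dist_eq_norm, ← map_sub, add_sub_add_right_eq_sub]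
      refine lt_of_le_of_lt ((flow A t).le_of_opNorm_le
        (hM t (by rw [abs_of_pos ht.1]; exact ht.2.trans (le_max_left _ _))) _) ?_
      rw [dist_eq_norm, lt_div_iff₀ (by positivity)] at hxy
      nlinarith [norm_nonneg (x - y)]
  have i0 : Integrable (fun t : ℝ => Real.exp (-lam * t)) (volume.restrict (Set.Ioi 0)) :=
    integrableOn_exp_mul_Ioi (a := -lam) (by linarith) 0
  have i1 : Integrable (fun t : ℝ => Real.exp (-lam * t)) (volume.restrict (Set.Ioi T)) :=
    integrableOn_exp_mul_Ioi (a := -lam) (by linarith) T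
  have i1' : Integrable ((Set.Ioi T).indicator fun t : ℝ => Real.exp (-lam * t)) volume :=
    (integrable_indicator_iff measurableSet_Ioi).2 i1
  have h4 : ‖ouResolvent A B b v ν lam g x - ouResolvent A B b v ν lam g y‖
      ≤ ∫ t in Set.Ioi (0 : ℝ), (Real.exp (-lam * t) * (lam * ε / 2)
        + (Set.Ioi T).indicator (fun t : ℝ => Real.exp (-lam * t)) t * (2 * K)) := by
    unfold ouResolvent
    rw [← integral_sub (integrableOn_ouResolvent A B b v hν hlam hgm hg x)
      (integrableOn_ouResolvent A B b v hν hlam hgm hg y)]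
    refine norm_integral_le_of_norm_le ((i0.mul_const _).add (i1'.restrict.mul_const _)) ?_
    filter_upwards [ae_restrict_mem measurableSet_Ioi] with t ht
    have he := (Real.exp_pos (-lam * t)).le
    rw [← mul_sub, norm_mul, Real.norm_of_nonneg he, Real.norm_eq_abs]
    have hlε : 0 ≤ lam * ε / 2 := by positivity
    by_cases htT : t ≤ T
    · rw [Set.indicator_of_notMem (by simpa using htT), zero_mul, add_zero]
      exact mul_le_mul_of_nonneg_left (hs t ⟨ht, htT⟩) he
    · rw [Set.indicator_of_mem (by simpa using htT)]
      have := mul_le_mul_of_nonneg_left (hd t) he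
      have := mul_nonneg he hlε
      linarith
  have h5 : ∫ t in Set.Ioi (0 : ℝ), (Set.Ioi T).indicator (fun t : ℝ => Real.exp (-lam * t)) t
      ≤ Real.exp (-lam * T) / lam := by
    calc _ ≤ ∫ t, (Set.Ioi T).indicator (fun t : ℝ => Real.exp (-lam * t)) t := by
          refine setIntegral_le_integral i1' (Eventually.of_forall fun t => ?_)
          exact Set.indicator_nonneg (fun _ _ => (Real.exp_pos _).le) _
      _ = _ := by
          rw [integral_indicator measurableSet_Ioi, integral_exp_mul_Ioi (by linarith),
            neg_div_neg_eq]
  rw [integral_add (i0.mul_const _) (i1'.restrict.mul_const _), integral_mul_const,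
    integral_mul_const, integral_exp_mul_Ioi (by linarith), mul_zero, Real.exp_zero,
    neg_div_neg_eq] at h4
  rw [dist_eq_norm]
  refine lt_of_le_of_lt h4 ?_
  have h6 := mul_le_mul_of_nonneg_right h5 (by positivity : 0 ≤ 2 * K)
  have h7 : 1 / lam * (lam * ε / 2) = ε / 2 := by field_simp
  linarith

end Resolvent

/-! ### The Schauder estimate along the strata -/

section SchauderEstimate

variable {E : Type*} [NormedAddCommGroup E] [InnerProductSpace ℝ E] [FiniteDimensional ℝ E]
  [MeasurableSpace E] [BorelSpace E]
variable {U : Type*} [NormedAddCommGroup U] [InnerProductSpace ℝ U] [FiniteDimensional ℝ U]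
  [MeasurableSpace U] [BorelSpace U]
variable {ι : Type*} [Fintype ι]
variable {A : E →L[ℝ] E} {B : U →L[ℝ] E} {n : ℕ} {ν : Measure U} [SigmaFinite ν]

/-- The Schauder estimate along the strata. -/
theorem exists_schauder_estimate (hν : Integrable (levyWeight id (Metric.ball 0 1)) ν)
    (hn : reachSpace A B n = ⊤)
    (μ : Measure (Metric.sphere (0 : U) 1)) [IsFiniteMeasure μ] {α ρ η β lam : ℝ} (hα0 : 0 < α)
    (hα : α < 2) (hρ : 0 < ρ) (hρ1 : ρ < 1) (hle : stable μ α ρ ≤ ν) (hη : 1 ≤ η)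
    (h : ∀ p : U, η⁻¹ * ‖p‖ ^ α ≤ ∫ s, |⟪p, (s : U)⟫| ^ α ∂μ) (hβ : 0 < β) (hβ1 : β < 1)
    (hlam : 0 < lam) :
    ∃ C : ℝ, 0 ≤ C ∧ ∀ (b : U) (v : ι → U) (K : ℝ) (g : E → ℝ), IsAnisoHolder A B n α β K g →
      ∀ i < n, ∀ x₀ : E,
        ContDiff ℝ (intPart ((α + β) / (1 + α * i)))
          (fun z : stratum A B i => ouResolvent A B b v ν lam g (x₀ + (z : E))) ∧
        zygmundNorm ((α + β) / (1 + α * i))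
          (fun z : stratum A B i => ouResolvent A B b v ν lam g (x₀ + (z : E)))
          ≤ ENNReal.ofReal (C * K) := by
  obtain ⟨C, hC, hC'⟩ := exists_isSmoothing (ι := ι) hν hn μ hα0 hα hρ hρ1 hle hη h hβ hβ1
  have hσ : ∀ i : ℕ, 1 ≤ 1 + α * (i : ℝ) := fun i => by
    have : 0 ≤ α * (i : ℝ) := by positivity
    linarith
  have hr := fun i : ℕ => resolventConst_nonneg α β (1 + α * i) lam (intPart ((α + β) / (1 + α * i)))
  refine ⟨∑ i ∈ Finset.range n, resolventConst α β (1 + α * i) lam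
    (intPart ((α + β) / (1 + α * i))) * C, Finset.sum_nonneg fun i _ => mul_nonneg (hr i) hC,
    fun b v K g hg i hi x₀ => ?_⟩
  have hK := hg.nonneg
  obtain ⟨h1, h2⟩ := (hC' b v K g hg i hi x₀).zygmundNorm_integral_le hα0 hα hβ hβ1 (hσ i) hlam
    (mul_nonneg hC hK) rfl
  refine ⟨h1, h2.trans (ENNReal.ofReal_le_ofReal ?_)⟩
  rw [← mul_assoc]
  refine mul_le_mul_of_nonneg_right ?_ hK
  exact Finset.single_le_sum (f := fun i : ℕ => resolventConst α β (1 + α * i) lam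
    (intPart ((α + β) / (1 + α * i))) * C) (fun i _ => mul_nonneg (hr i) hC) (Finset.mem_range.2 hi)

end SchauderEstimate

/-! ### The formal adjoint on test functions -/

section Adjoint

variable {E : Type*} [NormedAddCommGroup E] [InnerProductSpace ℝ E] [FiniteDimensional ℝ E]
  [MeasurableSpace E] [BorelSpace E]
variable {U : Type*} [NormedAddCommGroup U] [InnerProductSpace ℝ U] [FiniteDimensional ℝ U]
  [MeasurableSpace U] [BorelSpace U]
variable {ι : Type*} [Fintype ι]
variable (A : E →L[ℝ] E) (B : U →L[ℝ] E) (b : U) (v : ι → U) (ν : Measure U)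

/-- The integrand of the jump part of the adjoint operator. -/
def jumpTerm (φ : E → ℝ) (z : U) (x : E) : ℝ :=
  φ (x - B z) - φ x + (Metric.ball (0 : U) 1).indicator (fun z => fderiv ℝ φ x (B z)) z

/-- The formal adjoint of the Ornstein–Uhlenbeck operator, for a Gaussian part given by a sum of
squares of directions. -/
def ouDual (φ : E → ℝ) (x : E) : ℝ :=
  1 / 2 * ∑ j, iteratedFDeriv ℝ 2 φ x ![B (v j), B (v j)] - fderiv ℝ φ x (B b)
    + ∫ z, jumpTerm B φ z x ∂ν - (fderiv ℝ φ x (A x) + LinearMap.trace ℝ E A * φ x)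

variable {φ : E → ℝ} (hφ : ContDiff ℝ (⊤ : ℕ∞) φ) (hc : HasCompactSupport φ)
variable {V : Type*} [NormedAddCommGroup V] [NormedSpace ℝ V]

include hφ in
theorem contDiff_fderiv_apply (w : E) : ContDiff ℝ (⊤ : ℕ∞) fun x => fderiv ℝ φ x w :=
  (hφ.fderiv_right (m := (⊤ : ℕ∞)) (by exact_mod_cast le_top)).clm_apply contDiff_const

include hφ in
theorem iteratedFDeriv_two_apply_self (x w : E) :
    iteratedFDeriv ℝ 2 φ x ![w, w] = fderiv ℝ (fun y => fderiv ℝ φ y w) x w := by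
  rw [iteratedFDeriv_two_apply]
  have h : DifferentiableAt ℝ (fderiv ℝ φ) x :=
    (hφ.fderiv_right (m := (⊤ : ℕ∞)) (by exact_mod_cast le_top)).differentiable (by simp) x
  rw [fderiv_clm_apply h (differentiableAt_const w)]
  simp

omit [FiniteDimensional ℝ E] in
theorem integrable_smul_of_hasCompactSupport {ψ : E → ℝ} {G : E → V} {m : Measure E}
    [IsFiniteMeasureOnCompacts m] (hψ : Continuous ψ) (hψc : HasCompactSupport ψ)
    (hG : Continuous G) : Integrable (fun x => ψ x • G x) m :=
  (hψ.smul hG).integrable_of_hasCompactSupport (hψc.smul_right)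

include hφ hc in
theorem integral_fderiv_smul {G : E → V} (hG : ContDiff ℝ 1 G) (w : E) :
    ∫ x, fderiv ℝ φ x w • G x = -∫ x, φ x • fderiv ℝ G x w := by
  have hG' : Continuous fun x => fderiv ℝ G x w :=
    (hG.continuous_fderiv (by simp)).clm_apply continuous_const
  rw [integral_smul_fderiv_eq_neg_fderiv_smul_of_integrable, neg_neg]
  · exact integrable_smul_of_hasCompactSupport (contDiff_fderiv_apply hφ w).continuous
      (hc.fderiv_apply (𝕜 := ℝ) w) hG.continuous
  · exact integrable_smul_of_hasCompactSupport hφ.continuous hc hG'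
  · exact integrable_smul_of_hasCompactSupport hφ.continuous hc hG.continuous
  · exact fun x _ => hφ.differentiable (by simp) x
  · exact fun x _ => hG.differentiable (by simp) x

-- The left factor is the divergence of φ(x)Ax, so this is an integration by parts in each
-- coordinate of an orthonormal basis.
include hφ hc in
theorem integral_drift_smul {G : E → V} (hG : ContDiff ℝ 1 G) :
    ∫ x, (fderiv ℝ φ x (A x) + LinearMap.trace ℝ E A * φ x) • G x
      = -∫ x, φ x • fderiv ℝ G x (A x) := by
  let e := stdOrthonormalBasis ℝ E
  have hA : ∀ x, A x = ∑ k, ⟪e k, A x⟫ • e k := fun x => (e.sum_repr' (A x)).symm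
  have hAk : ∀ k, ContDiff ℝ (⊤ : ℕ∞) fun x => ⟪e k, A x⟫ := fun k =>
    contDiff_const.inner ℝ A.contDiff
  let ψ : Fin (Module.finrank ℝ E) → E → ℝ := fun k x => φ x * ⟪e k, A x⟫
  have hψ : ∀ k, ContDiff ℝ (⊤ : ℕ∞) (ψ k) := fun k => hφ.mul (hAk k)
  have hψc : ∀ k, HasCompactSupport (ψ k) := fun k => hc.mul_right
  have hG' : ∀ w, Continuous fun x => fderiv ℝ G x w := fun w =>
    (hG.continuous_fderiv (by simp)).clm_apply continuous_const
  have h1 : ∀ k x, fderiv ℝ (ψ k) x (e k)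
      = fderiv ℝ φ x (e k) * ⟪e k, A x⟫ + φ x * ⟪e k, A (e k)⟫ := by
    intro k x
    have h2 : HasFDerivAt (fun x => ⟪e k, A x⟫) ((innerSL ℝ (e k)).comp A) x :=
      ((innerSL ℝ (e k)).comp A).hasFDerivAt
    have h3 := (hφ.differentiable (by simp) x).hasFDerivAt.mul h2
    rw [show fderiv ℝ (ψ k) x = _ from h3.fderiv]
    simp
    ring
  have h2 : ∀ x, fderiv ℝ φ x (A x) + LinearMap.trace ℝ E A * φ x
      = ∑ k, fderiv ℝ (ψ k) x (e k) := by
    intro x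
    simp_rw [h1, Finset.sum_add_distrib, ← Finset.mul_sum]
    congr 1
    · conv_lhs => rw [hA x]
      rw [map_sum]
      refine Finset.sum_congr rfl fun k _ => ?_
      rw [map_smul, smul_eq_mul, mul_comm]
    · rw [LinearMap.trace_eq_sum_inner _ e, mul_comm]
      rfl
  have h3 : ∀ x, φ x • fderiv ℝ G x (A x) = ∑ k, ψ k x • fderiv ℝ G x (e k) := by
    intro x
    conv_lhs => rw [hA x]
    rw [map_sum, Finset.smul_sum]
    refine Finset.sum_congr rfl fun k _ => ?_
    rw [map_smul, smul_smul]
  simp_rw [h2, h3, Finset.sum_smul]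
  rw [integral_finsetSum, integral_finsetSum, ← Finset.sum_neg_distrib]
  · exact Finset.sum_congr rfl fun k _ => integral_fderiv_smul (hψ k) (hψc k) hG (e k)
  · exact fun k _ => integrable_smul_of_hasCompactSupport (hψ k).continuous (hψc k) (hG' _)
  · exact fun k _ => integrable_smul_of_hasCompactSupport
      (contDiff_fderiv_apply (hψ k) _).continuous ((hψc k).fderiv_apply (𝕜 := ℝ) _) hG.continuous

omit [FiniteDimensional ℝ E] [MeasurableSpace E] [BorelSpace E] in
theorem abs_taylor_one_le {M : ℝ} (hd : Differentiable ℝ φ)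
    (hM : ∀ x y, ‖fderiv ℝ φ x - fderiv ℝ φ y‖ ≤ M * ‖x - y‖) (x y : E) :
    |φ (x - y) - φ x + fderiv ℝ φ x y| ≤ M * ‖y‖ ^ 2 := by
  let f : E → ℝ := fun ζ => φ (x - ζ) + fderiv ℝ φ x ζ
  have hf : ∀ ζ, HasFDerivAt f (fderiv ℝ φ x - fderiv ℝ φ (x - ζ)) ζ := by
    intro ζ
    have h1 := ((hd (x - ζ)).hasFDerivAt.comp ζ ((hasFDerivAt_id ζ).const_sub x)).add
      (fderiv ℝ φ x).hasFDerivAt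
    convert! h1 using 1
    ext w
    simp
    ring
  have hM0 : 0 ≤ M * ‖y‖ := by
    have := (norm_nonneg _).trans (hM y 0)
    simpa using this
  have h := (convex_closedBall (0 : E) ‖y‖).norm_image_sub_le_of_norm_hasFDerivWithin_le
    (f := f) (f' := fun ζ => fderiv ℝ φ x - fderiv ℝ φ (x - ζ)) (C := M * ‖y‖)
    (fun ζ _ => (hf ζ).hasFDerivWithinAt) (fun ζ hζ => ?_) (x := 0) (y := y) (by simp) (by simp)
  · have e1 : f y - f 0 = φ (x - y) - φ x + fderiv ℝ φ x y := by
      simp only [f, sub_zero, map_zero]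
      ring
    rw [e1, sub_zero, Real.norm_eq_abs] at h
    exact h.trans (le_of_eq (by ring))
  · refine (hM _ _).trans ?_
    rw [sub_sub_cancel]
    rw [mem_closedBall_zero_iff] at hζ
    rcases eq_or_lt_of_le (norm_nonneg y) with h0 | h0
    · have : ‖ζ‖ = 0 := le_antisymm (h0 ▸ hζ) (norm_nonneg _)
      rw [this, ← h0]
    · exact mul_le_mul_of_nonneg_left hζ (nonneg_of_mul_nonneg_left hM0 h0)

omit [MeasurableSpace E] [BorelSpace E] in
include hφ hc in
theorem exists_abs_taylor_one_le : ∃ M : ℝ, 0 ≤ M ∧ ∀ x y : E,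
    |φ (x - y) - φ x + fderiv ℝ φ x y| ≤ M * ‖y‖ ^ 2 := by
  obtain ⟨M, hM⟩ := ContDiff.lipschitzWith_of_hasCompactSupport (𝕂 := ℝ) (hc.fderiv (𝕜 := ℝ))
    (hφ.fderiv_right (m := (⊤ : ℕ∞)) (by exact_mod_cast le_top)) (by simp)
  refine ⟨M, M.2, abs_taylor_one_le (hφ.differentiable (by simp)) fun x y => ?_⟩
  simpa [dist_eq_norm] using hM.dist_le_mul x y

include hφ in
theorem measurable_jumpTerm : Measurable fun q : U × E => jumpTerm B φ q.1 q.2 := by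
  have hd : Continuous (fderiv ℝ φ) := hφ.continuous_fderiv (by simp)
  have h1 : Continuous fun q : U × E => φ (q.2 - B q.1) - φ q.2 := by
    have := hφ.continuous
    fun_prop
  have h2 : Continuous fun q : U × E => fderiv ℝ φ q.2 (B q.1) := by fun_prop
  have h3 : (fun q : U × E => (Metric.ball (0 : U) 1).indicator
      (fun z => fderiv ℝ φ q.2 (B z)) q.1)
      = (Prod.fst ⁻¹' Metric.ball (0 : U) 1).indicator fun q : U × E => fderiv ℝ φ q.2 (B q.1) := by
    funext q
    simp only [Set.indicator, Set.mem_preimage]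
    rfl
  have h4 : Measurable (fun q : U × E => (Metric.ball (0 : U) 1).indicator
      (fun z => fderiv ℝ φ q.2 (B z)) q.1) := by
    rw [h3]
    exact h2.measurable.indicator (measurable_fst Metric.isOpen_ball.measurableSet)
  exact h1.measurable.add h4

-- Small jumps are controlled by a Taylor expansion on a fixed ball, the support enlarged by ‖B‖;
-- large jumps by translation invariance, which gives twice the L¹ norm of φ. The outcome is
-- integrability for the product of ν and Lebesgue measure.
include hφ hc in
theorem exists_integral_jumpTerm_le : ∃ C : ℝ, ∀ z, Integrable (jumpTerm B φ z) ∧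
    ∫ x, ‖jumpTerm B φ z x‖ ≤ C * levyWeight id (Metric.ball 0 1) z := by
  obtain ⟨M, hM0, hM⟩ := exists_abs_taylor_one_le hφ hc
  obtain ⟨R, hR⟩ := hc.isCompact.isBounded.subset_closedBall 0
  have hφ0 : ∀ x, R < ‖x‖ → φ x = 0 := fun x hx => by
    by_contra h
    exact absurd (mem_closedBall_zero_iff.1 (hR (subset_tsupport _ h))) (not_le.2 hx)
  have hdφ0 : ∀ x, R < ‖x‖ → fderiv ℝ φ x = 0 := fun x hx => by
    by_contra h
    exact absurd (mem_closedBall_zero_iff.1 (hR (support_fderiv_subset ℝ h))) (not_le.2 hx)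
  have hi : Integrable φ := hφ.continuous.integrable_of_hasCompactSupport hc
  set S : Set E := Metric.closedBall 0 (R + ‖B‖) with hS
  have hSf : volume S < ∞ := measure_closedBall_lt_top
  refine ⟨M * ‖B‖ ^ 2 * volume.real S + 2 * ∫ x, ‖φ x‖, fun z => ?_⟩
  have hm : AEStronglyMeasurable (jumpTerm B φ z) volume :=
    ((measurable_jumpTerm B hφ).comp measurable_prodMk_left).aestronglyMeasurable
  have hφn : 0 ≤ ∫ x, ‖φ x‖ := integral_nonneg fun x => norm_nonneg _
  by_cases hz : z ∈ Metric.ball (0 : U) 1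
  · have hw : levyWeight id (Metric.ball (0 : U) 1) z = ‖z‖ ^ 2 := by
      rw [levyWeight, Set.indicator_of_mem hz, Set.indicator_of_notMem (Set.notMem_compl_iff.2 hz), add_zero]
      rfl
    have hz1 : ‖z‖ ≤ 1 := (mem_ball_zero_iff.1 hz).le
    have hBz : ‖B z‖ ≤ ‖B‖ * ‖z‖ := B.le_opNorm z
    have hBz' : ‖B z‖ ≤ ‖B‖ := hBz.trans (mul_le_of_le_one_right (norm_nonneg _) hz1)
    have hb : ∀ x, ‖jumpTerm B φ z x‖ ≤ S.indicator (fun _ => M * ‖B‖ ^ 2 * ‖z‖ ^ 2) x := by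
      intro x
      rw [jumpTerm, Set.indicator_of_mem hz]
      by_cases hx : x ∈ S
      · rw [Set.indicator_of_mem hx]
        refine (hM x (B z)).trans ?_
        rw [mul_assoc, ← mul_pow]
        gcongr
      · rw [Set.indicator_of_notMem hx]
        have hx' : R + ‖B‖ < ‖x‖ := by
          rw [hS, mem_closedBall_zero_iff, not_le] at hx
          exact hx
        have h1 : R < ‖x‖ := by linarith [norm_nonneg B]
        have h2 : R < ‖x - B z‖ := by
          have := norm_sub_norm_le x (B z)
          linarith
        rw [hφ0 x h1, hφ0 _ h2, hdφ0 x h1]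
        simp
    have hbi : Integrable (S.indicator fun _ => M * ‖B‖ ^ 2 * ‖z‖ ^ 2) :=
      (integrable_indicator_iff measurableSet_closedBall).2
        (integrableOn_const (hs := hSf.ne))
    refine ⟨hbi.mono' hm (Eventually.of_forall hb), ?_⟩
    refine (integral_mono_of_nonneg (Eventually.of_forall fun x => norm_nonneg _) hbi
      (Eventually.of_forall hb)).trans ?_
    rw [integral_indicator measurableSet_closedBall, setIntegral_const, hw, smul_eq_mul]
    have : 0 ≤ (2 * ∫ x, ‖φ x‖) * ‖z‖ ^ 2 := by positivity
    linarith
  · have hw : levyWeight id (Metric.ball (0 : U) 1) z = 1 := by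
      rw [levyWeight, Set.indicator_of_notMem hz, Set.indicator_of_mem hz, zero_add]
      rfl
    have hi' : Integrable fun x => φ (x - B z) := hi.comp_sub_right _
    have hb : ∀ x, ‖jumpTerm B φ z x‖ ≤ ‖φ (x - B z)‖ + ‖φ x‖ := by
      intro x
      rw [jumpTerm, Set.indicator_of_notMem hz, add_zero]
      exact norm_sub_le _ _
    refine ⟨(hi'.norm.add hi.norm).mono' hm (Eventually.of_forall hb), ?_⟩
    refine (integral_mono_of_nonneg (Eventually.of_forall fun x => norm_nonneg _)
      (hi'.norm.add hi.norm) (Eventually.of_forall hb)).trans ?_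
    rw [hw, mul_one]
    simp only [Pi.add_apply]
    rw [integral_add hi'.norm hi.norm, integral_sub_right_eq_self (fun x => ‖φ x‖)]
    have : 0 ≤ M * ‖B‖ ^ 2 * volume.real S := by positivity
    linarith

variable {ν} [SigmaFinite ν] (hν : Integrable (levyWeight id (Metric.ball 0 1)) ν)

include hφ hc hν in
theorem integrable_jumpTerm :
    Integrable (fun q : U × E => jumpTerm B φ q.1 q.2) (ν.prod volume) := by
  obtain ⟨C, hC⟩ := exists_integral_jumpTerm_le B hφ hc
  have hm := (measurable_jumpTerm B hφ).aestronglyMeasurable (μ := ν.prod volume)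
  rw [integrable_prod_iff hm]
  refine ⟨Eventually.of_forall fun z => (hC z).1, (hν.const_mul C).mono'
    hm.norm.integral_prod_right' (Eventually.of_forall fun z => ?_)⟩
  rw [Real.norm_of_nonneg (integral_nonneg fun x => norm_nonneg _)]
  exact (hC z).2

include hφ in
theorem continuous_iteratedFDeriv_two_self (w : E) :
    Continuous fun x => iteratedFDeriv ℝ 2 φ x ![w, w] := by
  simp_rw [iteratedFDeriv_two_apply_self hφ]
  exact (contDiff_fderiv_apply (contDiff_fderiv_apply hφ w) w).continuous

include hφ hc in
theorem hasCompactSupport_iteratedFDeriv_two_self (w : E) :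
    HasCompactSupport fun x => iteratedFDeriv ℝ 2 φ x ![w, w] := by
  simp_rw [iteratedFDeriv_two_apply_self hφ]
  exact HasCompactSupport.fderiv_apply (𝕜 := ℝ) (hc.fderiv_apply (𝕜 := ℝ) w) w

include hφ in
theorem continuous_drift :
    Continuous fun x => fderiv ℝ φ x (A x) + LinearMap.trace ℝ E A * φ x := by
  have h1 : Continuous (fderiv ℝ φ) := hφ.continuous_fderiv (by simp)
  have h2 := hφ.continuous
  fun_prop

include hc in
theorem hasCompactSupport_drift :
    HasCompactSupport fun x => fderiv ℝ φ x (A x) + LinearMap.trace ℝ E A * φ x := by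
  refine HasCompactSupport.add ?_ hc.mul_left
  refine (hc.fderiv (𝕜 := ℝ)).mono fun x hx => ?_
  contrapose! hx
  simp only [Function.mem_support, ne_eq, not_not] at hx ⊢
  rw [hx]
  rfl

include hφ hc hν in
theorem integrable_ouDual : Integrable (ouDual A B b v ν φ) := by
  have h1 : Integrable fun x => 1 / 2 * ∑ j, iteratedFDeriv ℝ 2 φ x ![B (v j), B (v j)] :=
    (integrable_finsetSum _ fun j _ => (continuous_iteratedFDeriv_two_self hφ _).integrable_of_hasCompactSupport
      (hasCompactSupport_iteratedFDeriv_two_self hφ hc _)).const_mul _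
  have h2 : Integrable fun x => fderiv ℝ φ x (B b) :=
    (contDiff_fderiv_apply hφ _).continuous.integrable_of_hasCompactSupport
      (hc.fderiv_apply (𝕜 := ℝ) _)
  have h3 : Integrable fun x => ∫ z, jumpTerm B φ z x ∂ν :=
    (integrable_jumpTerm B hφ hc hν).integral_prod_right
  have h4 := (continuous_drift A hφ).integrable_of_hasCompactSupport (μ := volume)
    (hasCompactSupport_drift A hc)
  exact ((h1.sub h2).add h3).sub h4

variable [CompleteSpace V]

-- Fubini in the jump term. Vector values allow the same formula to be applied both to complex
-- characters and to weak solutions.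
include hφ hc hν in
theorem integral_ouDual_smul {G : E → V} {K : ℝ} (hG : Continuous G) (hGK : ∀ x, ‖G x‖ ≤ K) :
    ∫ x, ouDual A B b v ν φ x • G x
      = (1 / 2 : ℝ) • (∑ j, ∫ x, iteratedFDeriv ℝ 2 φ x ![B (v j), B (v j)] • G x)
        - (∫ x, fderiv ℝ φ x (B b) • G x) + (∫ z, (∫ x, jumpTerm B φ z x • G x) ∂ν)
        - ∫ x, (fderiv ℝ φ x (A x) + LinearMap.trace ℝ E A * φ x) • G x := by
  have i1 : ∀ j, Integrable fun x => iteratedFDeriv ℝ 2 φ x ![B (v j), B (v j)] • G x := fun j =>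
    integrable_smul_of_hasCompactSupport (continuous_iteratedFDeriv_two_self hφ _)
      (hasCompactSupport_iteratedFDeriv_two_self hφ hc _) hG
  have i1' : Integrable fun x =>
      (1 / 2 : ℝ) • ∑ j, iteratedFDeriv ℝ 2 φ x ![B (v j), B (v j)] • G x :=
    (integrable_finsetSum _ fun j _ => i1 j).smul (1 / 2 : ℝ)
  have i2 : Integrable fun x => fderiv ℝ φ x (B b) • G x :=
    integrable_smul_of_hasCompactSupport (contDiff_fderiv_apply hφ _).continuous
      (hc.fderiv_apply (𝕜 := ℝ) _) hG
  have i3' : Integrable (fun q : U × E => jumpTerm B φ q.1 q.2 • G q.2) (ν.prod volume) :=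
    (integrable_jumpTerm B hφ hc hν).smul_bdd K
      (hG.comp continuous_snd).aestronglyMeasurable (Eventually.of_forall fun q => hGK _)
  have i3 : Integrable fun x => ∫ z, jumpTerm B φ z x • G x ∂ν := i3'.integral_prod_right
  have i4 : Integrable fun x => (fderiv ℝ φ x (A x) + LinearMap.trace ℝ E A * φ x) • G x :=
    integrable_smul_of_hasCompactSupport (continuous_drift A hφ) (hasCompactSupport_drift A hc) hG
  have e1 : ∀ x, ouDual A B b v ν φ x • G x
      = (1 / 2 : ℝ) • ∑ j, iteratedFDeriv ℝ 2 φ x ![B (v j), B (v j)] • G x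
        - fderiv ℝ φ x (B b) • G x + ∫ z, jumpTerm B φ z x • G x ∂ν
        - (fderiv ℝ φ x (A x) + LinearMap.trace ℝ E A * φ x) • G x := by
    intro x
    rw [ouDual, integral_smul_const, ← Finset.sum_smul, smul_smul]
    simp only [sub_smul, add_smul]
  simp_rw [e1]
  have i12 : Integrable fun x => (1 / 2 : ℝ) • ∑ j, iteratedFDeriv ℝ 2 φ x ![B (v j), B (v j)] • G x
        - fderiv ℝ φ x (B b) • G x := i1'.sub i2
  have i123 : Integrable fun x => (1 / 2 : ℝ) • ∑ j, iteratedFDeriv ℝ 2 φ x ![B (v j), B (v j)] • G x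
        - fderiv ℝ φ x (B b) • G x + ∫ z, jumpTerm B φ z x • G x ∂ν := i12.add i3
  rw [integral_sub i123 i4, integral_add i12 i3, integral_sub i1' i2, integral_smul,
    integral_finsetSum _ fun j _ => i1 j, ← integral_integral_swap i3']

/-- The character `x ↦ exp(i⟨x, q⟩)`. -/
def character (q x : E) : ℂ := Complex.exp ((⟪x, q⟫ : ℝ) * Complex.I)

theorem norm_character (q x : E) : ‖character q x‖ = 1 := Complex.norm_exp_ofReal_mul_I _

theorem character_add (q x y : E) : character q (x + y) = character q x * character q y := by
  rw [character, inner_add_left, Complex.ofReal_add, add_mul, Complex.exp_add]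
  rfl

theorem hasFDerivAt_character (q x : E) : HasFDerivAt (character q)
    (((Complex.ofRealCLM.comp (innerSL ℝ q)).smulRight (Complex.I * character q x))) x := by
  have h1 : HasFDerivAt (fun x : E => ((⟪x, q⟫ : ℝ) : ℂ) * Complex.I)
      ((Complex.ofRealCLM.comp (innerSL ℝ q)).smulRight Complex.I) x := by
    have h2 := ((Complex.ofRealCLM.comp (innerSL ℝ q)).smulRight Complex.I).hasFDerivAt (x := x)
    convert! h2 using 1
    funext y
    simp [real_inner_comm]
  convert! h1.cexp using 1
  ext w
  simp [character]
  ring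

theorem fderiv_character (q x w : E) :
    fderiv ℝ (character q) x w = (⟪w, q⟫ : ℝ) * Complex.I * character q x := by
  rw [(hasFDerivAt_character q x).fderiv]
  simp [real_inner_comm]
  ring

theorem contDiff_character (q : E) : ContDiff ℝ 1 (character q) := by
  unfold character
  have h : ContDiff ℝ 1 fun x : E => ((⟪x, q⟫ : ℝ) : ℂ) :=
    Complex.ofRealCLM.contDiff.comp (contDiff_id.inner ℝ contDiff_const)
  exact (h.mul contDiff_const).cexp

-- Against a character every translation-invariant term is a Fourier multiplier, and together they
-- give the exponent of Z at B*q. Only the linear drift fails to be a multiplier; it survives as the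
-- second integral.
include hφ hc hν in
theorem integral_ouDual_character (q : E) :
    ∫ x, ouDual A B b v ν φ x • character q x
      = noiseExponent b v ν (ContinuousLinearMap.adjoint B q) * (∫ x, φ x • character q x)
        + ∫ x, φ x • (((⟪A x, q⟫ : ℝ) : ℂ) * Complex.I * character q x) := by
  have hG := contDiff_character q
  have h1 : ∀ w : E, ∀ ψ : E → ℝ, ContDiff ℝ (⊤ : ℕ∞) ψ → HasCompactSupport ψ →
      ∫ x, fderiv ℝ ψ x w • character q x
        = -((⟪w, q⟫ : ℝ) * Complex.I) * ∫ x, ψ x • character q x := by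
    intro w ψ hψ hψc
    rw [integral_fderiv_smul hψ hψc hG, neg_mul, ← integral_const_mul]
    congr 1
    refine integral_congr_ae (Eventually.of_forall fun x => ?_)
    simp only [fderiv_character, Complex.real_smul]
    ring
  have h2 : ∀ w : E, ∫ x, iteratedFDeriv ℝ 2 φ x ![w, w] • character q x
      = -((⟪w, q⟫ ^ 2 : ℝ) : ℂ) * ∫ x, φ x • character q x := by
    intro w
    simp_rw [iteratedFDeriv_two_apply_self hφ]
    rw [h1 w _ (contDiff_fderiv_apply hφ w) (hc.fderiv_apply (𝕜 := ℝ) w), h1 w φ hφ hc,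
      ← mul_assoc]
    congr 1
    rw [neg_mul_neg, mul_mul_mul_comm, Complex.I_mul_I]
    push_cast
    ring
  have hi : Integrable fun x => φ x • character q x :=
    integrable_smul_of_hasCompactSupport hφ.continuous hc hG.continuous
  have h3 : ∀ z, ∫ x, jumpTerm B φ z x • character q x
      = levyKernel id (Metric.ball 0 1) (ContinuousLinearMap.adjoint B q) z
        * ∫ x, φ x • character q x := by
    intro z
    have hi' : Integrable fun x => φ (x - B z) • character q x :=
      integrable_smul_of_hasCompactSupport (hφ.continuous.comp (continuous_sub_right _))
        (hc.comp_homeomorph (Homeomorph.subRight (B z))) hG.continuous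
    have e1 : ∫ x, φ (x - B z) • character q x
        = character q (B z) * ∫ x, φ x • character q x := by
      rw [← integral_add_right_eq_self _ (B z), ← integral_const_mul]
      refine integral_congr_ae (Eventually.of_forall fun x => ?_)
      simp only [add_sub_cancel_right, character_add, Complex.real_smul]
      ring
    have e2 : character q (B z)
        = Complex.exp ((⟪id z, ContinuousLinearMap.adjoint B q⟫ : ℝ) * Complex.I) := by
      rw [id, ContinuousLinearMap.adjoint_inner_right]
      rfl
    have e3 : (⟪B z, q⟫ : ℝ) = ⟪id z, ContinuousLinearMap.adjoint B q⟫ := by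
      rw [id, ContinuousLinearMap.adjoint_inner_right]
    by_cases hz : z ∈ Metric.ball (0 : U) 1
    · have i3 : Integrable fun x => fderiv ℝ φ x (B z) • character q x :=
        integrable_smul_of_hasCompactSupport (contDiff_fderiv_apply hφ _).continuous
          (hc.fderiv_apply (𝕜 := ℝ) _) hG.continuous
      simp only [jumpTerm, levyKernel, Set.indicator_of_mem hz, add_smul, sub_smul]
      have i4 : Integrable fun x => φ (x - B z) • character q x - φ x • character q x := hi'.sub hi
      rw [integral_add i4 i3, integral_sub hi' hi, e1, h1 (B z) φ hφ hc, e2, e3]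
      ring
    · simp only [jumpTerm, levyKernel, Set.indicator_of_notMem hz, add_zero, sub_smul]
      rw [integral_sub hi' hi, e1, e2]
      ring
  rw [integral_ouDual_smul A B b v hφ hc hν hG.continuous (fun x => (norm_character q x).le),
    h1 (B b) φ hφ hc, integral_drift_smul A hφ hc hG]
  simp_rw [h2, h3, integral_mul_const, fderiv_character]
  rw [noiseExponent, ← Finset.sum_mul, Finset.sum_neg_distrib]
  simp only [ContinuousLinearMap.adjoint_inner_right, Complex.real_smul]
  push_cast
  ring

end Adjoint

/-! ### Existence of weak solutions -/

section SignedMeasures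

variable {E : Type*} [NormedAddCommGroup E] [InnerProductSpace ℝ E] [FiniteDimensional ℝ E]
  [MeasurableSpace E] [BorelSpace E]
variable {X X' : Type*} [MeasurableSpace X] [MeasurableSpace X'] {m : Measure X} {m' : Measure X'}

/-- The image under `Y` of the positive part of the measure of density `H`. -/
def posPart (m : Measure X) (H : X → ℝ) (Y : X → E) : Measure E :=
  (m.withDensity fun x => ENNReal.ofReal (H x)).map Y

theorem isFiniteMeasure_posPart {H : X → ℝ} (hH : Integrable H m) (Y : X → E) :
    IsFiniteMeasure (posPart m H Y) := by
  have := isFiniteMeasure_withDensity_ofReal hH.2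
  unfold posPart
  infer_instance

theorem integral_posPart {V : Type*} [NormedAddCommGroup V] [NormedSpace ℝ V] {H : X → ℝ}
    (hH : Integrable H m) {Y : X → E} (hY : Measurable Y) {G : E → V} (hG : StronglyMeasurable G) :
    ∫ y, G y ∂posPart m H Y = ∫ x, max (H x) 0 • G (Y x) ∂m := by
  rw [posPart, integral_map hY.aemeasurable hG.aestronglyMeasurable,
    integral_withDensity_eq_integral_toReal_smul₀ hH.1.aemeasurable.ennreal_ofReal
      (Eventually.of_forall fun x => ENNReal.ofReal_lt_top)]
  simp only [ENNReal.toReal_ofReal']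

theorem integral_posPart_sub {V : Type*} [NormedAddCommGroup V] [NormedSpace ℝ V] {H : X → ℝ}
    (hH : Integrable H m) {Y : X → E} (hY : Measurable Y) {G : E → V} {K : ℝ}
    (hG : StronglyMeasurable G) (hGK : ∀ y, ‖G y‖ ≤ K) :
    ∫ y, G y ∂posPart m H Y - ∫ y, G y ∂posPart m (-H) Y = ∫ x, H x • G (Y x) ∂m := by
  have hGY : AEStronglyMeasurable (fun x => G (Y x)) m :=
    (hG.comp_measurable hY).aestronglyMeasurable
  have h1 : Integrable (fun x => max (H x) 0 • G (Y x)) m :=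
    hH.pos_part.smul_bdd K hGY (Eventually.of_forall fun x => hGK _)
  have h2 : Integrable (fun x => max ((-H) x) 0 • G (Y x)) m :=
    hH.neg.pos_part.smul_bdd K hGY (Eventually.of_forall fun x => hGK _)
  rw [integral_posPart hH hY hG, integral_posPart hH.neg hY hG, ← integral_sub h1 h2]
  refine integral_congr_ae (Eventually.of_forall fun x => ?_)
  simp only [← sub_smul, Pi.neg_apply]
  congr 1
  rcases le_total (H x) 0 with h | h
  · rw [max_eq_right h, max_eq_left (by linarith)]
    ring
  · rw [max_eq_left h, max_eq_right (by linarith)]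
    ring

theorem stronglyMeasurable_character (q : E) : StronglyMeasurable (character q) :=
  (contDiff_character q).continuous.stronglyMeasurable

/-- Two image measures with integrable signed densities agree as soon as their characteristic
functions do. -/
theorem integral_mul_comp_eq_of_character {H : X → ℝ} {H' : X' → ℝ} (hH : Integrable H m)
    (hH' : Integrable H' m') {Y : X → E} {Y' : X' → E} (hY : Measurable Y) (hY' : Measurable Y')
    (h : ∀ q, ∫ x, H x • character q (Y x) ∂m = ∫ x, H' x • character q (Y' x) ∂m')
    {g : E → ℝ} {K : ℝ} (hgm : Measurable g) (hg : ∀ y, |g y| ≤ K) :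
    ∫ x, H x * g (Y x) ∂m = ∫ x, H' x * g (Y' x) ∂m' := by
  have f1 := isFiniteMeasure_posPart hH Y
  have f2 := isFiniteMeasure_posPart hH.neg Y
  have f3 := isFiniteMeasure_posPart hH' Y'
  have f4 := isFiniteMeasure_posPart hH'.neg Y'
  -- The negative parts are moved across, so that both sides are finite positive measures and
  -- uniqueness of characteristic functions applies.
  have key : posPart m H Y + posPart m' (-H') Y' = posPart m (-H) Y + posPart m' H' Y' := by
    refine Measure.ext_of_charFun (funext fun q => ?_)
    have hc : ∀ (P : Measure E) [IsFiniteMeasure P], Integrable (character q) P := fun P _ =>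
      Integrable.of_bound (stronglyMeasurable_character q).aestronglyMeasurable 1
        (Eventually.of_forall fun x => (norm_character q x).le)
    have e1 : ∀ P : Measure E, charFun P q = ∫ y, character q y ∂P := fun P => rfl
    rw [e1, e1, integral_add_measure (hc _) (hc _), integral_add_measure (hc _) (hc _)]
    have h1 := integral_posPart_sub hH hY (stronglyMeasurable_character q)
      (fun y => (norm_character q y).le)
    have h2 := integral_posPart_sub hH' hY' (stronglyMeasurable_character q)
      (fun y => (norm_character q y).le)
    rw [h q, ← h2] at h1
    linear_combination h1
  have hgi : ∀ (P : Measure E) [IsFiniteMeasure P], Integrable g P := fun P _ =>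
    Integrable.of_bound hgm.aestronglyMeasurable K (Eventually.of_forall hg)
  have h1 := integral_posPart_sub hH hY hgm.stronglyMeasurable hg
  have h2 := integral_posPart_sub hH' hY' hgm.stronglyMeasurable hg
  have h3 := congrArg (fun P : Measure E => ∫ y, g y ∂P) key
  rw [integral_add_measure (hgi _) (hgi _), integral_add_measure (hgi _) (hgi _)] at h3
  simp only [smul_eq_mul] at h1 h2
  rw [← h1, ← h2]
  linarith

end SignedMeasures

/-! ### The resolvent solves the weak equation -/

section WeakSolution

variable {E : Type*} [NormedAddCommGroup E] [InnerProductSpace ℝ E] [FiniteDimensional ℝ E]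
  [MeasurableSpace E] [BorelSpace E]
variable {U : Type*} [NormedAddCommGroup U] [InnerProductSpace ℝ U] [FiniteDimensional ℝ U]
  [MeasurableSpace U] [BorelSpace U]
variable {ι : Type*} [Fintype ι]
variable (A : E →L[ℝ] E) (B : U →L[ℝ] E) (b : U) (v : ι → U) {ν : Measure U} [SigmaFinite ν]
  (hν : Integrable (levyWeight id (Metric.ball 0 1)) ν)
  {φ : E → ℝ} (hφ : ContDiff ℝ (⊤ : ℕ∞) φ) (hc : HasCompactSupport φ)

/-- The law of the noise as a kernel. -/
def ouKernel : Kernel ℝ E := ⟨fun t => (ouLaw A B b v ν t : Measure E), measurable_ouLaw A B b v hν⟩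

instance : IsMarkovKernel (ouKernel A B b v hν) :=
  ⟨fun t => inferInstanceAs (IsProbabilityMeasure (ouLaw A B b v ν t : Measure E))⟩

variable (ν) in
/-- The exponent of the noise along the adjoint flow. -/
def flowExponent (p : E) (s : ℝ) : ℂ :=
  noiseExponent b v ν (ContinuousLinearMap.adjoint B (ContinuousLinearMap.adjoint (flow A s) p))

include hν in
theorem continuous_flowExponent (p : E) : Continuous (flowExponent A B b v ν p) := by
  have h1 : Continuous fun s => ContinuousLinearMap.adjoint (flow A s) :=
    ContinuousLinearMap.adjoint.continuous.comp (continuous_flow A)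
  exact (continuous_noiseExponent b v hν).comp
    ((ContinuousLinearMap.adjoint B).continuous.comp (h1.clm_apply continuous_const))

-- The law of e^{tA}Y_t. Reversing time, s ↦ t - s, removes t from the integrand, which makes the
-- exponent differentiable in t by the fundamental theorem of calculus.
include hν in
theorem charFun_ouLaw_adjoint {t : ℝ} (ht : 0 ≤ t) (p : E) :
    charFun (ouLaw A B b v ν t : Measure E) (ContinuousLinearMap.adjoint (flow A t) p)
      = Complex.exp (∫ s in 0..t, flowExponent A B b v ν p s) := by
  rw [charFun_ouLaw A B b v hν, max_eq_left ht, ouExponent]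
  congr 1
  have h1 : ∀ s, noiseExponent b v ν (ContinuousLinearMap.adjoint (flow A (-s) ∘L B)
      (ContinuousLinearMap.adjoint (flow A t) p)) = flowExponent A B b v ν p (t - s) := by
    intro s
    rw [flowExponent, sub_eq_add_neg, flow_add, ContinuousLinearMap.adjoint_comp]
    congr 1
    change _ = ContinuousLinearMap.adjoint B (ContinuousLinearMap.adjoint (flow A t ∘L flow A (-s)) p)
    rw [ContinuousLinearMap.adjoint_comp]
    rfl
  simp_rw [h1]
  rw [intervalIntegral.integral_comp_sub_left (fun s => flowExponent A B b v ν p s)]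
  simp

/-- The Fourier transform of a test function. -/
def fourierTest (φ : E → ℝ) (q : E) : ℂ := ∫ x, φ x • character q x

-- The derivative falls on the character only, and the compact support of φ dominates it. The
-- resulting integral is the drift term that remains in the Fourier transform of the adjoint.
include hφ hc in
theorem hasDerivAt_fourierTest_flow (p : E) (t : ℝ) :
    HasDerivAt (fun t => fourierTest φ (ContinuousLinearMap.adjoint (flow A t) p))
      (∫ x, φ x • (((⟪A x, ContinuousLinearMap.adjoint (flow A t) p⟫ : ℝ) : ℂ) * Complex.I
        * character (ContinuousLinearMap.adjoint (flow A t) p) x)) t := by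
  obtain ⟨M, hM1, hM⟩ := exists_norm_flow_le A (|t| + 1)
  refine (hasDerivAt_integral_of_dominated_loc_of_deriv_le (s := Metric.ball t 1)
    (F := fun t x => φ x • character (ContinuousLinearMap.adjoint (flow A t) p) x)
    (F' := fun t x => φ x • (((⟪A x, ContinuousLinearMap.adjoint (flow A t) p⟫ : ℝ) : ℂ) * Complex.I
        * character (ContinuousLinearMap.adjoint (flow A t) p) x))
    (bound := fun x => ‖φ x • (M * ‖A x‖ * ‖p‖)‖)
    (Metric.ball_mem_nhds t one_pos) (Eventually.of_forall fun s => ?_) ?_ ?_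
    (Eventually.of_forall fun x s hs => ?_) ?_ (Eventually.of_forall fun x s hs => ?_)).2
  · exact (hφ.continuous.smul (contDiff_character _).continuous).aestronglyMeasurable
  · exact integrable_smul_of_hasCompactSupport hφ.continuous hc (contDiff_character _).continuous
  · refine (hφ.continuous.smul (Continuous.mul (Continuous.mul ?_ continuous_const)
      (contDiff_character _).continuous)).aestronglyMeasurable
    exact Complex.continuous_ofReal.comp (A.continuous.inner continuous_const)
  · have hs' : |s| ≤ |t| + 1 := by
      have h1 : |s - t| < 1 := by rwa [← Real.dist_eq]
      have := abs_sub_abs_le_abs_sub s t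
      linarith
    rw [norm_smul, norm_smul, norm_mul, norm_mul, norm_character, Complex.norm_I, mul_one, mul_one,
      Complex.norm_real]
    refine mul_le_mul_of_nonneg_left ?_ (norm_nonneg _)
    rw [ContinuousLinearMap.adjoint_inner_right]
    refine (norm_inner_le_norm _ _).trans (le_trans ?_ (le_abs_self _))
    gcongr
    exact (flow A s).le_of_opNorm_le (hM s hs') _
  · refine (integrable_smul_of_hasCompactSupport hφ.continuous hc ?_).norm
    fun_prop
  · have h3 : HasDerivAt (fun s => (⟪x, ContinuousLinearMap.adjoint (flow A s) p⟫ : ℝ))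
        (⟪A x, ContinuousLinearMap.adjoint (flow A s) p⟫ : ℝ) s := by
      simp_rw [ContinuousLinearMap.adjoint_inner_right]
      have h4 := (((hasDerivAt_flow A s).clm_apply (hasDerivAt_const s x)).inner ℝ
        (hasDerivAt_const s p))
      convert! h4 using 1
      simp
    have h6 := ((h3.ofReal_comp.mul_const Complex.I).cexp).const_smul (φ x)
    convert! h6 using 1
    simp only [character]
    ring_nf

include hφ hc in
theorem norm_fourierTest_le (q : E) : ‖fourierTest φ q‖ ≤ ∫ x, ‖φ x‖ := by
  refine norm_integral_le_of_norm_le (hφ.continuous.integrable_of_hasCompactSupport hc).norm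
    (Eventually.of_forall fun x => ?_)
  rw [norm_smul, norm_character, mul_one]

/-- The density `λ φ - 𝓛^* φ` tested against weak solutions. -/
def dualTest (lam : ℝ) (φ : E → ℝ) (x : E) : ℝ := lam * φ x - ouDual A B b v ν φ x

include hφ hc hν in
theorem integrable_dualTest (lam : ℝ) : Integrable (dualTest (ν := ν) A B b v lam φ) :=
  ((hφ.continuous.integrable_of_hasCompactSupport hc).const_mul lam).sub
    (integrable_ouDual A B b v hφ hc hν)

include hφ hc hν in
theorem fourierTest_dualTest (lam : ℝ) (q : E) :
    fourierTest (dualTest (ν := ν) A B b v lam φ) q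
      = (lam - noiseExponent b v ν (ContinuousLinearMap.adjoint B q)) * fourierTest φ q
        - ∫ x, φ x • (((⟪A x, q⟫ : ℝ) : ℂ) * Complex.I * character q x) := by
  have h1 := integral_ouDual_character A B b v hφ hc hν q
  have i1 : Integrable fun x => φ x • character q x :=
    integrable_smul_of_hasCompactSupport hφ.continuous hc (contDiff_character _).continuous
  have i2 : Integrable fun x => ouDual A B b v ν φ x • character q x :=
    (integrable_ouDual A B b v hφ hc hν).smul_bdd 1
      (stronglyMeasurable_character q).aestronglyMeasurable
      (Eventually.of_forall fun x => (norm_character q x).le)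
  have h2 : fourierTest (dualTest (ν := ν) A B b v lam φ) q
      = (lam : ℂ) * fourierTest φ q - ∫ x, ouDual A B b v ν φ x • character q x := by
    rw [fourierTest, fourierTest, ← integral_const_mul, ← integral_sub (i1.const_mul _) i2]
    refine integral_congr_ae (Eventually.of_forall fun x => ?_)
    simp only [dualTest, Complex.real_smul]
    push_cast
    ring
  rw [h2, h1, fourierTest]
  ring

/-- The Fourier transform of the test function along the adjoint flow, with the discount factor. -/
def discountedFourier (lam : ℝ) (φ : E → ℝ) (p : E) (t : ℝ) : ℂ :=
  (Real.exp (-lam * t) : ℂ) * Complex.exp (∫ s in 0..t, flowExponent A B b v ν p s)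
    * fourierTest φ (ContinuousLinearMap.adjoint (flow A t) p)

-- In the product rule the three factors contribute -λ, the exponent of the noise and the drift
-- term; together they form minus the Fourier transform of λφ - (L^{ou})*φ along the adjoint flow.
include hφ hc hν in
theorem hasDerivAt_discountedFourier (lam : ℝ) (p : E) (t : ℝ) :
    HasDerivAt (discountedFourier (ν := ν) A B b v lam φ p)
      (-discountedFourier (ν := ν) A B b v lam (dualTest (ν := ν) A B b v lam φ) p t) t := by
  have h1 : HasDerivAt (fun t : ℝ => (Real.exp (-lam * t) : ℂ))
      ((Real.exp (-lam * t) * -lam : ℝ) : ℂ) t := by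
    have := ((hasDerivAt_id t).const_mul (-lam)).exp.ofReal_comp
    rwa [mul_one] at this
  have h2 : HasDerivAt (fun t : ℝ => Complex.exp (∫ s in 0..t, flowExponent A B b v ν p s))
      (Complex.exp (∫ s in 0..t, flowExponent A B b v ν p s) * flowExponent A B b v ν p t) t :=
    ((continuous_flowExponent A B b v hν p).integral_hasStrictDerivAt 0 t).hasDerivAt.cexp
  have h3 := hasDerivAt_fourierTest_flow A hφ hc p t
  convert! (h1.mul h2).mul h3 using 1
  rw [discountedFourier, fourierTest_dualTest A B b v hν hφ hc, flowExponent]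
  simp only [Pi.mul_apply]
  push_cast
  ring

include hν in
theorem norm_exp_flowExponent_le {t : ℝ} (ht : 0 ≤ t) (p : E) :
    ‖Complex.exp (∫ s in 0..t, flowExponent A B b v ν p s)‖ ≤ 1 := by
  rw [← charFun_ouLaw_adjoint A B b v hν ht]
  exact norm_charFun_le_one _

include hν in
theorem norm_discountedFourier_le {lam : ℝ} {ψ : E → ℝ} {M : ℝ} (hM : ∀ q, ‖fourierTest ψ q‖ ≤ M)
    {t : ℝ} (ht : 0 ≤ t) (p : E) :
    ‖discountedFourier (ν := ν) A B b v lam ψ p t‖ ≤ Real.exp (-lam * t) * M := by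
  rw [discountedFourier, norm_mul, norm_mul, Complex.norm_real,
    Real.norm_of_nonneg (Real.exp_pos _).le, mul_assoc]
  refine mul_le_mul_of_nonneg_left ?_ (Real.exp_pos _).le
  exact (mul_le_of_le_one_left (norm_nonneg _) (norm_exp_flowExponent_le A B b v hν ht p)).trans
    (hM _)

-- Fundamental theorem of calculus on (0,∞): the boundary term at infinity is killed by the
-- discount, since the other two factors are bounded, and the one at 0 is the Fourier transform of
-- φ.
include hφ hc hν in
theorem integral_discountedFourier {lam : ℝ} (hlam : 0 < lam) (p : E) :
    ∫ t in Set.Ioi (0 : ℝ), discountedFourier (ν := ν) A B b v lam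
      (dualTest (ν := ν) A B b v lam φ) p t = fourierTest φ p := by
  have hd := hasDerivAt_discountedFourier A B b v hν hφ hc lam p
  have i0 : Integrable (fun t : ℝ => Real.exp (-lam * t)) (volume.restrict (Set.Ioi 0)) :=
    integrableOn_exp_mul_Ioi (a := -lam) (by linarith) 0
  have hh : ∀ q, ‖fourierTest (dualTest (ν := ν) A B b v lam φ) q‖
      ≤ ∫ x, ‖dualTest (ν := ν) A B b v lam φ x‖ := fun q => by
    refine norm_integral_le_of_norm_le (integrable_dualTest A B b v hν hφ hc lam).norm
      (Eventually.of_forall fun x => ?_)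
    rw [norm_smul, norm_character, mul_one]
  have h1 : IntegrableOn (fun t => -discountedFourier (ν := ν) A B b v lam
      (dualTest (ν := ν) A B b v lam φ) p t) (Set.Ioi 0) := by
    refine (i0.mul_const (∫ x, ‖dualTest (ν := ν) A B b v lam φ x‖)).mono' ?_ ?_
    · have e : (fun t => -discountedFourier (ν := ν) A B b v lam
          (dualTest (ν := ν) A B b v lam φ) p t)
          = deriv (discountedFourier (ν := ν) A B b v lam φ p) :=
        funext fun t => ((hd t).deriv).symm
      rw [e]
      exact (measurable_deriv _).aestronglyMeasurable
    · filter_upwards [ae_restrict_mem measurableSet_Ioi] with t ht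
      rw [norm_neg]
      exact norm_discountedFourier_le A B b v hν hh (le_of_lt ht) p
  have h2 : Tendsto (discountedFourier (ν := ν) A B b v lam φ p) atTop (𝓝 0) := by
    have h3 : Tendsto (fun t : ℝ => Real.exp (-lam * t) * ∫ x, ‖φ x‖) atTop (𝓝 0) := by
      have h4 : Tendsto (fun T : ℝ => -lam * T) atTop atBot :=
        tendsto_id.const_mul_atTop_of_neg (by linarith)
      simpa using (Real.tendsto_exp_atBot.comp h4).mul_const (∫ x, ‖φ x‖)
    refine squeeze_zero_norm' ?_ h3
    filter_upwards [eventually_ge_atTop 0] with t ht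
    exact norm_discountedFourier_le A B b v hν (norm_fourierTest_le hφ hc) ht p
  have h5 := integral_Ioi_of_hasDerivAt_of_tendsto (a := 0) (hd 0).continuousAt.continuousWithinAt
    (fun t _ => hd t) h1 h2
  rw [integral_neg, zero_sub, neg_inj] at h5
  rw [h5, discountedFourier]
  have h6 : ContinuousLinearMap.adjoint (flow A 0) p = p := by
    rw [flow_zero, ContinuousLinearMap.one_def, ContinuousLinearMap.adjoint_id]
    rfl
  rw [h6]
  simp

/-- The space-time-noise measure. -/
def spaceTimeNoise : Measure ((ℝ × E) × E) :=
  (((volume : Measure ℝ).restrict (Set.Ioi 0)) ⊗ₘ ouKernel A B b v hν).prod volume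

/-- The position of the Ornstein–Uhlenbeck process as a function of time, noise and starting
point. -/
def ouPosition (q : (ℝ × E) × E) : E := flow A q.1.1 (q.2 + q.1.2)

theorem measurable_ouPosition : Measurable (ouPosition A) := by
  have h : Continuous fun q : (ℝ × E) × E => flow A q.1.1 (q.2 + q.1.2) :=
    ((continuous_flow A).comp (continuous_fst.comp continuous_fst)).clm_apply
      (continuous_snd.add (continuous_snd.comp continuous_fst))
  exact h.measurable

theorem integrable_spaceTimeNoise {lam : ℝ} (hlam : 0 < lam) {h : E → ℝ} (hh : Integrable h) :
    Integrable (fun q : (ℝ × E) × E => Real.exp (-lam * q.1.1) * h q.2)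
      (spaceTimeNoise A B b v hν) := by
  have i0 : Integrable (fun t : ℝ => Real.exp (-lam * t)) (volume.restrict (Set.Ioi 0)) :=
    integrableOn_exp_mul_Ioi (a := -lam) (by linarith) 0
  rw [← Measure.fst_compProd ((volume : Measure ℝ).restrict (Set.Ioi 0)) (ouKernel A B b v hν)] at i0
  exact (i0.comp_measurable measurable_fst).mul_prod hh

variable {V : Type*} [NormedAddCommGroup V] [NormedSpace ℝ V] [CompleteSpace V]

theorem integrable_spaceTimeNoise_smul {lam : ℝ} (hlam : 0 < lam) {h : E → ℝ} (hh : Integrable h)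
    {G : E → V} {K : ℝ} (hG : StronglyMeasurable G) (hGK : ∀ y, ‖G y‖ ≤ K) :
    Integrable (fun q : (ℝ × E) × E => (Real.exp (-lam * q.1.1) * h q.2) • G (ouPosition A q))
      (spaceTimeNoise A B b v hν) :=
  (integrable_spaceTimeNoise A B b v hν hlam hh).smul_bdd K
    (hG.comp_measurable (measurable_ouPosition A)).aestronglyMeasurable
    (Eventually.of_forall fun _ => hGK _)

theorem integral_spaceTimeNoise_time {lam : ℝ} (hlam : 0 < lam) {h : E → ℝ} (hh : Integrable h)
    {G : E → V} {K : ℝ} (hG : StronglyMeasurable G) (hGK : ∀ y, ‖G y‖ ≤ K) :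
    ∫ q, (Real.exp (-lam * q.1.1) * h q.2) • G (ouPosition A q) ∂spaceTimeNoise A B b v hν
      = ∫ t in Set.Ioi (0 : ℝ), Real.exp (-lam * t) •
        ∫ y, (∫ x, h x • G (flow A t (x + y))) ∂(ouLaw A B b v ν t : Measure E) := by
  have hi := integrable_spaceTimeNoise_smul A B b v hν hlam hh hG hGK
  rw [spaceTimeNoise, integral_prod _ hi, Measure.integral_compProd hi.integral_prod_left]
  refine integral_congr_ae (Eventually.of_forall fun t => ?_)
  simp only [mul_smul, integral_smul, ouPosition]
  rfl

/-- Integrating time and noise first produces the resolvent; the opposite order, in which space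
comes first, produces Fourier transforms of the test function. -/
theorem integral_spaceTimeNoise_space {lam : ℝ} (hlam : 0 < lam) {h : E → ℝ} (hh : Integrable h)
    {g : E → ℝ} {K : ℝ} (hg : Measurable g) (hgK : ∀ y, |g y| ≤ K) :
    ∫ q, (Real.exp (-lam * q.1.1) * h q.2) * g (ouPosition A q) ∂spaceTimeNoise A B b v hν
      = ∫ x, ouResolvent A B b v ν lam g x * h x := by
  have hi := integrable_spaceTimeNoise_smul A B b v hν hlam hh hg.stronglyMeasurable hgK
  simp only [smul_eq_mul] at hi
  rw [spaceTimeNoise, integral_prod_symm _ hi]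
  refine integral_congr_ae ?_
  filter_upwards [hi.prod_left_ae] with x hx
  rw [Measure.integral_compProd hx, ouResolvent, ← integral_mul_const]
  refine integral_congr_ae (Eventually.of_forall fun t => ?_)
  simp only [ouPosition, ouSemigroup, integral_const_mul]
  rw [mul_right_comm]
  rfl

include hφ hc hν in
/-- The resolvent is a weak solution. -/
theorem integral_ouResolvent_mul_dualTest {lam : ℝ} (hlam : 0 < lam) {g : E → ℝ} {K : ℝ}
    (hg : Measurable g) (hgK : ∀ y, |g y| ≤ K) :
    ∫ x, ouResolvent A B b v ν lam g x * dualTest (ν := ν) A B b v lam φ x = ∫ x, φ x * g x := by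
  have hh := integrable_dualTest A B b v hν hφ hc lam
  rw [← integral_spaceTimeNoise_space A B b v hν hlam hh hg hgK]
  -- Both sides are integrals of g against image measures with signed densities, so g may be
  -- replaced by characters.
  refine integral_mul_comp_eq_of_character (Y' := id)
    (integrable_spaceTimeNoise A B b v hν hlam hh)
    (hφ.continuous.integrable_of_hasCompactSupport hc) (measurable_ouPosition A) measurable_id
    (fun p => ?_) hg hgK
  rw [integral_spaceTimeNoise_time A B b v hν hlam hh (stronglyMeasurable_character p)
    (fun y => (norm_character p y).le)]
  refine Eq.trans ?_ (integral_discountedFourier A B b v hν hφ hc hlam p)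
  refine setIntegral_congr_fun measurableSet_Ioi fun t ht => ?_
  have e1 : ∀ x y, character p (flow A t (x + y))
      = character (ContinuousLinearMap.adjoint (flow A t) p) x
        * character (ContinuousLinearMap.adjoint (flow A t) p) y := by
    intro x y
    rw [← character_add, character, character, ContinuousLinearMap.adjoint_inner_right]
  have e2 : ∀ y, ∫ x, dualTest (ν := ν) A B b v lam φ x • character p (flow A t (x + y))
      = fourierTest (dualTest (ν := ν) A B b v lam φ) (ContinuousLinearMap.adjoint (flow A t) p)
        * character (ContinuousLinearMap.adjoint (flow A t) p) y := by
    intro y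
    rw [fourierTest, ← integral_mul_const]
    refine integral_congr_ae (Eventually.of_forall fun x => ?_)
    simp only [e1, Complex.real_smul]
    ring
  simp only [e2]
  rw [integral_const_mul, discountedFourier,
    ← charFun_ouLaw_adjoint A B b v hν (le_of_lt ht), Complex.real_smul, mul_assoc]
  congr 1
  rw [mul_comm]
  rfl

end WeakSolution

/-! ### Uniqueness of weak solutions -/

section MaximumPrinciple

variable {E : Type*} [NormedAddCommGroup E] [InnerProductSpace ℝ E] [FiniteDimensional ℝ E]
  [MeasurableSpace E] [BorelSpace E]
variable {U : Type*} [NormedAddCommGroup U] [InnerProductSpace ℝ U] [FiniteDimensional ℝ U]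
  [MeasurableSpace U] [BorelSpace U]
variable {ι : Type*} [Fintype ι]

/-- Along a line, a positive second derivative at a maximum would make the point a local minimum as
well; the function would be locally constant and its second derivative zero. -/
theorem fderiv_fderiv_nonpos_of_isMax {F : E → ℝ} (hF : ContDiff ℝ (⊤ : ℕ∞) F) {x : E}
    (hx : ∀ y, F y ≤ F x) (e : E) : fderiv ℝ (fun y => fderiv ℝ F y e) x e ≤ 0 := by
  by_contra! hpos
  have hFd := hF.differentiable (by simp)
  have hFe := (contDiff_fderiv_apply hF e).differentiable (by simp)
  have hline : ∀ t : ℝ, HasDerivAt (fun t : ℝ => x + t • e) e t := fun t => by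
    simpa using ((hasDerivAt_id t).smul_const e).const_add x
  let f : ℝ → ℝ := fun t => F (x + t • e)
  have h1 : ∀ t, HasDerivAt f (fderiv ℝ F (x + t • e) e) t := fun t =>
    (hFd _).hasFDerivAt.comp_hasDerivAt t (hline t)
  have h2 : deriv f = fun t => fderiv ℝ F (x + t • e) e := funext fun t => (h1 t).deriv
  have h3 : deriv (deriv f) 0 = fderiv ℝ (fun y => fderiv ℝ F y e) x e := by
    rw [h2]
    have h := (hFe (x + (0 : ℝ) • e)).hasFDerivAt.comp_hasDerivAt 0 (hline 0)
    have h' := h.deriv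
    rw [zero_smul, add_zero] at h'
    exact h'
  have hmax : IsLocalMax f 0 := Eventually.of_forall fun t => by
    simp only [f, zero_smul, add_zero]
    exact hx _
  have hmin := isLocalMin_of_deriv_deriv_pos (f := f) (x₀ := 0) (by rw [h3]; exact hpos)
    hmax.deriv_eq_zero (h1 0).continuousAt
  have hconst : ∀ᶠ t in 𝓝 (0 : ℝ), f t = f 0 := by
    filter_upwards [hmax, hmin] with t ht ht'
    exact le_antisymm ht ht'
  have h4 : deriv f =ᶠ[𝓝 0] deriv fun _ => f 0 := Filter.EventuallyEq.deriv hconst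
  have h5 := h4.deriv_eq
  rw [h3] at h5
  simp at h5
  linarith

/-- A smooth cutoff function and bounds for its derivatives. -/
theorem exists_cutoff (E : Type*) [NormedAddCommGroup E] [InnerProductSpace ℝ E]
    [FiniteDimensional ℝ E] : ∃ (ψ : E → ℝ) (M : ℝ), ContDiff ℝ (⊤ : ℕ∞) ψ ∧ HasCompactSupport ψ ∧
      ψ 0 = 1 ∧ (∀ x, 0 ≤ ψ x) ∧ (∀ x, ψ x ≤ 1) ∧ (∀ x, 1 ≤ ‖x‖ → ψ x = 0) ∧ 0 ≤ M ∧
      (∀ x e, |fderiv ℝ ψ x e| ≤ M * ‖e‖) ∧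
      (∀ x e, |fderiv ℝ (fun y => fderiv ℝ ψ y e) x e| ≤ M * ‖e‖ ^ 2) ∧
      ∀ x y, |ψ (x - y) - ψ x + fderiv ℝ ψ x y| ≤ M * ‖y‖ ^ 2 := by
  let f : ContDiffBump (0 : E) := ⟨1 / 2, 1, by norm_num, by norm_num⟩
  have hf : ContDiff ℝ (⊤ : ℕ∞) f := f.contDiff
  have hc : HasCompactSupport f := f.hasCompactSupport
  obtain ⟨M₁, hM₁⟩ := (hf.continuous_fderiv (by simp)).bounded_above_of_compact_support
    (hc.fderiv (𝕜 := ℝ))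
  have hd : ContDiff ℝ (⊤ : ℕ∞) (fderiv ℝ f) :=
    hf.fderiv_right (m := (⊤ : ℕ∞)) (by exact_mod_cast le_top)
  obtain ⟨M₂, hM₂⟩ := (hd.continuous_fderiv (by simp)).bounded_above_of_compact_support
    ((hc.fderiv (𝕜 := ℝ)).fderiv (𝕜 := ℝ))
  obtain ⟨M₃, hM₃0, hM₃⟩ := exists_abs_taylor_one_le hf hc
  have h1 := (norm_nonneg _).trans (hM₁ 0)
  have h2 := (norm_nonneg _).trans (hM₂ 0)
  refine ⟨f, M₁ + M₂ + M₃, hf, hc, f.one_of_mem_closedBall (by simp [f]), fun x => f.nonneg,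
    fun x => f.le_one, fun x hx => f.zero_of_le_dist (by simpa [f] using hx), by positivity,
    fun x e => ?_, fun x e => ?_, fun x y => ?_⟩
  · refine ((fderiv ℝ f x).le_of_opNorm_le (hM₁ x) e).trans ?_
    gcongr
    linarith
  · have h3 : fderiv ℝ (fun y => fderiv ℝ f y e) x e = fderiv ℝ (fderiv ℝ f) x e e := by
      rw [fderiv_clm_apply (hd.differentiable (by simp) x) (differentiableAt_const e)]
      simp
    rw [h3]
    refine (((fderiv ℝ (fderiv ℝ f) x e).le_opNorm e).trans (mul_le_mul_of_nonneg_right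
      ((fderiv ℝ (fderiv ℝ f) x).le_of_opNorm_le (hM₂ x) e) (norm_nonneg e))).trans ?_
    rw [mul_assoc, ← sq]
    gcongr
    linarith
  · refine (hM₃ x y).trans ?_
    gcongr
    linarith

variable (A : E →L[ℝ] E) (B : U →L[ℝ] E) (b : U) (v : ι → U) (ν : Measure U)

/-- The Ornstein–Uhlenbeck operator. -/
def ouOperator (W : E → ℝ) (x : E) : ℝ :=
  1 / 2 * ∑ j, fderiv ℝ (fun y => fderiv ℝ W y (B (v j))) x (B (v j)) + fderiv ℝ W x (B b)
    + ∫ z, jumpTerm (-B) W z x ∂ν + fderiv ℝ W x (A x)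

variable {ν}

/-- The maximum principle on the whole space. -/
theorem le_div_of_subsolution (hν : Integrable (levyWeight id (Metric.ball 0 1)) ν) {W : E → ℝ}
    {lam M R : ℝ} (hlam : 0 < lam) (hW : ContDiff ℝ (⊤ : ℕ∞) W) (hWM : ∀ x, W x ≤ M)
    (hj : ∀ x, Integrable (fun z => jumpTerm (-B) W z x) ν)
    (hsub : ∀ x, lam * W x ≤ ouOperator A B b v ν W x + R) (x : E) : W x ≤ R / lam := by
  obtain ⟨ψ, D, hψ, hψc, hψ0, hψn, hψ1, hψz, hD0, hD1, hD2, hD3⟩ := exists_cutoff E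
  have hbdd : BddAbove (Set.range W) := ⟨M, by rintro _ ⟨y, rfl⟩; exact hWM y⟩
  set s := ⨆ y, W y with hs
  have hWs : ∀ y, W y ≤ s := fun y => le_ciSup hbdd y
  set w₀ := ∫ z, levyWeight id (Metric.ball (0 : U) 1) z ∂ν with hw₀
  set Λ := 1 / 2 * ∑ j, D * ‖B (v j)‖ ^ 2 + D * ‖B b‖ + (1 + D * ‖B‖ ^ 2) * w₀ + 2 * (D * ‖A‖)
    with hΛ
  -- The constant Λ does not depend on δ, so letting δ tend to 0 gives λ sup W ≤ R.
  suffices key : ∀ δ, 0 < δ → lam * (s - δ) ≤ 2 * δ * Λ + R by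
    rw [le_div_iff₀ hlam, mul_comm]
    refine le_trans (mul_le_mul_of_nonneg_left (hWs x) hlam.le) ?_
    have h1 : Tendsto (fun δ : ℝ => lam * (s - δ)) (𝓝[>] 0) (𝓝 (lam * (s - 0))) :=
      (Continuous.tendsto (by fun_prop) 0).mono_left nhdsWithin_le_nhds
    have h2 : Tendsto (fun δ : ℝ => 2 * δ * Λ + R) (𝓝[>] 0) (𝓝 (2 * 0 * Λ + R)) :=
      (Continuous.tendsto (f := fun δ : ℝ => 2 * δ * Λ + R) (by fun_prop) 0).mono_left
        nhdsWithin_le_nhds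
    have h3 := le_of_tendsto_of_tendsto h1 h2
      (eventually_nhdsWithin_of_forall fun δ hδ => key δ hδ)
    simpa using h3
  intro δ hδ
  obtain ⟨x₀, hx₀⟩ : ∃ x₀, s - δ < W x₀ := exists_lt_of_lt_ciSup (by linarith)
  -- The cutoff has radius k comparable to |x₀|: its gradient is of order 1/k, while on its support
  -- |Ax| is at most 2k‖A‖. The unbounded drift therefore contributes a constant independent of x₀.
  set k : ℝ := 1 + ‖x₀‖ with hk
  have hk1 : 1 ≤ k := by linarith [norm_nonneg x₀]
  have hk0 : 0 < k := by linarith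
  have hki : k⁻¹ ≤ 1 := inv_le_one_of_one_le₀ hk1
  have hki0 : 0 < k⁻¹ := inv_pos.2 hk0
  -- The height 2δ lifts the value at x₀ above s + δ, whereas outside the ball the sum stays below
  -- s. The maximum is therefore attained, and W is still at least s - δ there.
  let Ψ : E → ℝ := fun y => 2 * δ * ψ (k⁻¹ • (y - x₀))
  have hΨ : ContDiff ℝ (⊤ : ℕ∞) Ψ :=
    contDiff_const.mul (hψ.comp (contDiff_const.smul (contDiff_id.sub contDiff_const)))
  have hscale : ∀ (χ : E → ℝ), Differentiable ℝ χ → ∀ (c : ℝ) y e,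
      fderiv ℝ (fun y => c * χ (k⁻¹ • (y - x₀))) y e
        = c * (k⁻¹ * fderiv ℝ χ (k⁻¹ • (y - x₀)) e) := by
    intro χ hχ c y e
    have h1 : HasFDerivAt (fun y : E => k⁻¹ • (y - x₀)) (k⁻¹ • ContinuousLinearMap.id ℝ E) y :=
      ((hasFDerivAt_id y).sub_const x₀).const_smul k⁻¹
    have h2 := ((hχ _).hasFDerivAt.comp y h1).const_mul c
    rw [show fderiv ℝ (fun y => c * χ (k⁻¹ • (y - x₀))) y = _ from h2.fderiv]
    simp
  have hΨ1 : ∀ y e, fderiv ℝ Ψ y e = 2 * δ * (k⁻¹ * fderiv ℝ ψ (k⁻¹ • (y - x₀)) e) :=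
    hscale ψ (hψ.differentiable (by simp)) (2 * δ)
  have hΨ2 : ∀ y e, fderiv ℝ (fun y => fderiv ℝ Ψ y e) y e
      = 2 * δ * (k⁻¹ * (k⁻¹ * fderiv ℝ (fun y => fderiv ℝ ψ y e) (k⁻¹ • (y - x₀)) e)) := by
    intro y e
    have h1 : (fun y => fderiv ℝ Ψ y e)
        = fun y => (2 * δ * k⁻¹) * (fun y => fderiv ℝ ψ y e) (k⁻¹ • (y - x₀)) := by
      funext y
      rw [hΨ1]
      ring
    rw [h1, hscale _ ((contDiff_fderiv_apply hψ e).differentiable (by simp))]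
    ring
  -- the perturbed function attains its maximum
  let F : E → ℝ := fun y => W y + Ψ y
  have hF : ContDiff ℝ (⊤ : ℕ∞) F := hW.add hΨ
  have hFx₀ : s + δ < F x₀ := by
    simp only [F, Ψ, sub_self, smul_zero, hψ0]
    linarith
  have hout : ∀ y, k ≤ ‖y - x₀‖ → F y ≤ s := by
    intro y hy
    have : Ψ y = 0 := by
      simp only [Ψ]
      rw [hψz, mul_zero]
      rw [norm_smul, Real.norm_of_nonneg hki0.le, inv_mul_eq_div, le_div_iff₀ hk0, one_mul]
      exact hy
    simp only [F, this, add_zero]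
    exact hWs y
  obtain ⟨x₁, hx₁k, hx₁⟩ : ∃ x₁ ∈ Metric.closedBall x₀ k, ∀ y ∈ Metric.closedBall x₀ k, F y ≤ F x₁ :=
    (isCompact_closedBall x₀ k).exists_isMaxOn ⟨x₀, Metric.mem_closedBall_self hk0.le⟩
      hF.continuous.continuousOn
  have hx₁0 := hx₁ x₀ (Metric.mem_closedBall_self hk0.le)
  have hmax : ∀ y, F y ≤ F x₁ := by
    intro y
    by_cases hy : y ∈ Metric.closedBall x₀ k
    · exact hx₁ y hy
    · rw [mem_closedBall_iff_norm, not_le] at hy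
      linarith [hout y hy.le]
  have hx₁n : ‖x₁‖ ≤ 2 * k := by
    rw [mem_closedBall_iff_norm] at hx₁k
    have := norm_le_norm_add_norm_sub' x₁ x₀
    linarith
  have hW1 : s - δ ≤ W x₁ := by
    have : Ψ x₁ ≤ 2 * δ * 1 := mul_le_mul_of_nonneg_left (hψ1 _) (by linarith)
    simp only [F] at hx₁0 hFx₀
    linarith
  have hadd1 : ∀ y e, fderiv ℝ F y e = fderiv ℝ W y e + fderiv ℝ Ψ y e := by
    intro y e
    have := fderiv_add (hW.differentiable (by simp) y) (hΨ.differentiable (by simp) y)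
    rw [show fderiv ℝ F y = _ from this]
    rfl
  have hadd2 : ∀ y e, fderiv ℝ (fun y => fderiv ℝ F y e) y e
      = fderiv ℝ (fun y => fderiv ℝ W y e) y e + fderiv ℝ (fun y => fderiv ℝ Ψ y e) y e := by
    intro y e
    have h1 : (fun y => fderiv ℝ F y e) = (fun y => fderiv ℝ W y e) + fun y => fderiv ℝ Ψ y e :=
      funext fun y => hadd1 y e
    rw [h1, fderiv_add ((contDiff_fderiv_apply hW e).differentiable (by simp) y)
      ((contDiff_fderiv_apply hΨ e).differentiable (by simp) y)]
    rfl
  have hDF : fderiv ℝ F x₁ = 0 :=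
    IsLocalMax.fderiv_eq_zero (Eventually.of_forall hmax)
  have hDW : ∀ e, fderiv ℝ W x₁ e = -fderiv ℝ Ψ x₁ e := fun e => by
    have := hadd1 x₁ e
    rw [hDF] at this
    simp only [zero_apply] at this
    linarith
  have hΨ1b : ∀ e, |fderiv ℝ Ψ x₁ e| ≤ 2 * δ * (k⁻¹ * (D * ‖e‖)) := by
    intro e
    rw [hΨ1, abs_mul (2 * δ), abs_mul k⁻¹, abs_of_pos hki0, abs_of_pos (by linarith : 0 < 2 * δ)]
    gcongr
    exact hD1 _ _
  have hgauss : ∀ j, fderiv ℝ (fun y => fderiv ℝ W y (B (v j))) x₁ (B (v j))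
      ≤ 2 * δ * (D * ‖B (v j)‖ ^ 2) := by
    intro j
    have h1 := fderiv_fderiv_nonpos_of_isMax hF hmax (B (v j))
    rw [hadd2, hΨ2] at h1
    have h2 : |2 * δ * (k⁻¹ * (k⁻¹ * fderiv ℝ (fun y => fderiv ℝ ψ y (B (v j)))
        (k⁻¹ • (x₁ - x₀)) (B (v j))))| ≤ 2 * δ * (1 * (1 * (D * ‖B (v j)‖ ^ 2))) := by
      rw [abs_mul (2 * δ), abs_mul k⁻¹, abs_mul k⁻¹, abs_of_pos hki0, abs_of_pos (by linarith : 0 < 2 * δ)]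
      gcongr
      exact hD2 _ _
    have h3 := neg_abs_le (2 * δ * (k⁻¹ * (k⁻¹ * fderiv ℝ (fun y => fderiv ℝ ψ y (B (v j)))
        (k⁻¹ • (x₁ - x₀)) (B (v j)))))
    linarith
  have hdrift : fderiv ℝ W x₁ (B b) ≤ 2 * δ * (D * ‖B b‖) := by
    rw [hDW]
    refine (neg_le_abs _).trans ((hΨ1b _).trans ?_)
    refine mul_le_mul_of_nonneg_left ?_ (by linarith)
    exact mul_le_of_le_one_left (by positivity) hki
  have hlin : fderiv ℝ W x₁ (A x₁) ≤ 2 * δ * (2 * (D * ‖A‖)) := by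
    rw [hDW]
    refine (neg_le_abs _).trans ((hΨ1b _).trans ?_)
    refine mul_le_mul_of_nonneg_left ?_ (by linarith)
    have h1 : ‖A x₁‖ ≤ ‖A‖ * (2 * k) := (A.le_opNorm _).trans (by gcongr)
    calc k⁻¹ * (D * ‖A x₁‖) ≤ k⁻¹ * (D * (‖A‖ * (2 * k))) := by gcongr
      _ = 2 * (D * ‖A‖) := by field_simp
  have hjump : ∀ z, jumpTerm (-B) W z x₁
      ≤ 2 * δ * ((1 + D * ‖B‖ ^ 2) * levyWeight id (Metric.ball 0 1) z) := by
    intro z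
    have h1 : W (x₁ - (-B) z) - W x₁ ≤ Ψ x₁ - Ψ (x₁ - (-B) z) := by
      have := hmax (x₁ - (-B) z)
      simp only [F] at this
      linarith
    have hDB : 0 ≤ D * ‖B‖ ^ 2 := by positivity
    by_cases hz : z ∈ Metric.ball (0 : U) 1
    · rw [jumpTerm, levyWeight, Set.indicator_of_mem hz, Set.indicator_of_mem hz,
        Set.indicator_of_notMem (Set.notMem_compl_iff.2 hz), add_zero, id, hDW, hΨ1]
      have h2 := hD3 (k⁻¹ • (x₁ - x₀)) (k⁻¹ • (-B) z)
      rw [map_smul, smul_eq_mul, ← smul_sub, norm_smul, Real.norm_of_nonneg hki0.le, mul_pow,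
        neg_apply, norm_neg] at h2
      have h3 : Ψ x₁ - Ψ (x₁ - (-B) z)
          + -(2 * δ * (k⁻¹ * fderiv ℝ ψ (k⁻¹ • (x₁ - x₀)) ((-B) z)))
          = 2 * δ * -(ψ (k⁻¹ • (x₁ - x₀ - (-B) z)) - ψ (k⁻¹ • (x₁ - x₀))
            + k⁻¹ * fderiv ℝ ψ (k⁻¹ • (x₁ - x₀)) ((-B) z)) := by
        simp only [Ψ]
        rw [sub_right_comm x₁]
        ring
      have h4 : D * (k⁻¹ ^ 2 * ‖B z‖ ^ 2) ≤ (1 + D * ‖B‖ ^ 2) * ‖z‖ ^ 2 := by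
        have h5 : k⁻¹ ^ 2 ≤ 1 := pow_le_one₀ hki0.le hki
        have h6 : ‖B z‖ ^ 2 ≤ (‖B‖ * ‖z‖) ^ 2 := by
          gcongr
          exact B.le_opNorm z
        calc D * (k⁻¹ ^ 2 * ‖B z‖ ^ 2) ≤ D * (1 * (‖B‖ * ‖z‖) ^ 2) := by gcongr
          _ = D * ‖B‖ ^ 2 * ‖z‖ ^ 2 := by ring
          _ ≤ _ := by nlinarith [sq_nonneg ‖z‖]
      have h5 : 2 * δ * -(ψ (k⁻¹ • (x₁ - x₀ - (-B) z)) - ψ (k⁻¹ • (x₁ - x₀))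
            + k⁻¹ * fderiv ℝ ψ (k⁻¹ • (x₁ - x₀)) ((-B) z))
          ≤ 2 * δ * ((1 + D * ‖B‖ ^ 2) * ‖z‖ ^ 2) := by
        refine mul_le_mul_of_nonneg_left (((neg_le_abs _).trans h2).trans h4) (by linarith)
      linarith
    · rw [jumpTerm, levyWeight, Set.indicator_of_notMem hz, Set.indicator_of_notMem hz,
        Set.indicator_of_mem (Set.mem_compl hz), add_zero, zero_add, Pi.one_apply, mul_one]
      have h2 : Ψ x₁ ≤ 2 * δ * 1 := mul_le_mul_of_nonneg_left (hψ1 _) (by linarith)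
      have h3 : 0 ≤ Ψ (x₁ - (-B) z) := mul_nonneg (by linarith) (hψn _)
      have h4 : 0 ≤ 2 * δ * (D * ‖B‖ ^ 2) := by positivity
      linarith
  have hint : ∫ z, jumpTerm (-B) W z x₁ ∂ν ≤ 2 * δ * ((1 + D * ‖B‖ ^ 2) * w₀) := by
    rw [hw₀, ← integral_const_mul, ← integral_const_mul]
    exact integral_mono (hj x₁) ((hν.const_mul _).const_mul _) hjump
  have hsum : ∑ j, fderiv ℝ (fun y => fderiv ℝ W y (B (v j))) x₁ (B (v j))
      ≤ 2 * δ * ∑ j, D * ‖B (v j)‖ ^ 2 := by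
    rw [Finset.mul_sum]
    exact Finset.sum_le_sum fun j _ => hgauss j
  calc lam * (s - δ) ≤ lam * W x₁ := by gcongr
    _ ≤ ouOperator A B b v ν W x₁ + R := hsub x₁
    _ ≤ 2 * δ * Λ + R := by
        rw [ouOperator, hΛ]
        linarith

end MaximumPrinciple

/-! ### Mollification of weak solutions and uniqueness -/

section Mollification

variable {E : Type*} [NormedAddCommGroup E] [InnerProductSpace ℝ E] [FiniteDimensional ℝ E]
  [MeasurableSpace E] [BorelSpace E]

/-- The convolution of a function with a test function. -/
def mollify (w ρ : E → ℝ) (x : E) : ℝ := ∫ y, w y * ρ (x - y)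

variable {w ρ : E → ℝ} {M : ℝ}

theorem mollify_eq (w ρ : E → ℝ) :
    mollify w ρ = convolution w ρ (ContinuousLinearMap.mul ℝ ℝ) volume := rfl

theorem contDiff_mollify (hw : Continuous w) (hρ : ContDiff ℝ (⊤ : ℕ∞) ρ)
    (hc : HasCompactSupport ρ) : ContDiff ℝ (⊤ : ℕ∞) (mollify w ρ) := by
  rw [mollify_eq]
  exact hc.contDiff_convolution_right _ hw.locallyIntegrable hρ

theorem fderiv_mollify (hw : Continuous w) (hρ : ContDiff ℝ (⊤ : ℕ∞) ρ)
    (hc : HasCompactSupport ρ) (x e : E) :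
    fderiv ℝ (mollify w ρ) x e = mollify w (fun y => fderiv ℝ ρ y e) x := by
  rw [mollify_eq, (hc.hasFDerivAt_convolution_right (ContinuousLinearMap.mul ℝ ℝ)
    (hw.locallyIntegrable (μ := volume)) (hρ.of_le (by exact_mod_cast le_top)) x).fderiv,
    convolution_precompR_apply _ hw.locallyIntegrable (hc.fderiv (𝕜 := ℝ))
      (hρ.continuous_fderiv (by simp))]
  rfl

theorem abs_mollify_le (hwM : ∀ x, |w x| ≤ M) (hρ : Integrable ρ) (x : E) :
    |mollify w ρ x| ≤ M * ∫ y, |ρ y| := by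
  have h1 : ‖mollify w ρ x‖ ≤ ∫ y, M * |ρ (x - y)| := by
    refine norm_integral_le_of_norm_le ((hρ.abs.comp_sub_left x).const_mul M)
      (Eventually.of_forall fun y => ?_)
    rw [norm_mul]
    exact mul_le_mul_of_nonneg_right (hwM y) (norm_nonneg _)
  rwa [integral_const_mul, integral_sub_left_eq_self (fun y => |ρ y|)] at h1

/-- The rescaling of a test function. -/
def rescale (s : ℝ) (ρ : E → ℝ) (x : E) : ℝ := s ^ Module.finrank ℝ E * ρ (s • x)

theorem contDiff_rescale (hρ : ContDiff ℝ (⊤ : ℕ∞) ρ) (s : ℝ) :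
    ContDiff ℝ (⊤ : ℕ∞) (rescale s ρ) :=
  contDiff_const.mul (hρ.comp (contDiff_const.smul contDiff_id))

theorem hasCompactSupport_rescale (hc : HasCompactSupport ρ) {s : ℝ} (hs : s ≠ 0) :
    HasCompactSupport (rescale s ρ) :=
  (hc.comp_smul hs).mul_left

theorem mollify_rescale (w ρ : E → ℝ) {s : ℝ} (hs : 0 < s) (x : E) :
    mollify w (rescale s ρ) x = ∫ y, w (x - s⁻¹ • y) * ρ y := by
  have h1 : mollify w (rescale s ρ) x = ∫ y, w (x - y) * rescale s ρ y := by
    rw [mollify, ← integral_sub_left_eq_self (fun y => w (x - y) * rescale s ρ y) volume x]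
    simp only [sub_sub_cancel]
  have h2 := Measure.integral_comp_smul (volume : Measure E)
    (fun y => w (x - s⁻¹ • y) * ρ y) s
  rw [smul_eq_mul, abs_of_pos (by positivity), inv_mul_eq_div,
    eq_div_iff (by positivity)] at h2
  rw [h1, ← h2, mul_comm, ← integral_const_mul]
  refine integral_congr_ae (Eventually.of_forall fun y => ?_)
  simp only [rescale, smul_smul, inv_mul_cancel₀ hs.ne', one_smul]
  ring

/-- The kernel may have any sign and any mean. A bump function gives approximation of w, and a
kernel of mean zero gives convergence to zero. -/
theorem exists_mollify_rescale_close (hw : UniformContinuous w) (hwM : ∀ x, |w x| ≤ M)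
    (hρ : Continuous ρ) (hc : HasCompactSupport ρ) {ε : ℝ} (hε : 0 < ε) :
    ∃ S, 0 < S ∧ ∀ s ≥ S, ∀ x, |mollify w (rescale s ρ) x - w x * ∫ y, ρ y| ≤ ε := by
  have hρi : Integrable ρ := hρ.integrable_of_hasCompactSupport hc
  obtain ⟨r, hr⟩ := hc.isCompact.isBounded.subset_closedBall 0
  have hI : 0 ≤ ∫ y, |ρ y| := integral_nonneg fun y => abs_nonneg _
  set η := ε / (1 + ∫ y, |ρ y|) with hη
  have hη0 : 0 < η := by positivity
  obtain ⟨δ, hδ, hwδ⟩ := Metric.uniformContinuous_iff.1 hw η hη0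
  have hr0 : 0 < |r| + 1 := by positivity
  refine ⟨(|r| + 1) / δ, by positivity, fun s hs x => ?_⟩
  have hs0 : 0 < s := lt_of_lt_of_le (by positivity) hs
  have hi : Integrable fun y => w (x - s⁻¹ • y) * ρ y := by
    have hc' : Continuous fun y => w (x - s⁻¹ • y) := hw.continuous.comp (by fun_prop)
    exact hρi.bdd_mul hc'.aestronglyMeasurable (Eventually.of_forall fun y => hwM _)
  rw [mollify_rescale w ρ hs0, ← integral_const_mul, ← integral_sub hi (hρi.const_mul _)]
  have h1 : ‖∫ y, (w (x - s⁻¹ • y) * ρ y - w x * ρ y)‖ ≤ ∫ y, η * |ρ y| := by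
    refine norm_integral_le_of_norm_le (hρi.abs.const_mul η) (Eventually.of_forall fun y => ?_)
    rw [← sub_mul, norm_mul, Real.norm_eq_abs (ρ y)]
    by_cases hy : ρ y = 0
    · simp [hy]
    · refine mul_le_mul_of_nonneg_right ?_ (abs_nonneg _)
      rw [← dist_eq_norm]
      refine (hwδ ?_).le
      rw [dist_eq_norm, sub_sub_cancel_left, norm_neg, norm_smul, norm_inv,
        Real.norm_of_nonneg hs0.le, inv_mul_eq_div, div_lt_iff₀ hs0]
      have h2 : ‖y‖ ≤ r := mem_closedBall_zero_iff.1 (hr (subset_tsupport _ hy))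
      have h3 : |r| + 1 ≤ δ * s := by
        rw [ge_iff_le, div_le_iff₀ hδ] at hs
        linarith
      linarith [le_abs_self r]
  rw [integral_const_mul] at h1
  refine h1.trans ?_
  rw [hη, div_mul_eq_mul_div, div_le_iff₀ (by positivity)]
  nlinarith

variable {U : Type*} [NormedAddCommGroup U] [InnerProductSpace ℝ U] [FiniteDimensional ℝ U]
  [MeasurableSpace U] [BorelSpace U]
variable {ι : Type*} [Fintype ι]
variable (A : E →L[ℝ] E) (B : U →L[ℝ] E) (b : U) (v : ι → U) {ν : Measure U} [SigmaFinite ν]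
  (hν : Integrable (levyWeight id (Metric.ball 0 1)) ν)

/-- The error made by commuting the drift with a mollification. -/
def driftError (ρ : E → ℝ) (x : E) : ℝ := fderiv ℝ ρ x (A x) + LinearMap.trace ℝ E A * ρ x

/-- A linear vector field commutes with dilations: the factor s from the derivative is absorbed by
A(sx). Hence the commutator does not blow up when the kernel concentrates. -/
theorem driftError_rescale (hρ : ContDiff ℝ (⊤ : ℕ∞) ρ) (s : ℝ) :
    driftError A (rescale s ρ) = rescale s (driftError A ρ) := by
  funext x
  have h1 : HasFDerivAt (fun y : E => s • y) (s • ContinuousLinearMap.id ℝ E) x :=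
    (hasFDerivAt_id x).const_smul s
  have h2 := ((hρ.differentiable (by simp) (s • x)).hasFDerivAt.comp x h1).const_mul
    (s ^ Module.finrank ℝ E)
  rw [driftError, show fderiv ℝ (rescale s ρ) x = _ from h2.fderiv]
  simp only [rescale, driftError, smul_apply, smul_eq_mul, map_smul,
    ContinuousLinearMap.comp_smul, ContinuousLinearMap.comp_id]
  ring

/-- The integrand is the divergence of ρ(x)Ax. With mean zero, the error in the mollified equation
tends to zero uniformly. -/
theorem integral_driftError (hρ : ContDiff ℝ (⊤ : ℕ∞) ρ) (hc : HasCompactSupport ρ) :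
    ∫ x, driftError A ρ x = 0 := by
  have := integral_drift_smul A hρ hc (G := fun _ : E => (1 : ℝ)) contDiff_const
  simpa [driftError] using this

include hν in
/-- The equation satisfied by the mollification of a weak solution of the homogeneous equation. -/
theorem mollify_equation (hw : Continuous w) (hwM : ∀ x, |w x| ≤ M) {lam : ℝ}
    (hsol : ∀ φ : E → ℝ, ContDiff ℝ (⊤ : ℕ∞) φ → HasCompactSupport φ →
      ∫ x, w x * dualTest (ν := ν) A B b v lam φ x = 0)
    (hρ : ContDiff ℝ (⊤ : ℕ∞) ρ) (hc : HasCompactSupport ρ) (x : E) :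
    Integrable (fun z => jumpTerm (-B) (mollify w ρ) z x) ν ∧
      lam * mollify w ρ x = ouOperator A B b v ν (mollify w ρ) x
        - mollify w (driftError A ρ) x := by
  -- The weak equation tested with the reflected kernel centred at x is the pointwise equation for
  -- the mollification at x.
  let φ : E → ℝ := fun y => ρ (x - y)
  have hφ : ContDiff ℝ (⊤ : ℕ∞) φ := hρ.comp (contDiff_const.sub contDiff_id)
  have hφc : HasCompactSupport φ := hc.comp_homeomorph (Homeomorph.subLeft x)
  have hrefl : ∀ χ : E → ℝ, Differentiable ℝ χ → ∀ y e,
      fderiv ℝ (fun y => χ (x - y)) y e = -fderiv ℝ χ (x - y) e := by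
    intro χ hχ y e
    have := ((hχ (x - y)).hasFDerivAt.comp y ((hasFDerivAt_id y).const_sub x))
    rw [show fderiv ℝ (fun y => χ (x - y)) y = _ from this.fderiv]
    simp
  have hφ1 : ∀ y e, fderiv ℝ φ y e = -fderiv ℝ ρ (x - y) e :=
    hrefl ρ (hρ.differentiable (by simp))
  have hφ2 : ∀ y e, iteratedFDeriv ℝ 2 φ y ![e, e]
      = fderiv ℝ (fun y => fderiv ℝ ρ y e) (x - y) e := by
    intro y e
    rw [iteratedFDeriv_two_apply_self hφ]
    have h1 : (fun y => fderiv ℝ φ y e) = fun y => -(fun y => fderiv ℝ ρ y e) (x - y) :=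
      funext fun y => hφ1 y e
    rw [h1, fderiv_fun_neg, neg_apply, hrefl _ ((contDiff_fderiv_apply hρ e).differentiable (by simp)),
      neg_neg]
  have hi : ∀ {χ : E → ℝ}, Continuous χ → HasCompactSupport χ →
      ∀ y, Integrable fun z => w z * χ (y - z) := by
    intro χ hχ hχc y
    have h1 : HasCompactSupport fun z => χ (y - z) := hχc.comp_homeomorph (Homeomorph.subLeft y)
    exact (hw.mul (hχ.comp (by fun_prop))).integrable_of_hasCompactSupport h1.mul_left
  have hd : ∀ e, Continuous fun y => fderiv ℝ ρ y e := fun e => (contDiff_fderiv_apply hρ e).continuous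
  have hdc : ∀ e, HasCompactSupport fun y => fderiv ℝ ρ y e := fun e => hc.fderiv_apply (𝕜 := ℝ) e
  -- the jump part
  have hjump : ∀ z, ∫ y, jumpTerm B φ z y • w y = jumpTerm (-B) (mollify w ρ) z x := by
    intro z
    have e1 : ∀ y, φ (y - B z) = ρ (x - (-B) z - y) := fun y => by
      simp only [φ, neg_apply]
      congr 1
      abel
    by_cases hz : z ∈ Metric.ball (0 : U) 1
    · have e2 : ∀ y, jumpTerm B φ z y • w y = w y * ρ (x - (-B) z - y) - w y * ρ (x - y)
          + w y * fderiv ℝ ρ (x - y) ((-B) z) := by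
        intro y
        rw [jumpTerm, Set.indicator_of_mem hz, e1, hφ1, smul_eq_mul, neg_apply, map_neg]
        simp only [φ]
        ring
      have i1 := hi hρ.continuous hc (x - (-B) z)
      have i2 := hi hρ.continuous hc x
      have i3 := hi (hd ((-B) z)) (hdc ((-B) z)) x
      simp_rw [e2]
      have i12 : Integrable fun y => w y * ρ (x - (-B) z - y) - w y * ρ (x - y) := i1.sub i2
      rw [integral_add i12 i3, integral_sub i1 i2, jumpTerm, Set.indicator_of_mem hz,
        fderiv_mollify hw hρ hc]
      rfl
    · have e2 : ∀ y, jumpTerm B φ z y • w y = w y * ρ (x - (-B) z - y) - w y * ρ (x - y) := by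
        intro y
        rw [jumpTerm, Set.indicator_of_notMem hz, e1, smul_eq_mul]
        simp only [φ]
        ring
      simp_rw [e2]
      rw [integral_sub (hi hρ.continuous hc _) (hi hρ.continuous hc x), jumpTerm,
        Set.indicator_of_notMem hz, add_zero]
      rfl
  have hjint : Integrable (fun z => jumpTerm (-B) (mollify w ρ) z x) ν := by
    simp_rw [← hjump]
    have i3 : Integrable (fun q : U × E => jumpTerm B φ q.1 q.2 • w q.2) (ν.prod volume) :=
      (integrable_jumpTerm B hφ hφc hν).smul_bdd M
        (hw.comp continuous_snd).aestronglyMeasurable (Eventually.of_forall fun q => hwM _)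
    exact i3.integral_prod_left
  refine ⟨hjint, ?_⟩
  have h0 := hsol φ hφ hφc
  have hφw : Integrable fun y => w y * φ y := hi hρ.continuous hc x
  have hdw : Integrable fun y => ouDual A B b v ν φ y • w y :=
    (integrable_ouDual A B b v hφ hφc hν).smul_bdd M hw.aestronglyMeasurable
      (Eventually.of_forall hwM)
  have h1 : ∀ y, w y * dualTest (ν := ν) A B b v lam φ y
      = lam * (w y * φ y) - ouDual A B b v ν φ y • w y := fun y => by
    rw [dualTest, smul_eq_mul]
    ring
  simp_rw [h1] at h0
  rw [integral_sub (hφw.const_mul _) hdw, integral_const_mul,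
    integral_ouDual_smul A B b v hφ hφc hν hw hwM] at h0
  simp_rw [hjump] at h0
  have e1 : ∀ e, ∫ y, iteratedFDeriv ℝ 2 φ y ![e, e] • w y
      = fderiv ℝ (fun y => fderiv ℝ (mollify w ρ) y e) x e := by
    intro e
    have h2 : (fun y => fderiv ℝ (mollify w ρ) y e) = mollify w fun y => fderiv ℝ ρ y e :=
      funext fun y => fderiv_mollify hw hρ hc y e
    rw [h2, fderiv_mollify hw (contDiff_fderiv_apply hρ e) (hdc e), mollify]
    refine integral_congr_ae (Eventually.of_forall fun y => ?_)
    simp only [hφ2, smul_eq_mul]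
    ring
  have e2 : ∀ e, ∫ y, fderiv ℝ φ y e • w y = -fderiv ℝ (mollify w ρ) x e := by
    intro e
    rw [fderiv_mollify hw hρ hc, mollify, ← integral_neg]
    refine integral_congr_ae (Eventually.of_forall fun y => ?_)
    simp only [hφ1, smul_eq_mul]
    ring
  -- Writing Ay = Ax - A(x-y) separates the drift at x from the commutator.
  have e3 : ∫ y, (fderiv ℝ φ y (A y) + LinearMap.trace ℝ E A * φ y) • w y
      = mollify w (driftError A ρ) x - fderiv ℝ (mollify w ρ) x (A x) := by
    have i1 : Integrable fun y => w y * driftError A ρ (x - y) :=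
      hi (continuous_drift A hρ) (hasCompactSupport_drift A hc) x
    rw [fderiv_mollify hw hρ hc, mollify, mollify, ← integral_sub i1 (hi (hd _) (hdc _) x)]
    refine integral_congr_ae (Eventually.of_forall fun y => ?_)
    simp only [hφ1, smul_eq_mul, driftError, φ, map_sub]
    ring
  have e4 : ∫ y, w y * φ y = mollify w ρ x := rfl
  simp_rw [e1, e2, e3, e4, smul_eq_mul] at h0
  rw [ouOperator]
  linarith

-- The mollification is a subsolution with a right-hand side as small as desired, so the maximum
-- principle bounds it; it is also uniformly close to a positive multiple of w.
include hν in
theorem eq_zero_of_homogeneous (hw : UniformContinuous w) (hwM : ∀ x, |w x| ≤ M) {lam : ℝ}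
    (hlam : 0 < lam)
    (hsol : ∀ φ : E → ℝ, ContDiff ℝ (⊤ : ℕ∞) φ → HasCompactSupport φ →
      ∫ x, w x * dualTest (ν := ν) A B b v lam φ x = 0) (x : E) : w x ≤ 0 := by
  let f : ContDiffBump (0 : E) := ⟨1 / 2, 1, by norm_num, by norm_num⟩
  have hf : ContDiff ℝ (⊤ : ℕ∞) f := f.contDiff
  have hc : HasCompactSupport f := f.hasCompactSupport
  have hI : 0 < ∫ y, f y := f.integral_pos
  refine le_of_forall_pos_le_add fun ε hε => ?_
  rw [zero_add]
  -- Chosen so that η/λ + η = ε∫f: one share from the maximum principle, one from the approximation.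
  set η := ε * (∫ y, f y) / (1 + 1 / lam) with hη
  have hη0 : 0 < η := by positivity
  obtain ⟨S₁, hS₁, h1⟩ := exists_mollify_rescale_close hw hwM hf.continuous hc hη0
  obtain ⟨S₂, hS₂, h2⟩ := exists_mollify_rescale_close hw hwM (continuous_drift A hf)
    (hasCompactSupport_drift A hc) hη0
  set s := max S₁ S₂ with hs
  have hs0 : 0 < s := lt_max_of_lt_left hS₁
  have hρ := contDiff_rescale hf s
  have hρc := hasCompactSupport_rescale hc hs0.ne'
  have heq := mollify_equation A B b v hν hw.continuous hwM hsol hρ hρc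
  have hmax := le_div_of_subsolution A B b v hν (W := mollify w (rescale s f)) (R := η) hlam
    (contDiff_mollify hw.continuous hρ hρc)
    (fun x => (le_abs_self _).trans (abs_mollify_le hwM
      (hρ.continuous.integrable_of_hasCompactSupport hρc) x)) (fun x => (heq x).1)
    (fun x => ?_) x
  · have h3 := abs_le.1 (h1 s (le_max_left _ _) x)
    have h4 : w x * ∫ y, f y ≤ η / lam + η := by linarith [h3.1]
    have h5 : η / lam + η = ε * ∫ y, f y := by
      rw [hη]
      field_simp
      ring
    rw [h5] at h4
    exact le_of_mul_le_mul_right h4 hI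
  · have h3 := h2 s (le_max_right _ _) x
    have h4 : ∫ y, (fderiv ℝ f y (A y) + LinearMap.trace ℝ E A * f y) = 0 :=
      integral_driftError A hf hc
    rw [h4, mul_zero, sub_zero] at h3
    rw [(heq x).2, driftError_rescale A hf]
    have h5 := (abs_le.1 h3).1
    have h6 : mollify w (rescale s (driftError A f)) x
        = mollify w (rescale s fun x => fderiv ℝ f x (A x) + LinearMap.trace ℝ E A * f x) x := rfl
    linarith

include hν in
/-- Bounded uniformly continuous weak solutions of the homogeneous equation vanish. -/
theorem eq_zero_of_weakSolution (hw : UniformContinuous w) (hwM : ∀ x, |w x| ≤ M) {lam : ℝ}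
    (hlam : 0 < lam)
    (hsol : ∀ φ : E → ℝ, ContDiff ℝ (⊤ : ℕ∞) φ → HasCompactSupport φ →
      ∫ x, w x * dualTest (ν := ν) A B b v lam φ x = 0) : w = 0 := by
  funext x
  refine le_antisymm (eq_zero_of_homogeneous A B b v hν hw hwM hlam hsol x) ?_
  have := eq_zero_of_homogeneous A B b v hν (w := -w) (M := M) hw.neg
    (fun x => by simpa using hwM x) hlam (fun φ hφ hφc => by
      simp only [Pi.neg_apply, neg_mul, integral_neg, hsol φ hφ hφc, neg_zero]) x
  simpa using this

end Mollification

/-! ### Grid approximation of right-continuous paths -/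

section Grid

variable {E : Type*} [NormedAddCommGroup E]

/-- The least multiple of `h` that is at least `s`. -/
def gridCeil (h s : ℝ) : ℝ := ⌈s / h⌉ * h

theorem le_gridCeil {h : ℝ} (hh : 0 < h) (s : ℝ) : s ≤ gridCeil h s :=
  (div_le_iff₀ hh).1 (Int.le_ceil _)

theorem gridCeil_lt {h : ℝ} (hh : 0 < h) (s : ℝ) : gridCeil h s < s + h := by
  have h1 := mul_lt_mul_of_pos_right (Int.ceil_lt_add_one (s / h)) hh
  rwa [add_mul, div_mul_cancel₀ _ hh.ne', one_mul] at h1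

theorem gridCeil_of_mem {h s : ℝ} (hh : 0 < h) {k : ℕ} (hs : s ∈ Set.Ioc (k * h) ((k + 1) * h)) :
    gridCeil h s = (k + 1) * h := by
  have h1 : ⌈s / h⌉ = (k : ℤ) + 1 := by
    rw [Int.ceil_eq_iff]
    push_cast
    rw [add_sub_cancel_right, lt_div_iff₀ hh, div_le_iff₀ hh]
    exact hs
  rw [gridCeil, h1]
  push_cast
  rfl

theorem measurable_gridCeil (h : ℝ) : Measurable (gridCeil h) :=
  (measurable_from_top (f := fun k : ℤ => (k : ℝ) * h)).comp
    (Int.measurable_ceil.comp (measurable_id.div_const h))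

/-- Rounding up approaches s from the right, so right continuity is sufficient. -/
theorem tendsto_comp_gridCeil {f : ℝ → E} {s : ℝ} (hr : ContinuousWithinAt f (Set.Ici s) s) :
    Tendsto (fun h => f (gridCeil h s)) (𝓝[>] 0) (𝓝 (f s)) := by
  refine hr.tendsto.comp (tendsto_nhdsWithin_iff.2 ⟨?_, ?_⟩)
  · have h1 : Tendsto (fun h : ℝ => s + h) (𝓝[>] 0) (𝓝 s) := by
      have : Tendsto (fun h : ℝ => s + h) (𝓝 0) (𝓝 (s + 0)) := tendsto_const_nhds.add tendsto_id
      rw [add_zero] at this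
      exact this.mono_left nhdsWithin_le_nhds
    refine tendsto_of_tendsto_of_tendsto_of_le_of_le' tendsto_const_nhds h1 ?_ ?_
    · filter_upwards [self_mem_nhdsWithin] with h hh using le_gridCeil hh s
    · filter_upwards [self_mem_nhdsWithin] with h hh using (gridCeil_lt hh s).le
  · filter_upwards [self_mem_nhdsWithin] with h hh using le_gridCeil hh s

theorem tendsto_div_succ_nhdsGT {t : ℝ} (ht : 0 < t) :
    Tendsto (fun m : ℕ => t / ((m : ℝ) + 1)) atTop (𝓝[>] 0) := by
  refine tendsto_nhdsWithin_iff.2 ⟨?_, Eventually.of_forall fun m => ?_⟩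
  · have := (tendsto_one_div_add_atTop_nhds_zero_nat (𝕜 := ℝ)).const_mul t
    simpa [div_eq_mul_inv] using this
  · show 0 < t / ((m : ℝ) + 1)
    positivity

theorem measurable_of_rightContinuous [MeasurableSpace E] [BorelSpace E] {f : ℝ → E}
    (hr : ∀ s, ContinuousWithinAt f (Set.Ici s) s) : Measurable f := by
  refine measurable_of_tendsto_metrizable (f := fun (m : ℕ) s => f (gridCeil (1 / ((m : ℝ) + 1)) s))
    (fun m => ?_) (tendsto_pi_nhds.2 fun s => (tendsto_comp_gridCeil (hr s)).comp
      (tendsto_div_succ_nhdsGT one_pos))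
  exact (measurable_from_top (f := fun k : ℤ => f ((k : ℝ) * (1 / ((m : ℝ) + 1))))).comp
    (Int.measurable_ceil.comp (measurable_id.div_const _))

variable {f : ℝ → E} {M t : ℝ}

/-- Dominated convergence. The bound is needed up to 2t because rounding up may pass t, by less than
h ≤ t. -/
theorem tendsto_integral_norm_sub_gridCeil [MeasurableSpace E] [BorelSpace E]
    [SecondCountableTopology E]
    (hr : ∀ s, ContinuousWithinAt f (Set.Ici s) s)
    (ht : 0 < t) (hM : ∀ s ≤ 2 * t, ‖f s‖ ≤ M) :
    Tendsto (fun h => ∫ s in 0..t, ‖f s - f (gridCeil h s)‖) (𝓝[>] 0) (𝓝 0) := by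
  have hf := measurable_of_rightContinuous hr
  suffices h0 : Tendsto (fun h => ∫ s in 0..t, ‖f s - f (gridCeil h s)‖) (𝓝[>] 0)
      (𝓝 (∫ _ in (0 : ℝ)..t, (0 : ℝ))) by
    rwa [intervalIntegral.integral_zero] at h0
  refine intervalIntegral.tendsto_integral_filter_of_dominated_convergence (fun _ => M + M)
    (Eventually.of_forall fun h =>
      (hf.sub (hf.comp (measurable_gridCeil h))).norm.aestronglyMeasurable) ?_
    (intervalIntegrable_const (μ := volume)) (Eventually.of_forall fun s _ => ?_)
  · filter_upwards [Ioc_mem_nhdsGT ht] with h hh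
    refine Eventually.of_forall fun s hs => ?_
    rw [Set.uIoc_of_le ht.le] at hs
    rw [norm_norm]
    refine (norm_sub_le _ _).trans (add_le_add (hM _ (by linarith [hs.2])) (hM _ ?_))
    linarith [gridCeil_lt hh.1 s, hh.2, hs.2]
  · have := ((tendsto_comp_gridCeil (hr s)).const_sub (f s)).norm
    simpa using this

theorem sum_integral_norm_sub_eq [MeasurableSpace E] [BorelSpace E] [SecondCountableTopology E]
    (hr : ∀ s, ContinuousWithinAt f (Set.Ici s) s)
    (ht : 0 < t) (hM : ∀ s ≤ 2 * t, ‖f s‖ ≤ M) (m : ℕ) {h : ℝ} (hh : h = t / ((m : ℝ) + 1)) :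
    ∑ k ∈ Finset.range (m + 1), (∫ s in (k * h)..((k + 1) * h), ‖f s - f ((k + 1) * h)‖)
      = ∫ s in 0..t, ‖f s - f (gridCeil h s)‖ := by
  have hf := measurable_of_rightContinuous hr
  have hh0 : 0 < h := by rw [hh]; positivity
  have hmh : ((m : ℝ) + 1) * h = t := by rw [hh]; field_simp
  have hI : IntervalIntegrable (fun s => ‖f s - f (gridCeil h s)‖) volume 0 t := by
    rw [intervalIntegrable_iff]
    refine Measure.integrableOn_of_bounded (M := M + M) (by simp)
      (hf.sub (hf.comp (measurable_gridCeil h))).norm.aestronglyMeasurable ?_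
    refine (ae_restrict_iff' measurableSet_uIoc).2 (Eventually.of_forall fun s hs => ?_)
    rw [Set.uIoc_of_le ht.le] at hs
    rw [norm_norm]
    refine (norm_sub_le _ _).trans (add_le_add (hM _ (by linarith [hs.2])) (hM _ ?_))
    have : h ≤ t := by
      rw [← hmh]
      nlinarith [(Nat.cast_nonneg m : (0 : ℝ) ≤ m)]
    linarith [gridCeil_lt hh0 s, hs.2]
  have h1 := intervalIntegral.sum_integral_adjacent_intervals (n := m + 1)
    (f := fun s => ‖f s - f (gridCeil h s)‖) (μ := volume) (a := fun k : ℕ => (k : ℝ) * h)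
    (fun k hk => hI.mono_set ?_)
  · push_cast at h1
    rw [zero_mul, hmh] at h1
    rw [← h1]
    refine Finset.sum_congr rfl fun k _ => ?_
    have hle : (k : ℝ) * h ≤ (k + 1) * h := by nlinarith
    refine intervalIntegral.integral_congr_ae (Eventually.of_forall fun s hs => ?_)
    rw [Set.uIoc_of_le hle] at hs
    rw [gridCeil_of_mem hh0 hs]
  · have hk' : ((k : ℝ) + 1) ≤ m + 1 := by exact_mod_cast hk
    have hle : (k : ℝ) * h ≤ (k + 1) * h := by nlinarith
    push_cast
    rw [Set.uIcc_of_le hle, Set.uIcc_of_le ht.le]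
    refine Set.Icc_subset_Icc (by positivity) ?_
    rw [← hmh]
    gcongr

end Grid

/-! ### Variation of constants along càdlàg paths -/

section Path

variable {E : Type*} [NormedAddCommGroup E] [InnerProductSpace ℝ E] [FiniteDimensional ℝ E]
  [MeasurableSpace E] [BorelSpace E] (A : E →L[ℝ] E) {f ζ : ℝ → E} {M t : ℝ} {x : E}

/-- Right continuity and left limits bound the path near each point, and compactness of the interval
does the rest. -/
theorem exists_norm_le_of_isCadlagPath {f : ℝ≥0 → E} (hf : IsCadlagPath f) (T : ℝ≥0) :
    ∃ M, ∀ s ≤ T, ‖f s‖ ≤ M := by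
  have h1 : ∃ M, ∀ s ∈ Set.Icc 0 T, ‖f s‖ ≤ M := by
    refine isCompact_Icc.induction_on (p := fun S => ∃ M, ∀ s ∈ S, ‖f s‖ ≤ M) ⟨0, by simp⟩
      (fun S S' hS ⟨M, h⟩ => ⟨M, fun s hs => h s (hS hs)⟩)
      (fun S S' ⟨M, h⟩ ⟨M', h'⟩ => ⟨max M M', fun s hs => hs.elim
        (fun hs => (h s hs).trans (le_max_left _ _))
        (fun hs => (h' s hs).trans (le_max_right _ _))⟩) fun s _ => ?_
    obtain ⟨hr, l, hl⟩ := hf s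
    refine ⟨{r | ‖f r‖ ≤ max (‖f s‖ + 1) (‖l‖ + 1)}, mem_nhdsWithin_of_mem_nhds ?_,
      _, fun r hr => hr⟩
    rw [← nhdsLT_sup_nhdsGE s]
    refine ⟨?_, ?_⟩
    · filter_upwards [hl.norm.eventually_lt_const (lt_add_one _)] with r hr
      exact hr.le.trans (le_max_right _ _)
    · filter_upwards [hr.tendsto.norm.eventually_lt_const (lt_add_one _)] with r hr
      exact hr.le.trans (le_max_left _ _)
  exact h1.imp fun M hM s hs => hM s ⟨zero_le, hs⟩

theorem IsCadlagPath.continuousWithinAt_toNNReal {f : ℝ≥0 → E} (hf : IsCadlagPath f) (s : ℝ) :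
    ContinuousWithinAt (fun s : ℝ => f s.toNNReal) (Set.Ici s) s :=
  (hf s.toNNReal).1.comp continuous_real_toNNReal.continuousWithinAt
    fun _ hr => Real.toNNReal_mono hr

/-- Discrete variation of constants: the sum of the increments of s ↦ e^{(t-s)A}f(s) telescopes, and
on each cell the increment is e^{(t-s)A} applied to that of ζ up to an error whose sum vanishes. No
integral against ζ has to be defined. -/
theorem tendsto_sum_flow_increment (hr : ∀ s, ContinuousWithinAt f (Set.Ici s) s)
    (ht : 0 < t) (hM : ∀ s ≤ 2 * t, ‖f s‖ ≤ M)
    (heq : ∀ s, 0 ≤ s → f s = x + (∫ r in (0 : ℝ)..s, A (f r)) + ζ s) :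
    Tendsto (fun m : ℕ => ∑ k ∈ Finset.range (m + 1), flow A (t - k * (t / ((m : ℝ) + 1)))
        (ζ ((k + 1) * (t / ((m : ℝ) + 1))) - ζ (k * (t / ((m : ℝ) + 1)))))
      atTop (𝓝 (f t - flow A t (f 0))) := by
  obtain ⟨K, hK1, hK⟩ := exists_norm_flow_le A t
  have hf := measurable_of_rightContinuous hr
  have hM0 : 0 ≤ M := (norm_nonneg _).trans (hM t (by linarith))
  have hbdI : ∀ a b, 0 ≤ a → a ≤ b → b ≤ t → IntervalIntegrable f volume a b := by
    intro a b ha hab hb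
    rw [intervalIntegrable_iff, Set.uIoc_of_le hab]
    refine Measure.integrableOn_of_bounded (M := M) (by simp) hf.aestronglyMeasurable ?_
    exact (ae_restrict_iff' measurableSet_Ioc).2 (Eventually.of_forall fun s hs =>
      hM s (by linarith [hs.2]))
  set err : ℝ → ℝ := fun h => K * (M * t * ‖h⁻¹ • (flow A (-h) - 1 + h • A)‖
    + ‖A‖ * ∫ s in 0..t, ‖f s - f (gridCeil h s)‖) with herr
  have herr0 : Tendsto (fun m : ℕ => err (t / ((m : ℝ) + 1))) atTop (𝓝 0) := by
    refine Tendsto.comp (g := err) ?_ (tendsto_div_succ_nhdsGT ht)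
    have h1 : HasDerivAt (fun h => flow A (-h) - 1 + h • A) 0 0 := by
      have h2 := (hasDerivAt_flow A (-0)).scomp (0 : ℝ) (hasDerivAt_neg (0 : ℝ))
      have h3 := (h2.sub_const 1).add ((hasDerivAt_id (0 : ℝ)).smul_const A)
      convert! h3 using 1
      simp [flow_zero]
    have h4 := h1.tendsto_slope_zero_right
    simp only [zero_add, neg_zero, flow_zero, sub_self, zero_smul, add_zero, sub_zero] at h4
    have h5 := ((h4.norm.const_mul (M * t)).add ((tendsto_integral_norm_sub_gridCeil hr ht
      hM).const_mul ‖A‖)).const_mul K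
    simpa [herr] using h5
  rw [tendsto_iff_norm_sub_tendsto_zero]
  refine squeeze_zero (fun _ => norm_nonneg _) (fun m => ?_) herr0
  set h := t / ((m : ℝ) + 1) with hh
  have hh0 : 0 < h := by positivity
  have hmh : ((m : ℝ) + 1) * h = t := by rw [hh]; field_simp
  have hgrid : ∀ k ∈ Finset.range (m + 1), 0 ≤ (k : ℝ) * h ∧ (k : ℝ) * h ≤ (k + 1) * h
      ∧ ((k : ℝ) + 1) * h ≤ t := by
    intro k hk
    have hk' : ((k : ℝ) + 1) ≤ m + 1 := by exact_mod_cast Finset.mem_range.1 hk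
    refine ⟨by positivity, by nlinarith, ?_⟩
    rw [← hmh]
    gcongr
  have htel : f t - flow A t (f 0) = ∑ k ∈ Finset.range (m + 1),
      (flow A (t - (k + 1) * h) (f ((k + 1) * h)) - flow A (t - k * h) (f (k * h))) := by
    have := Finset.sum_range_sub (fun k : ℕ => flow A (t - k * h) (f (k * h))) (m + 1)
    push_cast at this
    rw [this, hmh, sub_self, flow_zero, zero_mul, sub_zero]
    rfl
  rw [htel, norm_sub_rev, ← Finset.sum_sub_distrib]
  have hterm : ∀ k ∈ Finset.range (m + 1),
      ‖flow A (t - (k + 1) * h) (f ((k + 1) * h)) - flow A (t - k * h) (f (k * h))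
        - flow A (t - k * h) (ζ ((k + 1) * h) - ζ (k * h))‖
      ≤ K * (M * h * ‖h⁻¹ • (flow A (-h) - 1 + h • A)‖
        + ‖A‖ * ∫ s in (k * h)..((k + 1) * h), ‖f s - f ((k + 1) * h)‖) := by
    intro k hk
    obtain ⟨g1, g2, g3⟩ := hgrid k hk
    have hI1 := hbdI _ _ le_rfl g1 (g2.trans g3)
    have hI2 := hbdI _ _ g1 g2 g3
    have e1 : f ((k + 1) * h) - f (k * h) - (ζ ((k + 1) * h) - ζ (k * h))
        = A (∫ s in (k * h)..((k + 1) * h), f s) := by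
      rw [heq _ (g1.trans g2), heq _ g1, A.intervalIntegral_comp_comm (hI1.trans hI2),
        A.intervalIntegral_comp_comm hI1, ← intervalIntegral.integral_add_adjacent_intervals
        hI1 hI2, map_add]
      abel
    have e2 : (∫ s in (k * h)..((k + 1) * h), f s) = h • f ((k + 1) * h)
        + ∫ s in (k * h)..((k + 1) * h), (f s - f ((k + 1) * h)) := by
      rw [intervalIntegral.integral_sub hI2 intervalIntegrable_const,
        intervalIntegral.integral_const]
      have : ((k : ℝ) + 1) * h - k * h = h := by ring
      rw [this]
      abel
    -- The error has two sources: the Taylor remainder e^{-hA} - 1 + hA, which is o(h), and the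
    -- replacement of f by its value at the right end of the cell.
    have e3 : flow A (t - (k + 1) * h) (f ((k + 1) * h)) - flow A (t - k * h) (f (k * h))
        - flow A (t - k * h) (ζ ((k + 1) * h) - ζ (k * h))
        = flow A (t - k * h) (h • (h⁻¹ • (flow A (-h) - 1 + h • A)) (f ((k + 1) * h))
          + A (∫ s in (k * h)..((k + 1) * h), (f s - f ((k + 1) * h)))) := by
      have h6 : t - (k + 1) * h = (t - k * h) + -h := by ring
      rw [h6, flow_add_apply, ← map_sub, ← map_sub]
      congr 1
      have h7 : h • (h⁻¹ • (flow A (-h) - 1 + h • A)) (f ((k + 1) * h))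
          = flow A (-h) (f ((k + 1) * h)) - f ((k + 1) * h) + A (h • f ((k + 1) * h)) := by
        rw [smul_apply, smul_smul, mul_inv_cancel₀ hh0.ne', one_smul, map_smul]
        rfl
      rw [h7, add_assoc, ← map_add, ← e2, ← e1]
      abel
    rw [e3]
    refine (ContinuousLinearMap.le_of_opNorm_le _ (hK _ ?_) _).trans ?_
    · rw [abs_of_nonneg (by linarith)]
      linarith
    refine mul_le_mul_of_nonneg_left ((norm_add_le _ _).trans (add_le_add ?_ ?_)) (by linarith)
    · rw [norm_smul, Real.norm_of_nonneg hh0.le]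
      calc h * ‖(h⁻¹ • (flow A (-h) - 1 + h • A)) (f ((k + 1) * h))‖
          ≤ h * (‖h⁻¹ • (flow A (-h) - 1 + h • A)‖ * M) := by
            refine mul_le_mul_of_nonneg_left ?_ hh0.le
            exact (ContinuousLinearMap.le_opNorm _ _).trans
              (mul_le_mul_of_nonneg_left (hM _ (by linarith)) (norm_nonneg _))
        _ = _ := by ring
    · refine (A.le_opNorm _).trans (mul_le_mul_of_nonneg_left ?_ (norm_nonneg _))
      exact intervalIntegral.norm_integral_le_integral_norm g2
  refine (norm_sum_le_of_le _ hterm).trans_eq ?_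
  rw [← Finset.mul_sum, Finset.sum_add_distrib, ← Finset.mul_sum,
    ← Finset.mul_sum, sum_integral_norm_sub_eq hr ht hM m hh, Finset.sum_const, Finset.card_range, nsmul_eq_mul,
    herr]
  have h8 : M * t = M * h * (m + 1) := by
    rw [← hmh]
    ring
  simp only [h8]
  push_cast
  ring

end Path

/-- Reversing the summation turns the points t - kh into right endpoints, so the grid estimate for
paths applies. Extending G by its value at 0 to negative times supplies the bound assumed there. -/
theorem tendsto_riemannSum {G : ℝ → ℂ} (hG : Continuous G) {t : ℝ} (ht : 0 < t) :
    Tendsto (fun m : ℕ => ∑ k ∈ Finset.range (m + 1),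
      ((t / ((m : ℝ) + 1) : ℝ) : ℂ) * G (t - k * (t / ((m : ℝ) + 1))))
      atTop (𝓝 (∫ s in 0..t, G s)) := by
  set f : ℝ → ℂ := fun s => G (max s 0) with hf
  have hfc : Continuous f := hG.comp (continuous_id.max continuous_const)
  obtain ⟨M, hM⟩ := isCompact_Icc.exists_bound_of_continuousOn (s := Set.Icc 0 (2 * t))
    hG.continuousOn
  have hfM : ∀ s ≤ 2 * t, ‖f s‖ ≤ M := fun s hs =>
    hM _ ⟨le_max_right _ _, max_le hs (by linarith)⟩
  have hr : ∀ s, ContinuousWithinAt f (Set.Ici s) s := fun s => hfc.continuousWithinAt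
  have hlim := (tendsto_integral_norm_sub_gridCeil hr ht hfM).comp (tendsto_div_succ_nhdsGT ht)
  rw [tendsto_iff_norm_sub_tendsto_zero]
  refine squeeze_zero (fun _ => norm_nonneg _) (fun m => ?_) hlim
  set h := t / ((m : ℝ) + 1) with hh
  have hh0 : 0 < h := by positivity
  have hmh : ((m : ℝ) + 1) * h = t := by rw [hh]; field_simp
  have e1 : ∑ k ∈ Finset.range (m + 1), (h : ℂ) * G (t - k * h)
      = ∑ k ∈ Finset.range (m + 1), (h : ℂ) * f ((k + 1) * h) := by
    rw [← Finset.sum_range_reflect]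
    refine Finset.sum_congr rfl fun k hk => ?_
    have hk' : k ≤ m := by
      have := Finset.mem_range.1 hk
      omega
    have h2 : t - ((m + 1 - 1 - k : ℕ) : ℝ) * h = (k + 1) * h := by
      rw [Nat.add_sub_cancel, Nat.cast_sub hk', ← hmh]
      ring
    rw [h2]
    simp only [hf]
    rw [max_eq_left (by positivity)]
  have e2 : (∫ s in 0..t, G s)
      = ∑ k ∈ Finset.range (m + 1), ∫ s in (k * h)..((k + 1) * h), f s := by
    have h1 := intervalIntegral.sum_integral_adjacent_intervals (n := m + 1)
      (f := f) (μ := volume) (a := fun k : ℕ => (k : ℝ) * h)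
      (fun k hk => hfc.intervalIntegrable _ _)
    push_cast at h1
    rw [h1, zero_mul, hmh]
    refine intervalIntegral.integral_congr fun s hs => ?_
    rw [Set.uIcc_of_le ht.le] at hs
    simp only [hf]
    rw [max_eq_left hs.1]
  rw [e1, e2, norm_sub_rev, ← Finset.sum_sub_distrib, Function.comp,
    ← sum_integral_norm_sub_eq hr ht hfM m hh]
  refine norm_sum_le_of_le _ fun k _ => ?_
  have hle : (k : ℝ) * h ≤ (k + 1) * h := by nlinarith
  have h3 : (∫ s in (k * h)..((k + 1) * h), f s) - (h : ℂ) * f ((k + 1) * h)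
      = ∫ s in (k * h)..((k + 1) * h), (f s - f ((k + 1) * h)) := by
    rw [intervalIntegral.integral_sub (hfc.intervalIntegrable _ _) intervalIntegrable_const,
      intervalIntegral.integral_const, Complex.real_smul]
    have : ((k : ℝ) + 1) * h - k * h = h := by ring
    rw [this]
  rw [h3]
  exact intervalIntegral.norm_integral_le_integral_norm hle

/-! ### The law of the process solving the equation -/

section Law

variable {E : Type*} [NormedAddCommGroup E] [InnerProductSpace ℝ E] [FiniteDimensional ℝ E]
  [MeasurableSpace E] [BorelSpace E]
variable {U : Type*} [NormedAddCommGroup U] [InnerProductSpace ℝ U] [FiniteDimensional ℝ U]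
  [MeasurableSpace U] [BorelSpace U]
variable {ι : Type*} [Fintype ι]
variable (A : E →L[ℝ] E) (B : U →L[ℝ] E) (b : U) (v : ι → U) {ν : Measure U} [SigmaFinite ν]
  (hν : Integrable (levyWeight id (Metric.ball 0 1)) ν)

theorem charFun_map_clm {Ω : Type*} [MeasurableSpace Ω] {Pr : Measure Ω} {Y : Ω → U}
    (hY : Measurable Y) (L : U →L[ℝ] E) (p : E) :
    charFun (Pr.map fun ω => L (Y ω)) p = charFun (Pr.map Y) (ContinuousLinearMap.adjoint L p) := by
  have hL : Measurable fun ω => L (Y ω) := L.continuous.measurable.comp hY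
  rw [charFun_apply, charFun_apply, integral_map hL.aemeasurable (by fun_prop),
    integral_map hY.aemeasurable (by fun_prop)]
  simp only [ContinuousLinearMap.adjoint_inner_right]

variable {Ω : Type*} [MeasurableSpace Ω] {Pr : Measure Ω} [IsProbabilityMeasure Pr]
  {Z : ℝ≥0 → Ω → U} {X : ℝ≥0 → Ω → E} {x : E}

/-- Independence turns the characteristic function of the sum into a product, and each factor is the
exponential of h times the exponent at the transported frequency. -/
theorem charFun_map_sum_increment (hZm : ∀ t, Measurable (Z t)) (hZi : HasIndepIncrements Z Pr)
    {ψ : U → ℂ} (hZc : ∀ (s h : ℝ≥0) (p : U), charFun (Pr.map fun ω => Z (s + h) ω - Z s ω) p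
      = Complex.exp ((h : ℝ) * ψ p)) (L : ℕ → U →L[ℝ] E) (h : ℝ≥0) (m : ℕ) (p : E) :
    charFun (Pr.map fun ω => ∑ k ∈ Finset.range m, L k (Z ((k + 1) * h) ω - Z (k * h) ω)) p
      = Complex.exp (∑ k ∈ Finset.range m,
          ((h : ℝ) : ℂ) * ψ (ContinuousLinearMap.adjoint (L k) p)) := by
  have hmono : Monotone fun k : ℕ => (k : ℝ≥0) * h := fun k l hkl => by
    have : (k : ℝ≥0) ≤ l := by exact_mod_cast hkl
    exact mul_le_mul_left this _
  have h1 := hZi.nat hmono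
  push_cast at h1
  have h2 := (h1.comp (fun k => L k) fun k => (L k).continuous.measurable).restrict
    (Finset.range m)
  have h3 := h2.charFun_map_fun_finsetSum_eq_prod (fun k _ =>
    ((L k).continuous.measurable.comp ((hZm _).sub (hZm _))).aemeasurable)
  have h4 := congrFun h3 p
  simp only [Finset.prod_apply, Function.comp_def, Pi.sub_apply] at h4
  rw [h4, Complex.exp_sum]
  refine Finset.prod_congr rfl fun k _ => ?_
  rw [charFun_map_clm (Y := fun ω => Z ((k + 1) * h) ω - Z (k * h) ω) ((hZm _).sub (hZm _)) (L k) p, ← hZc (k * h) h]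
  simp only [add_mul, one_mul]

-- The sums of flow-transported increments converge almost surely to X_t - e^{tA}x, so their
-- characteristic functions converge; these are exponentials of Riemann sums of a continuous
-- exponent.
include hν in
theorem charFun_map_ouProcess (hZm : ∀ t, Measurable (Z t)) (hZi : HasIndepIncrements Z Pr)
    (hZc : ∀ (s h : ℝ≥0) (p : U), charFun (Pr.map fun ω => Z (s + h) ω - Z s ω) p
      = Complex.exp ((h : ℝ) * noiseExponent b v ν p))
    (hZ0 : ∀ᵐ ω ∂Pr, Z 0 ω = 0) (hXm : ∀ t, Measurable (X t))
    (hXc : ∀ᵐ ω ∂Pr, IsCadlagPath fun t => X t ω)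
    (hXe : ∀ᵐ ω ∂Pr, ∀ t : ℝ≥0,
      X t ω = x + (∫ s in (0 : ℝ)..t, A (X s.toNNReal ω)) + B (Z t ω))
    {t : ℝ} (ht : 0 < t) (p : E) :
    charFun (Pr.map fun ω => X t.toNNReal ω - flow A t x) p
      = Complex.exp (∫ s in 0..t, flowExponent A B b v ν p s) := by
  set R : ℕ → Ω → E := fun m ω => ∑ k ∈ Finset.range (m + 1),
    (flow A (t - k * (t / ((m : ℝ) + 1))) ∘L B)
      (Z ((k + 1) * (t / ((m : ℝ) + 1)).toNNReal) ω - Z (k * (t / ((m : ℝ) + 1)).toNNReal) ω)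
    with hR
  have hRm : ∀ m, Measurable (R m) := fun m => Finset.measurable_fun_sum _ fun k _ =>
    (ContinuousLinearMap.continuous _).measurable.comp ((hZm _).sub (hZm _))
  have hlim : ∀ᵐ ω ∂Pr, Tendsto (fun m => R m ω) atTop (𝓝 (X t.toNNReal ω - flow A t x)) := by
    filter_upwards [hZ0, hXc, hXe] with ω h0 hc he
    obtain ⟨M, hM⟩ := exists_norm_le_of_isCadlagPath hc (2 * t).toNNReal
    have h1 := tendsto_sum_flow_increment A (x := x) (f := fun s => X s.toNNReal ω)
      (ζ := fun s => B (Z s.toNNReal ω)) (M := M) (hc.continuousWithinAt_toNNReal) ht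
      (fun s hs => hM _ (Real.toNNReal_mono hs)) (fun s hs => by
        have := he s.toNNReal
        rwa [Real.coe_toNNReal s hs] at this)
    have hX0 : X 0 ω = x := by
      rw [he 0, h0]
      simp
    simp only [Real.toNNReal_zero, hX0] at h1
    refine h1.congr fun m => Finset.sum_congr rfl fun k _ => ?_
    have hh0 : 0 ≤ t / ((m : ℝ) + 1) := by positivity
    have e1 : ((k : ℝ) * (t / ((m : ℝ) + 1))).toNNReal = k * (t / ((m : ℝ) + 1)).toNNReal := by
      rw [Real.toNNReal_mul (by positivity), Real.toNNReal_natCast]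
    have e2 : (((k : ℝ) + 1) * (t / ((m : ℝ) + 1))).toNNReal
        = (k + 1) * (t / ((m : ℝ) + 1)).toNNReal := by
      rw [Real.toNNReal_mul (by positivity), Real.toNNReal_add (by positivity) zero_le_one,
        Real.toNNReal_natCast, Real.toNNReal_one]
    rw [e1, e2, ContinuousLinearMap.comp_apply, map_sub B]
  have hXtm : Measurable fun ω => X t.toNNReal ω - flow A t x := (hXm _).sub_const _
  have hchar : Tendsto (fun m => charFun (Pr.map (R m)) p) atTop
      (𝓝 (charFun (Pr.map fun ω => X t.toNNReal ω - flow A t x) p)) := by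
    have e : ∀ Y : Ω → E, Measurable Y →
        charFun (Pr.map Y) p = ∫ ω, Complex.exp (⟪Y ω, p⟫ * Complex.I) ∂Pr := fun Y hY => by
      rw [charFun_apply, integral_map hY.aemeasurable (by fun_prop)]
    rw [e _ hXtm]
    simp_rw [fun m => e _ (hRm m)]
    refine tendsto_integral_of_dominated_convergence (fun _ => 1) (fun m => ?_)
      (integrable_const _) (fun m => Eventually.of_forall fun ω => ?_) ?_
    · have := hRm m
      exact Measurable.aestronglyMeasurable (by fun_prop)
    · rw [Complex.norm_exp_ofReal_mul_I]
    · filter_upwards [hlim] with ω h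
      exact ((Complex.continuous_ofReal.tendsto _).comp
        (h.inner tendsto_const_nhds)).mul_const _ |>.cexp
  refine tendsto_nhds_unique hchar ?_
  have hG : Continuous fun s => flowExponent A B b v ν p s := continuous_flowExponent A B b v hν p
  refine ((Complex.continuous_exp.tendsto _).comp (tendsto_riemannSum hG ht)).congr fun m => ?_
  rw [hR, charFun_map_sum_increment hZm hZi hZc, Function.comp]
  have hh0 : 0 ≤ t / ((m : ℝ) + 1) := by positivity
  rw [Real.coe_toNNReal _ hh0]
  simp only [flowExponent, ContinuousLinearMap.adjoint_comp, ContinuousLinearMap.comp_apply]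

-- By uniqueness of characteristic functions, X_t - e^{tA}x has the law of e^{tA}Y_t.
include hν in
theorem integral_ouProcess (hZm : ∀ t, Measurable (Z t)) (hZi : HasIndepIncrements Z Pr)
    (hZc : ∀ (s h : ℝ≥0) (p : U), charFun (Pr.map fun ω => Z (s + h) ω - Z s ω) p
      = Complex.exp ((h : ℝ) * noiseExponent b v ν p))
    (hZ0 : ∀ᵐ ω ∂Pr, Z 0 ω = 0) (hXm : ∀ t, Measurable (X t))
    (hXc : ∀ᵐ ω ∂Pr, IsCadlagPath fun t => X t ω)
    (hXe : ∀ᵐ ω ∂Pr, ∀ t : ℝ≥0,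
      X t ω = x + (∫ s in (0 : ℝ)..t, A (X s.toNNReal ω)) + B (Z t ω))
    {t : ℝ} (ht : 0 < t) {g : E → ℝ} (hg : Measurable g) :
    ∫ ω, g (X t.toNNReal ω) ∂Pr = ouSemigroup A B b v ν t g x := by
  have hXtm : Measurable fun ω => X t.toNNReal ω - flow A t x := (hXm _).sub_const _
  have hfm : Measurable (flow A t) := (flow A t).continuous.measurable
  have hlaw : (Pr.map fun ω => X t.toNNReal ω - flow A t x)
      = (ouLaw A B b v ν t : Measure E).map (flow A t) := by
    have := Measure.isProbabilityMeasure_map (μ := Pr) hXtm.aemeasurable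
    have := Measure.isProbabilityMeasure_map (μ := (ouLaw A B b v ν t : Measure E)) hfm.aemeasurable
    refine Measure.ext_of_charFun (funext fun p => ?_)
    rw [charFun_map_ouProcess A B b v hν hZm hZi hZc hZ0 hXm hXc hXe ht]
    have h2 := charFun_map_clm (Pr := (ouLaw A B b v ν t : Measure E)) measurable_id (flow A t) p
    rw [Measure.map_id, charFun_ouLaw_adjoint A B b v hν ht.le] at h2
    exact h2.symm
  have hgm : Measurable fun y => g (flow A t x + y) := hg.comp (measurable_const_add _)
  calc ∫ ω, g (X t.toNNReal ω) ∂Pr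
      = ∫ ω, g (flow A t x + (X t.toNNReal ω - flow A t x)) ∂Pr := by simp
    _ = ∫ y, g (flow A t x + y) ∂(Pr.map fun ω => X t.toNNReal ω - flow A t x) :=
        (integral_map hXtm.aemeasurable hgm.aestronglyMeasurable).symm
    _ = ∫ y, g (flow A t x + flow A t y) ∂(ouLaw A B b v ν t : Measure E) := by
        rw [hlaw, integral_map hfm.aemeasurable hgm.aestronglyMeasurable]
    _ = _ := by simp only [ouSemigroup, map_add]

end Law

/-! ### Translation of the matrix data into operators -/

section Matrices

variable {N d : ℕ}

/-- The continuous linear map of a matrix between Euclidean spaces. -/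
def matrixMap {m n : ℕ} (M : Matrix (Fin m) (Fin n) ℝ) :
    EuclideanSpace ℝ (Fin n) →L[ℝ] EuclideanSpace ℝ (Fin m) :=
  LinearMap.toContinuousLinearMap (Matrix.toEuclideanLin M)

theorem matrixMap_apply {m n : ℕ} (M : Matrix (Fin m) (Fin n) ℝ) (z : EuclideanSpace ℝ (Fin n)) :
    matrixMap M z = Matrix.toEuclideanLin M z := rfl

theorem matrixMap_pow_apply (A : Matrix (Fin N) (Fin N) ℝ) (B : Matrix (Fin N) (Fin d) ℝ) (k : ℕ)
    (z : EuclideanSpace ℝ (Fin d)) :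
    (matrixMap A ^ k) (matrixMap B z) = Matrix.toEuclideanLin (A ^ k * B) z := by
  induction k with
  | zero => simp [matrixMap_apply]
  | succ k ih =>
    rw [pow_succ', mul_apply_eq_comp, ih, pow_succ', Matrix.mul_assoc,
      matrixMap_apply]
    exact (congrArg (fun f => f z) (Matrix.toLpLin_mul 2 2 2 A (A ^ k * B))).symm

theorem reachable_eq (A : Matrix (Fin N) (Fin N) ℝ) (B : Matrix (Fin N) (Fin d) ℝ) (h : ℕ) :
    reachable A B h = reachSpace (matrixMap A) (matrixMap B) h := by
  unfold reachable reachSpace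
  refine biSup_congr fun k _ => congrArg LinearMap.range (LinearMap.ext fun z => ?_)
  exact (matrixMap_pow_apply A B k z).symm

/-- Layers are numbered from 1 and strata from 0, so that the exponent 1 + α(h-1) becomes 1 + αi. -/
theorem layer_eq (A : Matrix (Fin N) (Fin N) ℝ) (B : Matrix (Fin N) (Fin d) ℝ) (i : ℕ) :
    layer A B (i + 1) = stratum (matrixMap A) (matrixMap B) i := by
  rw [layer, stratum, reachable_eq, reachable_eq, Nat.add_sub_cancel]

theorem reachable_eq_top {A : Matrix (Fin N) (Fin N) ℝ} {B : Matrix (Fin N) (Fin d) ℝ} {r : ℕ}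
    (h : (kalmanMatrix A B r).rank = N) : reachable A B r = ⊤ := by
  have h1 : LinearMap.range (kalmanMatrix A B r).mulVecLin = ⊤ :=
    Submodule.eq_top_of_finrank_eq (by rw [Module.finrank_fin_fun]; exact h)
  refine eq_top_iff.2 fun y _ => ?_
  obtain ⟨w, hw⟩ := LinearMap.range_eq_top.1 h1 y.ofLp
  have h2 : y = ∑ k : Fin r, Matrix.toEuclideanLin (A ^ (k : ℕ) * B)
      (WithLp.toLp 2 fun j => w (k, j)) := by
    ext i
    rw [← hw, WithLp.ofLp_sum, Finset.sum_apply, Matrix.mulVecLin_apply, Matrix.mulVec,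
      dotProduct, Fintype.sum_prod_type]
    rfl
  rw [h2]
  exact Submodule.sum_mem _ fun k _ => Submodule.mem_iSup_of_mem (k : ℕ)
    (Submodule.mem_iSup_of_mem (Finset.mem_range.2 k.2) ⟨_, rfl⟩)

theorem rank_kalmanIndex {A : Matrix (Fin N) (Fin N) ℝ} {B : Matrix (Fin N) (Fin d) ℝ}
    (hK : KalmanCondition A B) : (kalmanMatrix A B (kalmanIndex A B)).rank = N :=
  Nat.sInf_mem (s := {r : ℕ | (kalmanMatrix A B r).rank = N}) ⟨N, hK⟩

theorem kalmanIndex_pos (hN : 0 < N) {A : Matrix (Fin N) (Fin N) ℝ} {B : Matrix (Fin N) (Fin d) ℝ}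
    (hK : KalmanCondition A B) : 0 < kalmanIndex A B := by
  rw [Nat.pos_iff_ne_zero]
  intro h0
  have h1 := rank_kalmanIndex hK
  have h2 := (kalmanMatrix A B (kalmanIndex A B)).rank_le_card_width
  rw [h1, Fintype.card_prod, Fintype.card_fin, h0, zero_mul] at h2
  omega

theorem trace_matrixMap (A : Matrix (Fin N) (Fin N) ℝ) :
    LinearMap.trace ℝ (EuclideanSpace ℝ (Fin N)) (matrixMap A) = A.trace := by
  have h1 : ((matrixMap A : EuclideanSpace ℝ (Fin N) →L[ℝ] EuclideanSpace ℝ (Fin N)) :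
      EuclideanSpace ℝ (Fin N) →ₗ[ℝ] EuclideanSpace ℝ (Fin N)) = Matrix.toLin
        (PiLp.basisFun 2 ℝ (Fin N)) (PiLp.basisFun 2 ℝ (Fin N)) A := by
    rw [← Matrix.toLpLin_eq_toLin]
    rfl
  rw [h1, Matrix.trace_toLin_eq]

-- The factorisation writes the Gaussian part as a sum of squares along the rows of C, the form used
-- for the exponent and for the adjoint operator.
open scoped MatrixOrder in
theorem exists_eq_transpose_mul_self {Q : Matrix (Fin d) (Fin d) ℝ} (hQ : Q.PosSemidef) :
    ∃ C : Matrix (Fin d) (Fin d) ℝ, Q = C.transpose * C := by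
  obtain ⟨C, hC⟩ := CStarAlgebra.nonneg_iff_eq_star_mul_self.mp hQ.nonneg
  exact ⟨C, hC⟩

/-- The rows of a matrix. -/
def matrixRow (C : Matrix (Fin d) (Fin d) ℝ) (j : Fin d) : EuclideanSpace ℝ (Fin d) :=
  WithLp.toLp 2 (C j)

theorem inner_toEuclideanLin_transpose_mul_self (C : Matrix (Fin d) (Fin d) ℝ)
    (p : EuclideanSpace ℝ (Fin d)) :
    ⟪p, Matrix.toEuclideanLin (C.transpose * C) p⟫ = ∑ j, ⟪matrixRow C j, p⟫ ^ 2 := by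
  have h1 : ∀ j, ⟪matrixRow C j, p⟫ = (C.mulVec p.ofLp) j := fun j => by
    rw [EuclideanSpace.inner_eq_star_dotProduct, dotProduct_comm]
    rfl
  have h2 : ⟪p, Matrix.toEuclideanLin (C.transpose * C) p⟫
      = p.ofLp ⬝ᵥ (C.transpose * C).mulVec p.ofLp := by
    rw [EuclideanSpace.inner_eq_star_dotProduct, dotProduct_comm]
    rfl
  rw [h2, ← Matrix.mulVec_mulVec, Matrix.dotProduct_mulVec, Matrix.vecMul_transpose, dotProduct]
  refine Finset.sum_congr rfl fun j _ => ?_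
  rw [h1, sq]

theorem iteratedFDeriv_two_eq_sum (φ : EuclideanSpace ℝ (Fin N) → ℝ)
    (x w : EuclideanSpace ℝ (Fin N)) :
    iteratedFDeriv ℝ 2 φ x ![w, w] = ∑ i, ∑ k, w i * w k * hessianMatrix φ x i k := by
  have hw : w = ∑ i, w i • EuclideanSpace.single i (1 : ℝ) := by
    have := (EuclideanSpace.basisFun (Fin N) ℝ).sum_repr w
    simpa using this.symm
  have h1 : ∀ a c, iteratedFDeriv ℝ 2 φ x ![a, c] = fderiv ℝ (fderiv ℝ φ) x a c := fun a c => by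
    rw [iteratedFDeriv_two_apply]
    rfl
  simp only [hessianMatrix, Matrix.of_apply, h1]
  conv_lhs => rw [hw]
  simp only [map_sum, map_smul, sum_apply, smul_apply, smul_eq_mul, Finset.mul_sum, mul_assoc]
  rw [Finset.sum_comm]
  exact Finset.sum_congr rfl fun i _ => Finset.sum_congr rfl fun k _ => mul_left_comm _ _ _

theorem trace_mul_hessianMatrix (B : Matrix (Fin N) (Fin d) ℝ) (C : Matrix (Fin d) (Fin d) ℝ)
    (φ : EuclideanSpace ℝ (Fin N) → ℝ) (x : EuclideanSpace ℝ (Fin N)) :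
    (B * (C.transpose * C) * B.transpose * hessianMatrix φ x).trace
      = ∑ j, iteratedFDeriv ℝ 2 φ x
          ![matrixMap B (matrixRow C j), matrixMap B (matrixRow C j)] := by
  have h1 : ∀ i j, (matrixMap B (matrixRow C j)) i = (B * C.transpose) i j := fun i j => rfl
  have h2 : B * (C.transpose * C) * B.transpose
      = (B * C.transpose) * (B * C.transpose).transpose := by
    rw [Matrix.transpose_mul, Matrix.transpose_transpose]
    simp only [Matrix.mul_assoc]
  rw [h2, Matrix.mul_assoc, Matrix.trace_mul_comm, Matrix.trace]
  refine Finset.sum_congr rfl fun j _ => ?_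
  rw [iteratedFDeriv_two_eq_sum, Matrix.diag_apply, Matrix.mul_apply]
  simp only [h1]
  generalize B * C.transpose = G
  simp only [Matrix.mul_apply, Finset.sum_mul, Matrix.transpose_apply]
  rw [Finset.sum_comm]
  exact Finset.sum_congr rfl fun i _ => Finset.sum_congr rfl fun k _ => mul_right_comm _ _ _

theorem ouAdjoint_eq (A : Matrix (Fin N) (Fin N) ℝ) (B : Matrix (Fin N) (Fin d) ℝ)
    (b : EuclideanSpace ℝ (Fin d)) (C : Matrix (Fin d) (Fin d) ℝ)
    (ν : Measure (EuclideanSpace ℝ (Fin d))) (φ : EuclideanSpace ℝ (Fin N) → ℝ)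
    (x : EuclideanSpace ℝ (Fin N)) :
    ouAdjoint A B b (C.transpose * C) ν φ x
      = ouDual (matrixMap A) (matrixMap B) b (matrixRow C) ν φ x := by
  rw [ouAdjoint, levyAdjoint, ouDual, trace_mul_hessianMatrix, trace_matrixMap]
  simp only [jumpTerm, matrixMap_apply]
  ring

theorem levySymbol_eq (b : EuclideanSpace ℝ (Fin d)) (C : Matrix (Fin d) (Fin d) ℝ)
    (ν : Measure (EuclideanSpace ℝ (Fin d))) (p : EuclideanSpace ℝ (Fin d)) :
    levySymbol b (C.transpose * C) ν p = -noiseExponent b (matrixRow C) ν p := by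
  have h1 : ∀ z, 1 - Complex.exp (Complex.I * (⟪p, z⟫ : ℝ))
      + (Metric.ball (0 : EuclideanSpace ℝ (Fin d)) 1).indicator
            (fun z => Complex.I * (⟪p, z⟫ : ℝ)) z
      = -levyKernel id (Metric.ball 0 1) p z := by
    intro z
    rw [levyKernel]
    simp only [id, real_inner_comm p, mul_comm Complex.I]
    ring
  rw [levySymbol, noiseExponent, inner_toEuclideanLin_transpose_mul_self]
  simp_rw [h1]
  rw [integral_neg]
  push_cast
  ring

end Matrices

/-! ### Integrability properties of Lévy measures -/

section LevyMeasure

variable {d : ℕ} {ν : Measure (EuclideanSpace ℝ (Fin d))}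

/-- With the density min(1, |z|²), which is positive off the uncharged origin, ν becomes a finite
measure; dividing the density out again gives back ν. -/
theorem IsLevyMeasure.sigmaFinite (hν : IsLevyMeasure ν) : SigmaFinite ν := by
  have hf : Measurable fun z : EuclideanSpace ℝ (Fin d) => min 1 (‖z‖ₑ ^ 2) := by fun_prop
  have h0 : ∀ᵐ z ∂ν, min 1 (‖z‖ₑ ^ 2) ≠ 0 := by
    have : ∀ᵐ z ∂ν, z ≠ 0 := by
      rw [ae_iff]
      simpa using hν.zero
    filter_upwards [this] with z hz
    simp [hz]
  have h1 : ∀ᵐ z ∂ν, min 1 (‖z‖ₑ ^ 2) ≠ ∞ := Eventually.of_forall fun z =>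
    (lt_of_le_of_lt (min_le_left _ _) ENNReal.one_lt_top).ne
  have : IsFiniteMeasure (ν.withDensity fun z => min 1 (‖z‖ₑ ^ 2)) :=
    isFiniteMeasure_withDensity hν.lintegral_lt_top.ne
  rw [← withDensity_inv_same hf h0 h1]
  refine SigmaFinite.withDensity_of_ne_top ?_
  rw [ae_withDensity_iff hf]
  filter_upwards [h0] with z hz _
  exact ENNReal.inv_ne_top.2 hz

theorem IsLevyMeasure.integrable_levyWeight (hν : IsLevyMeasure ν) :
    Integrable (levyWeight id (Metric.ball 0 1)) ν := by
  have hm : Measurable (levyWeight id (Metric.ball (0 : EuclideanSpace ℝ (Fin d)) 1)) :=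
    ((measurable_norm.pow_const 2).indicator Metric.isOpen_ball.measurableSet).add
      (measurable_one.indicator Metric.isOpen_ball.measurableSet.compl)
  refine ⟨hm.aestronglyMeasurable, lt_of_le_of_lt (lintegral_mono fun z => ?_)
    hν.lintegral_lt_top⟩
  by_cases hz : z ∈ Metric.ball (0 : EuclideanSpace ℝ (Fin d)) 1
  · rw [levyWeight, Set.indicator_of_mem hz, Set.indicator_of_notMem (Set.notMem_compl_iff.2 hz),
      add_zero, id, enorm_pow, enorm_norm, min_eq_right]
    rw [mem_ball_zero_iff] at hz
    refine pow_le_one₀ zero_le ?_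
    rw [← ofReal_norm]
    exact ENNReal.ofReal_le_one.2 hz.le
  · rw [levyWeight, Set.indicator_of_notMem hz, Set.indicator_of_mem (Set.mem_compl hz), zero_add,
      min_eq_left]
    · simp
    · rw [mem_ball_zero_iff, not_lt] at hz
      refine one_le_pow₀ ?_
      rw [← ofReal_norm]
      exact ENNReal.one_le_ofReal.2 hz

end LevyMeasure

/-! ### Zygmund norms of order less than one -/

section Holder

variable {F : Type*} [NormedAddCommGroup F] [NormedSpace ℝ F]

theorem intPart_eq_zero {γ : ℝ} (hγ1 : γ ≤ 1) : intPart γ = 0 := by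
  have : ⌈γ⌉₊ ≤ 1 := Nat.ceil_le.2 (by exact_mod_cast hγ1)
  rw [intPart]
  omega

theorem enorm_le_zygmundNorm {γ : ℝ} (hγ1 : γ < 1) (ψ : F → ℝ) (x : F) :
    ‖ψ x‖ₑ ≤ zygmundNorm γ ψ := by
  rw [zygmundNorm, intPart_eq_zero hγ1.le, zero_add, Finset.sum_range_one]
  refine le_trans ?_ (le_trans (le_iSup (fun x => ‖iteratedFDeriv ℝ 0 ψ x‖ₑ) x) le_self_add)
  rw [← ofReal_norm, ← ofReal_norm, norm_iteratedFDeriv_zero]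

theorem enorm_sub_le_zygmundNorm {γ : ℝ} (hγ : 0 < γ) (hγ1 : γ < 1) (ψ : F → ℝ) (x y : F) :
    ‖ψ x - ψ y‖ₑ ≤ zygmundNorm γ ψ * ‖x - y‖ₑ ^ γ := by
  rcases eq_or_ne x y with rfl | hxy
  · simp
  have hfrac : fracPart γ = γ := by rw [fracPart, intPart_eq_zero hγ1.le, Nat.cast_zero, sub_zero]
  have h0 : ‖x - y‖ₑ ≠ 0 := by simpa [sub_eq_zero] using hxy
  have h1 : ‖x - y‖ₑ ^ γ ≠ 0 := by
    rw [Ne, ENNReal.rpow_eq_zero_iff]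
    simp [h0, hγ.not_gt]
  have h2 : ‖x - y‖ₑ ^ γ ≠ ∞ := ENNReal.rpow_ne_top_of_nonneg hγ.le enorm_ne_top
  rw [← ENNReal.div_le_iff h1 h2]
  refine le_trans ?_ (le_add_self : zygmundSeminorm γ ψ ≤ zygmundNorm γ ψ)
  rw [zygmundSeminorm, hfrac, if_neg hγ1.ne, intPart_eq_zero hγ1.le]
  refine le_trans (le_of_eq ?_) (le_iSup_of_le x (le_iSup_of_le y (le_iSup_of_le hxy le_rfl)))
  congr 1
  rw [iteratedFDeriv_zero_eq_comp]
  simp only [Function.comp_apply]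
  rw [← map_sub, ← ofReal_norm, ← ofReal_norm, LinearIsometryEquiv.norm_map]

end Holder

/-! ### Anisotropic spaces in terms of strata -/

section Aniso

variable {N d : ℕ} {A : Matrix (Fin N) (Fin N) ℝ} {B : Matrix (Fin N) (Fin d) ℝ} {α β γ : ℝ}
  {g : EuclideanSpace ℝ (Fin N) → ℝ}

theorem zygmundNorm_le_anisoNorm {i : ℕ} (hi : i < kalmanIndex A B)
    (x : EuclideanSpace ℝ (Fin N)) :
    zygmundNorm (γ / (1 + α * i)) (fun z : stratum (matrixMap A) (matrixMap B) i =>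
      g (x + (z : EuclideanSpace ℝ (Fin N)))) ≤ anisoNorm A B α γ g := by
  rw [← layer_eq]
  have h1 := Finset.single_le_sum (f := fun h : ℕ => ⨆ x₀ : EuclideanSpace ℝ (Fin N),
    zygmundNorm (γ / (1 + α * ((h : ℝ) - 1)))
      (fun z : layer A B h => g (x₀ + (z : EuclideanSpace ℝ (Fin N))))) (fun _ _ => zero_le)
    (Finset.mem_Icc.2 ⟨Nat.le_add_left 1 i, hi⟩)
  refine le_trans ?_ h1
  simp only [Nat.cast_add, Nat.cast_one, add_sub_cancel_right]
  exact le_iSup (fun x : EuclideanSpace ℝ (Fin N) => zygmundNorm (γ / (1 + α * i))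
    (fun z : layer A B (i + 1) => g (x + (z : EuclideanSpace ℝ (Fin N))))) x

/-- All orders β/(1+αi) are below 1, so the norms are plain Hölder norms. The sup bound is read off
the stratum of index 0, which occurs because the Kalman index is positive. -/
theorem MemAniso.isAnisoHolder (hg : MemAniso A B α β g) (hn : 0 < kalmanIndex A B)
    (hα : 0 < α) (hβ : 0 < β) (hβ1 : β < 1) :
    IsAnisoHolder (matrixMap A) (matrixMap B) (kalmanIndex A B) α β (anisoNorm A B α β g).toReal
      g := by
  have hσ : ∀ i : ℕ, 0 < β / (1 + α * i) ∧ β / (1 + α * i) < 1 := fun i => by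
    have : 0 ≤ α * (i : ℝ) := by positivity
    refine ⟨by positivity, (div_lt_one (by positivity)).2 (by linarith)⟩
  have htop := hg.norm_lt_top.ne
  refine ⟨fun x => ?_, fun i hi w hw x => ?_⟩
  · have h1 := (enorm_le_zygmundNorm (hσ 0).2
      (fun z : stratum (matrixMap A) (matrixMap B) 0 => g (x + (z : EuclideanSpace ℝ (Fin N))))
      0).trans (zygmundNorm_le_anisoNorm hn x)
    rw [ZeroMemClass.coe_zero, add_zero] at h1
    have h2 := ENNReal.toReal_mono htop h1
    rwa [toReal_enorm] at h2
  · have h1 := (enorm_sub_le_zygmundNorm (hσ i).1 (hσ i).2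
      (fun z : stratum (matrixMap A) (matrixMap B) i => g (x + (z : EuclideanSpace ℝ (Fin N))))
      ⟨w, hw⟩ 0).trans (mul_le_mul_left (zygmundNorm_le_anisoNorm hi x) _)
    rw [ZeroMemClass.coe_zero, add_zero, sub_zero] at h1
    have h2 := ENNReal.toReal_mono
      (ENNReal.mul_ne_top htop (ENNReal.rpow_ne_top_of_nonneg (hσ i).1.le enorm_ne_top)) h1
    rwa [ENNReal.toReal_mul, ← ENNReal.toReal_rpow, toReal_enorm, toReal_enorm] at h2

theorem memAniso_of_stratum {M : ℝ≥0∞} (hM : M ≠ ∞)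
    (h : ∀ i < kalmanIndex A B, ∀ x : EuclideanSpace ℝ (Fin N),
      ContDiff ℝ (intPart (γ / (1 + α * i))) (fun z : stratum (matrixMap A) (matrixMap B) i =>
        g (x + (z : EuclideanSpace ℝ (Fin N)))) ∧
      zygmundNorm (γ / (1 + α * i)) (fun z : stratum (matrixMap A) (matrixMap B) i =>
        g (x + (z : EuclideanSpace ℝ (Fin N)))) ≤ M) :
    MemAniso A B α γ g ∧ anisoNorm A B α γ g ≤ kalmanIndex A B * M := by
  have h' : ∀ k ∈ Finset.Icc 1 (kalmanIndex A B), ∀ x : EuclideanSpace ℝ (Fin N),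
      ContDiff ℝ (intPart (γ / (1 + α * ((k : ℝ) - 1))))
        (fun z : layer A B k => g (x + (z : EuclideanSpace ℝ (Fin N)))) ∧
      zygmundNorm (γ / (1 + α * ((k : ℝ) - 1)))
        (fun z : layer A B k => g (x + (z : EuclideanSpace ℝ (Fin N)))) ≤ M := by
    intro k hk x
    obtain ⟨hk1, hk2⟩ := Finset.mem_Icc.1 hk
    obtain ⟨i, rfl⟩ := Nat.exists_eq_add_of_le' hk1
    have h1 := h i hk2 x
    rw [← layer_eq] at h1
    simpa only [Nat.cast_add, Nat.cast_one, add_sub_cancel_right] using h1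
  have hle : anisoNorm A B α γ g ≤ kalmanIndex A B * M := by
    refine (Finset.sum_le_card_nsmul _ _ M fun k hk => iSup_le fun x => (h' k hk x).2).trans_eq ?_
    rw [Nat.card_Icc, Nat.add_sub_cancel, nsmul_eq_mul]
  exact ⟨⟨fun k hk x => (h' k hk x).1, lt_of_le_of_lt hle (ENNReal.mul_lt_top (by simp) hM.lt_top)⟩,
    hle⟩

end Aniso

/-! ### The resolvent as the unique weak solution and as an expectation -/

section Solution

variable {N d : ℕ} {A : Matrix (Fin N) (Fin N) ℝ} {B : Matrix (Fin N) (Fin d) ℝ}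
  {b : EuclideanSpace ℝ (Fin d)} {C : Matrix (Fin d) (Fin d) ℝ}
  {ν : Measure (EuclideanSpace ℝ (Fin d))} {lam K : ℝ} {g : EuclideanSpace ℝ (Fin N) → ℝ}

theorem isWeakSolution_ouResolvent (hν : IsLevyMeasure ν) (hlam : 0 < lam)
    (hg : UniformContinuous g) (hgK : ∀ x, |g x| ≤ K) :
    IsWeakSolution A B b (C.transpose * C) ν lam g
      (ouResolvent (matrixMap A) (matrixMap B) b (matrixRow C) ν lam g) := by
  have := hν.sigmaFinite
  have hgm := hg.continuous.measurable
  refine ⟨⟨K / lam, abs_ouResolvent_le _ _ b _ hν.integrable_levyWeight hlam hgm hgK⟩,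
    uniformContinuous_ouResolvent _ _ b _ hν.integrable_levyWeight hlam hgm hgK hg,
    fun φ hφ hc => ?_⟩
  simp_rw [ouAdjoint_eq]
  exact integral_ouResolvent_mul_dualTest _ _ b _ hν.integrable_levyWeight hφ hc hlam hgm hgK

theorem IsWeakSolution.eq (hν : IsLevyMeasure ν) (hlam : 0 < lam)
    {u w : EuclideanSpace ℝ (Fin N) → ℝ}
    (hu : IsWeakSolution A B b (C.transpose * C) ν lam g u)
    (hw : IsWeakSolution A B b (C.transpose * C) ν lam g w) : w = u := by
  have := hν.sigmaFinite
  obtain ⟨M, hM⟩ := hu.bounded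
  obtain ⟨M', hM'⟩ := hw.bounded
  refine sub_eq_zero.1 (eq_zero_of_weakSolution (matrixMap A) (matrixMap B) b (matrixRow C)
    hν.integrable_levyWeight (M := M' + M) (hw.uniformContinuous.sub hu.uniformContinuous)
    (fun x => (abs_sub _ _).trans (add_le_add (hM' x) (hM x))) hlam fun φ hφ hc => ?_)
  have hi := integrable_dualTest (matrixMap A) (matrixMap B) b (matrixRow C)
    hν.integrable_levyWeight hφ hc lam
  have hi1 := hi.bdd_mul (c := M') hw.uniformContinuous.continuous.aestronglyMeasurable
    (Eventually.of_forall hM')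
  have hi2 := hi.bdd_mul (c := M) hu.uniformContinuous.continuous.aestronglyMeasurable
    (Eventually.of_forall hM)
  have h1 := hw.integral_eq φ hφ hc
  have h2 := hu.integral_eq φ hφ hc
  simp_rw [ouAdjoint_eq] at h1 h2
  simp only [Pi.sub_apply, sub_mul]
  rw [integral_sub hi1 hi2]
  exact sub_eq_zero.2 (h1.trans h2.symm)

theorem transitionSemigroup_eq (hν : IsLevyMeasure ν) {Ω : Type*} [MeasurableSpace Ω]
    {Pr : Measure Ω} [IsProbabilityMeasure Pr] {Z : ℝ≥0 → Ω → EuclideanSpace ℝ (Fin d)}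
    {X : EuclideanSpace ℝ (Fin N) → ℝ≥0 → Ω → EuclideanSpace ℝ (Fin N)}
    (hZ : IsLevyProcess Pr (levySymbol b (C.transpose * C) ν) Z)
    {x : EuclideanSpace ℝ (Fin N)} (hX : IsOUProcess Pr A B Z x (X x))
    (hg : Measurable g) {t : ℝ} (ht : 0 < t) :
    transitionSemigroup Pr X t.toNNReal g x
      = ouSemigroup (matrixMap A) (matrixMap B) b (matrixRow C) ν t g x := by
  have := hν.sigmaFinite
  refine integral_ouProcess (matrixMap A) (matrixMap B) b (matrixRow C) hν.integrable_levyWeight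
    hZ.measurable hZ.indep_increments (fun s h p => ?_) hZ.zero hX.measurable hX.cadlag
    hX.equation ht hg
  have h1 := hZ.symbol h p
  rw [levySymbol_eq, neg_mul_neg] at h1
  rw [(hZ.stationary_increments s h).map_eq, ← h1, charFun_apply,
    integral_map (hZ.measurable h).aemeasurable (by fun_prop)]
  simp only [real_inner_comm p, mul_comm Complex.I]

end Solution

end LevyOU

end

/-! ### Elliptic Schauder estimates -/

theorem mainTheorem2 {N d : ℕ} (hN : 0 < N)
    (A : Matrix (Fin N) (Fin N) ℝ) (B : Matrix (Fin N) (Fin d) ℝ)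
    (hB : B.rank = d) (hK : LevyOU.KalmanCondition A B)
    (ν : Measure (EuclideanSpace ℝ (Fin d))) (hν : LevyOU.IsLevyMeasure ν)
    (α r₀ : ℝ) (μ : Measure (Metric.sphere (0 : EuclideanSpace ℝ (Fin d)) 1))
    (hND : LevyOU.NonDegenerate ν α r₀ μ)
    (lam : ℝ) (hlam : 0 < lam) (β : ℝ) (hβ : 0 < β) (hβ' : β < 1) :
    ∃ C : ℝ, 0 < C ∧
      ∀ (b : EuclideanSpace ℝ (Fin d)) (Q : Matrix (Fin d) (Fin d) ℝ), Q.PosSemidef →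
      ∀ g : EuclideanSpace ℝ (Fin N) → ℝ, LevyOU.MemAniso A B α β g →
      ∃ u : EuclideanSpace ℝ (Fin N) → ℝ,
        LevyOU.IsWeakSolution A B b Q ν lam g u ∧
        (∀ v, LevyOU.IsWeakSolution A B b Q ν lam g v → v = u) ∧
        (∀ (Ω : Type*) [MeasurableSpace Ω] (Pr : Measure Ω) [IsProbabilityMeasure Pr]
          (Z : ℝ≥0 → Ω → EuclideanSpace ℝ (Fin d))
          (X : EuclideanSpace ℝ (Fin N) → ℝ≥0 → Ω → EuclideanSpace ℝ (Fin N)),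
          LevyOU.IsLevyProcess Pr (LevyOU.levySymbol b Q ν) Z →
          (∀ x, LevyOU.IsOUProcess Pr A B Z x (X x)) →
          ∀ x, IntegrableOn (fun t : ℝ => Real.exp (-lam * t)
                * LevyOU.transitionSemigroup Pr X t.toNNReal g x) (Set.Ioi 0) ∧
            u x = ∫ t in Set.Ioi (0 : ℝ), Real.exp (-lam * t)
                * LevyOU.transitionSemigroup Pr X t.toNNReal g x) ∧
        LevyOU.MemAniso A B α (α + β) u ∧
        LevyOU.anisoNorm A B α (α + β) u
          ≤ ENNReal.ofReal C * LevyOU.anisoNorm A B α β g := by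
  have hσ := hν.sigmaFinite
  have hα := hND.α_pos
  have hμ := hND.finite
  obtain ⟨η, hη, hη'⟩ := hND.nondegenerate
  have hn := LevyOU.kalmanIndex_pos hN hK
  have hreach : LevyOU.reachSpace (LevyOU.matrixMap A) (LevyOU.matrixMap B)
      (LevyOU.kalmanIndex A B) = ⊤ := by
    rw [← LevyOU.reachable_eq, LevyOU.reachable_eq_top (LevyOU.rank_kalmanIndex hK)]
  -- The truncation radius is lowered to min(r₀, 1/2), which preserves the domination by ν and puts
  -- all stable jumps inside the compensated unit ball. The constant is obtained before b, Q and g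
  -- are introduced.
  obtain ⟨C, hC0, hC⟩ := LevyOU.exists_schauder_estimate (ι := Fin d) hν.integrable_levyWeight
    hreach μ hα hND.α_lt_two (lt_min hND.r₀_pos (by norm_num : (0 : ℝ) < 1 / 2))
    (lt_of_le_of_lt (min_le_right _ _) (by norm_num))
    ((LevyOU.stable_mono μ (min_le_left _ _)).trans (LevyOU.stable_le μ hND.le_apply)) hη
    (fun p => (hη' p).1) hβ hβ' hlam
  -- The stratum estimates are summed over all layers, which gives the factor n; adding 1 makes the
  -- constant strictly positive.
  refine ⟨LevyOU.kalmanIndex A B * C + 1, by positivity, fun b Q hQ g hg => ?_⟩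
  obtain ⟨S, rfl⟩ := LevyOU.exists_eq_transpose_mul_self hQ
  have hgH := hg.isAnisoHolder hn hα hβ hβ'
  have hgu := hgH.uniformContinuous hreach hα hβ
  have hgm := hgu.continuous.measurable
  have hsol := LevyOU.isWeakSolution_ouResolvent (A := A) (B := B) (b := b) (C := S) hν hlam hgu
    hgH.bounded
  obtain ⟨hmem, hle⟩ := LevyOU.memAniso_of_stratum ENNReal.ofReal_ne_top
    fun i hi x₀ => hC b (LevyOU.matrixRow S) _ g hgH i hi x₀
  refine ⟨_, hsol, fun w hw => hsol.eq hν hlam hw, ?_, hmem, hle.trans ?_⟩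
  · intro Ω _ Pr _ Z X hZ hX x
    have hi : IntegrableOn (fun t : ℝ => Real.exp (-lam * t) * LevyOU.ouSemigroup
        (LevyOU.matrixMap A) (LevyOU.matrixMap B) b (LevyOU.matrixRow S) ν t g x) (Set.Ioi 0) :=
      LevyOU.integrableOn_ouResolvent _ _ b _ hν.integrable_levyWeight hlam hgm hgH.bounded x
    have hP : Set.EqOn (fun t : ℝ => Real.exp (-lam * t) * LevyOU.ouSemigroup (LevyOU.matrixMap A)
        (LevyOU.matrixMap B) b (LevyOU.matrixRow S) ν t g x)
        (fun t : ℝ => Real.exp (-lam * t) * LevyOU.transitionSemigroup Pr X t.toNNReal g x)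
        (Set.Ioi 0) := fun t ht => by
      simp only [LevyOU.transitionSemigroup_eq hν hZ (hX x) hgm ht]
    exact ⟨hi.congr_fun hP measurableSet_Ioi, setIntegral_congr_fun measurableSet_Ioi hP⟩
  · rw [ENNReal.ofReal_mul hC0, ENNReal.ofReal_toReal hg.norm_lt_top.ne, ← mul_assoc,
      ← ENNReal.ofReal_natCast, ← ENNReal.ofReal_mul (Nat.cast_nonneg _)]
    gcongr
    linarith
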